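/- All spaces are simplicial sets, and statements about homotopy types refer to geometric realizations. Operads have no units and are indexed by finite sets: an operad $\mathcal C$ consists of spaces $\mathcal C_S$, contravariant in bijections of finite sets $S$, and natural compositions $\circ_s:\mathcal C_S\times\mathcal C_T\to\mathcal C_{(S\setminus\{s\})\sqcup T}$ $(s\in S)$ satisfying the two usual associativity laws (nested and parallel composition). Let $\mathcal P$ be the operad of partitions (trees): for $|S|\ge 2$, $\mathcal P_S$ is the space of reduced rooted trees with leaves labelled bijectively by $S$ and internal edges of lengths in the unit interval (edges of length $0$ are shrunk); simplicially, it is the nerve of the poset of such tree shapes, ordered by $x\le y$ if $x$ arises from $y$ by shrinking internal edges. Put $\mathcal P_S=\emptyset$ for $|S|\le1$. Composition grafts trees, the new internal edge having length $1$. Let $\mathcal Q$ be the Barratt–Eccles operad: $\mathcal Q_S$ is the nerve of the category whose objects are the bijections $S\to\{1,\dots,|S|\}$ (equivalently the total orderings of $S$), with exactly one morphism between any two objects, and composition is substitution of total orderings (block permutation). The tree operad is $\mathcal T=\mathcal P\times\mathcal Q$. For a subset $M\subsetneq S$ with $|M|\ge2$ put $N=S\setminus M$ and $N^+=N\sqcup\{+\}$.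 Composition at $+$ gives a map $\mathcal T_M\times\mathcal T_{N^+}\to\mathcal T_S$; its image is called the face of $\mathcal T_S$ corresponding to the partition $S=M\sqcup N$. A subface of this face is the image of $F\times\mathcal T_{N^+}$ for a face $F$ of $\mathcal T_M$, or of $\mathcal T_M\times F$ for a face $F$ of $\mathcal T_{N^+}$. The boundary $\partial\mathcal T_S$ is the union of all faces of $\mathcal T_S$. **Proposition.** 1. $\mathcal T$ is an $E_\infty$ operad: $\mathcal T_S$ is contractible for every finite set $S$ with $|S|\ge2$, and any two different bijections $S\to S'$ of finite sets induce simplicial maps $\mathcal T_{S'}\to\mathcal T_S$ that differ on every simplex (in particular the symmetric groups act freely). Now let $S$ be a finite set with $n=|S|\ge 2$. 2. Each composition map $\mathcal T_M\times\mathcal T_{N^+}\to\mathcal T_S$ as above is injective. 3. The faces corresponding to two different partitions are disjoint, or their intersection is a subface of both. 4. There are homotopy equivalences $$\partial\mathcal T_S\simeq\bigvee_{(n-1)!}S^{n-3}\qquad\text{and}\qquad \mathcal T_S/\partial\mathcal T_S\simeq\bigvee_{(n-1)!}S^{n-2}.$$ For $n=2$ the first is read as $\partial\mathcal T_S=\emptyset$,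 and $\mathcal T_S/\emptyset$ is $\mathcal T_S$ with a disjoint point added. 5. As a $\mathbb Z\Sigma_n$-module, where $\Sigma_n$ is the group of permutations of $S$, the reduced integral cohomology $\tilde H^{n-3}(\partial\mathcal T_S)$ is isomorphic to $\varepsilon\operatorname{Lie}_n$, the twist by the sign character of the Lie representation, that is, of the multilinear part of the free Lie algebra over $\mathbb Z$ on $S$. (Reduced cohomology is that of the augmented cochain complex, so $\tilde H^{-1}(\emptyset)=\mathbb Z$.) For each $s\in S$ its restriction to the stabilizer $\Sigma_{n-1}$ of $s$ is isomorphic to the regular representation $\mathbb Z[\Sigma_{n-1}]$. -/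

import Mathlib

open CategoryTheory MonoidalCategory Opposite

universe u

noncomputable section

namespace TreeOperad

/-- The deleted disjoint union `(S ∖ {s}) ⊔ T`. -/
abbrev Ins {S : Type u} (s : S) (T : Type u) : Type u := {x : S // x ≠ s} ⊕ T

namespace Ins

/-- Functoriality of the deleted disjoint union in bijections. -/
def congr {S S' T T' : Type u} (e : S ≃ S') (f : T ≃ T') {s : S} {s' : S'} (h : e s = s') :
    Ins s T ≃ Ins s' T' :=
  Equiv.sumCongr
    (e.subtypeEquiv fun _ => not_congr ⟨fun hx => hx ▸ h, fun hx => e.injective (hx.trans h.symm)⟩) f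

/-- The canonical bijection `(S ⊔_s T) ⊔_t U ≃ S ⊔_s (T ⊔_t U)` for `t ∈ T`. -/
def assocNested {S T U : Type u} (s : S) (t : T) :
    Ins (Sum.inr t : Ins s T) U ≃ Ins s (Ins t U) where
  toFun
    | .inl ⟨.inl x, _⟩ => .inl x
    | .inl ⟨.inr y, h⟩ => .inr (.inl ⟨y, fun e => h (congrArg Sum.inr e)⟩)
    | .inr z => .inr (.inr z)
  invFun
    | .inl x => .inl ⟨.inl x, Sum.inl_ne_inr⟩
    | .inr (.inl y) => .inl ⟨.inr y.1, fun e => y.2 (Sum.inr_injective e)⟩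
    | .inr (.inr z) => .inr z
  left_inv := by rintro (⟨x | y, h⟩ | z) <;> rfl
  right_inv := by rintro (x | y | z) <;> rfl

/-- The canonical bijection `(S ⊔_s T) ⊔_{s'} U ≃ (S ⊔_{s'} U) ⊔_s T` for distinct `s, s' ∈ S`. -/
def assocParallel {S T U : Type u} (s s' : S) (h : s' ≠ s) :
    Ins (Sum.inl ⟨s', h⟩ : Ins s T) U ≃ Ins (Sum.inl ⟨s, h.symm⟩ : Ins s' U) T where
  toFun
    | .inl ⟨.inl x, hx⟩ => .inl ⟨.inl ⟨x.1, fun e => hx (congrArg Sum.inl (Subtype.ext e))⟩,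
        fun e => x.2 (congrArg Subtype.val (Sum.inl_injective e))⟩
    | .inl ⟨.inr y, _⟩ => .inr y
    | .inr z => .inl ⟨.inr z, Sum.inr_ne_inl⟩
  invFun
    | .inl ⟨.inl x, hx⟩ => .inl ⟨.inl ⟨x.1, fun e => hx (congrArg Sum.inl (Subtype.ext e))⟩,
        fun e => x.2 (congrArg Subtype.val (Sum.inl_injective e))⟩
    | .inl ⟨.inr z, _⟩ => .inr z
    | .inr y => .inl ⟨.inr y, Sum.inr_ne_inl⟩
  left_inv := by rintro (⟨x | y, h⟩ | z) <;> rfl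
  right_inv := by rintro (⟨x | y, h⟩ | z) <;> rfl

/-- The map `S ⊔_s T → S` that collapses `T` to the point `s`. -/
def collapse {S T : Type u} (s : S) : Ins s T → S :=
  Sum.elim Subtype.val fun _ => s

end Ins

/-- An operad of simplicial sets, without unit, indexed by all finite sets: spaces `C_S`,
contravariant in bijections of `S`, and natural compositions
`∘_s : C_S × C_T → C_{S ⊔_s T}` for `s ∈ S` that satisfy
`(x ∘_s y) ∘_t z = x ∘_s (y ∘_t z)` for `t ∈ T` and
`(x ∘_s y) ∘_{s'} z = (x ∘_{s'} z) ∘_s y` for `s' ∈ S` distinct from `s`, up to the canonical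
bijections of the labelling sets. -/
structure SOperad where
  /-- The simplicial set of operations with inputs labelled by `S`. -/
  obj (S : Type u) [Finite S] : SSet.{u}
  /-- Relabelling of inputs; it is contravariant. -/
  map {S S' : Type u} [Finite S] [Finite S'] (e : S ≃ S') : obj S' ⟶ obj S
  map_refl (S : Type u) [Finite S] : map (Equiv.refl S) = 𝟙 (obj S)
  map_trans {S S' S'' : Type u} [Finite S] [Finite S'] [Finite S''] (e : S ≃ S') (f : S' ≃ S'') :
    map (e.trans f) = map f ≫ map e
  /-- The composition `∘_s`. -/
  comp {S T : Type u} [Finite S] [Finite T] (s : S) : obj S ⊗ obj T ⟶ obj (Ins s T)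
  comp_natural {S S' T T' : Type u} [Finite S] [Finite S'] [Finite T] [Finite T']
    (e : S ≃ S') (f : T ≃ T') {s : S} {s' : S'} (h : e s = s') :
    (map e ⊗ₘ map f) ≫ comp s = comp s' ≫ map (Ins.congr e f h)
  assoc_nested {S T U : Type u} [Finite S] [Finite T] [Finite U] (s : S) (t : T)
    {k : SimplexCategoryᵒᵖ} (x : (obj S).obj k) (y : (obj T).obj k) (z : (obj U).obj k) :
    (comp (Sum.inr t : Ins s T)).app k ((comp s).app k (x, y), z) =
      (map (Ins.assocNested s t)).app k ((comp s).app k (x, (comp t).app k (y, z)))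
  assoc_parallel {S T U : Type u} [Finite S] [Finite T] [Finite U] (s s' : S) (h : s' ≠ s)
    {k : SimplexCategoryᵒᵖ} (x : (obj S).obj k) (y : (obj T).obj k) (z : (obj U).obj k) :
    (comp (Sum.inl ⟨s', h⟩ : Ins s T)).app k ((comp s).app k (x, y), z) =
      (map (Ins.assocParallel s s' h)).app k
        ((comp (Sum.inl ⟨s, h.symm⟩ : Ins s' U)).app k ((comp s').app k (x, z), y))

namespace SOperad

/-- The product of two operads, with componentwise relabelling and composition. -/
def prod (P Q : SOperad.{u}) : SOperad.{u} where
  obj S _ := P.obj S ⊗ Q.obj S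
  map e := P.map e ⊗ₘ Q.map e
  map_refl S _ := by simp [map_refl]
  map_trans e f := by simp [map_trans]
  comp s := tensorμ _ _ _ _ ≫ (P.comp s ⊗ₘ Q.comp s)
  comp_natural := by
    rintro S S' T T' _ _ _ _ e f s _ rfl
    rw [tensorμ_natural_assoc]
    simp only [Category.assoc, tensorHom_comp_tensorHom, comp_natural]
  assoc_nested s t k x y z :=
    Prod.ext (P.assoc_nested s t x.1 y.1 z.1) (Q.assoc_nested s t x.2 y.2 z.2)
  assoc_parallel s s' h k x y z :=
    Prod.ext (P.assoc_parallel s s' h x.1 y.1 z.1) (Q.assoc_parallel s s' h x.2 y.2 z.2)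

end SOperad

/-- An operad of preordered sets, without unit, indexed by all finite sets. It is only used as a
way to write down an operad of simplicial sets, by taking nerves. -/
structure PreordOperad where
  obj (S : Type u) [Finite S] : Type u
  [pre (S : Type u) [Finite S] : Preorder (obj S)]
  map {S S' : Type u} [Finite S] [Finite S'] (e : S ≃ S') : obj S' → obj S
  map_mono {S S' : Type u} [Finite S] [Finite S'] (e : S ≃ S') : Monotone (map e)
  map_refl {S : Type u} [Finite S] (x : obj S) : map (Equiv.refl S) x = x
  map_trans {S S' S'' : Type u} [Finite S] [Finite S'] [Finite S''] (e : S ≃ S') (f : S' ≃ S'')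
    (x : obj S'') : map (e.trans f) x = map e (map f x)
  comp {S T : Type u} [Finite S] [Finite T] (s : S) : obj S → obj T → obj (Ins s T)
  comp_mono {S T : Type u} [Finite S] [Finite T] (s : S) {x x' : obj S} {y y' : obj T} :
    x ≤ x' → y ≤ y' → comp s x y ≤ comp s x' y'
  comp_natural {S S' T T' : Type u} [Finite S] [Finite S'] [Finite T] [Finite T']
    (e : S ≃ S') (f : T ≃ T') {s : S} {s' : S'} (h : e s = s') (x : obj S') (y : obj T') :
    comp s (map e x) (map f y) = map (Ins.congr e f h) (comp s' x y)
  assoc_nested {S T U : Type u} [Finite S] [Finite T] [Finite U] (s : S) (t : T)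
    (x : obj S) (y : obj T) (z : obj U) :
    comp (Sum.inr t : Ins s T) (comp s x y) z =
      map (Ins.assocNested s t) (comp s x (comp t y z))
  assoc_parallel {S T U : Type u} [Finite S] [Finite T] [Finite U] (s s' : S) (h : s' ≠ s)
    (x : obj S) (y : obj T) (z : obj U) :
    comp (Sum.inl ⟨s', h⟩ : Ins s T) (comp s x y) z =
      map (Ins.assocParallel s s' h)
        (comp (Sum.inl ⟨s, h.symm⟩ : Ins s' U) (comp s' x z) y)

namespace PreordOperad

attribute [instance] PreordOperad.pre

/-- The map of nerves induced by a map of two variables that is monotone in both of them. -/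
def nerveMap₂ {X Y Z : Type u} [Preorder X] [Preorder Y] [Preorder Z] (f : X → Y → Z)
    (hf : ∀ {x x' y y'}, x ≤ x' → y ≤ y' → f x y ≤ f x' y') :
    CategoryTheory.nerve X ⊗ CategoryTheory.nerve Y ⟶ CategoryTheory.nerve Z where
  app k := ↾fun p => (Monotone.functor (f := fun i => f (p.1.obj i) (p.2.obj i))
    (fun _ _ h => hf (p.1.map (homOfLE h)).le (p.2.map (homOfLE h)).le) :
      ComposableArrows Z k.unop.len)
  naturality _ _ _ := rfl

/-- The operad of simplicial sets obtained by taking the nerve of each preordered set. A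
`k`-simplex of the nerve is a chain `x₀ ≤ x₁ ≤ ⋯ ≤ x_k`. -/
def nerve (P : PreordOperad.{u}) : SOperad.{u} where
  obj S _ := CategoryTheory.nerve (P.obj S)
  map e := nerveMap (P.map_mono e).functor
  map_refl S _ := by
    ext k x i
    exact P.map_refl _
  map_trans e f := by
    ext k x i
    exact P.map_trans e f _
  comp s := nerveMap₂ (P.comp s) (P.comp_mono s)
  comp_natural e f s s' h := by
    ext k x i
    exact P.comp_natural e f h _ _
  assoc_nested s t k x y z :=
    nerve.ext_of_isThin (funext fun i => P.assoc_nested s t (x.obj i) (y.obj i) (z.obj i))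
  assoc_parallel s s' h k x y z :=
    nerve.ext_of_isThin (funext fun i => P.assoc_parallel s s' h (x.obj i) (y.obj i) (z.obj i))

end PreordOperad

/-- The combinatorial type of a reduced rooted tree with at least two twigs (leaves), labelled
bijectively by `S`. An internal edge is recorded as the set of twigs above it: this is a subset of
`S` with at least two elements, different from `S`, and for two internal edges these sets are nested
or disjoint. A tree is determined by its set of internal edges, and every such family of sets
occurs. The tree without internal edges is the star tree (corolla). -/
@[ext]
structure LabelledTree (S : Type u) where
  two_le : 2 ≤ Nat.card S
  edges : Set (Set S)
  nontrivial_of_mem : ∀ A ∈ edges, A.Nontrivial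
  ne_univ_of_mem : ∀ A ∈ edges, A ≠ Set.univ
  nested_or_disjoint : ∀ A ∈ edges, ∀ B ∈ edges, A ⊆ B ∨ B ⊆ A ∨ Disjoint A B

namespace LabelledTree

/-- `x ≤ y` iff `x` is obtained from `y` by shrinking some internal edges to length zero. -/
instance (S : Type u) : PartialOrder (LabelledTree S) :=
  PartialOrder.lift edges fun _ _ h => LabelledTree.ext h

/-- Relabelling of the twigs along a bijection. -/
def map {S S' : Type u} (e : S ≃ S') (x : LabelledTree S') : LabelledTree S where
  two_le := by rw [Nat.card_congr e]; exact x.two_le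
  edges := {A | ∃ B ∈ x.edges, A = e ⁻¹' B}
  nontrivial_of_mem := by
    rintro _ ⟨B, hB, rfl⟩
    exact (x.nontrivial_of_mem B hB).preimage e.surjective
  ne_univ_of_mem := by
    rintro _ ⟨B, hB, rfl⟩ h
    exact x.ne_univ_of_mem B hB (Set.preimage_eq_univ_iff.1 h |> fun h => by simpa using h)
  nested_or_disjoint := by
    rintro _ ⟨A, hA, rfl⟩ _ ⟨B, hB, rfl⟩
    rcases x.nested_or_disjoint A hA B hB with h | h | h
    · exact .inl (Set.preimage_mono h)
    · exact .inr (.inl (Set.preimage_mono h))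
    · exact .inr (.inr (h.preimage e))

/-- Grafting: the root of `y` is grafted into the twig `s` of `x`. The internal edges of the result
are those of `x`, the new internal edge (above which lie exactly the twigs of `y`), and those
of `y`. -/
def graft {S T : Type u} [Finite S] [Finite T] (s : S) (x : LabelledTree S) (y : LabelledTree T) :
    LabelledTree (Ins s T) where
  two_le := by
    have := y.two_le
    rw [Nat.card_sum]
    omega
  edges := {A | (∃ B ∈ x.edges, A = Ins.collapse s ⁻¹' B) ∨ A = Set.range Sum.inr ∨
    ∃ B ∈ y.edges, A = Sum.inr '' B}
  nontrivial_of_mem := by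
    have hT : Nontrivial T := Finite.one_lt_card_iff_nontrivial.1 y.two_le
    rintro _ (⟨B, hB, rfl⟩ | rfl | ⟨B, hB, rfl⟩)
    · refine (x.nontrivial_of_mem B hB).preimage ?_
      intro a
      by_cases h : a = s
      · exact ⟨.inr (Classical.arbitrary T), h.symm⟩
      · exact ⟨.inl ⟨a, h⟩, rfl⟩
    · rw [← Set.image_univ]
      exact Set.nontrivial_univ.image Sum.inr_injective
    · exact (y.nontrivial_of_mem B hB).image Sum.inr_injective
  ne_univ_of_mem := by
    have hT : Nontrivial T := Finite.one_lt_card_iff_nontrivial.1 y.two_le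
    have hS : Nontrivial S := Finite.one_lt_card_iff_nontrivial.1 x.two_le
    obtain ⟨a, ha⟩ := exists_ne s
    rintro _ (⟨B, hB, rfl⟩ | rfl | ⟨B, hB, rfl⟩) h
    · refine x.ne_univ_of_mem B hB (Set.eq_univ_of_forall fun b => ?_)
      by_cases hb : b = s
      · have : (Sum.inr (Classical.arbitrary T) : Ins s T) ∈ Ins.collapse s ⁻¹' B := h ▸ trivial
        exact hb ▸ this
      · have : (Sum.inl ⟨b, hb⟩ : Ins s T) ∈ Ins.collapse s ⁻¹' B := h ▸ trivial
        exact this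
    · have : (Sum.inl ⟨a, ha⟩ : Ins s T) ∈ Set.range (Sum.inr : T → Ins s T) := h ▸ trivial
      simp at this
    · have : (Sum.inl ⟨a, ha⟩ : Ins s T) ∈ (Sum.inr : T → Ins s T) '' B := h ▸ trivial
      simp at this
  nested_or_disjoint := by
    have key : ∀ B : Set S, (Set.range Sum.inr ⊆ Ins.collapse (T := T) s ⁻¹' B) ∨
        Disjoint (Ins.collapse (T := T) s ⁻¹' B) (Set.range Sum.inr) := by
      intro B
      by_cases h : s ∈ B
      · left; rintro _ ⟨t, rfl⟩; exact h
      · right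
        rw [Set.disjoint_left]
        rintro _ hb ⟨t, rfl⟩
        exact h hb
    have sub : ∀ B : Set T, (Sum.inr '' B : Set (Ins s T)) ⊆ Set.range Sum.inr :=
      fun B => Set.image_subset_range _ _
    rintro _ (⟨A, hA, rfl⟩ | rfl | ⟨A, hA, rfl⟩) _ (⟨B, hB, rfl⟩ | rfl | ⟨B, hB, rfl⟩)
    · rcases x.nested_or_disjoint A hA B hB with h | h | h
      · exact .inl (Set.preimage_mono h)
      · exact .inr (.inl (Set.preimage_mono h))
      · exact .inr (.inr (h.preimage _))
    · rcases key A with h | h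
      · exact .inr (.inl h)
      · exact .inr (.inr h)
    · rcases key A with h | h
      · exact .inr (.inl ((sub B).trans h))
      · exact .inr (.inr (h.mono_right (sub B)))
    · rcases key B with h | h
      · exact .inl h
      · exact .inr (.inr h.symm)
    · exact .inl subset_rfl
    · exact .inr (.inl (sub B))
    · rcases key B with h | h
      · exact .inl ((sub A).trans h)
      · exact .inr (.inr (h.mono_right (sub A)).symm)
    · exact .inl (sub A)
    · rcases y.nested_or_disjoint A hA B hB with h | h | h
      · exact .inl (Set.image_mono h)
      · exact .inr (.inl (Set.image_mono h))
      · exact .inr (.inr ((Set.disjoint_image_iff Sum.inr_injective).2 h))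

end LabelledTree

/-- The partially ordered sets of labelled trees, with grafting. -/
def treePreordOperad : PreordOperad.{u} where
  obj S _ := LabelledTree S
  map := LabelledTree.map
  map_mono := by
    rintro S S' _ _ e x y h _ ⟨B, hB, rfl⟩
    exact ⟨B, h hB, rfl⟩
  map_refl x := by
    ext A
    simp [LabelledTree.map]
  map_trans e f x := by
    ext A
    constructor
    · rintro ⟨B, hB, rfl⟩
      exact ⟨_, ⟨B, hB, rfl⟩, rfl⟩
    · rintro ⟨_, ⟨B, hB, rfl⟩, rfl⟩
      exact ⟨B, hB, rfl⟩
  comp := LabelledTree.graft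
  comp_mono := by
    rintro S T _ _ s x x' y y' hx hy _ (⟨B, hB, rfl⟩ | rfl | ⟨B, hB, rfl⟩)
    · exact .inl ⟨B, hx hB, rfl⟩
    · exact .inr (.inl rfl)
    · exact .inr (.inr ⟨B, hy hB, rfl⟩)
  comp_natural := by
    rintro S S' T T' _ _ _ _ e f s _ rfl x y
    have h1 : ∀ B : Set S', Ins.collapse (T := T) s ⁻¹' (e ⁻¹' B) =
        Ins.congr e f rfl ⁻¹' (Ins.collapse (T := T') (e s) ⁻¹' B) := by
      intro B
      ext (a | b) <;> rfl
    have h2 : (Set.range Sum.inr : Set (Ins s T)) =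
        Ins.congr e f rfl ⁻¹' (Set.range Sum.inr : Set (Ins (e s) T')) := by
      ext (a | b) <;> simp [Ins.congr]
    have h3 : ∀ B : Set T', (Sum.inr '' (f ⁻¹' B) : Set (Ins s T)) =
        Ins.congr e f rfl ⁻¹' (Sum.inr '' B : Set (Ins (e s) T')) := by
      intro B
      ext (a | b) <;> simp [Ins.congr]
    ext A
    constructor
    · rintro (⟨_, ⟨B, hB, rfl⟩, rfl⟩ | rfl | ⟨_, ⟨B, hB, rfl⟩, rfl⟩)
      · exact ⟨_, .inl ⟨B, hB, rfl⟩, h1 B⟩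
      · exact ⟨_, .inr (.inl rfl), h2⟩
      · exact ⟨_, .inr (.inr ⟨B, hB, rfl⟩), h3 B⟩
    · rintro ⟨_, (⟨B, hB, rfl⟩ | rfl | ⟨B, hB, rfl⟩), rfl⟩
      · exact .inl ⟨_, ⟨B, hB, rfl⟩, (h1 B).symm⟩
      · exact .inr (.inl h2.symm)
      · exact .inr (.inr ⟨_, ⟨B, hB, rfl⟩, (h3 B).symm⟩)
  assoc_nested := by
    intro S T U _ _ _ s t x y z
    have h1 : ∀ B : Set S, Ins.collapse (T := U) (Sum.inr t : Ins s T) ⁻¹'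
        (Ins.collapse s ⁻¹' B) = Ins.assocNested s t ⁻¹' (Ins.collapse s ⁻¹' B) := by
      intro B
      ext (⟨a | b, h⟩ | c) <;> rfl
    have h2 : Ins.collapse (T := U) (Sum.inr t : Ins s T) ⁻¹' (Set.range Sum.inr) =
        Ins.assocNested s t ⁻¹' (Set.range Sum.inr) := by
      ext (⟨a | b, h⟩ | c) <;> simp [Ins.assocNested, Ins.collapse]
    have h3 : ∀ B : Set T, Ins.collapse (T := U) (Sum.inr t : Ins s T) ⁻¹' (Sum.inr '' B) =
        Ins.assocNested s t ⁻¹' (Sum.inr '' (Ins.collapse t ⁻¹' B)) := by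
      intro B
      ext (⟨a | b, h⟩ | c) <;> simp [Ins.assocNested, Ins.collapse]
    have h4 : (Set.range Sum.inr : Set (Ins (Sum.inr t : Ins s T) U)) =
        Ins.assocNested s t ⁻¹' (Sum.inr '' (Set.range Sum.inr)) := by
      ext (⟨a | b, h⟩ | c) <;> simp [Ins.assocNested]
    have h5 : ∀ B : Set U, (Sum.inr '' B : Set (Ins (Sum.inr t : Ins s T) U)) =
        Ins.assocNested s t ⁻¹' (Sum.inr '' (Sum.inr '' B)) := by
      intro B
      ext (⟨a | b, h⟩ | c) <;> simp [Ins.assocNested]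
    ext A
    constructor
    · rintro (⟨_, (⟨B, hB, rfl⟩ | rfl | ⟨B, hB, rfl⟩), rfl⟩ | rfl | ⟨B, hB, rfl⟩)
      · exact ⟨_, .inl ⟨B, hB, rfl⟩, h1 B⟩
      · exact ⟨_, .inr (.inl rfl), h2⟩
      · exact ⟨_, .inr (.inr ⟨_, .inl ⟨B, hB, rfl⟩, rfl⟩), h3 B⟩
      · exact ⟨_, .inr (.inr ⟨_, .inr (.inl rfl), rfl⟩), h4⟩
      · exact ⟨_, .inr (.inr ⟨_, .inr (.inr ⟨B, hB, rfl⟩), rfl⟩), h5 B⟩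
    · rintro ⟨_, (⟨B, hB, rfl⟩ | rfl | ⟨_, (⟨B, hB, rfl⟩ | rfl | ⟨B, hB, rfl⟩), rfl⟩), rfl⟩
      · exact .inl ⟨_, .inl ⟨B, hB, rfl⟩, (h1 B).symm⟩
      · exact .inl ⟨_, .inr (.inl rfl), h2.symm⟩
      · exact .inl ⟨_, .inr (.inr ⟨B, hB, rfl⟩), (h3 B).symm⟩
      · exact .inr (.inl h4.symm)
      · exact .inr (.inr ⟨B, hB, (h5 B).symm⟩)
  assoc_parallel := by
    intro S T U _ _ _ s s' hs x y z
    have h1 : ∀ B : Set S, Ins.collapse (T := U) (Sum.inl ⟨s', hs⟩ : Ins s T) ⁻¹'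
        (Ins.collapse s ⁻¹' B) = Ins.assocParallel s s' hs ⁻¹'
          (Ins.collapse (T := T) (Sum.inl ⟨s, hs.symm⟩ : Ins s' U) ⁻¹'
            (Ins.collapse s' ⁻¹' B)) := by
      intro B
      ext (⟨a | b, h⟩ | c) <;> rfl
    have h2 : Ins.collapse (T := U) (Sum.inl ⟨s', hs⟩ : Ins s T) ⁻¹' (Set.range Sum.inr) =
        Ins.assocParallel s s' hs ⁻¹' (Set.range Sum.inr) := by
      ext (⟨a | b, h⟩ | c) <;> simp [Ins.assocParallel, Ins.collapse]
    have h3 : ∀ B : Set T, Ins.collapse (T := U) (Sum.inl ⟨s', hs⟩ : Ins s T) ⁻¹'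
        (Sum.inr '' B) = Ins.assocParallel s s' hs ⁻¹' (Sum.inr '' B) := by
      intro B
      ext (⟨a | b, h⟩ | c) <;> simp [Ins.assocParallel, Ins.collapse]
    have h4 : (Set.range Sum.inr : Set (Ins (Sum.inl ⟨s', hs⟩ : Ins s T) U)) =
        Ins.assocParallel s s' hs ⁻¹' (Ins.collapse (T := T)
          (Sum.inl ⟨s, hs.symm⟩ : Ins s' U) ⁻¹' (Set.range Sum.inr)) := by
      ext (⟨a | b, h⟩ | c) <;> simp [Ins.assocParallel, Ins.collapse]
    have h5 : ∀ B : Set U, (Sum.inr '' B : Set (Ins (Sum.inl ⟨s', hs⟩ : Ins s T) U)) =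
        Ins.assocParallel s s' hs ⁻¹' (Ins.collapse (T := T)
          (Sum.inl ⟨s, hs.symm⟩ : Ins s' U) ⁻¹' (Sum.inr '' B)) := by
      intro B
      ext (⟨a | b, h⟩ | c) <;> simp [Ins.assocParallel, Ins.collapse]
    ext A
    constructor
    · rintro (⟨_, (⟨B, hB, rfl⟩ | rfl | ⟨B, hB, rfl⟩), rfl⟩ | rfl | ⟨B, hB, rfl⟩)
      · exact ⟨_, .inl ⟨_, .inl ⟨B, hB, rfl⟩, rfl⟩, h1 B⟩
      · exact ⟨_, .inr (.inl rfl), h2⟩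
      · exact ⟨_, .inr (.inr ⟨B, hB, rfl⟩), h3 B⟩
      · exact ⟨_, .inl ⟨_, .inr (.inl rfl), rfl⟩, h4⟩
      · exact ⟨_, .inl ⟨_, .inr (.inr ⟨B, hB, rfl⟩), rfl⟩, h5 B⟩
    · rintro ⟨_, (⟨_, (⟨B, hB, rfl⟩ | rfl | ⟨B, hB, rfl⟩), rfl⟩ | rfl | ⟨B, hB, rfl⟩), rfl⟩
      · exact .inl ⟨_, .inl ⟨B, hB, rfl⟩, (h1 B).symm⟩
      · exact .inr (.inl h4.symm)
      · exact .inr (.inr ⟨B, hB, (h5 B).symm⟩)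
      · exact .inl ⟨_, .inr (.inl rfl), h2.symm⟩
      · exact .inl ⟨_, .inr (.inr ⟨B, hB, rfl⟩), (h3 B).symm⟩

/-- A (strict) total ordering of `S`; for finite `S` it is the same as a bijection
`S ≃ {1, …, n}`. -/
@[ext]
structure TotalOrdering (S : Type u) where
  lt : S → S → Prop
  irrefl : ∀ a, ¬ lt a a
  trans : ∀ a b c, lt a b → lt b c → lt a c
  total : ∀ a b, a ≠ b → lt a b ∨ lt b a

namespace TotalOrdering

/-- There is exactly one morphism between any two total orderings, namely the unique isomorphism
under `S` between the corresponding bijections `S ≃ {1, …, n}`. -/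
instance (S : Type u) : Preorder (TotalOrdering S) where
  le _ _ := True
  le_refl _ := trivial
  le_trans _ _ _ _ _ := trivial

/-- Relabelling along a bijection. -/
def map {S S' : Type u} (e : S ≃ S') (x : TotalOrdering S') : TotalOrdering S where
  lt a b := x.lt (e a) (e b)
  irrefl _ := x.irrefl _
  trans _ _ _ := x.trans _ _ _
  total _ _ h := x.total _ _ (e.injective.ne h)

/-- Substitution of total orderings (block permutation): the elements of `T` are put, in the order
given by `y`, at the place of `s` in the ordering `x`. -/
def subst {S T : Type u} (s : S) (x : TotalOrdering S) (y : TotalOrdering T) :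
    TotalOrdering (Ins s T) where
  lt a b := x.lt (Ins.collapse s a) (Ins.collapse s b) ∨
    ∃ t t', a = .inr t ∧ b = .inr t' ∧ y.lt t t'
  irrefl := by
    rintro a (h | ⟨t, t', rfl, h, h'⟩)
    · exact x.irrefl _ h
    · obtain rfl := Sum.inr_injective h
      exact y.irrefl _ h'
  trans := by
    rintro a b c (h | ⟨t, t', rfl, rfl, h⟩) (h' | ⟨u, u', hu, rfl, h'⟩)
    · exact .inl (x.trans _ _ _ h h')
    · subst hu; exact .inl h
    · exact .inl h'
    · obtain rfl := Sum.inr_injective hu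
      exact .inr ⟨_, _, rfl, rfl, y.trans _ _ _ h h'⟩
  total := by
    rintro (a | t) (b | t') h
    · rcases x.total a b (fun e => h (congrArg _ (Subtype.ext e))) with h | h
      exacts [.inl (.inl h), .inr (.inl h)]
    · rcases x.total a s a.2 with h | h
      exacts [.inl (.inl h), .inr (.inl h)]
    · rcases x.total b s b.2 with h | h
      exacts [.inr (.inl h), .inl (.inl h)]
    · rcases y.total t t' (fun e => h (congrArg _ e)) with h | h
      exacts [.inl (.inr ⟨_, _, rfl, rfl, h⟩), .inr (.inr ⟨_, _, rfl, rfl, h⟩)]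

end TotalOrdering

/-- The chaotic preorders of total orderings, with substitution. -/
def orderingPreordOperad : PreordOperad.{u} where
  obj S _ := TotalOrdering S
  map := TotalOrdering.map
  map_mono _ _ _ _ := trivial
  map_refl _ := rfl
  map_trans _ _ _ := rfl
  comp := TotalOrdering.subst
  comp_mono _ _ _ _ _ _ _ := trivial
  comp_natural := by
    rintro S S' T T' _ _ _ _ e f s _ rfl x y
    ext (a | a) (b | b) <;> simp [TotalOrdering.subst, TotalOrdering.map, Ins.congr, Ins.collapse]
  assoc_nested := by
    intro S T U _ _ _ s t x y z
    ext (⟨a | a, ha⟩ | a) (⟨b | b, hb⟩ | b) <;>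
      simp [TotalOrdering.subst, TotalOrdering.map, Ins.assocNested, Ins.collapse, x.irrefl] <;>
      grind [TotalOrdering.irrefl]
  assoc_parallel := by
    intro S T U _ _ _ s s' h x y z
    ext (⟨a | a, _⟩ | a) (⟨b | b, _⟩ | b) <;>
      simp [TotalOrdering.subst, TotalOrdering.map, Ins.assocParallel, Ins.collapse, x.irrefl]

/-- The operad `𝒫` of partitions (the operad of trees). A `k`-simplex of `𝒫_S` is a chain
`x₀ ≤ ⋯ ≤ x_k` of labelled trees, which is the same as the tree `x_k` together with a length in
`Δ[1]_k`, not constantly zero, for each of its internal edges. So `𝒫_S` is the simplicial set of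
`S`-trees with internal edges of lengths in the interval `Δ[1]`, where edges of length zero are
shrunk; its realization is the space of `S`-trees with edge lengths in `[0, 1]`. Composition is
grafting, and the new internal edge has constant length `1`. If `S` has less than two elements,
`𝒫_S` is empty. -/
def partitionOperad : SOperad.{u} := treePreordOperad.nerve

/-- The Barratt–Eccles operad `𝒬`: here `𝒬_S` is the nerve of the category of bijections
`S ≃ {1, …, n}` and isomorphisms under `S`, so it is `EΣ_n` for `n = |S|`. -/
def barrattEcclesOperad : SOperad.{u} := orderingPreordOperad.nerve

/-- The tree operad `𝒯 = 𝒫 × 𝒬`. -/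
def treeOperad : SOperad.{u} := partitionOperad.prod barrattEcclesOperad

namespace SOperad
variable (C : SOperad.{u})

/-- An operad without operations of arity less than two is `E_∞` if all its spaces of arity at
least two are contractible, and bijections act freely: different bijections `S ≃ S'` induce
maps `C_{S'} → C_S` that are everywhere different. In particular the symmetric group of `S` acts
freely on `C_S`. -/
structure IsEInfty : Prop where
  contractible (S : Type u) [Finite S] : 2 ≤ Nat.card S →
    ContractibleSpace (SSet.toTop.obj (C.obj S))
  free {S S' : Type u} [Finite S] [Finite S'] (e e' : S ≃ S') {k : SimplexCategoryᵒᵖ}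
    (x : (C.obj S').obj k) : (C.map e).app k x = (C.map e').app k x → e = e'

end SOperad

open Classical in
/-- The bijection `S = N ⊔ M ≃ N⁺ ⊔_+ M`, where `N = S ∖ M` and `N⁺ = N ⊔ {+}`. -/
def partEquiv {S : Type u} (M : Set S) : S ≃ Ins (none : Option ↥Mᶜ) ↥M where
  toFun a := if h : a ∈ M then .inr ⟨a, h⟩ else .inl ⟨some ⟨a, h⟩, nofun⟩
  invFun
    | .inl ⟨some a, _⟩ => a
    | .inl ⟨none, h⟩ => absurd rfl h
    | .inr a => a
  left_inv a := by
    by_cases h : a ∈ M <;> simp [h]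
  right_inv := by
    rintro (⟨_ | ⟨a, h⟩, h'⟩ | ⟨a, h⟩)
    · exact absurd rfl h'
    · exact dif_neg h
    · exact dif_pos h

lemma partEquiv_of_mem {S : Type u} {M : Set S} {a : S} (h : a ∈ M) :
    partEquiv M a = .inr ⟨a, h⟩ := dif_pos h

lemma partEquiv_of_notMem {S : Type u} {M : Set S} {a : S} (h : a ∉ M) :
    partEquiv M a = .inl ⟨some ⟨a, h⟩, nofun⟩ := dif_neg h

/-- The subset `M` gives a partition `S = M ⊔ N` with `|M| ≥ 2` and `|N⁺| ≥ 2`. -/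
def IsProper {S : Type u} (M : Set S) : Prop := M.Nontrivial ∧ M ≠ Set.univ

namespace SOperad
variable (C : SOperad.{u})

/-- The composition map `C_M × C_{N⁺} → C_S` for the partition `S = M ⊔ N`; it composes operations
at the input `+`, which is `none : Option Mᶜ`. -/
def faceMap {S : Type u} [Finite S] (M : Set S) :
    C.obj ↥M ⊗ C.obj (Option ↥Mᶜ) ⟶ C.obj S :=
  (β_ _ _).hom ≫ C.comp none ≫ C.map (partEquiv M)

/-- The face of `C_S` that corresponds to the partition `S = M ⊔ N`. -/
def face {S : Type u} [Finite S] (M : Set S) : (C.obj S).Subcomplex :=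
  SSet.Subcomplex.range (C.faceMap M)

/-- `K` is a face of the face `C_M × C_{N⁺}` of `C_S`, that is, the image of
`F × C_{N⁺}` for a face `F` of `C_M` or of `C_M × F` for a face `F` of `C_{N⁺}`. -/
def IsSubface {S : Type u} [Finite S] (M : Set S) (K : (C.obj S).Subcomplex) : Prop :=
  (∃ L : Set ↥M, IsProper L ∧ K = ((C.face L).prod ⊤).image (C.faceMap M)) ∨
  (∃ L : Set (Option ↥Mᶜ), IsProper L ∧
    K = ((⊤ : (C.obj ↥M).Subcomplex).prod (C.face L)).image (C.faceMap M))

/-- The boundary `∂C_S`: the union of all faces of `C_S`. -/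
def boundary (S : Type u) [Finite S] : (C.obj S).Subcomplex :=
  ⨆ (M : Set S) (_ : IsProper M), C.face M

lemma mem_boundary {S : Type u} [Finite S] {k : SimplexCategoryᵒᵖ} (x : (C.obj S).obj k) :
    x ∈ (C.boundary S).obj k ↔
      ∃ (M : Set S), IsProper M ∧ ∃ (y : (C.obj ↥M).obj k) (z : (C.obj (Option ↥Mᶜ)).obj k),
        (C.map (partEquiv M)).app k ((C.comp none).app k (z, y)) = x := by
  simp only [boundary, face, Subfunctor.iSup_obj, Set.mem_iUnion, exists_prop]
  refine exists_congr fun M => and_congr_right fun _ => ?_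
  constructor
  · rintro ⟨⟨y, z⟩, h⟩
    exact ⟨y, z, h⟩
  · rintro ⟨y, z, h⟩
    exact ⟨⟨y, z⟩, h⟩

lemma map_mem_boundary {S S' : Type u} [Finite S] [Finite S'] (e : S ≃ S')
    {k : SimplexCategoryᵒᵖ} (x : (C.obj S').obj k) (hx : x ∈ (C.boundary S').obj k) :
    (C.map e).app k x ∈ (C.boundary S).obj k := by
  obtain ⟨M, hM, y, z, rfl⟩ := (C.mem_boundary x).1 hx
  have hM' : IsProper (e ⁻¹' M) := ⟨hM.1.preimage e.surjective, fun h => hM.2 (by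
    rw [← e.surjective.image_preimage M, h, Set.image_univ, e.range_eq_univ])⟩
  let g : ↥(e ⁻¹' M) ≃ ↥M := e.subtypeEquiv fun _ => Iff.rfl
  let f : Option ↥(e ⁻¹' M)ᶜ ≃ Option ↥Mᶜ := Equiv.optionCongr (e.subtypeEquiv fun _ => Iff.rfl)
  refine (C.mem_boundary _).2 ⟨e ⁻¹' M, hM', (C.map g).app k y, (C.map f).app k z, ?_⟩
  let E : Ins (none : Option ↥(e ⁻¹' M)ᶜ) ↥(e ⁻¹' M) ≃ Ins (none : Option ↥Mᶜ) ↥M :=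
    Ins.congr f g rfl
  have h1 : (C.comp none).app k ((C.map f).app k z, (C.map g).app k y) =
      (C.map E).app k ((C.comp none).app k (z, y)) :=
    congr($(C.comp_natural f g (s := none) (s' := none) rfl).app k (z, y))
  have h2 : (partEquiv (e ⁻¹' M)).trans E = e.trans (partEquiv M) := by
    ext1 a
    by_cases h : e a ∈ M
    · have h' : a ∈ e ⁻¹' M := h
      rw [Equiv.trans_apply, Equiv.trans_apply, partEquiv_of_mem h, partEquiv_of_mem h']
      rfl
    · have h' : a ∉ e ⁻¹' M := h
      rw [Equiv.trans_apply, Equiv.trans_apply, partEquiv_of_notMem h, partEquiv_of_notMem h']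
      rfl
  have h3 : C.map E ≫ C.map (partEquiv (e ⁻¹' M)) = C.map (partEquiv M) ≫ C.map e := by
    rw [← C.map_trans, h2, C.map_trans]
  rw [h1]
  exact congr($(h3).app k ((C.comp none).app k (z, y)))

lemma range_boundary_le {S S' : Type u} [Finite S] [Finite S'] (e : S ≃ S') :
    SSet.Subcomplex.range ((C.boundary S').ι ≫ C.map e) ≤ C.boundary S := by
  rintro k _ ⟨x, rfl⟩
  exact C.map_mem_boundary e x.1 x.2

/-- The restriction `∂C_{S'} → ∂C_S` of the relabelling map. -/
def boundaryMap {S S' : Type u} [Finite S] [Finite S'] (e : S ≃ S') :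
    (C.boundary S').toSSet ⟶ (C.boundary S).toSSet :=
  SSet.Subcomplex.lift ((C.boundary S').ι ≫ C.map e) (C.range_boundary_le e)

lemma boundaryMap_ι {S S' : Type u} [Finite S] [Finite S'] (e : S ≃ S') :
    C.boundaryMap e ≫ (C.boundary S).ι = (C.boundary S').ι ≫ C.map e := rfl

lemma boundaryMap_refl (S : Type u) [Finite S] :
    C.boundaryMap (Equiv.refl S) = 𝟙 (C.boundary S).toSSet := by
  rw [← cancel_mono (C.boundary S).ι, boundaryMap_ι, C.map_refl]
  simp

lemma boundaryMap_trans {S S' S'' : Type u} [Finite S] [Finite S'] [Finite S''] (e : S ≃ S')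
    (f : S' ≃ S'') : C.boundaryMap (e.trans f) = C.boundaryMap f ≫ C.boundaryMap e := by
  rw [← cancel_mono (C.boundary S).ι]
  rw [boundaryMap_ι, Category.assoc, boundaryMap_ι, ← Category.assoc, boundaryMap_ι, C.map_trans,
    Category.assoc]

end SOperad

/-- The quotient `X / A`, in which `A` is collapsed to a point; for empty `A` a disjoint point is
added. -/
def collapseSubcomplex {X : SSet.{u}} (A : X.Subcomplex) : SSet.{u} :=
  Limits.pushout A.ι (Limits.terminal.from A.toSSet)

/-- The sphere `S^d`. -/
abbrev Sphere (d : ℕ) : Type := Metric.sphere (0 : EuclideanSpace ℝ (Fin (d + 1))) 1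

/-- A base point of `S^d`. -/
def Sphere.base (d : ℕ) : Sphere d := ⟨EuclideanSpace.single 0 1, by simp⟩

/-- The identification of all base points with the additional point. -/
inductive WedgeRel (r d : ℕ) : PUnit.{1} ⊕ (Σ _ : Fin r, Sphere d) →
    PUnit.{1} ⊕ (Σ _ : Fin r, Sphere d) → Prop
  | base (i : Fin r) : WedgeRel r d (.inl .unit) (.inr ⟨i, Sphere.base d⟩)

/-- The wedge of `r` copies of `S^d`. -/
abbrev WedgeOfSpheres (r d : ℕ) : Type := Quot (WedgeRel r d)

section Cohomology

/-- The simplices of the augmented simplicial set: in index `j` these are the simplices of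
dimension `j - 1`, with a single simplex of dimension `-1`. -/
def AugSimplex (X : SSet.{u}) : ℕ → Type u
  | 0 => PUnit
  | k + 1 => X.obj (op (SimplexCategory.mk k))

/-- The map of augmented simplices induced by a simplicial map. -/
def AugSimplex.map {X Y : SSet.{u}} (f : X ⟶ Y) : (j : ℕ) → AugSimplex X j → AugSimplex Y j
  | 0 => id
  | _ + 1 => f.app _

/-- Augmented integral cochains of degree `j - 1`. -/
abbrev RedCochain (X : SSet.{u}) (j : ℕ) : Type u := AugSimplex X j → ℤ

/-- The faces of augmented simplices. -/
def augFace (X : SSet.{u}) : (j : ℕ) → Fin (j + 1) → AugSimplex X (j + 1) → AugSimplex X j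
  | 0 => fun _ _ => PUnit.unit
  | _ + 1 => fun i x => X.δ i x

/-- The coboundary, from degree `j - 1` to degree `j`. -/
def redCochainD (X : SSet.{u}) (j : ℕ) : RedCochain X j →ₗ[ℤ] RedCochain X (j + 1) where
  toFun c x := ∑ i : Fin (j + 1), (-1) ^ (i : ℕ) * c (augFace X j i x)
  map_add' c c' := by
    funext x
    simp [mul_add, Finset.sum_add_distrib]
  map_smul' a c := by
    funext x
    simp [Finset.mul_sum, mul_left_comm]

/-- Coboundaries of degree `j - 1`. -/
def redCoboundary (X : SSet.{u}) : (j : ℕ) → Submodule ℤ (RedCochain X j)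
  | 0 => ⊥
  | j + 1 => LinearMap.range (redCochainD X j)

/-- Cocycles of degree `j - 1`. -/
def redCocycle (X : SSet.{u}) (j : ℕ) : Submodule ℤ (RedCochain X j) :=
  LinearMap.ker (redCochainD X j)

/-- The reduced integral cohomology of `X` in degree `j - 1`: the cohomology of the augmented
cochain complex. In particular it is `ℤ` in degree `-1` for the empty simplicial set. -/
abbrev RedCohomology (X : SSet.{u}) (j : ℕ) : Type u :=
  ↥(redCocycle X j) ⧸ (redCoboundary X j).submoduleOf (redCocycle X j)

/-- Pullback of cochains. -/
def redCochainMap {X Y : SSet.{u}} (f : X ⟶ Y) (j : ℕ) : RedCochain Y j →ₗ[ℤ] RedCochain X j :=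
  LinearMap.funLeft ℤ ℤ (AugSimplex.map f j)

lemma redCochainMap_d {X Y : SSet.{u}} (f : X ⟶ Y) (j : ℕ) (c : RedCochain Y j) :
    redCochainMap f (j + 1) (redCochainD Y j c) = redCochainD X j (redCochainMap f j c) := by
  funext x
  change ∑ i : Fin (j + 1), (-1) ^ (i : ℕ) * c (augFace Y j i (AugSimplex.map f (j + 1) x)) =
    ∑ i : Fin (j + 1), (-1) ^ (i : ℕ) * c (AugSimplex.map f j (augFace X j i x))
  refine Finset.sum_congr rfl fun i _ => ?_
  have h : augFace Y j i (AugSimplex.map f (j + 1) x) =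
      AugSimplex.map f j (augFace X j i x) := by
    cases j with
    | zero => rfl
    | succ j => exact (SSet.δ_naturality_apply f i x).symm
  exact congrArg (fun t => (-1) ^ (i : ℕ) * c t) h

lemma redCochainMap_mem_cocycle {X Y : SSet.{u}} (f : X ⟶ Y) (j : ℕ) (c : RedCochain Y j)
    (hc : c ∈ redCocycle Y j) : redCochainMap f j c ∈ redCocycle X j := by
  have hc' : redCochainD Y j c = 0 := hc
  change redCochainD X j _ = 0
  rw [← redCochainMap_d, hc', map_zero]

lemma redCochainMap_mem_coboundary {X Y : SSet.{u}} (f : X ⟶ Y) (j : ℕ) (c : RedCochain Y j)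
    (hc : c ∈ redCoboundary Y j) : redCochainMap f j c ∈ redCoboundary X j := by
  cases j with
  | zero =>
    have h : c = 0 := hc
    rw [h, LinearMap.map_zero]
    exact Submodule.zero_mem (redCoboundary X 0)
  | succ j =>
    obtain ⟨b, rfl⟩ := hc
    exact ⟨redCochainMap f j b, (redCochainMap_d f j b).symm⟩

/-- The map in reduced cohomology induced by a simplicial map. -/
def redCohomologyMap {X Y : SSet.{u}} (f : X ⟶ Y) (j : ℕ) :
    RedCohomology Y j →ₗ[ℤ] RedCohomology X j :=
  Submodule.mapQ _ _ ((redCochainMap f j).restrict (redCochainMap_mem_cocycle f j))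
    fun c hc => redCochainMap_mem_coboundary f j c.1 hc

lemma redCohomologyMap_id (X : SSet.{u}) (j : ℕ) :
    redCohomologyMap (𝟙 X) j = LinearMap.id := by
  refine LinearMap.ext fun a => ?_
  induction a using Submodule.Quotient.induction_on with
  | H c =>
    refine congrArg _ (Subtype.ext (funext fun x => ?_))
    cases j <;> rfl

lemma redCohomologyMap_comp {X Y Z : SSet.{u}} (f : X ⟶ Y) (g : Y ⟶ Z) (j : ℕ) :
    redCohomologyMap (f ≫ g) j = redCohomologyMap f j ∘ₗ redCohomologyMap g j := by
  refine LinearMap.ext fun a => ?_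
  induction a using Submodule.Quotient.induction_on with
  | H c =>
    refine congrArg _ (Subtype.ext (funext fun x => ?_))
    cases j <;> rfl

end Cohomology

/-- The action of the symmetric group of `S` on the reduced integral cohomology of `∂C_S` in degree
`j - 1`. The group acts on `∂C_S` from the right, so that cohomology is a left module. -/
def SOperad.boundaryCohomologyRep (C : SOperad.{u}) (S : Type u) [Finite S] (j : ℕ) :
    Representation ℤ (Equiv.Perm S) (RedCohomology (C.boundary S).toSSet j) where
  toFun σ := redCohomologyMap (C.boundaryMap σ) j
  map_one' := by
    rw [Equiv.Perm.one_def, C.boundaryMap_refl, redCohomologyMap_id]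
    rfl
  map_mul' σ τ := by
    rw [Equiv.Perm.mul_def, C.boundaryMap_trans, redCohomologyMap_comp]
    rfl

section Lie

variable (R : Type) [CommRing R]

/-- `IsLieMonomial R A x`: the element `x` of the free Lie algebra on `S` is an iterated bracket of
generators in which each generator labelled by an element of `A` occurs exactly once, and no other
generator occurs. -/
inductive IsLieMonomial {S : Type u} : Set S → FreeLieAlgebra R S → Prop
  | of (s : S) : IsLieMonomial {s} (FreeLieAlgebra.of R s)
  | bracket {A B : Set S} {x y : FreeLieAlgebra R S} (h : Disjoint A B) (hx : IsLieMonomial A x)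
      (hy : IsLieMonomial B y) : IsLieMonomial (A ∪ B) ⁅x, y⁆

/-- The underlying module of the Lie representation: the multilinear part of the free Lie algebra
on `S`, spanned by the brackets that contain each generator exactly once. -/
def multilinearLie (S : Type u) : Submodule R (FreeLieAlgebra R S) :=
  Submodule.span R {x | IsLieMonomial R Set.univ x}

/-- The automorphism of the free Lie algebra that permutes the generators. -/
def freeLieMap {S : Type u} (σ : Equiv.Perm S) : FreeLieAlgebra R S →ₗ⁅R⁆ FreeLieAlgebra R S :=
  FreeLieAlgebra.lift R fun s => FreeLieAlgebra.of R (σ s)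

lemma freeLieMap_of {S : Type u} (σ : Equiv.Perm S) (s : S) :
    freeLieMap R σ (FreeLieAlgebra.of R s) = FreeLieAlgebra.of R (σ s) :=
  FreeLieAlgebra.lift_of_apply _ _

variable {R} in
lemma IsLieMonomial.map {S : Type u} (σ : Equiv.Perm S) {A : Set S} {x : FreeLieAlgebra R S}
    (h : IsLieMonomial R A x) : IsLieMonomial R (σ '' A) (freeLieMap R σ x) := by
  induction h with
  | of s =>
    rw [Set.image_singleton, freeLieMap_of]
    exact .of _
  | bracket h _ _ hx hy =>
    rw [Set.image_union, LieHom.map_lie]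
    exact .bracket ((Set.disjoint_image_iff σ.injective).2 h) hx hy

lemma freeLieMap_mem {S : Type u} (σ : Equiv.Perm S) (x : FreeLieAlgebra R S)
    (hx : x ∈ multilinearLie R S) : (freeLieMap R σ : _ →ₗ[R] _) x ∈ multilinearLie R S := by
  refine (Submodule.span_le.2 ?_ : multilinearLie R S ≤ (multilinearLie R S).comap
    (freeLieMap R σ : FreeLieAlgebra R S →ₗ[R] FreeLieAlgebra R S)) hx
  intro y hy
  refine Submodule.subset_span ?_
  have := IsLieMonomial.map σ hy
  rwa [Set.image_univ, σ.range_eq_univ] at this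

/-- The Lie representation of the symmetric group of `S`. -/
def lieRep (S : Type u) : Representation R (Equiv.Perm S) ↥(multilinearLie R S) where
  toFun σ := (freeLieMap R σ : FreeLieAlgebra R S →ₗ[R] FreeLieAlgebra R S).restrict
    (freeLieMap_mem R σ)
  map_one' := by
    have : freeLieMap R (1 : Equiv.Perm S) = LieHom.id := by
      refine FreeLieAlgebra.hom_ext fun s => ?_
      rw [freeLieMap_of]
      rfl
    refine LinearMap.ext fun x => Subtype.ext ?_
    exact congr($this x.1)
  map_mul' σ τ := by
    have : freeLieMap R (σ * τ) = (freeLieMap R σ).comp (freeLieMap R τ) := by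
      refine FreeLieAlgebra.hom_ext fun s => ?_
      rw [LieHom.comp_apply, freeLieMap_of, freeLieMap_of, freeLieMap_of]
      rfl
    refine LinearMap.ext fun x => Subtype.ext ?_
    exact congr($this x.1)

/-- The twist of a representation of a symmetric group by the sign character. -/
def signTwist {S : Type u} [Fintype S] [DecidableEq S] {V : Type u} [AddCommGroup V] [Module ℤ V]
    (ρ : Representation ℤ (Equiv.Perm S) V) : Representation ℤ (Equiv.Perm S) V where
  toFun σ := (Equiv.Perm.sign σ : ℤ) • ρ σ
  map_one' := by simp
  map_mul' σ τ := by
    refine LinearMap.ext fun x => ?_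
    simp [mul_smul]

end Lie
end TreeOperad

end

/-! Faces and the operad structure. A simplex of `treeOperad.obj S` is a chain of trees together
with a sequence of orderings. It lies on the face of `M` exactly when `M` is an edge of every tree
and an interval of every ordering (`mem_face_iff`), and cutting at `M` recovers both factors. This
gives injectivity, and it describes intersections: two edges of one tree are nested or disjoint, so
crossing sets give disjoint faces. Freeness holds because an order automorphism of a finite total
order is trivial; contractibility comes from a homotopy to the star tree.

Homotopy types. Every tree has an ordering for which all its edges are intervals, and orderings may
be changed at will along a homotopy. So the pair of the operad space and its boundary is equivalent
to the nerve of the poset of trees with the subcomplex of trees that have an internal edge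
(`treeOperad_pair`). A point of this nerve amounts to a function of edge lengths in `[0, 1]`; the
boundary becomes the link `treeLink`, where the longest edge has length one, and the quotient
becomes the one-point compactification of the cone `treeCone`.

Fix a twig `s`. The edges below `s` form a chain, and the one with `j` twigs above it, if present,
is the edge of level `j`. For `j = 1, 2, …` the trees without edge of level `j + 1` are collapsed to
infinity. They form a contractible subspace: the subtree on the set `B` of level `j` slides towards
the root and then beyond it on an ever longer new edge. A passed edge `N` becomes `N \ B`, and this
is an edge precisely because level `j + 1` is missing. In the end all levels are present, the trees
are combs, and combs correspond to words that start with `s`. Hence there remain `(n - 1)!` open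
cells of dimension `n - 2`, or `n - 3` in the link, where level two is normalized. Their one-point
compactification is the wedge of spheres.

Cohomology. In top degree, normalized cochains are spanned by indicators of flags, that is, binary
trees with an order of their edges. Coboundaries make the order of the edges matter only up to sign
and relate the trees that differ in one edge; this reduces all flags to combs that start with `s`
(`cocycle_mem`). Conversely, every word `w` gives a cycle, the sphere of bracketings of `w`, and the
comb of a word `e` evaluates on it to a sign or zero: it is nonzero iff the positions in `e` of the
successive letters of `w` form a valley (`wordPairing_combFlag`).

In the free Lie algebra the coefficient of `w` in the left-normed bracket of `e` obeys the same rule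
up to the sign of the permutation between the words (`lieCoeff_wordComb`). Among words that start
with `s` a valley is the identity, so both pairings are dual to the combs, which are therefore bases
on both sides. Matching the combs with signs gives an isomorphism that intertwines the pairings with
all words, and relabelling words shows that it is equivariant up to the sign character. The
stabilizer of `s` permutes the basis of combs simply transitively, which is the regular
representation. -/

noncomputable section

namespace TreeOperad

/-! ### Points of the geometric realization -/

section Realization

open Simplicial

variable {X Y : SSet.{u}}

/-- The point of `|X|` given by a simplex and barycentric coordinates in it. -/
def realize {k : ℕ} (x : X.obj (op ⦋k⦌)) (w : stdSimplex ℝ (Fin (k + 1))) : SSet.toTop.obj X :=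
  SSet.toTop.map (SSet.yonedaEquiv.symm x) (⦋k⦌.toTopHomeo.symm w)

lemma continuous_realize {k : ℕ} (x : X.obj (op ⦋k⦌)) : Continuous (realize x) :=
  (SSet.toTop.map (SSet.yonedaEquiv.symm x)).hom.continuous.comp ⦋k⦌.toTopHomeo.symm.continuous

lemma realize_map {k l : ℕ} (f : (⦋k⦌ : SimplexCategory) ⟶ ⦋l⦌) (x : X.obj (op ⦋l⦌))
    (w : stdSimplex ℝ (Fin (k + 1))) :
    realize (X.map f.op x) w = realize x (stdSimplex.map f w) := by
  have h : SSet.yonedaEquiv.symm (X.map f.op x) =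
      SSet.stdSimplex.map f ≫ SSet.yonedaEquiv.symm x := by
    ext m α
    change X.map (SSet.stdSimplex.objEquiv α).op (X.map f.op x) =
      X.map (SSet.stdSimplex.objEquiv α ≫ f).op x
    rw [op_comp, Functor.map_comp]
    rfl
  unfold realize
  rw [h, SimplexCategory.toTopHomeo_symm_naturality_apply, Functor.map_comp]
  rfl

lemma toTop_map_realize (g : X ⟶ Y) {k : ℕ} (x : X.obj (op ⦋k⦌))
    (w : stdSimplex ℝ (Fin (k + 1))) :
    SSet.toTop.map g (realize x w) = realize (g.app _ x) w := by
  have h : SSet.yonedaEquiv.symm (g.app _ x) = SSet.yonedaEquiv.symm x ≫ g := by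
    apply SSet.yonedaEquiv.injective
    simp
  unfold realize
  rw [h, Functor.map_comp]
  rfl

/-- The simplicial map to the singular simplicial set of `Z` given by a natural family of maps. -/
def singularOfFamily {Z : Type u} [TopologicalSpace Z]
    (G : ∀ k : ℕ, X.obj (op ⦋k⦌) → C(stdSimplex ℝ (Fin (k + 1)), Z))
    (hG : ∀ {k l : ℕ} (f : (⦋k⦌ : SimplexCategory) ⟶ ⦋l⦌) (x : X.obj (op ⦋l⦌)) w,
      G k (X.map f.op x) w = G l x (stdSimplex.map f w)) :
    X ⟶ TopCat.toSSet.obj (TopCat.of Z) where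
  app k := ↾fun x => ((TopCat.of Z).toSSetObjEquiv k).symm (G k.unop.len x)
  naturality k l f := by
    ext x
    apply ((TopCat.of Z).toSSetObjEquiv l).injective
    ext w
    exact hG (k := l.unop.len) (l := k.unop.len) f.unop x w

/-- The unit of the adjunction sends a simplex to its characteristic map; this turns the abstract
adjoint into a formula on points. -/
lemma homEquiv_symm_realize {Z : TopCat.{u}} (φ : X ⟶ TopCat.toSSet.obj Z) {k : ℕ}
    (x : X.obj (op ⦋k⦌)) (w : stdSimplex ℝ (Fin (k + 1))) :
    (sSetTopAdj.homEquiv X Z).symm φ (realize x w) =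
      Z.toSSetObjEquiv _ (φ.app _ x) w := by
  obtain ⟨f, rfl⟩ := (sSetTopAdj.homEquiv X Z).surjective φ
  rw [Equiv.symm_apply_apply, Adjunction.homEquiv_unit]
  have h := sSetTopAdj_unit_app_app_down X (op ⦋k⦌) x
  change _ = (((sSetTopAdj.unit.app X).app _ x).down ≫ f).hom (ULift.up w)
  rw [h]
  rfl

/-- A natural family of maps on simplices gives a map on the geometric realization. -/
def realizeDesc {Z : Type u} [TopologicalSpace Z]
    (G : ∀ k : ℕ, X.obj (op ⦋k⦌) → C(stdSimplex ℝ (Fin (k + 1)), Z))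
    (hG : ∀ {k l : ℕ} (f : (⦋k⦌ : SimplexCategory) ⟶ ⦋l⦌) (x : X.obj (op ⦋l⦌)) w,
      G k (X.map f.op x) w = G l x (stdSimplex.map f w)) : C(SSet.toTop.obj X, Z) :=
  ((sSetTopAdj.homEquiv X (TopCat.of Z)).symm (singularOfFamily G hG)).hom

lemma realizeDesc_realize {Z : Type u} [TopologicalSpace Z]
    (G : ∀ k : ℕ, X.obj (op ⦋k⦌) → C(stdSimplex ℝ (Fin (k + 1)), Z))
    (hG : ∀ {k l : ℕ} (f : (⦋k⦌ : SimplexCategory) ⟶ ⦋l⦌) (x : X.obj (op ⦋l⦌)) w,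
      G k (X.map f.op x) w = G l x (stdSimplex.map f w)) {k : ℕ} (x : X.obj (op ⦋k⦌))
    (w : stdSimplex ℝ (Fin (k + 1))) :
    realizeDesc G hG (realize x w) = G k x w :=
  homEquiv_symm_realize _ _ _

lemma toTop_hom_ext {Z : TopCat.{u}} {f g : SSet.toTop.obj X ⟶ Z}
    (h : ∀ (k : ℕ) (x : X.obj (op ⦋k⦌)) w, f (realize x w) = g (realize x w)) : f = g := by
  apply (sSetTopAdj.homEquiv X Z).injective
  ext k x
  apply (Z.toSSetObjEquiv k).injective
  ext w
  have := h k.unop.len x w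
  rw [← (sSetTopAdj.homEquiv X Z).symm_apply_apply f,
    ← (sSetTopAdj.homEquiv X Z).symm_apply_apply g, homEquiv_symm_realize,
    homEquiv_symm_realize] at this
  exact this

/-- The two-point indiscrete space. -/
def IndiscreteProp : Type u := ULift.{u} Prop

instance : TopologicalSpace IndiscreteProp.{u} := ⊤

/-- Every predicate is a continuous map to the indiscrete two-point space. The predicate "is hit by
a simplex" and the constant true predicate agree on all points coming from simplices, hence are
equal as maps on the realization. -/
lemma exists_realize (p : SSet.toTop.obj X) :
    ∃ (k : ℕ) (x : X.obj (op ⦋k⦌)) (w : stdSimplex ℝ (Fin (k + 1))), realize x w = p := by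
  let mk (q : SSet.toTop.obj X → Prop) : SSet.toTop.obj X ⟶ TopCat.of IndiscreteProp.{u} :=
    TopCat.ofHom ⟨fun a => (ULift.up (q a) : ULift.{u} Prop), continuous_top⟩
  have h : mk (fun a => ∃ (k : ℕ) (x : X.obj (op ⦋k⦌)) (w : stdSimplex ℝ (Fin (k + 1))),
      realize x w = a) = mk fun _ => True := by
    refine toTop_hom_ext fun k x w => ?_
    have : (∃ (k' : ℕ) (x' : X.obj (op ⦋k'⦌)) (w' : stdSimplex ℝ (Fin (k' + 1))),
      realize x' w' = realize x w) = True := eq_true ⟨k, x, w, rfl⟩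
    exact congrArg (ULift.up.{u}) this
  have h2 : (_ : ULift.{u} Prop) = _ := congrArg (fun f : SSet.toTop.obj X ⟶ _ => f p) h
  exact of_eq_true (congrArg ULift.down h2)

end Realization

/-! ### Realization of simplicial homotopies -/

section Prism

open Simplicial unitInterval

/-- The sum of the first `m` barycentric coordinates. -/
def cumul {k : ℕ} (w : stdSimplex ℝ (Fin (k + 1))) (m : ℕ) : ℝ :=
  ∑ j : Fin (k + 1) with j.val < m, w j

lemma cumul_zero {k : ℕ} (w : stdSimplex ℝ (Fin (k + 1))) : cumul w 0 = 0 := by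
  simp [cumul]

lemma cumul_of_le {k : ℕ} (w : stdSimplex ℝ (Fin (k + 1))) {m : ℕ} (h : k + 1 ≤ m) :
    cumul w m = 1 := by
  rw [← stdSimplex.sum_eq_one w, cumul]
  refine Finset.sum_congr (Finset.filter_true_of_mem fun j _ => by omega) fun _ _ => rfl

lemma sum_filter_lt_succ {k : ℕ} (f : Fin (k + 1) → ℝ) (j : Fin (k + 1)) :
    (∑ i : Fin (k + 1) with i.val < j.val + 1, f i) =
      (∑ i : Fin (k + 1) with i.val < j.val, f i) + f j := by
  have : (Finset.univ.filter fun i : Fin (k + 1) => i.val < j.val + 1) =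
      insert j (Finset.univ.filter fun i : Fin (k + 1) => i.val < j.val) := by
    ext i
    simp [Fin.ext_iff]
    omega
  rw [this, Finset.sum_insert (by simp), add_comm]

lemma cumul_succ {k : ℕ} (w : stdSimplex ℝ (Fin (k + 1))) (j : Fin (k + 1)) :
    cumul w (j.val + 1) = cumul w j.val + w j :=
  sum_filter_lt_succ _ j

lemma cumul_mono {k : ℕ} (w : stdSimplex ℝ (Fin (k + 1))) : Monotone (cumul w) := by
  intro a b h
  refine Finset.sum_le_sum_of_subset_of_nonneg (fun j => ?_) fun j _ _ => w.2.1 j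
  simp only [Finset.mem_filter, Finset.mem_univ, true_and]
  omega

@[fun_prop]
lemma continuous_cumul {k : ℕ} (m : ℕ) :
    Continuous fun w : stdSimplex ℝ (Fin (k + 1)) => cumul w m :=
  continuous_finsetSum _ fun j _ => (continuous_apply j).comp continuous_subtype_val

/-- The part of the interval of length `w j` that lies below `t`. -/
def lowPart {k : ℕ} (w : stdSimplex ℝ (Fin (k + 1))) (t : ℝ) (j : Fin (k + 1)) : ℝ :=
  min t (cumul w (j + 1)) - min t (cumul w j)

lemma sum_lowPart {k : ℕ} (w : stdSimplex ℝ (Fin (k + 1))) {t : ℝ} (ht : 0 ≤ t) (m : ℕ) :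
    ∑ j : Fin (k + 1) with j.val < m, lowPart w t j = min t (cumul w m) := by
  induction m with
  | zero => simp [cumul_zero, ht]
  | succ m ih =>
    by_cases h : m < k + 1
    · have := sum_filter_lt_succ (lowPart w t) ⟨m, h⟩
      simp only at this
      rw [this, ih, lowPart]
      ring
    · have h1 : (Finset.univ.filter fun j : Fin (k + 1) => j.val < m + 1) =
          Finset.univ.filter fun j : Fin (k + 1) => j.val < m := by
        ext j
        simp
        omega
      rw [h1, ih, cumul_of_le w (by omega), cumul_of_le w (by omega)]

lemma lowPart_nonneg {k : ℕ} (w : stdSimplex ℝ (Fin (k + 1))) (t : ℝ) (j : Fin (k + 1)) :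
    0 ≤ lowPart w t j :=
  sub_nonneg.2 (min_le_min_left _ (cumul_mono w (Nat.le_succ _)))

lemma lowPart_le {k : ℕ} (w : stdSimplex ℝ (Fin (k + 1))) (t : ℝ) (j : Fin (k + 1)) :
    lowPart w t j ≤ w j := by
  have h := cumul_succ w j
  have h1 := w.2.1 j
  change 0 ≤ w j at h1
  unfold lowPart
  rw [h]
  rcases le_total t (cumul w j) with h2 | h2
  · rw [min_eq_left h2, min_eq_left (by linarith)]
    linarith
  · rw [min_eq_right h2]
    linarith [min_le_right t (cumul w j + w j)]

/-- The coordinates of a point of the prism `Δᵏ × I`, doubled into the parts below and above the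
cut. -/
def doubled {k : ℕ} (w : stdSimplex ℝ (Fin (k + 1))) (t : I) :
    stdSimplex ℝ (Fin (k + 1) ⊕ Fin (k + 1)) :=
  ⟨Sum.elim (lowPart w t) (fun j => w j - lowPart w t j), by
    rintro (j | j)
    · exact lowPart_nonneg _ _ _
    · exact sub_nonneg.2 (lowPart_le _ _ _), by
    rw [Fintype.sum_sum_type, ← Finset.sum_add_distrib, ← stdSimplex.sum_eq_one w]
    simp⟩

lemma continuous_doubled {k : ℕ} :
    Continuous fun p : stdSimplex ℝ (Fin (k + 1)) × I => doubled p.1 p.2 := by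
  have hw : ∀ j, Continuous fun p : stdSimplex ℝ (Fin (k + 1)) × I => p.1 j := fun j =>
    (continuous_apply j).comp (continuous_subtype_val.comp continuous_fst)
  have hl : ∀ j, Continuous fun p : stdSimplex ℝ (Fin (k + 1)) × I => lowPart p.1 p.2 j := by
    intro j
    unfold lowPart
    fun_prop
  refine Continuous.subtype_mk (continuous_pi ?_) _
  rintro (j | j)
  · exact hl j
  · exact (hw j).sub (hl j)

lemma stdSimplex_map_apply {α β : Type*} [Fintype α] [Fintype β] [DecidableEq β] (f : α → β)
    (w : stdSimplex ℝ α) (b : β) : stdSimplex.map f w b = ∑ a with f a = b, w a := by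
  simp [FunOnFinite.linearMap_apply_apply]

lemma cumul_map {k l : ℕ} (f : Fin (k + 1) →o Fin (l + 1)) (w : stdSimplex ℝ (Fin (k + 1)))
    (m : ℕ) : cumul (stdSimplex.map f w) m = ∑ j with (f j).val < m, w j := by
  unfold cumul
  simp_rw [stdSimplex_map_apply]
  rw [← Finset.sum_fiberwise_of_maps_to
    (s := Finset.univ.filter fun j => (f j).val < m)
    (t := Finset.univ.filter fun j : Fin (l + 1) => j.val < m) (g := f) (by simp)]
  refine Finset.sum_congr rfl fun p hp => Finset.sum_congr ?_ fun _ _ => rfl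
  ext j
  simp only [Finset.mem_filter, Finset.mem_univ, true_and] at hp ⊢
  constructor
  · rintro rfl
    exact ⟨hp, rfl⟩
  · exact And.right

lemma exists_lt_iff_of_monotone {k l : ℕ} (f : Fin (k + 1) →o Fin (l + 1)) (m : ℕ) :
    ∃ m' : ℕ, ∀ j, (f j).val < m ↔ j.val < m' := by
  by_cases h : ∀ j, (f j).val < m
  · exact ⟨k + 1, fun j => ⟨fun _ => j.2, fun _ => h j⟩⟩
  · have h' : ∃ m' : ℕ, ∃ h : m' < k + 1, m ≤ (f ⟨m', h⟩).val := by
      push Not at h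
      obtain ⟨j, hj⟩ := h
      exact ⟨j, j.2, hj⟩
    classical
    refine ⟨Nat.find h', fun j => ?_⟩
    obtain ⟨h1, h2⟩ := Nat.find_spec h'
    constructor
    · intro h3
      by_contra h4
      have : f ⟨Nat.find h', h1⟩ ≤ f j := f.monotone (Fin.mk_le_of_le_val (not_lt.1 h4))
      have : (f ⟨Nat.find h', h1⟩).val ≤ (f j).val := this
      omega
    · intro h3
      have := Nat.find_min h' h3
      push Not at this
      exact this j.2

/-- A monotone map pulls initial segments back to initial segments, so the partial sums of both
sides are the same truncations `min t _`; the individual terms are differences of partial sums. -/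
lemma lowPart_map {k l : ℕ} (f : Fin (k + 1) →o Fin (l + 1)) (w : stdSimplex ℝ (Fin (k + 1)))
    {t : ℝ} (ht : 0 ≤ t) (p : Fin (l + 1)) :
    lowPart (stdSimplex.map f w) t p = ∑ j with f j = p, lowPart w t j := by
  have key : ∀ m, min t (cumul (stdSimplex.map f w) m) =
      ∑ j with (f j).val < m, lowPart w t j := by
    intro m
    obtain ⟨m', hm'⟩ := exists_lt_iff_of_monotone f m
    rw [cumul_map]
    simp_rw [hm']
    rw [sum_lowPart w ht]
    rfl
  rw [lowPart, key, key]
  have : (Finset.univ.filter fun j => (f j).val < p.val + 1) =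
      (Finset.univ.filter fun j => (f j).val < p.val) ∪ Finset.univ.filter fun j => f j = p := by
    ext j
    simp [Fin.ext_iff]
    omega
  rw [this, Finset.sum_union]
  · ring
  · rw [Finset.disjoint_left]
    intro j
    simp only [Finset.mem_filter, Finset.mem_univ, true_and]
    rintro h rfl
    omega

lemma doubled_map {k l : ℕ} (f : Fin (k + 1) →o Fin (l + 1)) (w : stdSimplex ℝ (Fin (k + 1)))
    (t : I) : doubled (stdSimplex.map f w) t = stdSimplex.map (Sum.map f f) (doubled w t) := by
  refine stdSimplex.ext (funext fun p => ?_)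
  rw [stdSimplex_map_apply, Finset.sum_filter, Fintype.sum_sum_type]
  rcases p with p | p
  · change lowPart _ _ _ = _
    simp [lowPart_map f w t.2.1, doubled, Finset.sum_filter]
    rfl
  · change stdSimplex.map f w p - lowPart _ _ _ = _
    rw [lowPart_map f w t.2.1, stdSimplex_map_apply, ← Finset.sum_sub_distrib, Finset.sum_filter]
    simp [doubled]
    rfl

/-- Positions of the doubled coordinates in the `i`-th simplex of the prism. -/
def prismPos {k : ℕ} (i : Fin (k + 1)) : Fin (k + 1) ⊕ Fin (k + 1) → Fin (k + 2) :=
  Sum.elim (fun j => (min j i).castSucc) (fun j => (max j i).succ)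

/-- The projection of the `i`-th simplex of the prism to `Δᵏ`. -/
def prismFst {k : ℕ} (i : Fin (k + 1)) : Fin (k + 2) →o Fin (k + 1) :=
  ⟨i.predAbove, i.predAbove_right_monotone⟩

/-- The projection of the `i`-th simplex of the prism to `Δ¹`. -/
def prismSnd {k : ℕ} (i : Fin (k + 1)) : Fin (k + 2) →o Fin 2 :=
  ⟨fun p => if p ≤ i.castSucc then 0 else 1, by
    intro p q h
    by_cases hq : q ≤ i.castSucc
    · simp [hq, h.trans hq]
    · simp only [hq, if_false]
      exact Fin.le_last _⟩

lemma prismFst_apply {k : ℕ} (i : Fin (k + 1)) (p : Fin (k + 2)) :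
    prismFst i p = i.predAbove p := rfl

lemma prismSnd_apply {k : ℕ} (i : Fin (k + 1)) (p : Fin (k + 2)) :
    prismSnd i p = if p ≤ i.castSucc then 0 else 1 := rfl

variable {X Y : SSet.{u}}

/-- The value of a simplicial homotopy at a simplex of `X` and a simplex of the interval, both
pulled back to `Δˡ`. -/
def homotopyAt (H : X ⊗ Δ[1] ⟶ Y) {k l : ℕ} (x : X.obj (op ⦋k⦌)) (a : Fin (l + 1) →o Fin (k + 1))
    (α : Fin (l + 1) →o Fin 2) : Y.obj (op ⦋l⦌) :=
  H.app _ (X.map (SimplexCategory.mkHom a).op x,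
    SSet.stdSimplex.objEquiv.symm (SimplexCategory.mkHom α))

lemma realize_homotopyAt_comp (H : X ⊗ Δ[1] ⟶ Y) {k l m : ℕ} (x : X.obj (op ⦋k⦌))
    (a : Fin (l + 1) →o Fin (k + 1)) (α : Fin (l + 1) →o Fin 2) (r : Fin (m + 1) →o Fin (l + 1))
    (w : stdSimplex ℝ (Fin (m + 1))) :
    realize (homotopyAt H x (a.comp r) (α.comp r)) w =
      realize (homotopyAt H x a α) (stdSimplex.map r w) := by
  have h : homotopyAt H x (a.comp r) (α.comp r) =
      Y.map (SimplexCategory.mkHom r).op (homotopyAt H x a α) := by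
    unfold homotopyAt
    have h1 : X.map (SimplexCategory.mkHom (a.comp r)).op x =
        X.map (SimplexCategory.mkHom r).op (X.map (SimplexCategory.mkHom a).op x) := by
      have : SimplexCategory.mkHom (a.comp r) =
        SimplexCategory.mkHom r ≫ SimplexCategory.mkHom a := rfl
      rw [this, op_comp, Functor.map_comp]
      rfl
    rw [h1]
    exact NatTrans.naturality_apply H (SimplexCategory.mkHom r).op
      (show (X ⊗ Δ[1]).obj (op ⦋l⦌) from (X.map (SimplexCategory.mkHom a).op x,
        SSet.stdSimplex.objEquiv.symm (SimplexCategory.mkHom α)))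
  rw [h]
  exact realize_map (SimplexCategory.mkHom r) _ w

/-- The `i`-th piece of the realized homotopy on the prism over a simplex. -/
def prismPiece (H : X ⊗ Δ[1] ⟶ Y) {k : ℕ} (x : X.obj (op ⦋k⦌)) (i : Fin (k + 1))
    (w : stdSimplex ℝ (Fin (k + 1))) (t : I) : SSet.toTop.obj Y :=
  realize (homotopyAt H x (prismFst i) (prismSnd i)) (stdSimplex.map (prismPos i) (doubled w t))

lemma continuous_prismPiece (H : X ⊗ Δ[1] ⟶ Y) {k : ℕ} (x : X.obj (op ⦋k⦌)) (i : Fin (k + 1)) :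
    Continuous fun p : stdSimplex ℝ (Fin (k + 1)) × I => prismPiece H x i p.1 p.2 :=
  (continuous_realize _).comp ((stdSimplex.continuous_map _).comp continuous_doubled)

/-- The cut `t` lies in the `i`-th interval. -/
def CutAt {k : ℕ} (i : Fin (k + 1)) (w : stdSimplex ℝ (Fin (k + 1))) (t : I) : Prop :=
  cumul w i ≤ t ∧ t ≤ cumul w (i + 1)

lemma exists_cutAt {k : ℕ} (w : stdSimplex ℝ (Fin (k + 1))) (t : I) : ∃ i, CutAt i w t := by
  have h : ∃ m : ℕ, t ≤ cumul w (m + 1) := ⟨k, by rw [cumul_of_le w le_rfl]; exact t.2.2⟩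
  classical
  have hk : Nat.find h ≤ k := Nat.find_min' h (by rw [cumul_of_le w le_rfl]; exact t.2.2)
  refine ⟨⟨Nat.find h, by omega⟩, ?_, Nat.find_spec h⟩
  change cumul w (Nat.find h) ≤ t
  rcases Nat.eq_zero_or_pos (Nat.find h) with h0 | h0
  · rw [h0, cumul_zero]
    exact t.2.1
  · have := Nat.find_min h (Nat.sub_lt h0 one_pos)
    rw [Nat.sub_add_cancel (show 1 ≤ _ from h0)] at this
    exact (not_le.1 this).le

lemma isClosed_cutAt {k : ℕ} (i : Fin (k + 1)) :
    IsClosed (Set.ofPred fun p : stdSimplex ℝ (Fin (k + 1)) × I => CutAt i p.1 p.2) :=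
  (isClosed_le ((continuous_cumul _).comp continuous_fst)
    (continuous_subtype_val.comp continuous_snd)).inter
    (isClosed_le (continuous_subtype_val.comp continuous_snd)
      ((continuous_cumul _).comp continuous_fst))

lemma CutAt.lowPart_eq_zero {k : ℕ} {i : Fin (k + 1)} {w : stdSimplex ℝ (Fin (k + 1))} {t : I}
    (h : CutAt i w t) {j : Fin (k + 1)} (hj : i < j) : lowPart w t j = 0 := by
  have h1 : cumul w (i + 1) ≤ cumul w j := cumul_mono w (by simpa using hj)
  have h2 : cumul w j ≤ cumul w (j + 1) := cumul_mono w (by omega)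
  unfold lowPart
  rw [min_eq_left (h.2.trans (h1.trans h2)), min_eq_left (h.2.trans h1), sub_self]

lemma CutAt.lowPart_eq {k : ℕ} {i : Fin (k + 1)} {w : stdSimplex ℝ (Fin (k + 1))} {t : I}
    (h : CutAt i w t) {j : Fin (k + 1)} (hj : j < i) : lowPart w t j = w j := by
  have h1 : cumul w (j + 1) ≤ cumul w i := cumul_mono w (by simpa using hj)
  have h2 : cumul w j ≤ cumul w (j + 1) := cumul_mono w (by omega)
  unfold lowPart
  rw [min_eq_right (h1.trans h.1), min_eq_right (h2.trans (h1.trans h.1)), cumul_succ]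
  ring

lemma stdSimplex_map_congr {α β : Type*} [Fintype α] [Fintype β] {f g : α → β}
    {w : stdSimplex ℝ α} (h : ∀ a, w a ≠ 0 → f a = g a) :
    stdSimplex.map f w = stdSimplex.map g w := by
  classical
  refine stdSimplex.ext (funext fun b => ?_)
  rw [stdSimplex_map_apply, stdSimplex_map_apply, Finset.sum_filter, Finset.sum_filter]
  refine Finset.sum_congr rfl fun a _ => ?_
  by_cases ha : w a = 0
  · simp [ha]
  · rw [h a ha]

/-- If the cut lies in both intervals, the weights strictly between them vanish and the point lies
on a common face of the two prism simplices. This compatibility lets the pieces be glued. -/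
lemma prismPiece_eq_of_lt (H : X ⊗ Δ[1] ⟶ Y) {k : ℕ} (x : X.obj (op ⦋k⦌)) {i i' : Fin (k + 1)}
    (hi : i < i') {w : stdSimplex ℝ (Fin (k + 1))} {t : I} (h : CutAt i w t) (h' : CutAt i' w t) :
    prismPiece H x i w t = prismPiece H x i' w t := by
  -- Retraction onto the positions `≤ i` and `≥ i' + 1`, the only ones that carry weight. After
  -- composition with `r` the two prism simplices have the same projections.
  let r : Fin (k + 2) →o Fin (k + 2) := ⟨fun p => if p ≤ i.castSucc then p else max p i'.succ, by
    intro p q hpq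
    simp only [Fin.le_def, Fin.lt_def] at *
    split_ifs <;> simp <;> omega⟩
  have hr : ∀ p, r p = if p ≤ i.castSucc then p else max p i'.succ := fun _ => rfl
  have hs : ∀ a, doubled w t a ≠ 0 → (∃ j ≤ i, a = .inl j) ∨ ∃ j, i' ≤ j ∧ a = .inr j := by
    rintro (j | j) ha
    · refine .inl ⟨j, ?_, rfl⟩
      by_contra hj
      exact ha (h.lowPart_eq_zero (not_le.1 hj))
    · refine .inr ⟨j, ?_, rfl⟩
      by_contra hj
      exact ha (sub_eq_zero.2 (h'.lowPart_eq (not_le.1 hj)).symm)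
  have e1 : stdSimplex.map (prismPos i) (doubled w t) =
      stdSimplex.map (prismPos i') (doubled w t) := by
    refine stdSimplex_map_congr fun a ha => ?_
    rcases hs a ha with ⟨j, hj, rfl⟩ | ⟨j, hj, rfl⟩
    · simp [prismPos, min_eq_left hj, min_eq_left (hj.trans hi.le)]
    · simp [prismPos, max_eq_left hj, max_eq_left (hi.le.trans hj)]
  have e2 : stdSimplex.map r (stdSimplex.map (prismPos i) (doubled w t)) =
      stdSimplex.map (prismPos i) (doubled w t) := by
    rw [stdSimplex.map_comp_apply]
    refine stdSimplex_map_congr fun a ha => ?_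
    rcases hs a ha with ⟨j, hj, rfl⟩ | ⟨j, hj, rfl⟩
    · simp [prismPos, hr, hj]
    · have h1 : ¬ j.succ ≤ i.castSucc := by
        simp only [Fin.le_def, Fin.lt_def, Fin.val_succ, Fin.val_castSucc] at *
        omega
      have h2 : max j i = j := max_eq_left (hi.le.trans hj)
      have h3 : max j.succ i'.succ = j.succ := max_eq_left (Fin.succ_le_succ_iff.2 hj)
      simp only [prismPos, hr, Function.comp_apply, Sum.elim_inr, h2, h1, if_false, h3]
  have e3 : (prismFst i).comp r = (prismFst i').comp r := by
    ext p
    simp only [prismFst_apply, hr, OrderHom.comp_coe, Function.comp_apply]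
    by_cases hp : p ≤ i.castSucc
    · have hp' : p ≤ i'.castSucc := hp.trans (Fin.castSucc_le_castSucc_iff.2 hi.le)
      rw [if_pos hp, Fin.predAbove_of_le_castSucc _ _ hp, Fin.predAbove_of_le_castSucc _ _ hp']
    · have h2 : i'.castSucc < max p i'.succ := lt_max_of_lt_right Fin.castSucc_lt_succ
      have h1 : i.castSucc < max p i'.succ := lt_max_of_lt_left (not_le.1 hp)
      rw [if_neg hp, Fin.predAbove_of_castSucc_lt _ _ h1, Fin.predAbove_of_castSucc_lt _ _ h2]
  have e4 : (prismSnd i).comp r = (prismSnd i').comp r := by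
    ext p
    simp only [prismSnd_apply, hr, OrderHom.comp_coe, Function.comp_apply]
    simp only [Fin.le_def, Fin.lt_def, Fin.val_castSucc] at hi ⊢
    split_ifs <;> simp_all <;> omega
  unfold prismPiece
  rw [← e1]
  conv_lhs => rw [← e2]
  conv_rhs => rw [← e2]
  rw [← realize_homotopyAt_comp, ← realize_homotopyAt_comp, e3, e4]

lemma prismPiece_eq (H : X ⊗ Δ[1] ⟶ Y) {k : ℕ} (x : X.obj (op ⦋k⦌)) {i i' : Fin (k + 1)}
    {w : stdSimplex ℝ (Fin (k + 1))} {t : I} (h : CutAt i w t) (h' : CutAt i' w t) :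
    prismPiece H x i w t = prismPiece H x i' w t := by
  rcases lt_trichotomy i i' with hi | rfl | hi
  · exact prismPiece_eq_of_lt H x hi h h'
  · rfl
  · exact (prismPiece_eq_of_lt H x hi h' h).symm

/-- The realized homotopy on the prism over a simplex. -/
def prismMap (H : X ⊗ Δ[1] ⟶ Y) {k : ℕ} (x : X.obj (op ⦋k⦌))
    (w : stdSimplex ℝ (Fin (k + 1))) (t : I) : SSet.toTop.obj Y :=
  prismPiece H x (exists_cutAt w t).choose w t

lemma prismMap_eq (H : X ⊗ Δ[1] ⟶ Y) {k : ℕ} (x : X.obj (op ⦋k⦌)) {i : Fin (k + 1)}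
    {w : stdSimplex ℝ (Fin (k + 1))} {t : I} (h : CutAt i w t) :
    prismMap H x w t = prismPiece H x i w t :=
  prismPiece_eq H x (exists_cutAt w t).choose_spec h

lemma continuous_prismMap (H : X ⊗ Δ[1] ⟶ Y) {k : ℕ} (x : X.obj (op ⦋k⦌)) :
    Continuous fun p : stdSimplex ℝ (Fin (k + 1)) × I => prismMap H x p.1 p.2 := by
  refine (locallyFinite_of_finite fun i : Fin (k + 1) =>
    (Set.ofPred fun p : stdSimplex ℝ (Fin (k + 1)) × I => CutAt i p.1 p.2)).continuous ?_ isClosed_cutAt fun i => ?_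
  · exact Set.eq_univ_of_forall fun p => Set.mem_iUnion.2 (exists_cutAt p.1 p.2)
  · exact (continuous_prismPiece H x i).continuousOn.congr fun p hp => prismMap_eq H x hp

/-- Naturality for all monotone maps, degeneracies included, is what is needed to define the
homotopy on the realization. A cut in interval `i` becomes a cut in interval `f i` because `f` is
monotone. -/
lemma prismMap_mkHom (H : X ⊗ Δ[1] ⟶ Y) {k l : ℕ} (f : Fin (k + 1) →o Fin (l + 1))
    (x : X.obj (op ⦋l⦌)) (w : stdSimplex ℝ (Fin (k + 1))) (t : I) :
    prismMap H (X.map (SimplexCategory.mkHom f).op x) w t =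
      prismMap H x (stdSimplex.map f w) t := by
  obtain ⟨i, hi⟩ := exists_cutAt w t
  have hi' : CutAt (f i) (stdSimplex.map f w) t := by
    constructor
    · refine le_trans ?_ hi.1
      rw [cumul_map]
      refine Finset.sum_le_sum_of_subset_of_nonneg (fun j => ?_) fun j _ _ => w.2.1 j
      simp only [Finset.mem_filter, Finset.mem_univ, true_and]
      intro h
      by_contra h'
      exact absurd (f.monotone (not_lt.1 h' : i ≤ j)) (not_le.2 h)
    · refine le_trans hi.2 ?_
      rw [cumul_map]
      refine Finset.sum_le_sum_of_subset_of_nonneg (fun j => ?_) fun j _ _ => w.2.1 j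
      simp only [Finset.mem_filter, Finset.mem_univ, true_and]
      intro h
      exact Nat.lt_succ_of_le (f.monotone (Nat.le_of_lt_succ h : j ≤ i))
  rw [prismMap_eq H _ hi, prismMap_eq H _ hi']
  -- The map of prism simplices over `f`: positions up to `i` stay in the bottom half, later ones in
  -- the top half.
  let g : Fin (k + 2) →o Fin (l + 2) :=
    ⟨fun p => if p ≤ i.castSucc then (f (i.predAbove p)).castSucc else (f (i.predAbove p)).succ, by
      intro p q hpq
      have h1 : (f (i.predAbove p)).val ≤ (f (i.predAbove q)).val :=
        f.monotone (i.predAbove_right_monotone hpq)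
      simp only [Fin.le_def] at *
      split_ifs <;> simp <;> omega⟩
  have hg : ∀ p, g p = if p ≤ i.castSucc then (f (i.predAbove p)).castSucc else
      (f (i.predAbove p)).succ := fun _ => rfl
  have h0 : ∀ p : Fin (k + 2), (p ≤ i.castSucc → i.predAbove p ≤ i ∧ g p = (f (i.predAbove p)).castSucc)
      ∧ (¬ p ≤ i.castSucc → i ≤ i.predAbove p ∧ g p = (f (i.predAbove p)).succ) := by
    intro p
    refine ⟨fun h => ⟨?_, (hg p).trans (if_pos h)⟩, fun h => ⟨?_, (hg p).trans (if_neg h)⟩⟩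
    · rw [Fin.predAbove_of_le_castSucc _ _ h]
      simpa [Fin.le_def] using h
    · rw [Fin.predAbove_of_castSucc_lt _ _ (not_le.1 h)]
      simp only [Fin.le_def, Fin.val_castSucc, Fin.val_pred] at h ⊢
      omega
  have e1 : f.comp (prismFst i) = (prismFst (f i)).comp g := by
    ext p
    by_cases h : p ≤ i.castSucc
    · obtain ⟨h1, h2⟩ := (h0 p).1 h
      have := f.monotone h1
      simp [prismFst_apply, h2, Fin.predAbove_of_le_castSucc, this]
    · obtain ⟨h1, h2⟩ := (h0 p).2 h
      have := f.monotone h1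
      simp [prismFst_apply, h2, Fin.predAbove_of_castSucc_lt, this, Fin.castSucc_lt_succ_iff]
  have e2 : prismSnd i = (prismSnd (f i)).comp g := by
    ext p
    by_cases h : p ≤ i.castSucc
    · obtain ⟨h1, h2⟩ := (h0 p).1 h
      have := f.monotone h1
      simp [prismSnd_apply, h2, h, this]
    · obtain ⟨h1, h2⟩ := (h0 p).2 h
      have := f.monotone h1
      have h3 : ¬ (f (i.predAbove p)).succ ≤ (f i).castSucc := by
        rw [not_le, Fin.castSucc_lt_succ_iff]
        exact this
      simp [prismSnd_apply, h2, h, h3]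
  have e3 : homotopyAt H (X.map (SimplexCategory.mkHom f).op x) (prismFst i) (prismSnd i) =
      homotopyAt H x ((prismFst (f i)).comp g) ((prismSnd (f i)).comp g) := by
    rw [← e1, ← e2]
    unfold homotopyAt
    have : X.map (SimplexCategory.mkHom (f.comp (prismFst i))).op x =
        X.map (SimplexCategory.mkHom (prismFst i)).op (X.map (SimplexCategory.mkHom f).op x) := by
      have : SimplexCategory.mkHom (f.comp (prismFst i)) =
        SimplexCategory.mkHom (prismFst i) ≫ SimplexCategory.mkHom f := rfl
      rw [this, op_comp, Functor.map_comp]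
      rfl
    rw [this]
  unfold prismPiece
  rw [e3, realize_homotopyAt_comp, doubled_map, stdSimplex.map_comp_apply,
    stdSimplex.map_comp_apply]
  congr 2
  funext a
  rcases a with j | j
  · have h1 : (min j i).castSucc ≤ i.castSucc := by simp
    simp only [Function.comp_apply, prismPos, Sum.elim_inl, Sum.map_inl]
    rw [((h0 _).1 h1).2, Fin.predAbove_of_le_castSucc _ _ h1, Fin.castPred_castSucc,
      f.monotone.map_min]
  · have h1 : ¬ (max j i).succ ≤ i.castSucc := by
      rw [not_le, Fin.castSucc_lt_succ_iff]
      exact le_max_right _ _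
    simp only [Function.comp_apply, prismPos, Sum.elim_inr, Sum.map_inr]
    rw [((h0 _).2 h1).2, Fin.predAbove_of_castSucc_lt _ _ (not_le.1 h1), Fin.pred_succ,
      f.monotone.map_max]

lemma prismMap_map (H : X ⊗ Δ[1] ⟶ Y) {k l : ℕ} (f : (⦋k⦌ : SimplexCategory) ⟶ ⦋l⦌)
    (x : X.obj (op ⦋l⦌)) (w : stdSimplex ℝ (Fin (k + 1))) (t : I) :
    prismMap H (X.map f.op x) w t = prismMap H x (stdSimplex.map f w) t :=
  prismMap_mkHom H f.toOrderHom x w t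

/-- The realization of a simplicial homotopy. It runs from the end `1` to the end `0`. -/
def realizeHomotopy (H : X ⊗ Δ[1] ⟶ Y) : C(SSet.toTop.obj X, C(I, SSet.toTop.obj Y)) :=
  realizeDesc (fun _ x => ContinuousMap.curry ⟨_, continuous_prismMap H x⟩) fun f x w => by
    ext t
    exact prismMap_map H f x w t

lemma realizeHomotopy_realize (H : X ⊗ Δ[1] ⟶ Y) {k : ℕ} (x : X.obj (op ⦋k⦌))
    (w : stdSimplex ℝ (Fin (k + 1))) (t : I) :
    realizeHomotopy H (realize x w) t = prismMap H x w t :=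
  DFunLike.congr_fun (realizeDesc_realize _ (fun f x w => by
    ext t
    exact prismMap_map H f x w t) x w) t

/-- At time zero all weight lies above the cut, hence over the vertex `1` of the interval. -/
lemma realizeHomotopy_zero (H : X ⊗ Δ[1] ⟶ Y) (p : SSet.toTop.obj X) :
    realizeHomotopy H p 0 = SSet.toTop.map (SSet.ι₁ ≫ H) p := by
  obtain ⟨k, x, w, rfl⟩ := exists_realize p
  have h0 : CutAt 0 w 0 := ⟨by simp [cumul_zero], by
    simpa [cumul_zero] using cumul_mono w (Nat.zero_le 1)⟩
  rw [realizeHomotopy_realize, prismMap_eq H x h0, toTop_map_realize, prismPiece]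
  have e : stdSimplex.map (prismPos 0) (doubled w 0) = stdSimplex.map (Fin.succOrderEmb (k + 1)).toOrderHom w := by
    -- Adding the two halves recovers `w`. Both sides are thus pushed forward from the doubled
    -- point, and the two maps need only agree on its support.
    have h1 : w = stdSimplex.map (Sum.elim id id) (doubled w 0) := by
      refine stdSimplex.ext (funext fun j => ?_)
      rw [stdSimplex_map_apply, Finset.sum_filter, Fintype.sum_sum_type]
      change w j = (∑ i, if i = j then lowPart w (0 : I) i else 0) +
        ∑ i, if i = j then w i - lowPart w (0 : I) i else 0
      simp
    conv_rhs => rw [h1, stdSimplex.map_comp_apply]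
    refine stdSimplex_map_congr ?_
    rintro (j | j) ha
    · refine absurd ?_ ha
      change lowPart w (0 : I) j = 0
      have h : ∀ m, (0 : ℝ) ≤ cumul w m := fun m => by
        simpa [cumul_zero] using cumul_mono w (Nat.zero_le m)
      simp [lowPart, h]
    · simp [prismPos]
  rw [e, ← realize_homotopyAt_comp]
  congr 1
  have e1 : (prismFst (0 : Fin (k + 1))).comp (Fin.succOrderEmb (k + 1)).toOrderHom = .id := by
    ext p
    simp [prismFst_apply]
  have e2 : (prismSnd (0 : Fin (k + 1))).comp (Fin.succOrderEmb (k + 1)).toOrderHom = OrderHom.const _ 1 := by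
    ext p
    simp [prismSnd_apply]
  rw [e1, e2]
  unfold homotopyAt
  have : X.map (SimplexCategory.mkHom (OrderHom.id : Fin (k + 1) →o Fin (k + 1))).op x = x :=
    Functor.map_id_apply X _ x
  rw [this]
  rfl

lemma realizeHomotopy_one (H : X ⊗ Δ[1] ⟶ Y) (p : SSet.toTop.obj X) :
    realizeHomotopy H p 1 = SSet.toTop.map (SSet.ι₀ ≫ H) p := by
  obtain ⟨k, x, w, rfl⟩ := exists_realize p
  have h0 : CutAt (Fin.last k) w 1 := ⟨by
    simpa [cumul_of_le] using cumul_mono w (Nat.le_succ k), by simp [cumul_of_le]⟩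
  rw [realizeHomotopy_realize, prismMap_eq H x h0, toTop_map_realize, prismPiece]
  have hc : ∀ m, cumul w m ≤ 1 := fun m => by
    rw [← cumul_of_le w (le_max_right m (k + 1))]
    exact cumul_mono w (le_max_left _ _)
  have hl : ∀ j, lowPart w (1 : I) j = w j := by
    intro j
    have := cumul_succ w j
    have h1 : cumul w j + w j ≤ 1 := this ▸ hc _
    simp [lowPart, hc, this, h1]
  have e : stdSimplex.map (prismPos (Fin.last k)) (doubled w 1) =
      stdSimplex.map (Fin.castSuccOrderEmb (n := k + 1)).toOrderHom w := by
    have h1 : w = stdSimplex.map (Sum.elim id id) (doubled w 1) := by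
      refine stdSimplex.ext (funext fun j => ?_)
      rw [stdSimplex_map_apply, Finset.sum_filter, Fintype.sum_sum_type]
      change w j = (∑ i, if i = j then lowPart w (1 : I) i else 0) +
        ∑ i, if i = j then w i - lowPart w (1 : I) i else 0
      simp
    conv_rhs => rw [h1, stdSimplex.map_comp_apply]
    refine stdSimplex_map_congr ?_
    rintro (j | j) ha
    · simp [prismPos, Fin.le_last]
    · refine absurd ?_ ha
      change w j - lowPart w (1 : I) j = 0
      rw [hl, sub_self]
  rw [e, ← realize_homotopyAt_comp]
  congr 1
  have e1 : (prismFst (Fin.last k)).comp (Fin.castSuccOrderEmb (n := k + 1)).toOrderHom = .id := by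
    ext p
    simp [prismFst_apply, Fin.predAbove_of_le_castSucc, Fin.le_last]
  have e2 : (prismSnd (Fin.last k)).comp (Fin.castSuccOrderEmb (n := k + 1)).toOrderHom =
      OrderHom.const _ 0 := by
    ext p
    simp [prismSnd_apply, Fin.le_last]
  rw [e1, e2]
  unfold homotopyAt
  have : X.map (SimplexCategory.mkHom (OrderHom.id : Fin (k + 1) →o Fin (k + 1))).op x = x :=
    Functor.map_id_apply X _ x
  rw [this]
  rfl

/-- The homotopy between the realizations of two simplicially homotopic maps. -/
def toTopHomotopy (H : X ⊗ Δ[1] ⟶ Y) :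
    (SSet.toTop.map (SSet.ι₁ ≫ H)).hom.Homotopy (SSet.toTop.map (SSet.ι₀ ≫ H)).hom where
  toFun p := realizeHomotopy H p.2 p.1
  continuous_toFun :=
    (ContinuousMap.continuous_uncurry_of_continuous (realizeHomotopy H)).comp continuous_swap
  map_zero_left := realizeHomotopy_zero H
  map_one_left := realizeHomotopy_one H

end Prism

/-! ### Faces of the tree operad -/

section Faces

variable {S : Type u}

open Classical in
/-- The map that collapses `M` to the additional point. -/
def collapseTo (M : Set S) (a : S) : Option ↥Mᶜ := if h : a ∈ M then none else some ⟨a, h⟩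

lemma collapseTo_of_mem {M : Set S} {a : S} (h : a ∈ M) : collapseTo M a = none := dif_pos h

lemma collapseTo_of_notMem {M : Set S} {a : S} (h : a ∉ M) : collapseTo M a = some ⟨a, h⟩ :=
  dif_neg h

lemma collapseTo_eq_none {M : Set S} {a : S} : collapseTo M a = none ↔ a ∈ M := by
  by_cases h : a ∈ M <;> simp [collapseTo, h]

lemma collapseTo_eq_some {M : Set S} {a : S} {b : ↥Mᶜ} : collapseTo M a = some b ↔ a = b := by
  by_cases h : a ∈ M
  · simp only [collapseTo, h, dif_pos, reduceCtorEq, false_iff]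
    rintro rfl
    exact b.2 h
  · simp [collapseTo, h, Subtype.ext_iff]

lemma collapseTo_surjective {M : Set S} (hM : M.Nonempty) : Function.Surjective (collapseTo M) := by
  rintro (_ | b)
  · obtain ⟨a, ha⟩ := hM
    exact ⟨a, collapseTo_of_mem ha⟩
  · exact ⟨b, collapseTo_of_notMem b.2⟩

lemma collapse_partEquiv (M : Set S) (a : S) :
    Ins.collapse none (partEquiv M a) = collapseTo M a := by
  by_cases h : a ∈ M
  · rw [partEquiv_of_mem h, collapseTo_of_mem h]
    rfl
  · rw [partEquiv_of_notMem h, collapseTo_of_notMem h]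
    rfl

lemma IsProper.card_left [Finite S] {M : Set S} (hM : IsProper M) : 2 ≤ Nat.card M :=
  Finite.one_lt_card_iff_nontrivial.2 hM.1.coe_sort

lemma IsProper.card_right [Finite S] {M : Set S} (hM : IsProper M) :
    2 ≤ Nat.card (Option ↥Mᶜ) := by
  obtain ⟨a, ha⟩ := (Set.ne_univ_iff_exists_notMem M).1 hM.2
  refine Finite.one_lt_card_iff_nontrivial.2 ⟨none, some ⟨a, ha⟩, nofun⟩

/-- The composition of trees at the additional point. -/
def faceTree [Finite S] (M : Set S) (y : LabelledTree ↥M) (z : LabelledTree (Option ↥Mᶜ)) :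
    LabelledTree S := LabelledTree.map (partEquiv M) (LabelledTree.graft none z y)

lemma mem_faceTree_edges [Finite S] {M : Set S} {y : LabelledTree ↥M}
    {z : LabelledTree (Option ↥Mᶜ)} {A : Set S} : A ∈ (faceTree M y z).edges ↔
      (∃ B ∈ z.edges, A = collapseTo M ⁻¹' B) ∨ A = M ∨ ∃ B ∈ y.edges, A = Subtype.val '' B := by
  have h1 : ∀ B, partEquiv M ⁻¹' (Ins.collapse none ⁻¹' B) = collapseTo M ⁻¹' B := by
    intro B
    ext a
    simp [collapse_partEquiv]
  have h2 : partEquiv M ⁻¹' (Set.range Sum.inr) = M := by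
    ext a
    by_cases h : a ∈ M
    · simp [partEquiv_of_mem h, h]
    · simp [partEquiv_of_notMem h, h]
  have h3 : ∀ B : Set ↥M, partEquiv M ⁻¹' (Sum.inr '' B) = Subtype.val '' B := by
    intro B
    ext a
    by_cases h : a ∈ M
    · simp [partEquiv_of_mem h, h]
    · simp [partEquiv_of_notMem h, h]
  constructor
  · rintro ⟨_, (⟨B, hB, rfl⟩ | rfl | ⟨B, hB, rfl⟩), rfl⟩
    · exact .inl ⟨B, hB, h1 B⟩
    · exact .inr (.inl h2)
    · exact .inr (.inr ⟨B, hB, h3 B⟩)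
  · rintro (⟨B, hB, rfl⟩ | rfl | ⟨B, hB, rfl⟩)
    · exact ⟨_, .inl ⟨B, hB, rfl⟩, (h1 B).symm⟩
    · exact ⟨_, .inr (.inl rfl), h2.symm⟩
    · exact ⟨_, .inr (.inr ⟨B, hB, rfl⟩), (h3 B).symm⟩

/-- The edges of a composite are told apart by their position relative to `M`: the preimage of a
nontrivial set contains a letter outside `M`, whereas the other edges are contained in `M`. So the
lower factor can be read off. -/
lemma mem_edges_right_iff [Finite S] {M : Set S} (hM : M.Nonempty) {y : LabelledTree ↥M}
    {z : LabelledTree (Option ↥Mᶜ)} {B : Set (Option ↥Mᶜ)} :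
    B ∈ z.edges ↔ B.Nontrivial ∧ collapseTo M ⁻¹' B ∈ (faceTree M y z).edges := by
  refine ⟨fun h => ⟨z.nontrivial_of_mem B h, mem_faceTree_edges.2 (.inl ⟨B, h, rfl⟩)⟩, ?_⟩
  rintro ⟨hB, h⟩
  have key : ¬ collapseTo M ⁻¹' B ⊆ M := by
    intro h
    obtain ⟨b, hb, hb'⟩ := hB.exists_ne none
    obtain ⟨b, rfl⟩ := Option.ne_none_iff_exists'.1 hb'
    refine b.2 (h ?_)
    rw [Set.mem_preimage, collapseTo_of_notMem b.2]
    exact hb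
  rcases mem_faceTree_edges.1 h with ⟨B', hB', h⟩ | h | ⟨B', -, h⟩
  · rwa [(collapseTo_surjective hM).preimage_injective h]
  · exact absurd h.le key
  · exact absurd (h.le.trans (by simp)) key

lemma mem_edges_left_iff [Finite S] {M : Set S} {y : LabelledTree ↥M}
    {z : LabelledTree (Option ↥Mᶜ)} {B : Set ↥M} :
    B ∈ y.edges ↔ B ≠ Set.univ ∧ Subtype.val '' B ∈ (faceTree M y z).edges := by
  refine ⟨fun h => ⟨y.ne_univ_of_mem B h, mem_faceTree_edges.2 (.inr (.inr ⟨B, h, rfl⟩))⟩, ?_⟩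
  rintro ⟨hB, h⟩
  have key : ¬ M ⊆ Subtype.val '' B := by
    intro h
    refine hB (Set.eq_univ_of_forall fun a => ?_)
    obtain ⟨b, hb, h⟩ := h a.2
    rwa [← Subtype.ext h]
  rcases mem_faceTree_edges.1 h with ⟨B', hB', h⟩ | h | ⟨B', hB', h⟩
  · exfalso
    obtain ⟨b, hb, hb'⟩ := (z.nontrivial_of_mem _ hB').exists_ne none
    obtain ⟨b, rfl⟩ := Option.ne_none_iff_exists'.1 hb'
    have : (b : S) ∈ collapseTo M ⁻¹' B' := by
      rw [Set.mem_preimage, collapseTo_of_notMem b.2]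
      exact hb
    rw [← h] at this
    obtain ⟨c, -, hc⟩ := this
    exact b.2 (hc ▸ c.2)
  · exact absurd h.ge key
  · rwa [Subtype.val_injective.image_injective h]

/-- The part of a tree above the edge `M`. -/
def restrictTree [Finite S] {M : Set S} (hM : IsProper M) (x : LabelledTree S) :
    LabelledTree ↥M where
  two_le := hM.card_left
  edges := {B | B ≠ Set.univ ∧ Subtype.val '' B ∈ x.edges}
  nontrivial_of_mem := by
    rintro B ⟨-, h⟩
    exact (Set.image_nontrivial Subtype.val_injective).1 (x.nontrivial_of_mem _ h)
  ne_univ_of_mem _ h := h.1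
  nested_or_disjoint := by
    rintro A ⟨-, hA⟩ B ⟨-, hB⟩
    simpa [Set.image_subset_image_iff, Set.disjoint_image_iff, Subtype.val_injective] using
      x.nested_or_disjoint _ hA _ hB

/-- The part of a tree that remains after the part above the edge `M` is cut off. -/
def contractTree [Finite S] {M : Set S} (hM : IsProper M) (x : LabelledTree S) :
    LabelledTree (Option ↥Mᶜ) where
  two_le := hM.card_right
  edges := {B | B.Nontrivial ∧ collapseTo M ⁻¹' B ∈ x.edges}
  nontrivial_of_mem _ h := h.1
  ne_univ_of_mem := by
    rintro _ ⟨-, h⟩ rfl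
    exact x.ne_univ_of_mem _ h Set.preimage_univ
  nested_or_disjoint := by
    rintro A ⟨-, hA⟩ B ⟨-, hB⟩
    have hs := collapseTo_surjective hM.1.nonempty
    simpa [hs.preimage_subset_preimage_iff, Set.disjoint_preimage_iff hs] using
      x.nested_or_disjoint _ hA _ hB

/-- An edge that is nested with or disjoint from `M` is either contained in `M` or a union of fibres
of the collapse, so it comes from one of the two factors. -/
lemma faceTree_restrict_contract [Finite S] {M : Set S} (hM : IsProper M) (x : LabelledTree S)
    (hx : M ∈ x.edges) : faceTree M (restrictTree hM x) (contractTree hM x) = x := by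
  ext A
  rw [mem_faceTree_edges]
  constructor
  · rintro (⟨B, ⟨-, hB⟩, rfl⟩ | rfl | ⟨B, ⟨-, hB⟩, rfl⟩) <;> assumption
  · intro hA
    by_cases h : A = M
    · exact .inr (.inl h)
    by_cases h' : A ⊆ M
    · have hA' : Subtype.val '' (Subtype.val ⁻¹' A : Set ↥M) = A := by
        rw [Subtype.image_preimage_coe, Set.inter_eq_right.2 h']
      refine .inr (.inr ⟨Subtype.val ⁻¹' A, ⟨?_, by rwa [hA']⟩, hA'.symm⟩)
      intro h2
      rw [h2] at hA'
      exact h (by simpa using hA'.symm)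
    · have hA' : collapseTo M ⁻¹' (collapseTo M '' A) = A := by
        refine (Set.subset_preimage_image _ _).antisymm' ?_
        rintro a ⟨b, hb, hab⟩
        by_cases ha : a ∈ M
        · rw [collapseTo_of_mem ha, collapseTo_eq_none] at hab
          rcases x.nested_or_disjoint _ hA _ hx with h1 | h1 | h1
          · exact absurd h1 h'
          · exact h1 ha
          · exact absurd hab (Set.disjoint_left.1 h1 hb)
        · rw [collapseTo_of_notMem ha, collapseTo_eq_some] at hab
          have hba : b = a := hab
          exact hba ▸ hb
      refine .inl ⟨collapseTo M '' A, ⟨?_, by rwa [hA']⟩, hA'.symm⟩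
      obtain ⟨b, hb, hbM⟩ := Set.not_subset.1 h'
      obtain ⟨c, hc, hcb⟩ := (x.nontrivial_of_mem _ hA).exists_ne b
      refine ⟨_, ⟨b, hb, rfl⟩, _, ⟨c, hc, rfl⟩, fun h2 => hcb ?_⟩
      rw [collapseTo_of_notMem hbM, eq_comm, collapseTo_eq_some] at h2
      exact h2

/-- `M` is an interval of the total ordering `o`. -/
def IsInterval (o : TotalOrdering S) (M : Set S) : Prop :=
  ∀ a ∉ M, ∀ b ∈ M, ∀ b' ∈ M, o.lt a b → o.lt a b'

lemma TotalOrdering.asymm (o : TotalOrdering S) {a b : S} (h : o.lt a b) : ¬ o.lt b a :=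
  fun h' => o.irrefl _ (o.trans _ _ _ h h')

/-- The composition of total orderings at the additional point. -/
def faceOrder (M : Set S) (y : TotalOrdering ↥M) (z : TotalOrdering (Option ↥Mᶜ)) :
    TotalOrdering S := TotalOrdering.map (partEquiv M) (TotalOrdering.subst none z y)

lemma faceOrder_lt {M : Set S} {y : TotalOrdering ↥M} {z : TotalOrdering (Option ↥Mᶜ)} {a b : S} :
    (faceOrder M y z).lt a b ↔ z.lt (collapseTo M a) (collapseTo M b) ∨
      ∃ (ha : a ∈ M) (hb : b ∈ M), y.lt ⟨a, ha⟩ ⟨b, hb⟩ := by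
  change z.lt (Ins.collapse none (partEquiv M a)) (Ins.collapse none (partEquiv M b)) ∨ _ ↔ _
  rw [collapse_partEquiv, collapse_partEquiv]
  refine or_congr_right ?_
  constructor
  · rintro ⟨t, t', ha, hb, h⟩
    have ha' : a = t := by rw [← (partEquiv M).symm_apply_apply a, ha]; rfl
    have hb' : b = t' := by rw [← (partEquiv M).symm_apply_apply b, hb]; rfl
    subst ha' hb'
    exact ⟨t.2, t'.2, h⟩
  · rintro ⟨ha, hb, h⟩
    exact ⟨_, _, partEquiv_of_mem ha, partEquiv_of_mem hb, h⟩

lemma faceOrder_lt_of_mem {M : Set S} {y : TotalOrdering ↥M} {z : TotalOrdering (Option ↥Mᶜ)}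
    (a b : ↥M) : (faceOrder M y z).lt a b ↔ y.lt a b := by
  rw [faceOrder_lt, collapseTo_of_mem a.2, collapseTo_of_mem b.2]
  exact ⟨fun h => h.elim (fun h => absurd h (z.irrefl _)) fun ⟨_, _, h⟩ => h,
    fun h => .inr ⟨a.2, b.2, h⟩⟩

lemma faceOrder_lt_of_ne {M : Set S} {y : TotalOrdering ↥M} {z : TotalOrdering (Option ↥Mᶜ)}
    {a b : S} (h : collapseTo M a ≠ collapseTo M b) : (faceOrder M y z).lt a b ↔
      z.lt (collapseTo M a) (collapseTo M b) := by
  rw [faceOrder_lt, or_iff_left]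
  rintro ⟨ha, hb, -⟩
  exact h (by rw [collapseTo_of_mem ha, collapseTo_of_mem hb])

lemma isInterval_faceOrder (M : Set S) (y : TotalOrdering ↥M) (z : TotalOrdering (Option ↥Mᶜ)) :
    IsInterval (faceOrder M y z) M := by
  intro a ha b hb b' hb'
  have h : ∀ c ∈ M, collapseTo M a ≠ collapseTo M c := fun c hc h => by
    rw [collapseTo_of_mem hc, collapseTo_eq_none] at h
    exact ha h
  rw [faceOrder_lt_of_ne (h b hb), faceOrder_lt_of_ne (h b' hb'), collapseTo_of_mem hb,
    collapseTo_of_mem hb']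
  exact id

lemma faceOrder_injective {M : Set S} (hM : M.Nonempty) {y y' : TotalOrdering ↥M}
    {z z' : TotalOrdering (Option ↥Mᶜ)} (h : faceOrder M y z = faceOrder M y' z') :
    y = y' ∧ z = z' := by
  constructor
  · ext a b
    rw [← faceOrder_lt_of_mem (z := z), h, faceOrder_lt_of_mem]
  · ext p q
    by_cases hpq : p = q
    · subst hpq
      simp [z.irrefl, z'.irrefl]
    obtain ⟨a, rfl⟩ := collapseTo_surjective hM p
    obtain ⟨b, rfl⟩ := collapseTo_surjective hM q
    rw [← faceOrder_lt_of_ne (y := y) hpq, h, faceOrder_lt_of_ne hpq]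

/-- The restriction of a total ordering to a subset. -/
def restrictOrder (M : Set S) (o : TotalOrdering S) : TotalOrdering ↥M where
  lt a b := o.lt a b
  irrefl _ := o.irrefl _
  trans _ _ _ := o.trans _ _ _
  total _ _ h := o.total _ _ (Subtype.coe_ne_coe.2 h)

/-- The total ordering induced on the quotient by an interval. -/
def contractOrder {M : Set S} (hM : M.Nonempty) (o : TotalOrdering S) :
    TotalOrdering (Option ↥Mᶜ) where
  lt p q := o.lt (Function.surjInv (collapseTo_surjective hM) p)
    (Function.surjInv (collapseTo_surjective hM) q)
  irrefl _ := o.irrefl _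
  trans _ _ _ := o.trans _ _ _
  total _ _ h := o.total _ _ ((Function.injective_surjInv _).ne h)

lemma faceOrder_restrict_contract {M : Set S} (hM : M.Nonempty) (o : TotalOrdering S)
    (ho : IsInterval o M) : faceOrder M (restrictOrder M o) (contractOrder hM o) = o := by
  -- The definition of an interval speaks only of elements before `M`; the mirror image follows from
  -- totality.
  have ho' : ∀ a ∉ M, ∀ b ∈ M, ∀ b' ∈ M, o.lt b a → o.lt b' a := by
    intro a ha b hb b' hb' h
    by_contra h2
    have hne : b' ≠ a := by rintro rfl; exact ha hb'
    rcases o.total _ _ hne with h3 | h3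
    · exact h2 h3
    · exact o.asymm h (ho a ha b' hb' b hb h3)
  -- The contracted ordering uses chosen representatives; for an interval the choice does not affect
  -- comparisons with other classes.
  have key : ∀ a b, collapseTo M a ≠ collapseTo M b →
      (o.lt (Function.surjInv (collapseTo_surjective hM) (collapseTo M a))
        (Function.surjInv (collapseTo_surjective hM) (collapseTo M b)) ↔ o.lt a b) := by
    intro a b hab
    have ha := Function.surjInv_eq (collapseTo_surjective hM) (collapseTo M a)
    have hb := Function.surjInv_eq (collapseTo_surjective hM) (collapseTo M b)
    generalize Function.surjInv (collapseTo_surjective hM) (collapseTo M a) = a' at ha ⊢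
    generalize Function.surjInv (collapseTo_surjective hM) (collapseTo M b) = b' at hb ⊢
    have hsame : ∀ c c', c ∉ M → collapseTo M c' = collapseTo M c → c' = c := by
      intro c c' hc h
      rwa [collapseTo_of_notMem hc, collapseTo_eq_some] at h
    by_cases haM : a ∈ M
    · have hbM : b ∉ M := fun h => hab (by rw [collapseTo_of_mem haM, collapseTo_of_mem h])
      rw [hsame b b' hbM hb]
      rw [collapseTo_of_mem haM, collapseTo_eq_none] at ha
      exact ⟨ho' b hbM a' ha a haM, ho' b hbM a haM a' ha⟩
    · rw [hsame a a' haM ha]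
      by_cases hbM : b ∈ M
      · rw [collapseTo_of_mem hbM, collapseTo_eq_none] at hb
        exact ⟨ho a haM b' hb b hbM, ho a haM b hbM b' hb⟩
      · rw [hsame b b' hbM hb]
  ext a b
  by_cases hab : collapseTo M a = collapseTo M b
  · rw [faceOrder_lt, hab, or_iff_right ((contractOrder hM o).irrefl _)]
    constructor
    · rintro ⟨_, _, h⟩
      exact h
    · intro h
      by_cases hb : b ∈ M
      · rw [collapseTo_of_mem hb, collapseTo_eq_none] at hab
        exact ⟨hab, hb, h⟩
      · rw [collapseTo_of_notMem hb, collapseTo_eq_some] at hab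
        subst hab
        exact absurd h (o.irrefl _)
  · rw [faceOrder_lt_of_ne hab]
    exact key a b hab

lemma isInterval_faceOrder_of_subset {M M' : Set S} (h : M' ⊆ M) {y : TotalOrdering ↥M}
    {z : TotalOrdering (Option ↥Mᶜ)} :
    IsInterval (faceOrder M y z) M' ↔ IsInterval y (Subtype.val ⁻¹' M') := by
  constructor
  · intro H a ha b hb b' hb' hab
    rw [← faceOrder_lt_of_mem (z := z)] at hab ⊢
    exact H a ha b hb b' hb' hab
  · intro H a ha b hb b' hb' hab
    by_cases haM : a ∈ M
    · have := H ⟨a, haM⟩ ha ⟨b, h hb⟩ hb ⟨b', h hb'⟩ hb'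
      rw [← faceOrder_lt_of_mem (z := z), ← faceOrder_lt_of_mem (z := z)] at this
      exact this hab
    · exact isInterval_faceOrder M y z a haM b (h hb) b' (h hb') hab

lemma isInterval_faceOrder_preimage {M : Set S} (hM : M.Nonempty) {L : Set (Option ↥Mᶜ)}
    {y : TotalOrdering ↥M} {z : TotalOrdering (Option ↥Mᶜ)} :
    IsInterval (faceOrder M y z) (collapseTo M ⁻¹' L) ↔ IsInterval z L := by
  have hne : ∀ {p q}, p ∉ L → q ∈ L → p ≠ q := fun hp hq h => hp (h ▸ hq)
  constructor
  · intro H p hp q hq q' hq' hpq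
    obtain ⟨a, rfl⟩ := collapseTo_surjective hM p
    obtain ⟨b, rfl⟩ := collapseTo_surjective hM q
    obtain ⟨b', rfl⟩ := collapseTo_surjective hM q'
    rw [← faceOrder_lt_of_ne (y := y) (hne hp hq)] at hpq
    rw [← faceOrder_lt_of_ne (y := y) (hne hp hq')]
    exact H a hp b hq b' hq' hpq
  · intro H a ha b hb b' hb' hab
    rw [faceOrder_lt_of_ne (hne ha hb)] at hab
    rw [faceOrder_lt_of_ne (hne ha hb')]
    exact H _ ha _ hb _ hb' hab

lemma faceTree_injective [Finite S] {M : Set S} (hM : M.Nonempty) {y y' : LabelledTree ↥M}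
    {z z' : LabelledTree (Option ↥Mᶜ)} (h : faceTree M y z = faceTree M y' z') :
    y = y' ∧ z = z' := by
  constructor
  · ext B
    rw [mem_edges_left_iff (z := z), h, ← mem_edges_left_iff]
  · ext B
    rw [mem_edges_right_iff hM (y := y), h, ← mem_edges_right_iff hM]

lemma mem_edges_faceTree_of_subset [Finite S] {M M' : Set S} (h : M' ⊆ M) (hne : M' ≠ M)
    {y : LabelledTree ↥M} {z : LabelledTree (Option ↥Mᶜ)} :
    M' ∈ (faceTree M y z).edges ↔ (Subtype.val ⁻¹' M' : Set ↥M) ∈ y.edges := by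
  have h1 : Subtype.val '' (Subtype.val ⁻¹' M' : Set ↥M) = M' := by
    rw [Subtype.image_preimage_coe, Set.inter_eq_right.2 h]
  rw [mem_edges_left_iff (z := z), h1, and_iff_right]
  intro h2
  rw [h2] at h1
  exact hne (by simpa using h1.symm)

/-! #### Simplices of the faces -/

variable [Finite S]

lemma treeOperad_ext {k : SimplexCategoryᵒᵖ} {x y : (treeOperad.obj S).obj k}
    (h1 : ∀ i, (x.1 : ComposableArrows (LabelledTree S) _).obj i =
      (y.1 : ComposableArrows (LabelledTree S) _).obj i)
    (h2 : ∀ i, (x.2 : ComposableArrows (TotalOrdering S) _).obj i =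
      (y.2 : ComposableArrows (TotalOrdering S) _).obj i) : x = y :=
  Prod.ext (nerve.ext_of_isThin (funext h1)) (nerve.ext_of_isThin (funext h2))

theorem faceMap_injective {M : Set S} (hM : IsProper M) (k : SimplexCategoryᵒᵖ) :
    Function.Injective ((treeOperad.faceMap M).app k) := by
  rintro ⟨y, z⟩ ⟨y', z'⟩ h
  have h1 : ∀ i, _ ∧ _ := fun i => faceTree_injective hM.1.nonempty
    (congrArg (fun x : (treeOperad.obj S).obj k =>
      (x.1 : ComposableArrows (LabelledTree S) _).obj i) h)
  have h2 : ∀ i, _ ∧ _ := fun i => faceOrder_injective hM.1.nonempty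
    (congrArg (fun x : (treeOperad.obj S).obj k =>
      (x.2 : ComposableArrows (TotalOrdering S) _).obj i) h)
  exact Prod.ext (treeOperad_ext (fun i => (h1 i).1) fun i => (h2 i).1)
    (treeOperad_ext (fun i => (h1 i).2) fun i => (h2 i).2)

/-- The criterion for all questions about faces. Given the conditions at each vertex, cutting every
tree and every ordering at `M` yields simplices of the two factors; no further compatibility is
needed because the categories are thin. -/
lemma mem_face_iff {M : Set S} (hM : IsProper M) {k : SimplexCategoryᵒᵖ}
    (x : (treeOperad.obj S).obj k) : x ∈ (treeOperad.face M).obj k ↔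
      ∀ i, M ∈ ((x.1 : ComposableArrows (LabelledTree S) _).obj i).edges ∧
        IsInterval ((x.2 : ComposableArrows (TotalOrdering S) _).obj i) M := by
  constructor
  · rintro ⟨⟨y, z⟩, rfl⟩ i
    exact ⟨mem_faceTree_edges.2 (.inr (.inl rfl)), isInterval_faceOrder M _ _⟩
  · intro h
    let y : (treeOperad.obj ↥M).obj k :=
      ((Monotone.functor (f := fun i => restrictTree hM
        ((x.1 : ComposableArrows (LabelledTree S) _).obj i)) fun i j hij B hB =>
          ⟨hB.1, (x.1.map (homOfLE hij)).le hB.2⟩ : ComposableArrows (LabelledTree ↥M) _),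
      (Monotone.functor (f := fun i => restrictOrder M
        ((x.2 : ComposableArrows (TotalOrdering S) _).obj i)) fun _ _ _ => trivial :
          ComposableArrows (TotalOrdering ↥M) _))
    let z : (treeOperad.obj (Option ↥Mᶜ)).obj k :=
      ((Monotone.functor (f := fun i => contractTree hM
        ((x.1 : ComposableArrows (LabelledTree S) _).obj i)) fun i j hij B hB =>
          ⟨hB.1, (x.1.map (homOfLE hij)).le hB.2⟩ :
          ComposableArrows (LabelledTree (Option ↥Mᶜ)) _),
      (Monotone.functor (f := fun i => contractOrder hM.1.nonempty
        ((x.2 : ComposableArrows (TotalOrdering S) _).obj i)) fun _ _ _ => trivial :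
          ComposableArrows (TotalOrdering (Option ↥Mᶜ)) _))
    exact ⟨(y, z), treeOperad_ext (fun i => faceTree_restrict_contract hM _ (h i).1)
      fun i => faceOrder_restrict_contract hM.1.nonempty _ (h i).2⟩

lemma isSubface_left {M M' : Set S} (hM : IsProper M) (hM' : IsProper M') (h : M' ⊆ M)
    (hne : M' ≠ M) : treeOperad.IsSubface M (treeOperad.face M ⊓ treeOperad.face M') := by
  have hL : IsProper (Subtype.val ⁻¹' M' : Set ↥M) := by
    refine ⟨(Set.image_nontrivial Subtype.val_injective).1 (by
      rw [Subtype.image_preimage_coe, Set.inter_eq_right.2 h]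
      exact hM'.1), fun h2 => hne (h.antisymm ?_)⟩
    simpa using h2
  refine .inl ⟨_, hL, ?_⟩
  ext k x
  constructor
  · rintro ⟨⟨⟨y, z⟩, rfl⟩, hx⟩
    refine ⟨(y, z), ⟨(mem_face_iff hL y).2 fun i => ?_, trivial⟩, rfl⟩
    obtain ⟨h1, h2⟩ := (mem_face_iff hM' _).1 hx i
    exact ⟨(mem_edges_faceTree_of_subset h hne).1 h1, (isInterval_faceOrder_of_subset h).1 h2⟩
  · rintro ⟨⟨y, z⟩, ⟨hy, -⟩, rfl⟩
    refine ⟨⟨_, rfl⟩, (mem_face_iff hM' _).2 fun i => ?_⟩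
    obtain ⟨h1, h2⟩ := (mem_face_iff hL y).1 hy i
    exact ⟨(mem_edges_faceTree_of_subset h hne).2 h1, (isInterval_faceOrder_of_subset h).2 h2⟩

/-- A set that contains `M` or is disjoint from it is a union of fibres of the collapse, so it is an
edge or an interval of the composite iff its image is one in the lower factor. -/
lemma isSubface_right {M M' : Set S} (hM : IsProper M) (hM' : IsProper M') (hne : M' ≠ M)
    (h : M ⊆ M' ∨ Disjoint M M') :
    treeOperad.IsSubface M (treeOperad.face M ⊓ treeOperad.face M') := by
  have hpre : collapseTo M ⁻¹' (collapseTo M '' M') = M' := by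
    refine (Set.subset_preimage_image _ _).antisymm' ?_
    rintro a ⟨b, hb, hab⟩
    by_cases ha : a ∈ M
    · rw [collapseTo_of_mem ha, collapseTo_eq_none] at hab
      rcases h with h | h
      · exact h ha
      · exact absurd hb (Set.disjoint_left.1 h hab)
    · rw [collapseTo_of_notMem ha, collapseTo_eq_some] at hab
      have hba : b = a := hab
      exact hba ▸ hb
  have hnt : (collapseTo M '' M').Nontrivial := by
    have : ¬ M' ⊆ M := by
      intro h2
      rcases h with h | h
      · exact hne (h2.antisymm h)
      · obtain ⟨a, ha⟩ := hM'.1.nonempty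
        exact Set.disjoint_left.1 h (h2 ha) ha
    obtain ⟨b, hb, hbM⟩ := Set.not_subset.1 this
    obtain ⟨c, hc, hcb⟩ := hM'.1.exists_ne b
    refine ⟨_, ⟨b, hb, rfl⟩, _, ⟨c, hc, rfl⟩, fun h2 => hcb ?_⟩
    rw [collapseTo_of_notMem hbM, eq_comm, collapseTo_eq_some] at h2
    exact h2
  have hL : IsProper (collapseTo M '' M') := by
    refine ⟨hnt, fun h2 => hM'.2 ?_⟩
    rw [← hpre, h2, Set.preimage_univ]
  have key : ∀ (y : LabelledTree ↥M) z, M' ∈ (faceTree M y z).edges ↔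
      collapseTo M '' M' ∈ z.edges := by
    intro y z
    rw [mem_edges_right_iff hM.1.nonempty (y := y), hpre, and_iff_right hnt]
  have key' : ∀ (y : TotalOrdering ↥M) z, IsInterval (faceOrder M y z) M' ↔
      IsInterval z (collapseTo M '' M') := by
    intro y z
    rw [← isInterval_faceOrder_preimage hM.1.nonempty (y := y), hpre]
  refine .inr ⟨_, hL, ?_⟩
  ext k x
  constructor
  · rintro ⟨⟨⟨y, z⟩, rfl⟩, hx⟩
    refine ⟨(y, z), ⟨trivial, (mem_face_iff hL z).2 fun i => ?_⟩, rfl⟩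
    obtain ⟨h1, h2⟩ := (mem_face_iff hM' _).1 hx i
    exact ⟨(key _ _).1 h1, (key' _ _).1 h2⟩
  · rintro ⟨⟨y, z⟩, ⟨-, hz⟩, rfl⟩
    refine ⟨⟨_, rfl⟩, (mem_face_iff hM' _).2 fun i => ?_⟩
    obtain ⟨h1, h2⟩ := (mem_face_iff hL z).1 hz i
    exact ⟨(key _ _).2 h1, (key' _ _).2 h2⟩

/-- Crossing sets are never edges of the same tree. Otherwise each of the two sets determines a face
of one of the factors belonging to the other. -/
theorem face_inf_face {M M' : Set S} (hM : IsProper M) (hM' : IsProper M') (hne : M ≠ M') :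
    treeOperad.face M ⊓ treeOperad.face M' = ⊥ ∨ ∃ K : (treeOperad.obj S).Subcomplex,
      treeOperad.face M ⊓ treeOperad.face M' = K ∧ treeOperad.IsSubface M K ∧
        treeOperad.IsSubface M' K := by
  by_cases h : M ⊆ M' ∨ M' ⊆ M ∨ Disjoint M M'
  · refine .inr ⟨_, rfl, ?_, ?_⟩
    · rcases h with h | h | h
      · exact isSubface_right hM hM' hne.symm (.inl h)
      · exact isSubface_left hM hM' h hne.symm
      · exact isSubface_right hM hM' hne.symm (.inr h)
    · rw [inf_comm]
      rcases h with h | h | h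
      · exact isSubface_left hM' hM h hne
      · exact isSubface_right hM' hM hne (.inl h)
      · exact isSubface_right hM' hM hne (.inr h.symm)
  · left
    refine eq_bot_iff.2 fun k x hx => h ?_
    exact (((x.1 : ComposableArrows (LabelledTree S) _).obj 0).nested_or_disjoint) _
      ((mem_face_iff hM x).1 hx.1 0).1 _ ((mem_face_iff hM' x).1 hx.2 0).1

/-- Edges persist along a chain, so the tree condition needs to be checked at the first vertex only;
the orderings are unrelated and have to be checked at all vertices. -/
lemma mem_boundary_iff {k : SimplexCategoryᵒᵖ} (x : (treeOperad.obj S).obj k) :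
    x ∈ (treeOperad.boundary S).obj k ↔ ∃ M,
      M ∈ ((x.1 : ComposableArrows (LabelledTree S) _).obj 0).edges ∧
      ∀ i, IsInterval ((x.2 : ComposableArrows (TotalOrdering S) _).obj i) M := by
  simp only [SOperad.boundary, Subfunctor.iSup_obj, Set.mem_iUnion, exists_prop]
  constructor
  · rintro ⟨M, hM, h⟩
    exact ⟨M, ((mem_face_iff hM x).1 h 0).1, fun i => ((mem_face_iff hM x).1 h i).2⟩
  · rintro ⟨M, h, h'⟩
    have hM : IsProper M := ⟨LabelledTree.nontrivial_of_mem _ _ h, LabelledTree.ne_univ_of_mem _ _ h⟩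
    exact ⟨M, hM, (mem_face_iff hM x).2 fun i => ⟨(x.1.map (homOfLE (Fin.zero_le i))).le h, h' i⟩⟩

/-- Each tree has a planar structure. -/
theorem exists_isInterval (S : Type u) [Finite S] (x : LabelledTree S) :
    ∃ o : TotalOrdering S, ∀ M ∈ x.edges, IsInterval o M := by
  induction h : Nat.card S using Nat.strong_induction_on generalizing S with
  | _ n ih =>
  subst h
  by_cases hx : x.edges.Nonempty
  · obtain ⟨M, hMx⟩ := hx
    have hM : IsProper M := ⟨x.nontrivial_of_mem _ hMx, x.ne_univ_of_mem _ hMx⟩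
    have hc : Nat.card ↥M + Nat.card ↥Mᶜ = Nat.card S := by
      rw [← Set.ncard_add_ncard_compl M]
      rfl
    have h2 := hM.card_left
    have h3 := hM.card_right
    have h4 : Nat.card (Option ↥Mᶜ) = Nat.card ↥Mᶜ + 1 := Finite.card_option
    obtain ⟨oy, hy⟩ := ih _ (by omega) ↥M (restrictTree hM x) rfl
    obtain ⟨oz, hz⟩ := ih _ (by omega) (Option ↥Mᶜ) (contractTree hM x) rfl
    refine ⟨faceOrder M oy oz, fun A hA => ?_⟩
    rw [← faceTree_restrict_contract hM x hMx] at hA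
    rcases mem_faceTree_edges.1 hA with ⟨B, hB, rfl⟩ | rfl | ⟨B, hB, rfl⟩
    · exact (isInterval_faceOrder_preimage hM.1.nonempty).2 (hz B hB)
    · exact isInterval_faceOrder A _ _
    · rw [isInterval_faceOrder_of_subset (by simp),
        Set.preimage_image_eq _ Subtype.val_injective]
      exact hy B hB
  · obtain ⟨n, ⟨e⟩⟩ := Finite.exists_equiv_fin S
    refine ⟨⟨fun a b => e a < e b, fun a => lt_irrefl _, fun a b c => lt_trans, fun a b h =>
      lt_or_gt_of_ne (e.injective.ne h)⟩, fun M hM => absurd ⟨M, hM⟩ hx⟩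

end Faces

/-! ### Homotopy equivalences of pairs -/

section Pairs

open Simplicial Limits

variable {X Y : SSet.{u}}

/-- Homotopic to the identity on both sides. -/
def homotopyEquivOfSimplicial (f : X ⟶ Y) (g : Y ⟶ X) (hgf : g ≫ f = 𝟙 Y) (H : X ⊗ Δ[1] ⟶ X)
    (h₁ : SSet.ι₁ ≫ H = 𝟙 X) (h₀ : SSet.ι₀ ≫ H = f ≫ g) :
    ContinuousMap.HomotopyEquiv (SSet.toTop.obj X) (SSet.toTop.obj Y) where
  toFun := (SSet.toTop.map f).hom
  invFun := (SSet.toTop.map g).hom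
  left_inv := by
    have h := (toTopHomotopy H).symm
    rw [h₁, h₀, Functor.map_comp, CategoryTheory.Functor.map_id] at h
    exact ⟨h⟩
  right_inv := by
    have : (SSet.toTop.map f).hom.comp (SSet.toTop.map g).hom = ContinuousMap.id _ := by
      have h : SSet.toTop.map g ≫ SSet.toTop.map f = 𝟙 _ := by
        rw [← Functor.map_comp, hgf, CategoryTheory.Functor.map_id]
      exact congrArg TopCat.Hom.hom h
    rw [this]

/-- The projection to the quotient by a subcomplex. -/
def collapseProj (A : X.Subcomplex) : X ⟶ collapseSubcomplex A := pushout.inl _ _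

/-- The base point of the quotient by a subcomplex. -/
def collapsePoint (A : X.Subcomplex) : (⊤_ SSet.{u}) ⟶ collapseSubcomplex A := pushout.inr _ _

lemma collapse_condition (A : X.Subcomplex) :
    A.ι ≫ collapseProj A = terminal.from _ ≫ collapsePoint A := pushout.condition

lemma collapse_hom_ext {A : X.Subcomplex} {Z : SSet.{u}} {f g : collapseSubcomplex A ⟶ Z}
    (h : collapseProj A ≫ f = collapseProj A ≫ g)
    (h' : collapsePoint A ≫ f = collapsePoint A ≫ g) : f = g := pushout.hom_ext h h'

/-- Maps out of the quotient by a subcomplex. -/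
def collapseDesc (A : X.Subcomplex) {Z : SSet.{u}} (f : X ⟶ Z) (z : (⊤_ SSet.{u}) ⟶ Z)
    (h : A.ι ≫ f = terminal.from _ ≫ z) : collapseSubcomplex A ⟶ Z := pushout.desc f z h

lemma collapseProj_desc (A : X.Subcomplex) {Z : SSet.{u}} (f : X ⟶ Z) (z : (⊤_ SSet.{u}) ⟶ Z)
    (h : A.ι ≫ f = terminal.from _ ≫ z) : collapseProj A ≫ collapseDesc A f z h = f :=
  pushout.inl_desc _ _ _

lemma collapsePoint_desc (A : X.Subcomplex) {Z : SSet.{u}} (f : X ⟶ Z) (z : (⊤_ SSet.{u}) ⟶ Z)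
    (h : A.ι ≫ f = terminal.from _ ≫ z) : collapsePoint A ≫ collapseDesc A f z h = z :=
  pushout.inr_desc _ _ _

variable {A : X.Subcomplex} {B : Y.Subcomplex}

/-- The restriction of a map of pairs. -/
def restrictMap (f : X ⟶ Y) (hf : A ≤ B.preimage f) : A.toSSet ⟶ B.toSSet :=
  SSet.Subcomplex.lift (A.ι ≫ f) (by
    rintro k _ ⟨x, rfl⟩
    exact hf _ x.2)

lemma restrictMap_ι (f : X ⟶ Y) (hf : A ≤ B.preimage f) :
    restrictMap f hf ≫ B.ι = A.ι ≫ f := rfl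

/-- The map of quotients induced by a map of pairs. -/
def collapseMap (f : X ⟶ Y) (hf : A ≤ B.preimage f) :
    collapseSubcomplex A ⟶ collapseSubcomplex B :=
  collapseDesc A (f ≫ collapseProj B) (collapsePoint B) (by
    rw [← Category.assoc, ← restrictMap_ι f hf, Category.assoc, collapse_condition,
      ← Category.assoc, Subsingleton.elim (restrictMap f hf ≫ _) (terminal.from _)])

/-- The homotopy on a quotient induced by a homotopy of pairs. -/
def collapseHomotopy (H : X ⊗ Δ[1] ⟶ Y) (hH : ∀ (k : SimplexCategoryᵒᵖ) (x : (X ⊗ Δ[1]).obj k),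
    x.1 ∈ A.obj k → H.app k x ∈ B.obj k) :
    collapseSubcomplex A ⊗ Δ[1] ⟶ collapseSubcomplex B :=
  -- The product with the interval has a right adjoint, so after currying the homotopy is an
  -- ordinary map out of the quotient, constant on the base point.
  (β_ _ _).hom ≫ MonoidalClosed.uncurry (collapseDesc A
    (MonoidalClosed.curry ((β_ _ _).hom ≫ H ≫ collapseProj B))
    (MonoidalClosed.curry (terminal.from _ ≫ collapsePoint B)) (by
      rw [← MonoidalClosed.curry_natural_left, ← MonoidalClosed.curry_natural_left]
      congr 1
      let H' : A.toSSet ⊗ Δ[1] ⟶ B.toSSet := SSet.Subcomplex.lift (A.ι ▷ Δ[1] ≫ H) (by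
        rintro k _ ⟨x, rfl⟩
        exact hH _ _ x.1.2)
      have h : A.ι ▷ Δ[1] ≫ H = H' ≫ B.ι := rfl
      rw [BraidedCategory.braiding_naturality_right_assoc, reassoc_of% h, collapse_condition]
      simp only [← Category.assoc]
      congr 1
      exact Subsingleton.elim _ _))

lemma collapseHomotopy_proj (H : X ⊗ Δ[1] ⟶ Y)
    (hH : ∀ (k : SimplexCategoryᵒᵖ) (x : (X ⊗ Δ[1]).obj k), x.1 ∈ A.obj k → H.app k x ∈ B.obj k) :
    collapseProj A ▷ Δ[1] ≫ collapseHomotopy H hH = H ≫ collapseProj B := by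
  unfold collapseHomotopy
  rw [BraidedCategory.braiding_naturality_left_assoc, ← MonoidalClosed.uncurry_natural_left,
    collapseProj_desc, MonoidalClosed.uncurry_curry]
  simp

lemma collapseHomotopy_point (H : X ⊗ Δ[1] ⟶ Y)
    (hH : ∀ (k : SimplexCategoryᵒᵖ) (x : (X ⊗ Δ[1]).obj k), x.1 ∈ A.obj k → H.app k x ∈ B.obj k) :
    collapsePoint A ▷ Δ[1] ≫ collapseHomotopy H hH = terminal.from _ ≫ collapsePoint B := by
  unfold collapseHomotopy
  rw [BraidedCategory.braiding_naturality_left_assoc, ← MonoidalClosed.uncurry_natural_left,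
    collapsePoint_desc, MonoidalClosed.uncurry_curry, ← Category.assoc]
  congr 1
  exact Subsingleton.elim _ _

/-- A homotopy that preserves the subcomplex restricts to it and descends to the quotient. Since `g`
is a strict section of `f`, a homotopy is needed on one side only. -/
theorem homotopyEquiv_of_pair (f : X ⟶ Y) (g : Y ⟶ X) (hf : A ≤ B.preimage f)
    (hg : B ≤ A.preimage g) (hgf : g ≫ f = 𝟙 Y) (H : X ⊗ Δ[1] ⟶ X)
    (h₁ : SSet.ι₁ ≫ H = 𝟙 X) (h₀ : SSet.ι₀ ≫ H = f ≫ g)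
    (hH : ∀ (k : SimplexCategoryᵒᵖ) (x : (X ⊗ Δ[1]).obj k), x.1 ∈ A.obj k → H.app k x ∈ A.obj k) :
    Nonempty (ContinuousMap.HomotopyEquiv (SSet.toTop.obj A.toSSet) (SSet.toTop.obj B.toSSet)) ∧
    Nonempty (ContinuousMap.HomotopyEquiv (SSet.toTop.obj (collapseSubcomplex A))
      (SSet.toTop.obj (collapseSubcomplex B))) := by
  constructor
  · let H' : A.toSSet ⊗ Δ[1] ⟶ A.toSSet := SSet.Subcomplex.lift (A.ι ▷ Δ[1] ≫ H) (by
      rintro k _ ⟨x, rfl⟩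
      exact hH _ _ x.1.2)
    have hH' : H' ≫ A.ι = A.ι ▷ Δ[1] ≫ H := rfl
    refine ⟨homotopyEquivOfSimplicial (restrictMap f hf) (restrictMap g hg) ?_ H' ?_ ?_⟩
    · rw [← cancel_mono B.ι, Category.assoc, restrictMap_ι, ← Category.assoc, restrictMap_ι,
        Category.assoc, hgf]
      simp
    · rw [← cancel_mono A.ι, Category.assoc, hH', ← Category.assoc,
        SSet.ι₁_comp, Category.assoc, h₁]
      simp
    · rw [← cancel_mono A.ι, Category.assoc, hH', ← Category.assoc,
        SSet.ι₀_comp, Category.assoc, h₀]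
      rfl
  · refine ⟨homotopyEquivOfSimplicial (collapseMap f hf) (collapseMap g hg) ?_
      (collapseHomotopy H hH) ?_ ?_⟩
    · refine collapse_hom_ext ?_ ?_
      · rw [collapseMap, collapseMap, ← Category.assoc, collapseProj_desc, Category.assoc,
          collapseProj_desc, ← Category.assoc, hgf]
        simp
      · rw [collapseMap, collapseMap, ← Category.assoc, collapsePoint_desc, collapsePoint_desc]
        simp
    · refine collapse_hom_ext ?_ ?_
      · rw [← Category.assoc, ← SSet.ι₁_comp, Category.assoc, collapseHomotopy_proj,
          ← Category.assoc, h₁]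
        simp
      · rw [← Category.assoc, ← SSet.ι₁_comp, Category.assoc, collapseHomotopy_point,
          ← Category.assoc, Subsingleton.elim (_ ≫ terminal.from _) (𝟙 _)]
        simp
    · refine collapse_hom_ext ?_ ?_
      · rw [← Category.assoc, ← SSet.ι₀_comp, Category.assoc, collapseHomotopy_proj,
          ← Category.assoc, h₀, collapseMap, collapseMap, ← Category.assoc, collapseProj_desc,
          Category.assoc, Category.assoc, collapseProj_desc]
      · rw [← Category.assoc, ← SSet.ι₀_comp, Category.assoc, collapseHomotopy_point,
          ← Category.assoc, Subsingleton.elim (_ ≫ terminal.from _) (𝟙 _), collapseMap,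
          collapseMap, ← Category.assoc, collapsePoint_desc, collapsePoint_desc]
        simp

/-- A simplicial set with a homotopy from the identity to a constant map. -/
theorem contractibleSpace_of_homotopy (H : X ⊗ Δ[1] ⟶ X) (h₁ : SSet.ι₁ ≫ H = 𝟙 X)
    (x₀ : X _⦋0⦌) (h₀ : ∀ (k : ℕ) (x : X _⦋k⦌), (SSet.ι₀ ≫ H).app _ x =
      X.map (SimplexCategory.const ⦋k⦌ ⦋0⦌ 0).op x₀) :
    ContractibleSpace (SSet.toTop.obj X) := by
  have e : (SSet.toTop.map (SSet.ι₀ ≫ H)).hom =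
      ContinuousMap.const _ (realize x₀ (stdSimplex.vertex 0)) := by
    ext p
    obtain ⟨k, x, w, rfl⟩ := exists_realize p
    change SSet.toTop.map _ _ = realize x₀ (stdSimplex.vertex 0)
    rw [toTop_map_realize, h₀, realize_map]
    congr 1
    exact Subsingleton.elim _ _
  have h := toTopHomotopy H
  rw [h₁, e, CategoryTheory.Functor.map_id] at h
  exact (contractible_iff_id_nullhomotopic _).2 ⟨_, ⟨h⟩⟩

end Pairs

/-! ### The tree operad is an `E_∞` operad -/

section TreePair

open Simplicial

variable {S : Type u} [Finite S]

/-- A total ordering for which all edges of the tree are intervals. -/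
def compatibleOrder (x : LabelledTree S) : TotalOrdering S := (exists_isInterval S x).choose

lemma isInterval_compatibleOrder {x : LabelledTree S} {M : Set S} (h : M ∈ x.edges) :
    IsInterval (compatibleOrder x) M := (exists_isInterval S x).choose_spec M h

/-- The value of a simplex of the interval at a vertex. -/
def intervalValue {k : SimplexCategoryᵒᵖ} (α : (Δ[1] : SSet.{u}).obj k)
    (i : Fin (k.unop.len + 1)) : Fin 2 := (SSet.stdSimplex.objEquiv α).toOrderHom i

lemma intervalValue_mono {k : SimplexCategoryᵒᵖ} (α : (Δ[1] : SSet.{u}).obj k) :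
    Monotone (intervalValue α) := (SSet.stdSimplex.objEquiv α).toOrderHom.monotone

/-- The star tree. -/
def starTree (h : 2 ≤ Nat.card S) : LabelledTree S :=
  ⟨h, ∅, fun _ h => h.elim, fun _ h => h.elim, fun _ h => h.elim⟩

/-- The homotopy from the identity to a constant map. -/
def starHomotopy (h : 2 ≤ Nat.card S) : treeOperad.obj S ⊗ Δ[1] ⟶ treeOperad.obj S where
  app k := ↾fun p => ((Monotone.functor (f := fun i =>
      if intervalValue p.2 i = 0 then starTree h else
        (p.1.1 : ComposableArrows (LabelledTree S) _).obj i) (by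
      intro i j hij
      have h1 := intervalValue_mono p.2 hij
      by_cases hi : intervalValue p.2 i = 0
      · simp only [hi]
        exact Set.empty_subset _
      · have hj : intervalValue p.2 j ≠ 0 := fun hj => hi (le_antisymm (hj ▸ h1) (Fin.zero_le _))
        simp only [hi, hj]
        exact (p.1.1.map (homOfLE hij)).le) : ComposableArrows (LabelledTree S) k.unop.len),
    (Monotone.functor (f := fun i => if intervalValue p.2 i = 0 then compatibleOrder (starTree h)
      else (p.1.2 : ComposableArrows (TotalOrdering S) _).obj i) (fun _ _ _ => trivial) :
        ComposableArrows (TotalOrdering S) k.unop.len))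
  naturality _ _ _ := rfl

theorem contractibleSpace_treeOperad (h : 2 ≤ Nat.card S) :
    ContractibleSpace (SSet.toTop.obj (treeOperad.obj S)) := by
  refine contractibleSpace_of_homotopy (starHomotopy h) ?_
    (((Functor.const _).obj (starTree h) : ComposableArrows (LabelledTree S) 0),
      ((Functor.const _).obj (compatibleOrder (starTree h)) :
        ComposableArrows (TotalOrdering S) 0)) fun k x => ?_
  · ext k x
    exact treeOperad_ext (fun i => rfl) fun i => rfl
  · exact treeOperad_ext (fun i => rfl) fun i => rfl

/-- The subcomplex of chains of trees with internal edges. -/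
def treeBoundary (S : Type u) : (nerve (LabelledTree S)).Subcomplex where
  obj k := Set.ofPred fun x : ComposableArrows (LabelledTree S) k.unop.len =>
    (x.obj 0).edges.Nonempty
  map f := by
    rintro x ⟨M, hM⟩
    exact ⟨M, (x.map (homOfLE (Fin.zero_le (f.unop.toOrderHom 0)))).le hM⟩

/-- The projection of the tree operad to chains of trees. -/
def treeProj (S : Type u) [Finite S] : treeOperad.obj S ⟶ nerve (LabelledTree S) where
  app k := ↾fun x => x.1
  naturality _ _ _ := rfl

/-- The section given by compatible orderings. -/
def treeSection (S : Type u) [Finite S] : nerve (LabelledTree S) ⟶ treeOperad.obj S where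
  app k := ↾fun x => (x, (Monotone.functor
    (f := fun i => compatibleOrder ((x : ComposableArrows (LabelledTree S) _).obj i))
      (fun _ _ _ => trivial) : ComposableArrows (TotalOrdering S) k.unop.len))
  naturality _ _ _ := rfl

/-- The homotopy from the identity to the composition of the projection and the section. -/
def orderHomotopy (S : Type u) [Finite S] :
    treeOperad.obj S ⊗ Δ[1] ⟶ treeOperad.obj S where
  app k := ↾fun p => (p.1.1, (Monotone.functor (f := fun i => if intervalValue p.2 i = 0 then
      compatibleOrder ((p.1.1 : ComposableArrows (LabelledTree S) _).obj i)
      else (p.1.2 : ComposableArrows (TotalOrdering S) _).obj i) (fun _ _ _ => trivial) :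
        ComposableArrows (TotalOrdering S) k.unop.len))
  naturality _ _ _ := rfl

lemma treeSection_proj : treeSection S ≫ treeProj S = 𝟙 _ := rfl

lemma orderHomotopy_one : SSet.ι₁ ≫ orderHomotopy S = 𝟙 _ := by
  ext k x
  exact treeOperad_ext (fun i => rfl) fun i => rfl

lemma orderHomotopy_zero : SSet.ι₀ ≫ orderHomotopy S = treeProj S ≫ treeSection S := by
  ext k x
  exact treeOperad_ext (fun i => rfl) fun i => rfl

lemma orderHomotopy_mem (k : SimplexCategoryᵒᵖ) (x : (treeOperad.obj S ⊗ Δ[1]).obj k)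
    (hx : x.1 ∈ (treeOperad.boundary S).obj k) :
    (orderHomotopy S).app k x ∈ (treeOperad.boundary S).obj k := by
  rw [mem_boundary_iff] at hx ⊢
  obtain ⟨M, hM, h⟩ := hx
  refine ⟨M, hM, fun i => ?_⟩
  have key : ∀ o o' : TotalOrdering S, IsInterval o M → IsInterval o' M →
      IsInterval (if intervalValue x.2 i = 0 then o else o') M := by
    intro o o' ho ho'
    by_cases h0 : intervalValue x.2 i = 0
    · rwa [if_pos h0]
    · rwa [if_neg h0]
  exact key _ _ (isInterval_compatibleOrder ((x.1.1.map (homOfLE (Fin.zero_le i))).le hM)) (h i)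

lemma boundary_le_preimage :
    treeOperad.boundary S ≤ (treeBoundary S).preimage (treeProj S) := by
  intro k x hx
  obtain ⟨M, hM, -⟩ := (mem_boundary_iff x).1 hx
  exact ⟨M, hM⟩

lemma treeBoundary_le_preimage :
    treeBoundary S ≤ (treeOperad.boundary S).preimage (treeSection S) := by
  rintro k x ⟨M, hM⟩
  exact (mem_boundary_iff _).2 ⟨M, hM, fun i =>
    isInterval_compatibleOrder ((x.map (homOfLE (Fin.zero_le i))).le hM)⟩

/-- The orderings contribute no homotopy: any two sequences of orderings are joined by a homotopy,
and along it an interval of both remains an interval, as the condition is imposed vertex by vertex.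
-/
theorem treeOperad_pair (S : Type u) [Finite S] :
    Nonempty (ContinuousMap.HomotopyEquiv (SSet.toTop.obj (treeOperad.boundary S).toSSet)
      (SSet.toTop.obj (treeBoundary S).toSSet)) ∧
    Nonempty (ContinuousMap.HomotopyEquiv
      (SSet.toTop.obj (collapseSubcomplex (treeOperad.boundary S)))
      (SSet.toTop.obj (collapseSubcomplex (treeBoundary S)))) :=
  homotopyEquiv_of_pair (treeProj S) (treeSection S) boundary_le_preimage treeBoundary_le_preimage
    treeSection_proj (orderHomotopy S) orderHomotopy_one orderHomotopy_zero orderHomotopy_mem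

/-- A bijection that preserves a total ordering of a finite set is the identity. -/
lemma TotalOrdering.map_injective {S S' : Type u} [Finite S] (e e' : S ≃ S')
    (o : TotalOrdering S') (h : o.map e = o.map e') : e = e' := by
  have h : ∀ a b, o.lt (e a) (e b) ↔ o.lt (e' a) (e' b) := fun a b =>
    iff_of_eq (congrArg (fun o : TotalOrdering S => o.lt a b) h)
  let f : S' → S' := fun a => e' (e.symm a)
  have hf : ∀ a b, o.lt (f a) (f b) ↔ o.lt a b := by
    intro a b
    rw [← h]
    simp
  have := Finite.of_equiv S e
  have : IsTrans S' o.lt := ⟨o.trans⟩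
  have : Std.Irrefl o.lt := ⟨o.irrefl⟩
  have wf : WellFounded o.lt := Finite.wellFounded_of_trans_of_irrefl o.lt
  have key : ∀ a, f a = a := by
    intro a
    -- Consider a least element `a` that is moved. If `f a < a`, then `f a` is already fixed,
    -- contradicting injectivity; if `a < f a`, the preimage of `a` has nowhere to be.
    induction a using wf.induction with
    | _ a ih =>
    by_contra hne
    rcases o.total _ _ hne with h1 | h1
    · have h2 := ih _ h1
      rw [← hf, h2] at h1
      exact o.irrefl _ h1
    · obtain ⟨b, hb⟩ : ∃ b, f b = a := ⟨e (e'.symm a), by simp [f]⟩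
      have h2 : ¬ o.lt b a := fun h2 => by
        rw [ih b h2] at hb
        subst hb
        exact o.irrefl _ h2
      have h3 : b ≠ a := by
        rintro rfl
        exact hne hb
      rcases o.total _ _ h3 with h4 | h4
      · exact h2 h4
      · rw [← hf, hb] at h4
        exact o.irrefl _ (o.trans _ _ _ h1 h4)
  ext a
  have := key (e a)
  simpa [f] using this.symm

theorem isEInfty_treeOperad : treeOperad.{u}.IsEInfty where
  contractible _ _ h := contractibleSpace_treeOperad h
  free e e' _ x h := TotalOrdering.map_injective e e'
    ((x.2 : ComposableArrows (TotalOrdering _) _).obj 0)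
    (congrArg (fun y => (y.2 : ComposableArrows (TotalOrdering _) _).obj 0) h)

lemma boundary_eq_bot (h : Nat.card S = 2) : treeOperad.boundary S = ⊥ := by
  refine eq_bot_iff.2 fun k x hx => ?_
  obtain ⟨M, hM, -⟩ := (mem_boundary_iff x).1 hx
  have h1 : IsProper M := ⟨LabelledTree.nontrivial_of_mem _ _ hM, LabelledTree.ne_univ_of_mem _ _ hM⟩
  have h2 : Nat.card ↥M + Nat.card ↥Mᶜ = Nat.card S := by
    rw [← Set.ncard_add_ncard_compl M]
    rfl
  have h3 := h1.card_left
  have h4 := h1.card_right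
  rw [Finite.card_option] at h4
  omega

end TreePair

/-! ### Points of the realization of chains of trees -/

section Heights

open Simplicial

open Classical in
/-- The sum of the weights of the sets that contain a given element. -/
def chainHeight {α : Type*} {k : ℕ} (E : Fin (k + 1) → Set α)
    (w : stdSimplex ℝ (Fin (k + 1))) (a : α) : ℝ := ∑ i with a ∈ E i, w i

lemma sum_filter_ge {k : ℕ} (w : stdSimplex ℝ (Fin (k + 1))) (m : ℕ) :
    ∑ j : Fin (k + 1) with m ≤ j.val, w j = 1 - cumul w m := by
  rw [← stdSimplex.sum_eq_one w, cumul,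
    ← Finset.sum_filter_add_sum_filter_not Finset.univ (fun j : Fin (k + 1) => j.val < m)]
  simp

/-- As `E` increases, the height of `a` is the total weight from the first index with `a ∈ E i`
onwards. The superlevel sets of the height at levels in `(0, 1]` are therefore the members of the
chain. -/
lemma le_chainHeight_iff {α : Type*} {k : ℕ} {E : Fin (k + 1) → Set α} (hE : Monotone E)
    {w : stdSimplex ℝ (Fin (k + 1))} {i : Fin (k + 1)} {c : ℝ}
    (h1 : 1 - cumul w (i + 1) < c) (h2 : c ≤ 1 - cumul w i) (a : α) :
    c ≤ chainHeight E w a ↔ a ∈ E i := by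
  constructor
  · intro h
    by_contra ha
    refine absurd (h.trans ?_) (not_le.2 h1)
    rw [← sum_filter_ge]
    refine Finset.sum_le_sum_of_subset_of_nonneg (fun j hj => ?_) fun j _ _ => w.2.1 j
    simp only [Finset.mem_filter, Finset.mem_univ, true_and] at hj ⊢
    by_contra h3
    exact ha (hE (by rw [Fin.le_def]; omega : j ≤ i) hj)
  · intro ha
    refine h2.trans ?_
    rw [← sum_filter_ge]
    refine Finset.sum_le_sum_of_subset_of_nonneg (fun j hj => ?_) fun j _ _ => w.2.1 j
    simp only [Finset.mem_filter, Finset.mem_univ, true_and] at hj ⊢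
    exact hE (Fin.le_def.2 hj) ha

lemma exists_level {k : ℕ} (w : stdSimplex ℝ (Fin (k + 1))) {c : ℝ} (h0 : 0 < c) (h1 : c ≤ 1) :
    ∃ i : Fin (k + 1), 1 - cumul w (i + 1) < c ∧ c ≤ 1 - cumul w i := by
  have h : ∃ m, 1 - cumul w m < c := ⟨k + 1, by rw [cumul_of_le w le_rfl]; linarith⟩
  classical
  have h2 := Nat.find_spec h
  have h3 : Nat.find h ≠ 0 := by
    intro h4
    rw [h4, cumul_zero] at h2
    linarith
  obtain ⟨m, hm⟩ := Nat.exists_eq_succ_of_ne_zero h3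
  have h4 := Nat.find_min h (m := m) (by omega)
  have h5 : m < k + 1 := by
    by_contra h5
    rw [cumul_of_le w (not_lt.1 h5)] at h4
    linarith
  exact ⟨⟨m, h5⟩, by rw [hm] at h2; exact h2, not_lt.1 h4⟩

lemma range_eq_superlevel {α : Type*} {k : ℕ} {E : Fin (k + 1) → Set α} (hE : Monotone E)
    {w : stdSimplex ℝ (Fin (k + 1))} (hw : ∀ i, 0 < w i) :
    Set.range E = (fun c => Set.ofPred fun a => c ≤ chainHeight E w a) '' Set.Ioc (0 : ℝ) 1 := by
  ext A
  constructor
  · rintro ⟨i, rfl⟩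
    have h1 : cumul w (i + 1) = cumul w i + w i := cumul_succ w i
    refine ⟨1 - cumul w i, ⟨?_, ?_⟩, ?_⟩
    · have h2 := cumul_mono w (show i.val + 1 ≤ k + 1 by omega)
      rw [cumul_of_le w le_rfl] at h2
      linarith [hw i]
    · have h2 := cumul_mono w (Nat.zero_le i)
      rw [cumul_zero] at h2
      linarith
    · ext a
      exact le_chainHeight_iff hE (by linarith [hw i]) le_rfl a
  · rintro ⟨c, ⟨h0, h1⟩, rfl⟩
    obtain ⟨i, h2, h3⟩ := exists_level w h0 h1
    refine ⟨i, ?_⟩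
    ext a
    exact (le_chainHeight_iff hE h2 h3 a).symm

/-- This recovers the weights: the top of the range of levels that cut out `E i` is a tail sum of
`w`. -/
lemma isGreatest_level {α : Type*} {k : ℕ} {E : Fin (k + 1) → Set α} (hE : StrictMono E)
    {w : stdSimplex ℝ (Fin (k + 1))} (hw : ∀ i, 0 < w i) (i : Fin (k + 1)) :
    IsGreatest (Set.ofPred fun c : ℝ => c ∈ Set.Ioc (0 : ℝ) 1 ∧
      (Set.ofPred fun a => c ≤ chainHeight E w a) = E i) (1 - cumul w i) := by
  have h1 : cumul w (i + 1) = cumul w i + w i := cumul_succ w i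
  refine ⟨⟨⟨?_, ?_⟩, ?_⟩, ?_⟩
  · have h2 := cumul_mono w (show i.val + 1 ≤ k + 1 by omega)
    rw [cumul_of_le w le_rfl] at h2
    linarith [hw i]
  · have h2 := cumul_mono w (Nat.zero_le i)
    rw [cumul_zero] at h2
    linarith
  · ext a
    exact le_chainHeight_iff hE.monotone (by linarith [hw i]) le_rfl a
  · rintro c ⟨⟨h2, h3⟩, h4⟩
    obtain ⟨j, h5, h6⟩ := exists_level w h2 h3
    have h7 : E j = E i := by
      rw [← h4]
      ext a
      exact (le_chainHeight_iff hE.monotone h5 h6 a).symm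
    rwa [hE.injective h7] at h6

lemma chain_eq_of_height_eq {α : Type*} {k : ℕ} {E E' : Fin (k + 1) → Set α} (hE : StrictMono E)
    (hE' : StrictMono E') {w w' : stdSimplex ℝ (Fin (k + 1))} (hw : ∀ i, 0 < w i)
    (hw' : ∀ i, 0 < w' i) (h : chainHeight E w = chainHeight E' w') : E = E' ∧ w = w' := by
  have h1 : E = E' := (StrictMono.range_inj hE hE').1 (by
    rw [range_eq_superlevel hE.monotone hw, range_eq_superlevel hE'.monotone hw', h])
  subst h1
  refine ⟨rfl, ?_⟩
  have h2 : ∀ i : ℕ, i ≤ k + 1 → cumul w i = cumul w' i := by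
    intro i hi
    rcases hi.lt_or_eq with hi | rfl
    · have h3 := isGreatest_level hE hw ⟨i, hi⟩
      rw [h] at h3
      have := h3.unique (isGreatest_level hE hw' ⟨i, hi⟩)
      simp only at this
      linarith
    · rw [cumul_of_le w le_rfl, cumul_of_le w' le_rfl]
  refine stdSimplex.ext (funext fun i => ?_)
  have h3 := cumul_succ w i
  rw [h2 _ (by omega), h2 _ (by omega), cumul_succ w' i] at h3
  linarith

lemma length_eq_of_height_eq {α : Type*} {k k' : ℕ} {E : Fin (k + 1) → Set α}
    {E' : Fin (k' + 1) → Set α} (hE : StrictMono E) (hE' : StrictMono E')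
    {w : stdSimplex ℝ (Fin (k + 1))} {w' : stdSimplex ℝ (Fin (k' + 1))} (hw : ∀ i, 0 < w i)
    (hw' : ∀ i, 0 < w' i) (h : chainHeight E w = chainHeight E' w') : k = k' := by
  have h1 : Set.range E = Set.range E' := by
    rw [range_eq_superlevel hE.monotone hw, range_eq_superlevel hE'.monotone hw', h]
  have h2 := congrArg Set.ncard h1
  rw [← Set.image_univ, ← Set.image_univ, Set.ncard_image_of_injective _ hE.injective,
    Set.ncard_image_of_injective _ hE'.injective] at h2
  simpa using h2

variable {P : Type u} [PartialOrder P] {X : SSet.{u}}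

/-- The vertices of a simplex of a nerve. -/
def nerveVertex {k : ℕ} (x : (nerve P) _⦋k⦌) (i : Fin (k + 1)) : P :=
  (x : ComposableArrows P k).obj i

lemma nerveVertex_mono {k : ℕ} (x : (nerve P) _⦋k⦌) : Monotone (nerveVertex x) :=
  fun _ _ h => ((x : ComposableArrows P k).map (homOfLE h)).le

lemma nerveVertex_ext {k : ℕ} {x y : (nerve P) _⦋k⦌} (h : nerveVertex x = nerveVertex y) : x = y :=
  nerve.ext_of_isThin h

/-- The simplex of a nerve given by a chain. -/
def nerveMk {k : ℕ} (f : Fin (k + 1) → P) (hf : Monotone f) : (nerve P) _⦋k⦌ :=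
  (hf.functor : ComposableArrows P k)

lemma nerveVertex_map (ι : X ⟶ nerve P) {k l : ℕ} (f : (⦋k⦌ : SimplexCategory) ⟶ ⦋l⦌)
    (x : X _⦋l⦌) (i : Fin (k + 1)) :
    nerveVertex (ι.app _ (X.map f.op x)) i = nerveVertex (ι.app _ x) (f i) := by
  rw [NatTrans.naturality_apply]
  rfl

/-- Each point lies in the interior of a nondegenerate simplex. -/
lemma exists_realize_pos (ι : X ⟶ nerve P) (hι : ∀ k, Function.Injective (ι.app k))
    (p : SSet.toTop.obj X) : ∃ (k : ℕ) (x : X _⦋k⦌) (w : stdSimplex ℝ (Fin (k + 1))),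
      realize x w = p ∧ (∀ i, 0 < w i) ∧ StrictMono (nerveVertex (ι.app _ x)) := by
  have hex : ∃ k, ∃ (x : X _⦋k⦌) (w : stdSimplex ℝ (Fin (k + 1))), realize x w = p :=
    exists_realize p
  classical
  -- Take the dimension minimal. A vanishing weight would move the point to a face, a repeated
  -- vertex would allow a degeneracy to be removed; both lower the dimension.
  obtain ⟨x, w, hp⟩ := Nat.find_spec hex
  have hmin := fun m hm => Nat.find_min hex (m := m) hm
  generalize Nat.find hex = k at x w hp hmin
  refine ⟨k, x, w, hp, ?_, ?_⟩
  · intro i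
    refine lt_of_le_of_ne (w.2.1 i) fun hi => ?_
    change 0 = w i at hi
    cases k with
    | zero =>
      have h := stdSimplex.sum_eq_one w
      have hi0 : i = 0 := by omega
      rw [Fin.sum_univ_one, ← hi0, ← hi] at h
      exact zero_ne_one h
    | succ k =>
      refine hmin k k.lt_succ_self ⟨X.map (SimplexCategory.δ i).op x,
        ⟨fun j => w (i.succAbove j), fun j => w.2.1 _, ?_⟩, ?_⟩
      · rw [← stdSimplex.sum_eq_one w, Fin.sum_univ_succAbove _ i, ← hi, zero_add]
      · rw [realize_map, ← hp]
        congr 1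
        refine stdSimplex.ext (funext fun j => ?_)
        rw [stdSimplex_map_apply]
        change ∑ a with i.succAbove a = j, w (i.succAbove a) = w j
        rcases Fin.eq_self_or_eq_succAbove i j with rfl | ⟨j, rfl⟩
        · rw [Finset.sum_eq_zero, hi]
          intro a ha
          exact absurd (Finset.mem_filter.1 ha).2 (Fin.succAbove_ne _ _)
        · simp [Finset.filter_eq']
  · cases k with
    | zero =>
      intro i j hij
      omega
    | succ k =>
      refine Fin.strictMono_iff_lt_succ.2 fun i => ?_
      refine lt_of_le_of_ne (nerveVertex_mono _ (Fin.castSucc_lt_succ).le) fun hi => ?_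
      refine hmin k k.lt_succ_self ⟨X.map (SimplexCategory.δ i.succ).op x,
        stdSimplex.map (SimplexCategory.σ i) w, ?_⟩
      rw [← realize_map, ← hp]
      congr 1
      refine hι _ (nerveVertex_ext (funext fun j => ?_))
      rw [nerveVertex_map, nerveVertex_map]
      change nerveVertex _ (i.succ.succAbove (i.predAbove j)) = _
      by_cases hj : j = i.succ
      · subst hj
        rw [Fin.predAbove_succ_self, Fin.succAbove_succ_self, hi]
      · rw [Fin.succ_succAbove_predAbove hj]

lemma finite_labelledTree (S : Type u) [Finite S] : Finite (LabelledTree S) :=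
  Finite.of_injective LabelledTree.edges fun _ _ h => LabelledTree.ext h

/-- Strict chains in a finite poset have bounded length, so finitely many simplices cover the
realization. -/
lemma compactSpace_realization [Finite P] (ι : X ⟶ nerve P)
    (hι : ∀ k, Function.Injective (ι.app k)) : CompactSpace (SSet.toTop.obj X) := by
  have hfin : ∀ k : ℕ, Finite (X _⦋k⦌) := fun k =>
    Finite.of_injective (fun x => nerveVertex (ι.app _ x)) fun x y h => hι _ (nerveVertex_ext h)
  have h : (Set.univ : Set (SSet.toTop.obj X)) =
      ⋃ p : Σ k : Fin (Nat.card P), X _⦋k.1⦌, Set.range (realize p.2) := by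
    refine (Set.eq_univ_of_forall fun p => ?_).symm
    obtain ⟨k, x, w, rfl, -, hx⟩ := exists_realize_pos ι hι p
    have hk : k < Nat.card P := by
      simpa using Nat.card_le_card_of_injective _ hx.injective
    exact Set.mem_iUnion.2 ⟨⟨⟨k, hk⟩, x⟩, w, rfl⟩
  refine ⟨?_⟩
  rw [h]
  exact isCompact_iUnion fun p => isCompact_range (continuous_realize p.2)

variable {S : Type u}

/-- The edges of the trees in a chain. -/
def chainEdges (ι : X ⟶ nerve (LabelledTree S)) {k : ℕ} (x : X _⦋k⦌) (i : Fin (k + 1)) :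
    Set (Set S) := (nerveVertex (ι.app _ x) i).edges

lemma chainEdges_mono (ι : X ⟶ nerve (LabelledTree S)) {k : ℕ} (x : X _⦋k⦌) :
    Monotone (chainEdges ι x) := fun _ _ h => nerveVertex_mono (ι.app _ x) h

lemma chainHeight_comp {α : Type*} {k l : ℕ} (f : Fin (k + 1) → Fin (l + 1))
    (E : Fin (l + 1) → Set α) (w : stdSimplex ℝ (Fin (k + 1))) :
    chainHeight (E ∘ f) w = chainHeight E (stdSimplex.map f w) := by
  classical
  funext a
  unfold chainHeight
  simp_rw [stdSimplex_map_apply]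
  rw [← Finset.sum_fiberwise_of_maps_to
    (s := Finset.univ.filter fun j => a ∈ (E ∘ f) j)
    (t := Finset.univ.filter fun j : Fin (l + 1) => a ∈ E j) (g := f) (by simp)]
  refine Finset.sum_congr rfl fun p hp => Finset.sum_congr ?_ fun _ _ => rfl
  ext j
  simp only [Finset.mem_filter, Finset.mem_univ, true_and] at hp ⊢
  constructor
  · exact And.right
  · rintro rfl
    exact ⟨hp, rfl⟩

lemma continuous_chainHeight {α : Type*} {k : ℕ} (E : Fin (k + 1) → Set α) :
    Continuous (chainHeight E) := by
  classical
  refine continuous_pi fun a => ?_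
  exact continuous_finsetSum _ fun i _ => (continuous_apply i).comp continuous_subtype_val

lemma chainEdges_map (ι : X ⟶ nerve (LabelledTree S)) {k l : ℕ}
    (f : (⦋k⦌ : SimplexCategory) ⟶ ⦋l⦌) (x : X _⦋l⦌) (w : stdSimplex ℝ (Fin (k + 1))) :
    chainHeight (chainEdges ι (X.map f.op x)) w =
      chainHeight (chainEdges ι x) (stdSimplex.map f w) := by
  rw [← chainHeight_comp]
  congr 1
  funext i
  exact congrArg LabelledTree.edges (nerveVertex_map ι f x i)

/-- The map that assigns to a point of the space of trees the lengths of all edges. -/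
def heightMap (ι : X ⟶ nerve (LabelledTree S)) : C(SSet.toTop.obj X, Set S → ℝ) :=
  realizeDesc (fun _ x => ⟨_, continuous_chainHeight (chainEdges ι x)⟩) (chainEdges_map ι)

lemma heightMap_realize (ι : X ⟶ nerve (LabelledTree S)) {k : ℕ} (x : X _⦋k⦌)
    (w : stdSimplex ℝ (Fin (k + 1))) :
    heightMap ι (realize x w) = chainHeight (chainEdges ι x) w := realizeDesc_realize _ (chainEdges_map ι) x w

lemma heightMap_comp {Y : SSet.{u}} (f : Y ⟶ X) (ι : X ⟶ nerve (LabelledTree S))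
    (p : SSet.toTop.obj Y) : heightMap ι (SSet.toTop.map f p) = heightMap (f ≫ ι) p := by
  obtain ⟨k, x, w, rfl⟩ := exists_realize p
  rw [toTop_map_realize, heightMap_realize, heightMap_realize]
  rfl

lemma strictMono_chainEdges (ι : X ⟶ nerve (LabelledTree S)) {k : ℕ} {x : X _⦋k⦌}
    (h : StrictMono (nerveVertex (ι.app _ x))) : StrictMono (chainEdges ι x) := fun _ _ hij =>
  lt_of_le_of_ne (chainEdges_mono ι x hij.le) fun h2 => (h hij).ne (LabelledTree.ext h2)

lemma heightMap_injective (ι : X ⟶ nerve (LabelledTree S))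
    (hι : ∀ k, Function.Injective (ι.app k)) : Function.Injective (heightMap ι) := by
  intro p q h
  obtain ⟨k, x, w, rfl, hw, hx⟩ := exists_realize_pos ι hι p
  obtain ⟨k', x', w', rfl, hw', hx'⟩ := exists_realize_pos ι hι q
  rw [heightMap_realize, heightMap_realize] at h
  have hE := strictMono_chainEdges ι hx
  have hE' := strictMono_chainEdges ι hx'
  obtain rfl := length_eq_of_height_eq hE hE' hw hw' h
  obtain ⟨h1, rfl⟩ := chain_eq_of_height_eq hE hE' hw hw' h
  have : x = x' := hι _ (nerveVertex_ext (funext fun i => LabelledTree.ext (congrFun h1 i)))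
  rw [this]

/-- The cone of trees with internal edges of arbitrary nonnegative lengths. -/
def treeCone (S : Type u) : Set (Set S → ℝ) :=
  Set.ofPred fun h => (∀ M, 0 ≤ h M) ∧ (∀ M, h M ≠ 0 → IsProper M) ∧
    ∀ M M', h M ≠ 0 → h M' ≠ 0 → M ⊆ M' ∨ M' ⊆ M ∨ Disjoint M M'

lemma chainHeight_nonneg {α : Type*} {k : ℕ} (E : Fin (k + 1) → Set α)
    (w : stdSimplex ℝ (Fin (k + 1))) (a : α) : 0 ≤ chainHeight E w a :=
  Finset.sum_nonneg fun i _ => w.2.1 i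

lemma chainHeight_le_one {α : Type*} {k : ℕ} (E : Fin (k + 1) → Set α)
    (w : stdSimplex ℝ (Fin (k + 1))) (a : α) : chainHeight E w a ≤ 1 := by
  classical
  rw [← stdSimplex.sum_eq_one w]
  exact Finset.sum_le_sum_of_subset_of_nonneg (Finset.subset_univ _) fun i _ _ => w.2.1 i

lemma mem_of_chainHeight_ne_zero {α : Type*} {k : ℕ} {E : Fin (k + 1) → Set α} (hE : Monotone E)
    {w : stdSimplex ℝ (Fin (k + 1))} {a : α} (h : chainHeight E w a ≠ 0) : a ∈ E (Fin.last k) := by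
  classical
  obtain ⟨i, hi, -⟩ := Finset.exists_ne_zero_of_sum_ne_zero h
  exact hE (Fin.le_last i) (Finset.mem_filter.1 hi).2

lemma chainHeight_eq_one_iff {α : Type*} {k : ℕ} {E : Fin (k + 1) → Set α} (hE : Monotone E)
    {w : stdSimplex ℝ (Fin (k + 1))} (hw : ∀ i, 0 < w i) {a : α} :
    chainHeight E w a = 1 ↔ a ∈ E 0 := by
  have h0 : cumul w 0 = 0 := cumul_zero w
  have h1 : cumul w (0 + 1) = cumul w 0 + w 0 := cumul_succ w 0
  rw [← le_chainHeight_iff (w := w) (i := 0) (c := 1) hE (by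
    change 1 - cumul w (0 + 1) < 1
    linarith [hw 0]) (by
    change 1 ≤ 1 - cumul w 0
    linarith)]
  exact ⟨fun h => h.ge, fun h => (chainHeight_le_one E w a).antisymm h⟩

lemma heightMap_mem_treeCone (ι : X ⟶ nerve (LabelledTree S)) (p : SSet.toTop.obj X) :
    heightMap ι p ∈ treeCone S := by
  obtain ⟨k, x, w, rfl⟩ := exists_realize p
  rw [heightMap_realize]
  have h := fun M => mem_of_chainHeight_ne_zero (a := M) (chainEdges_mono ι x) (w := w)
  exact ⟨chainHeight_nonneg _ _, fun M hM => ⟨LabelledTree.nontrivial_of_mem _ _ (h M hM),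
    LabelledTree.ne_univ_of_mem _ _ (h M hM)⟩, fun M M' hM hM' =>
    LabelledTree.nested_or_disjoint _ _ (h M hM) _ (h M' hM')⟩

lemma heightMap_le_one (ι : X ⟶ nerve (LabelledTree S)) (p : SSet.toTop.obj X) (M : Set S) :
    heightMap ι p M ≤ 1 := by
  obtain ⟨k, x, w, rfl⟩ := exists_realize p
  rw [heightMap_realize]
  exact chainHeight_le_one _ _ _

open Classical in
/-- The total weight may be any positive number. -/
lemma exists_chain [Finite S] (hS : 2 ≤ Nat.card S) (h : Set S → ℝ) (hh : h ∈ treeCone S) (t : ℝ)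
    (ht : 0 < t) (hle : ∀ M, h M ≤ t) :
    ∃ (k : ℕ) (x : Fin (k + 1) → LabelledTree S) (w : Fin (k + 1) → ℝ), Monotone x ∧
      (∀ i, 0 < w i) ∧ ∑ i, w i = t ∧ (∀ i, ∀ M ∈ (x i).edges, h M ≠ 0) ∧
      ∀ M, h M = ∑ i with M ∈ (x i).edges, w i := by
  induction hn : (Set.ofPred fun M => h M ≠ 0).ncard using Nat.strong_induction_on
    generalizing h t with
  | _ n ih =>
  subst hn
  obtain ⟨y, hy⟩ : ∃ y : LabelledTree S, ∀ M, M ∈ y.edges ↔ h M ≠ 0 :=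
    ⟨⟨hS, Set.ofPred fun M => h M ≠ 0, fun M hM => (hh.2.1 M hM).1,
      fun M hM => (hh.2.1 M hM).2, fun M hM M' hM' => hh.2.2 M M' hM hM'⟩, fun M => Iff.rfl⟩
  by_cases hc : ∀ M, h M ≠ 0 → h M = t
  · refine ⟨0, fun _ => y, fun _ => t, monotone_const, fun _ => ht, by simp, fun _ M h => (hy M).1 h,
      fun M => ?_⟩
    by_cases hM : h M = 0
    · rw [hM, Finset.filter_false_of_mem fun _ _ => by simpa [hy] using hM, Finset.sum_empty]
    · rw [hc M hM, Finset.filter_true_of_mem fun _ _ => by simpa [hy] using hM]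
      simp
  · push Not at hc
    obtain ⟨M₀, hM₀, hM₀t⟩ := hc
    -- Peel off a horizontal layer: the tree `y` of all edges gets the smallest positive length as
    -- its weight and becomes the last tree of the chain. Subtracting this length kills at least
    -- `M₁`, and the total weight `t` drops by the same amount.
    obtain ⟨M₁, hM₁, hmin⟩ := Set.exists_min_image (Set.ofPred fun M => h M ≠ 0) h (Set.toFinite _)
      ⟨M₀, hM₀⟩
    have hM₁ : h M₁ ≠ 0 := hM₁
    have hmin : ∀ M, h M ≠ 0 → h M₁ ≤ h M := hmin
    have hpos : 0 < h M₁ := lt_of_le_of_ne (hh.1 _) hM₁.symm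
    have hlt : h M₁ < t := (hmin _ hM₀).trans_lt (lt_of_le_of_ne (hle _) hM₀t)
    let h' : Set S → ℝ := fun M => if h M = 0 then 0 else h M - h M₁
    have h'ne : ∀ M, h' M ≠ 0 → h M ≠ 0 := fun M h1 h2 => h1 (by simp [h', h2])
    have h'1 : h' M₁ = 0 := by simp [h']
    obtain ⟨k, x, w, hx, hw, hsum, hsub, heq⟩ := ih _ (Set.ncard_lt_ncard
      (Set.ssubset_iff_subset_ne.2 ⟨h'ne, fun h2 =>
        (h2.symm ▸ hM₁ : M₁ ∈ Set.ofPred fun M => h' M ≠ 0) h'1⟩)) h' ⟨fun M => by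
          by_cases h2 : h M = 0
          · simp [h', h2]
          · simpa [h', h2] using hmin M h2, fun M hM => hh.2.1 M (h'ne M hM),
        fun M M' hM hM' => hh.2.2 M M' (h'ne M hM) (h'ne M' hM')⟩ (t - h M₁) (sub_pos.2 hlt)
      (fun M => by
        by_cases h2 : h M = 0
        · simpa [h', h2] using hlt.le
        · simpa [h', h2] using hle M) rfl
    have hxy : ∀ i, x i ≤ y := fun i M hM => (hy M).2 (h'ne M (hsub i M hM))
    refine ⟨k + 1, Fin.snoc x y, Fin.snoc w (h M₁), ?_, ?_, ?_, ?_, ?_⟩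
    · intro i j hij
      induction j using Fin.lastCases with
      | last =>
        rw [Fin.snoc_last]
        induction i using Fin.lastCases with
        | last => rw [Fin.snoc_last]
        | cast i => rw [Fin.snoc_castSucc]; exact hxy i
      | cast j =>
        induction i using Fin.lastCases with
        | last => exact absurd hij (not_le.2 (Fin.castSucc_lt_last j))
        | cast i =>
          rw [Fin.snoc_castSucc, Fin.snoc_castSucc]
          exact hx (Fin.castSucc_le_castSucc_iff.1 hij)
    · intro i
      induction i using Fin.lastCases with
      | last => rwa [Fin.snoc_last]
      | cast i => rw [Fin.snoc_castSucc]; exact hw i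
    · rw [Fin.sum_univ_castSucc]
      simp [hsum]
    · intro i
      induction i using Fin.lastCases with
      | last => rw [Fin.snoc_last]; exact fun M hM => (hy M).1 hM
      | cast i => rw [Fin.snoc_castSucc]; exact fun M hM => h'ne M (hsub i M hM)
    · intro M
      rw [Finset.sum_filter, Fin.sum_univ_castSucc]
      simp only [Fin.snoc_castSucc, Fin.snoc_last]
      rw [← Finset.sum_filter, ← heq]
      by_cases h2 : h M = 0
      · rw [if_neg (by simpa [hy] using h2)]
        simp [h', h2]
      · rw [if_pos (by simpa [hy] using h2)]
        simp [h', h2]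

lemma exists_realize_height [Finite S] (hS : 2 ≤ Nat.card S) {h : Set S → ℝ} (hh : h ∈ treeCone S)
    (hle : ∀ M, h M ≤ 1) : ∃ (k : ℕ) (x : (nerve (LabelledTree S)) _⦋k⦌)
      (w : stdSimplex ℝ (Fin (k + 1))), (∀ i, 0 < w i) ∧ heightMap (𝟙 _) (realize x w) = h := by
  obtain ⟨k, x, w, hx, hw, hsum, -, heq⟩ := exists_chain hS h hh 1 one_pos hle
  refine ⟨k, nerveMk x hx, ⟨w, fun i => (hw i).le, hsum⟩, hw, ?_⟩
  rw [heightMap_realize]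
  funext M
  rw [heq]
  rfl

lemma mem_treeBoundary_of_height {k : ℕ} {x : (nerve (LabelledTree S)) _⦋k⦌}
    {w : stdSimplex ℝ (Fin (k + 1))} (hw : ∀ i, 0 < w i) {M : Set S}
    (h : heightMap (𝟙 _) (realize x w) M = 1) : x ∈ (treeBoundary S).obj _ := by
  rw [heightMap_realize] at h
  exact ⟨M, (chainHeight_eq_one_iff (chainEdges_mono (𝟙 _) x) hw).1 h⟩

end Heights

/-! ### The boundary and the quotient as spaces of edge lengths -/

section Quotients

open Simplicial Limits

variable {X : SSet.{u}}

/-- Maps out of the realization of a quotient. -/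
def collapseTopDesc (A : X.Subcomplex) {Z : Type u} [TopologicalSpace Z]
    (f : C(SSet.toTop.obj X, Z)) (z : Z) (h : ∀ p, f (SSet.toTop.map A.ι p) = z) :
    C(SSet.toTop.obj (collapseSubcomplex A), Z) :=
  ((sSetTopAdj.homEquiv _ (TopCat.of Z)).symm (collapseDesc A
    (sSetTopAdj.homEquiv _ (TopCat.of Z) (TopCat.ofHom f))
    (sSetTopAdj.homEquiv _ (TopCat.of Z) (TopCat.ofHom (ContinuousMap.const _ z))) (by
      rw [← Adjunction.homEquiv_naturality_left, ← Adjunction.homEquiv_naturality_left]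
      congr 1
      ext p
      exact h p))).hom

variable (A : X.Subcomplex)

lemma collapseTopDesc_proj {Z : Type u} [TopologicalSpace Z]
    (f : C(SSet.toTop.obj X, Z)) (z : Z) (h : ∀ p, f (SSet.toTop.map A.ι p) = z)
    (p : SSet.toTop.obj X) :
    collapseTopDesc A f z h (SSet.toTop.map (collapseProj A) p) = f p := by
  have : SSet.toTop.map (collapseProj A) ≫ TopCat.ofHom (collapseTopDesc A f z h) =
      TopCat.ofHom f := by
    change SSet.toTop.map _ ≫ (sSetTopAdj.homEquiv _ (TopCat.of Z)).symm _ = _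
    rw [← Adjunction.homEquiv_naturality_left_symm, collapseProj_desc, Equiv.symm_apply_apply]
  exact congr($this p)

lemma collapseTopDesc_point {Z : Type u} [TopologicalSpace Z]
    (f : C(SSet.toTop.obj X, Z)) (z : Z) (h : ∀ p, f (SSet.toTop.map A.ι p) = z)
    (p : SSet.toTop.obj (⊤_ SSet.{u})) :
    collapseTopDesc A f z h (SSet.toTop.map (collapsePoint A) p) = z := by
  have : SSet.toTop.map (collapsePoint A) ≫ TopCat.ofHom (collapseTopDesc A f z h) =
      TopCat.ofHom (ContinuousMap.const _ z) := by
    change SSet.toTop.map _ ≫ (sSetTopAdj.homEquiv _ (TopCat.of Z)).symm _ = _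
    rw [← Adjunction.homEquiv_naturality_left_symm, collapsePoint_desc, Equiv.symm_apply_apply]
  exact congr($this p)

lemma collapse_top_hom_ext {Z : TopCat.{u}} {f g : SSet.toTop.obj (collapseSubcomplex A) ⟶ Z}
    (h : ∀ p, f (SSet.toTop.map (collapseProj A) p) = g (SSet.toTop.map (collapseProj A) p))
    (h' : ∀ p, f (SSet.toTop.map (collapsePoint A) p) = g (SSet.toTop.map (collapsePoint A) p)) :
    f = g := by
  apply (sSetTopAdj.homEquiv _ Z).injective
  refine collapse_hom_ext ?_ ?_
  · rw [← Adjunction.homEquiv_naturality_left, ← Adjunction.homEquiv_naturality_left]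
    congr 1
    ext p
    exact h p
  · rw [← Adjunction.homEquiv_naturality_left, ← Adjunction.homEquiv_naturality_left]
    congr 1
    ext p
    exact h' p

/-- As for simplices, the predicate is compared with the true one as a map to the indiscrete
two-point space, on which maps from a pushout can be tested. -/
lemma exists_proj_or_point (q : SSet.toTop.obj (collapseSubcomplex A)) :
    (∃ p, SSet.toTop.map (collapseProj A) p = q) ∨
      ∃ p, SSet.toTop.map (collapsePoint A) p = q := by
  let Q := SSet.toTop.obj (collapseSubcomplex A)
  let mk (q : Q → Prop) : Q ⟶ TopCat.of IndiscreteProp.{u} :=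
    TopCat.ofHom ⟨fun a => (ULift.up (q a) : ULift.{u} Prop), continuous_top⟩
  have h : mk (fun q => (∃ p, SSet.toTop.map (collapseProj A) p = q) ∨
      ∃ p, SSet.toTop.map (collapsePoint A) p = q) = mk fun _ => True := by
    refine collapse_top_hom_ext A (fun p => congrArg (ULift.up.{u}) ?_)
      fun p => congrArg (ULift.up.{u}) ?_
    · exact eq_true (.inl ⟨p, rfl⟩)
    · exact eq_true (.inr ⟨p, rfl⟩)
  have h2 : (_ : ULift.{u} Prop) = _ := congrArg (fun f : Q ⟶ _ => f q) h
  exact of_eq_true (congrArg ULift.down h2)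

lemma subsingleton_toTop_terminal : Subsingleton (SSet.toTop.obj (⊤_ SSet.{u})) := by
  have hs : ∀ k : ℕ, Subsingleton ((⊤_ SSet.{u}) _⦋k⦌) := fun k =>
    ⟨fun x y => SSet.yonedaEquiv.symm.injective (Subsingleton.elim _ _)⟩
  let x₀ : (⊤_ SSet.{u}) _⦋0⦌ := SSet.yonedaEquiv (terminal.from _)
  have h : ∀ p : SSet.toTop.obj (⊤_ SSet.{u}), p = realize x₀ (stdSimplex.vertex 0) := by
    intro p
    obtain ⟨k, x, w, rfl⟩ := exists_realize p
    rw [Subsingleton.elim x ((⊤_ SSet.{u}).map (SimplexCategory.const ⦋k⦌ ⦋0⦌ 0).op x₀),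
      realize_map]
    congr 1
    exact Subsingleton.elim _ _
  exact ⟨fun p q => (h p).trans (h q).symm⟩

/-- The base point of the realization of a quotient. -/
def collapseBase : SSet.toTop.obj (collapseSubcomplex A) :=
  SSet.toTop.map (collapsePoint A) (realize (SSet.yonedaEquiv (terminal.from _) :
    (⊤_ SSet.{u}) _⦋0⦌) (stdSimplex.vertex 0))

lemma map_point_eq_base (p : SSet.toTop.obj (⊤_ SSet.{u})) :
    SSet.toTop.map (collapsePoint A) p = collapseBase A :=
  congrArg _ (subsingleton_toTop_terminal.elim _ _)

lemma map_proj_eq_base (p : SSet.toTop.obj A.toSSet) :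
    SSet.toTop.map (collapseProj A) (SSet.toTop.map A.ι p) = collapseBase A := by
  have h : SSet.toTop.map A.ι ≫ SSet.toTop.map (collapseProj A) =
      SSet.toTop.map (terminal.from A.toSSet) ≫ SSet.toTop.map (collapsePoint A) := by
    rw [← Functor.map_comp, collapse_condition, Functor.map_comp]
  exact congr($h p).trans (map_point_eq_base A _)

lemma compactSpace_collapse (h : CompactSpace (SSet.toTop.obj X)) :
    CompactSpace (SSet.toTop.obj (collapseSubcomplex A)) := by
  refine ⟨?_⟩
  have : (Set.univ : Set (SSet.toTop.obj (collapseSubcomplex A))) =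
      Set.range (SSet.toTop.map (collapseProj A)) ∪ {collapseBase A} := by
    refine (Set.eq_univ_of_forall fun q => ?_).symm
    rcases exists_proj_or_point A q with ⟨p, rfl⟩ | ⟨p, rfl⟩
    · exact .inl ⟨p, rfl⟩
    · exact .inr (map_point_eq_base A p)
  rw [this]
  exact (isCompact_range (SSet.toTop.map (collapseProj A)).hom.continuous).union
    isCompact_singleton

end Quotients

/-! ### Continuity of maps to a one-point compactification -/

section OnePoint

/-- A criterion for the continuity of maps to a one-point compactification. -/
lemma continuous_onePoint {X E : Type*} [TopologicalSpace X] [TopologicalSpace E] {C : Set E}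
    (f : X → OnePoint C) (V : Set X) (hV : IsOpen V) (F : X → E) (hF : ContinuousOn F V)
    (hfV : ∀ x ∈ V, ∃ h : F x ∈ C, f x = ((⟨F x, h⟩ : C) : OnePoint C))
    (hfV' : ∀ x ∉ V, f x = OnePoint.infty) (δ : C → ℝ) (hδ : Continuous δ) (hδ0 : ∀ y, 0 < δ y)
    (hD : ∀ x ∉ V, ∃ D : X → ℝ, ContinuousAt D x ∧ D x ≤ 0 ∧
      ∀ x' ∈ V, ∀ h : F x' ∈ C, δ ⟨F x', h⟩ ≤ D x') : Continuous f := by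
  refine continuous_iff_continuousAt.2 fun x => ?_
  by_cases hx : x ∈ V
  · have hC : ∀ x ∈ V, F x ∈ C := fun x hx => (hfV x hx).1
    have h1 : ContinuousOn f V := by
      rw [continuousOn_iff_continuous_domRestrict]
      have h2 : Continuous fun x : V => (⟨F x, hC x x.2⟩ : C) :=
        (continuousOn_iff_continuous_domRestrict.1 hF).subtype_mk _
      have h3 : V.domRestrict f = fun x : V => ((⟨F x, hC x x.2⟩ : C) : OnePoint C) :=
        funext fun x => (hfV x x.2).2
      rw [h3]
      exact OnePoint.continuous_coe.comp h2
    exact h1.continuousAt (hV.mem_nhds hx)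
  · rw [ContinuousAt, hfV' x hx, Filter.tendsto_def]
    intro s hs
    obtain ⟨t, hts, ht, htm⟩ := mem_nhds_iff.1 hs
    obtain ⟨K, hK, hK'⟩ : ∃ K : Set C, IsCompact K ∧ ∀ y ∉ K, (y : OnePoint C) ∈ t := by
      refine ⟨((↑) ⁻¹' t)ᶜ, ((OnePoint.isOpen_iff_of_mem htm).1 ht).2, fun y hy => ?_⟩
      simpa using hy
    -- The positive function `δ` is bounded below on the compact set `K`. Near a point mapped to
    -- infinity the bound `D` drops below this minimum, so the values leave `K`.
    have hε : ∃ ε > 0, ∀ y ∈ K, ε ≤ δ y := by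
      rcases K.eq_empty_or_nonempty with rfl | hne
      · exact ⟨1, one_pos, fun y hy => hy.elim⟩
      · obtain ⟨y, -, hy⟩ := hK.exists_isMinOn hne hδ.continuousOn
        exact ⟨δ y, hδ0 y, fun z hz => hy hz⟩
    obtain ⟨ε, hε, hεK⟩ := hε
    obtain ⟨D, hD, hDx, hδD⟩ := hD x hx
    have h1 : ∀ᶠ x' in nhds x, D x' < ε :=
      hD.eventually_lt continuousAt_const (hDx.trans_lt hε)
    filter_upwards [h1] with x' hx'
    refine hts ?_
    by_cases h : x' ∈ V
    · obtain ⟨h2, h3⟩ := hfV x' h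
      rw [h3]
      refine hK' _ fun h4 => ?_
      linarith [hεK _ h4, hδD x' h h2]
    · rw [hfV' x' h]
      exact htm

end OnePoint

/-! ### The link and the compactified cone -/

section Homeomorphisms

open Simplicial

variable {S : Type u}

/-- The space of trees with internal edges whose longest internal edge has length one. -/
def treeLink (S : Type u) [Fintype S] : Set (Set S → ℝ) :=
  Set.ofPred fun h => h ∈ treeCone S ∧ ‖h‖ = 1

lemma isClosed_treeCone (S : Type u) : IsClosed (treeCone S) := by
  have hc : ∀ M : Set S, Continuous fun h : Set S → ℝ => h M := fun M => continuous_apply M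
  have hM : ∀ M : Set S, IsOpen (Set.ofPred fun h : Set S → ℝ => h M ≠ 0) := fun M =>
    isOpen_ne_fun (hc M) continuous_const
  have : treeCone S = (⋂ M, Set.ofPred fun h : Set S → ℝ => 0 ≤ h M) ∩
      ((⋂ M, Set.ofPred fun h : Set S → ℝ => h M ≠ 0 → IsProper M) ∩
      ⋂ M, ⋂ M', Set.ofPred fun h : Set S → ℝ =>
        h M ≠ 0 → h M' ≠ 0 → M ⊆ M' ∨ M' ⊆ M ∨ Disjoint M M') := by
    ext h
    simp [treeCone]
  rw [this]
  refine (isClosed_iInter fun M => isClosed_le continuous_const (hc M)).inter (.inter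
    (isClosed_iInter fun M => ?_) (isClosed_iInter fun M => isClosed_iInter fun M' => ?_))
  · exact isClosed_imp (hM M) isClosed_const
  · exact isClosed_imp (hM M) (isClosed_imp (hM M') isClosed_const)

lemma smul_mem_treeCone {h : Set S → ℝ} (hh : h ∈ treeCone S) {r : ℝ} (hr : 0 ≤ r) :
    r • h ∈ treeCone S := by
  have : ∀ M, (r • h) M ≠ 0 → h M ≠ 0 := fun M h1 h2 => h1 (by simp [h2])
  exact ⟨fun M => mul_nonneg hr (hh.1 M), fun M hM => hh.2.1 M (this M hM),
    fun M M' hM hM' => hh.2.2 M M' (this M hM) (this M' hM')⟩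

variable [Fintype S]

lemma norm_le_one_of_treeCone {h : Set S → ℝ} (hh : h ∈ treeCone S) {r : ℝ} (hr : 0 ≤ r) :
    ‖h‖ ≤ r ↔ ∀ M, h M ≤ r := by
  rw [pi_norm_le_iff_of_nonneg hr]
  exact forall_congr' fun M => by rw [Real.norm_of_nonneg (hh.1 M)]

lemma exists_eq_norm {h : Set S → ℝ} (hh : h ∈ treeCone S) : ∃ M, h M = ‖h‖ := by
  obtain ⟨M, hM⟩ := Finite.exists_max h
  refine ⟨M, le_antisymm ?_ ((norm_le_one_of_treeCone hh (hh.1 M)).2 hM)⟩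
  exact (Real.norm_of_nonneg (hh.1 M)).ge.trans (norm_le_pi_norm h M)

lemma heightMap_mem_treeLink (p : SSet.toTop.obj (treeBoundary S).toSSet) :
    heightMap (treeBoundary S).ι p ∈ treeLink S := by
  have h1 := heightMap_mem_treeCone (treeBoundary S).ι p
  refine ⟨h1, le_antisymm ((norm_le_one_of_treeCone h1 zero_le_one).2
    (heightMap_le_one _ p)) ?_⟩
  obtain ⟨k, x, w, rfl, hw, -⟩ := exists_realize_pos (treeBoundary S).ι
    (fun k => Subtype.val_injective) p
  obtain ⟨M, hM⟩ := x.2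
  have h2 : heightMap (treeBoundary S).ι (realize x w) M = 1 := by
    rw [heightMap_realize]
    exact (chainHeight_eq_one_iff (chainEdges_mono _ x) hw).2 hM
  rw [← h2]
  exact (Real.le_norm_self _).trans (norm_le_pi_norm _ M)

lemma exists_boundary_of_norm_eq_one (hS : 2 ≤ Nat.card S) {h : Set S → ℝ} (hh : h ∈ treeLink S) :
    ∃ p, heightMap (treeBoundary S).ι p = h := by
  obtain ⟨M, hM⟩ := exists_eq_norm hh.1
  obtain ⟨k, x, w, hw, rfl⟩ := exists_realize_height hS hh.1
    ((norm_le_one_of_treeCone hh.1 zero_le_one).1 hh.2.le)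
  rw [hh.2] at hM
  have hx := mem_treeBoundary_of_height hw hM
  exact ⟨realize (X := (treeBoundary S).toSSet) ⟨x, hx⟩ w,
    (heightMap_realize (X := (treeBoundary S).toSSet) _ _ _).trans
      (heightMap_realize (𝟙 _) x w).symm⟩

/-- Edge lengths form a continuous bijection from a compact space to a Hausdorff one. An edge has
length one exactly when it belongs to the first tree of the chain, so the norm-one functions come
from the boundary. -/
theorem boundary_homeomorph (hS : 2 ≤ Nat.card S) :
    Nonempty (SSet.toTop.obj (treeBoundary S).toSSet ≃ₜ treeLink S) := by
  have := finite_labelledTree S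
  have hι : ∀ k, Function.Injective ((treeBoundary S).ι.app k) := fun k => Subtype.val_injective
  have := compactSpace_realization (treeBoundary S).ι hι
  let f : SSet.toTop.obj (treeBoundary S).toSSet → treeLink S := fun p =>
    ⟨_, heightMap_mem_treeLink p⟩
  have hf : Function.Bijective f := ⟨fun p q h =>
    heightMap_injective _ hι (congrArg Subtype.val h), fun h => by
      obtain ⟨p, hp⟩ := exists_boundary_of_norm_eq_one hS h.2
      exact ⟨p, Subtype.ext hp⟩⟩
  exact ⟨Continuous.homeoOfEquivCompactToT2 (f := Equiv.ofBijective f hf)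
    ((heightMap _).continuous.subtype_mk _)⟩

open Classical in
/-- The map from trees with edges of length at most one to the one-point compactification of the
cone. -/
def expand (h : Set S → ℝ) : OnePoint (treeCone S) :=
  if hh : ‖h‖ < 1 ∧ h ∈ treeCone S then
    ((⟨(1 - ‖h‖)⁻¹ • h, smul_mem_treeCone hh.2 (inv_nonneg.2 (sub_nonneg.2 hh.1.le))⟩ :
      treeCone S) : OnePoint (treeCone S))
  else OnePoint.infty

/-- The scaling factor is visible in the norm of the image. This yields injectivity, the inverse `y
↦ (1 + ‖y‖)⁻¹ • y`, and the decay `1 - ‖h‖` near infinity. -/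
lemma norm_expand {h : Set S → ℝ} (hh : ‖h‖ < 1) : 1 + ‖(1 - ‖h‖)⁻¹ • h‖ = (1 - ‖h‖)⁻¹ := by
  have : 0 < 1 - ‖h‖ := by linarith
  rw [norm_smul, Real.norm_of_nonneg (by positivity)]
  field_simp
  ring

lemma continuous_expand_heightMap :
    Continuous fun p : SSet.toTop.obj (nerve (LabelledTree S)) =>
      expand (heightMap (𝟙 _) p) := by
  have hc : Continuous fun p : SSet.toTop.obj (nerve (LabelledTree S)) =>
      heightMap (𝟙 _) p := (heightMap _).continuous
  refine continuous_onePoint _ (Set.ofPred fun p => ‖heightMap (𝟙 _) p‖ < 1)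
    (isOpen_lt hc.norm continuous_const)
    (fun p => (1 - ‖heightMap (𝟙 _) p‖)⁻¹ • heightMap (𝟙 _) p) ?_ ?_ ?_
    (fun y => (1 + ‖(y : Set S → ℝ)‖)⁻¹) ?_ ?_ ?_
  · refine ContinuousOn.smul (ContinuousOn.inv₀ (continuous_const.sub hc.norm).continuousOn ?_)
      hc.continuousOn
    intro p hp
    exact (sub_pos.2 hp).ne'
  · intro p hp
    have hp : ‖heightMap (𝟙 _) p‖ < 1 ∧ heightMap (𝟙 _) p ∈ treeCone S :=
      ⟨hp, heightMap_mem_treeCone _ _⟩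
    exact ⟨smul_mem_treeCone hp.2 (inv_nonneg.2 (sub_nonneg.2 hp.1.le)), dif_pos hp⟩
  · intro p hp
    exact dif_neg fun h => hp h.1
  · exact Continuous.inv₀ (continuous_const.add continuous_subtype_val.norm) fun y => by
      positivity
  · intro y
    positivity
  · intro p hp
    have : ¬ ‖heightMap (𝟙 _) p‖ < 1 := hp
    refine ⟨fun p => 1 - ‖heightMap (𝟙 _) p‖, (continuous_const.sub hc.norm).continuousAt,
      by linarith, fun p hp h => ?_⟩
    simp only
    rw [norm_expand hp, inv_inv]

lemma eq_of_expand_eq {h h' : Set S → ℝ} (hh : ‖h‖ < 1) (hh' : ‖h'‖ < 1)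
    (e : (1 - ‖h‖)⁻¹ • h = (1 - ‖h'‖)⁻¹ • h') : h = h' := by
  have h1 := norm_expand hh
  rw [e, norm_expand hh'] at h1
  rw [h1] at e
  have : 0 < 1 - ‖h‖ := by linarith
  exact smul_right_injective _ (inv_ne_zero this.ne') e

/-- Trees with all edges shorter than one fill the cone after radial expansion; all others belong to
the boundary and go to infinity together with the base point. -/
theorem collapse_homeomorph (hS : 2 ≤ Nat.card S) :
    Nonempty (SSet.toTop.obj (collapseSubcomplex (treeBoundary S)) ≃ₜ OnePoint (treeCone S)) := by
  have := finite_labelledTree S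
  have := compactSpace_collapse (treeBoundary S)
    (compactSpace_realization (𝟙 (nerve (LabelledTree S))) fun k => Function.injective_id)
  have : LocallyCompactSpace (treeCone S) := (isClosed_treeCone S).locallyCompactSpace
  have hι : ∀ k, Function.Injective ((𝟙 (nerve (LabelledTree S)) :
    nerve (LabelledTree S) ⟶ _).app k) := fun k => Function.injective_id
  let f := collapseTopDesc (treeBoundary S) ⟨_, continuous_expand_heightMap⟩ OnePoint.infty
    fun p => dif_neg fun h => by
      rw [heightMap_comp, Category.comp_id] at h
      exact h.1.ne (heightMap_mem_treeLink p).2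
  have hproj : ∀ p, f (SSet.toTop.map (collapseProj (treeBoundary S)) p) =
      expand (heightMap (𝟙 _) p) := fun p => collapseTopDesc_proj _ _ _ _ p
  have hbase : f (collapseBase _) = OnePoint.infty := collapseTopDesc_point _ _ _ _ _
  have hlt : ∀ p, ‖heightMap (𝟙 (nerve (LabelledTree S))) p‖ < 1 →
      ∃ h, expand (heightMap (𝟙 _) p) = ((⟨(1 - ‖heightMap (𝟙 _) p‖)⁻¹ • heightMap (𝟙 _) p, h⟩ :
        treeCone S) : OnePoint (treeCone S)) := fun p hp =>
    ⟨smul_mem_treeCone (heightMap_mem_treeCone _ p) (inv_nonneg.2 (sub_nonneg.2 hp.le)),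
      dif_pos ⟨hp, heightMap_mem_treeCone _ p⟩⟩
  have hcases : ∀ q, q = collapseBase (treeBoundary S) ∨ ∃ p,
      SSet.toTop.map (collapseProj (treeBoundary S)) p = q ∧ ‖heightMap (𝟙 _) p‖ < 1 := by
    intro q
    rcases exists_proj_or_point _ q with ⟨p, rfl⟩ | ⟨p, rfl⟩
    · by_cases hp : ‖heightMap (𝟙 _) p‖ < 1
      · exact .inr ⟨p, rfl, hp⟩
      · left
        have h1 := heightMap_mem_treeCone (𝟙 _) p
        obtain ⟨p', hp'⟩ := exists_boundary_of_norm_eq_one hS ⟨h1, le_antisymm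
          ((norm_le_one_of_treeCone h1 zero_le_one).2 (heightMap_le_one _ p)) (not_lt.1 hp)⟩
        rw [← Category.comp_id (treeBoundary S).ι, ← heightMap_comp] at hp'
        rw [← heightMap_injective _ hι hp']
        exact map_proj_eq_base _ _
    · exact .inl (map_point_eq_base _ p)
  have hf : Function.Bijective f := by
    constructor
    · intro q q' h
      rcases hcases q with rfl | ⟨p, rfl, hp⟩ <;> rcases hcases q' with rfl | ⟨p', rfl, hp'⟩
      · rfl
      · obtain ⟨h2, h3⟩ := hlt p' hp'
        rw [hbase, hproj, h3] at h
        exact absurd h (OnePoint.infty_ne_coe _)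
      · obtain ⟨h2, h3⟩ := hlt p hp
        rw [hbase, hproj, h3] at h
        exact absurd h (OnePoint.coe_ne_infty _)
      · obtain ⟨h2, h3⟩ := hlt p hp
        obtain ⟨h2', h3'⟩ := hlt p' hp'
        rw [hproj, hproj, h3, h3'] at h
        rw [heightMap_injective _ hι (eq_of_expand_eq hp hp'
          (congrArg Subtype.val (OnePoint.coe_injective h)))]
    · intro y
      induction y using OnePoint.rec with
      | infty => exact ⟨_, hbase⟩
      | coe y =>
        have h1 : 0 < 1 + ‖(y : Set S → ℝ)‖ := by positivity
        have h2 := smul_mem_treeCone y.2 (inv_nonneg.2 h1.le)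
        have h3 : ‖(1 + ‖(y : Set S → ℝ)‖)⁻¹ • (y : Set S → ℝ)‖ =
            1 - (1 + ‖(y : Set S → ℝ)‖)⁻¹ := by
          rw [norm_smul, Real.norm_of_nonneg (by positivity)]
          field_simp
          ring
        have h4 : ‖(1 + ‖(y : Set S → ℝ)‖)⁻¹ • (y : Set S → ℝ)‖ < 1 := by
          rw [h3]
          have := inv_pos.2 h1
          linarith
        obtain ⟨k, x, w, hw, hx⟩ := exists_realize_height hS h2
          ((norm_le_one_of_treeCone h2 zero_le_one).1 h4.le)
        refine ⟨SSet.toTop.map (collapseProj (treeBoundary S)) (realize x w), ?_⟩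
        obtain ⟨h5, h6⟩ := hlt (realize x w) (by rwa [hx])
        rw [hproj, h6]
        congr 1
        refine Subtype.ext ?_
        simp only
        rw [hx, h3, sub_sub_cancel, inv_inv, smul_smul, mul_inv_cancel₀ h1.ne', one_smul]
  exact ⟨Continuous.homeoOfEquivCompactToT2 (f := Equiv.ofBijective f hf) f.continuous⟩

end Homeomorphisms

/-! ### Sliding a subtree towards the root -/

section Slide

variable {S : Type u} [Fintype S]

open Classical in
/-- The length of the path from the root of the subtree on `B` to the edge `M`. -/
def pathBelow (B : Set S) (h : Set S → ℝ) (M : Set S) : ℝ := ∑ N with B ⊂ N ∧ N ⊂ M, h N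

lemma pathBelow_nonneg {h : Set S → ℝ} (hh : ∀ M, 0 ≤ h M) (B M : Set S) : 0 ≤ pathBelow B h M :=
  Finset.sum_nonneg fun _ _ => hh _

lemma pathBelow_add_le {h : Set S → ℝ} (hh : ∀ M, 0 ≤ h M) {B M M' : Set S} (hB : B ⊂ M)
    (hM : M ⊂ M') : pathBelow B h M + h M ≤ pathBelow B h M' := by
  classical
  have : pathBelow B h M + h M =
      ∑ N ∈ insert M (Finset.univ.filter fun N => B ⊂ N ∧ N ⊂ M), h N := by
    rw [Finset.sum_insert (by simp [ssubset_irrefl]), add_comm, pathBelow]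
  rw [this]
  refine Finset.sum_le_sum_of_subset_of_nonneg (fun N hN => ?_) fun _ _ _ => hh _
  rcases Finset.mem_insert.1 hN with rfl | hN
  · simp [hB, hM]
  · have := (Finset.mem_filter.1 hN).2
    simp [this.1, this.2.trans hM]

open Classical in
/-- The subtree on `B` is moved by the length `t` towards the root; beyond the root, a new edge is
created. -/
def slide (B : Set S) (t : ℝ) (h : Set S → ℝ) (M : Set S) : ℝ :=
  -- An edge `M ⊃ B` begins at distance `pathBelow B h M` from `B`. Its part beyond distance `t`
  -- survives; the part within distance `t` no longer carries `B` and is added to `M \ B`. If the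
  -- distance exceeds the whole path, the excess becomes the length of an edge at the complement of
  -- `B`.
  if B ⊂ M then min (h M) (max 0 (pathBelow B h M + h M - t))
  else if M.Nonempty ∧ Disjoint M B then h M + if M ∪ B = Set.univ then
      max 0 (t - pathBelow B h Set.univ)
    else min (max 0 (t - pathBelow B h (M ∪ B))) (h (M ∪ B))
  else h M

variable {B : Set S} {t : ℝ} {h : Set S → ℝ}

lemma continuous_pathBelow (B M : Set S) : Continuous fun h : Set S → ℝ => pathBelow B h M :=
  continuous_finsetSum _ fun N _ => continuous_apply N

lemma continuous_slide (B : Set S) :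
    Continuous fun p : ℝ × (Set S → ℝ) => slide B p.1 p.2 := by
  have h1 : ∀ M, Continuous fun p : ℝ × (Set S → ℝ) => p.2 M := fun M =>
    (continuous_apply M).comp continuous_snd
  have h2 : ∀ M, Continuous fun p : ℝ × (Set S → ℝ) => pathBelow B p.2 M := fun M =>
    (continuous_pathBelow B M).comp continuous_snd
  refine continuous_pi fun M => ?_
  unfold slide
  split_ifs
  · exact (h1 M).min (continuous_const.max (((h2 M).add (h1 M)).sub continuous_fst))
  · exact (h1 M).add (continuous_const.max (continuous_fst.sub (h2 _)))
  · exact (h1 M).add ((continuous_const.max (continuous_fst.sub (h2 _))).min (h1 _))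
  · exact h1 M

lemma slide_of_ssubset {M : Set S} (hM : B ⊂ M) :
    slide B t h M = min (h M) (max 0 (pathBelow B h M + h M - t)) := if_pos hM

lemma slide_sdiff {M : Set S} (hB : B.Nonempty) (hM : B ⊂ M) (hne : M ≠ Set.univ) :
    slide B t h (M \ B) = h (M \ B) + min (max 0 (t - pathBelow B h M)) (h M) := by
  have h1 : ¬ B ⊂ M \ B := by
    intro h1
    obtain ⟨b, hb⟩ := hB
    exact (h1.1 hb).2 hb
  have h2 : (M \ B).Nonempty ∧ Disjoint (M \ B) B :=
    ⟨Set.sdiff_nonempty.2 hM.2, Set.disjoint_sdiff_left⟩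
  have h3 : M \ B ∪ B = M := Set.sdiff_union_of_subset hM.1
  rw [slide, if_neg h1, if_pos h2, h3, if_neg hne]

lemma slide_compl (hB : B.Nonempty) (hne : B ≠ Set.univ) :
    slide B t h Bᶜ = h Bᶜ + max 0 (t - pathBelow B h Set.univ) := by
  have h1 : ¬ B ⊂ Bᶜ := by
    intro h1
    obtain ⟨b, hb⟩ := hB
    exact h1.1 hb hb
  have h2 : Bᶜ.Nonempty ∧ Disjoint Bᶜ B :=
    ⟨Set.nonempty_compl.2 hne, disjoint_compl_left⟩
  have h3 : Bᶜ ∪ B = Set.univ := Set.compl_union_self B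
  rw [slide, if_neg h1, if_pos h2, h3, if_pos rfl]

lemma slide_zero (hh : ∀ M, 0 ≤ h M) : slide B 0 h = h := by
  funext M
  have h1 := pathBelow_nonneg hh B
  unfold slide
  split_ifs
  · rw [min_eq_left]
    rw [sub_zero]
    exact le_max_of_le_right (by linarith [h1 M])
  · rw [max_eq_left (by linarith [h1 Set.univ]), add_zero]
  · rw [max_eq_left (by linarith [h1 (M ∪ B)]), min_eq_left (hh _), add_zero]
  · rfl

lemma slide_nonneg (hh : ∀ M, 0 ≤ h M) (M : Set S) : 0 ≤ slide B t h M := by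
  unfold slide
  split_ifs
  · exact le_min (hh _) (le_max_left _ _)
  · exact add_nonneg (hh _) (le_max_left _ _)
  · exact add_nonneg (hh _) (le_min (le_max_left _ _) (hh _))
  · exact hh _

/-- The edges of the tree after sliding. -/
lemma slide_ne_zero (hh : ∀ M, 0 ≤ h M) (hc : ∀ M, h M ≠ 0 → B ⊆ M ∨ M ⊆ B ∨ Disjoint B M)
    {M : Set S} (hM : slide B t h M ≠ 0) : (h M ≠ 0 ∧ (Disjoint B M ∨ M ⊆ B)) ∨
      (h M ≠ 0 ∧ B ⊂ M ∧ t < pathBelow B h M + h M) ∨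
      ∃ N, B ⊂ N ∧ M = N \ B ∧ pathBelow B h N < t ∧ (N = Set.univ ∨ h N ≠ 0) := by
  have hu : M.Nonempty ∧ Disjoint M B → B ⊂ M ∪ B ∧ M = (M ∪ B) \ B := by
    rintro ⟨⟨a, ha⟩, h2⟩
    refine ⟨⟨Set.subset_union_right, fun h3 => Set.disjoint_left.1 h2 ha (h3 (.inl ha))⟩, ?_⟩
    rw [Set.union_sdiff_right, h2.sdiff_eq_left]
  unfold slide at hM
  split_ifs at hM with h1 h2 h3
  · refine .inr (.inl ⟨fun h4 => hM (by rw [h4]; exact min_eq_left (le_max_left _ _)), h1, ?_⟩)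
    by_contra h5
    exact hM (by rw [max_eq_left (by linarith), min_eq_right (hh M)])
  · by_cases h4 : h M = 0
    · refine .inr (.inr ⟨Set.univ, h3 ▸ (hu h2).1, h3 ▸ (hu h2).2, ?_, .inl rfl⟩)
      by_contra h5
      exact hM (by rw [h4, max_eq_left (by linarith), add_zero])
    · exact .inl ⟨h4, .inl h2.2.symm⟩
  · by_cases h4 : h M = 0
    · refine .inr (.inr ⟨M ∪ B, (hu h2).1, (hu h2).2, ?_, .inr fun h5 => ?_⟩)
      · by_contra h5
        exact hM (by rw [h4, max_eq_left (by linarith), min_eq_left (hh _), add_zero])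
      · exact hM (by rw [h4, h5, min_eq_right (le_max_left _ _), add_zero])
    · exact .inl ⟨h4, .inl h2.2.symm⟩
  · refine .inl ⟨hM, ?_⟩
    rcases M.eq_empty_or_nonempty with rfl | h3
    · exact .inl (Set.disjoint_empty _)
    · rcases hc M hM with h4 | h4 | h4
      · exact .inr (by_contra fun h5 => h1 ⟨h4, h5⟩)
      · exact .inr h4
      · exact absurd ⟨h3, h4.symm⟩ h2

/-- A passed edge `N` turns into `N \ B`, which is an edge only if it has at least two twigs: this
is `hgap`, and `hBc` is the same condition for the new edge at the root. Compatibility of the edges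
reduces to that of the original ones together with `univ`. -/
lemma slide_mem_treeCone (hh : h ∈ treeCone S) (hB : B.Nonempty) (hBc : Bᶜ.Nontrivial)
    (hc : ∀ M, h M ≠ 0 → B ⊆ M ∨ M ⊆ B ∨ Disjoint B M) (ht : 0 ≤ t)
    (hgap : t = 0 ∨ ∀ N, B ⊂ N → h N ≠ 0 → (N \ B).Nontrivial) : slide B t h ∈ treeCone S := by
  rcases hgap with rfl | hgap
  · rwa [slide_zero hh.1]
  have key := fun M => slide_ne_zero (B := B) (t := t) (M := M) hh.1 hc
  have hpos := fun M => pathBelow_nonneg hh.1 B M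
  have hlam : ∀ N, (N = Set.univ ∨ h N ≠ 0) → ∀ N', (N' = Set.univ ∨ h N' ≠ 0) →
      N ⊆ N' ∨ N' ⊆ N ∨ Disjoint N N' := by
    rintro N (rfl | hN) N' (rfl | hN')
    · exact .inl subset_rfl
    · exact .inr (.inl (Set.subset_univ _))
    · exact .inl (Set.subset_univ _)
    · exact hh.2.2 N N' hN hN'
  have hnest : ∀ N, (N = Set.univ ∨ h N ≠ 0) → ∀ N', (N' = Set.univ ∨ h N' ≠ 0) → B ⊂ N →
      B ⊂ N' → N ⊆ N' ∨ N' ⊆ N := by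
    intro N h1 N' h2 h3 h4
    rcases hlam N h1 N' h2 with h5 | h5 | h5
    · exact .inl h5
    · exact .inr h5
    · obtain ⟨b, hb⟩ := hB
      exact absurd (h4.1 hb) (Set.disjoint_left.1 h5 (h3.1 hb))
  have h12 : ∀ M N, h M ≠ 0 → (Disjoint B M ∨ M ⊆ B) → B ⊂ N → (N = Set.univ ∨ h N ≠ 0) →
      M ⊆ N \ B ∨ Disjoint M (N \ B) := by
    rintro M N h1 (h2 | h2) h3 h4
    · rcases hlam M (.inr h1) N h4 with h5 | h5 | h5
      · exact .inl (Set.subset_sdiff.2 ⟨h5, h2.symm⟩)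
      · obtain ⟨b, hb⟩ := hB
        exact absurd (h5 (h3.1 hb)) (Set.disjoint_left.1 h2 hb)
      · exact .inr (h5.mono_right Set.sdiff_subset)
    · exact .inr (Set.disjoint_sdiff_right.mono_left h2)
  -- A surviving edge lies nearer to the root than every passed one, because the distance from `B`
  -- grows along the path.
  have h23 : ∀ M N, h M ≠ 0 → B ⊂ M → t < pathBelow B h M + h M → B ⊂ N →
      pathBelow B h N < t → (N = Set.univ ∨ h N ≠ 0) → N \ B ⊆ M := by
    intro M N h1 h2 h3 h4 h5 h6
    refine Set.sdiff_subset.trans ?_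
    rcases hnest M (.inr h1) N h6 h2 h4 with h7 | h7
    · by_contra h8
      have := pathBelow_add_le hh.1 h2 ⟨h7, h8⟩
      linarith
    · exact h7
  refine ⟨slide_nonneg hh.1, fun M hM => ?_, fun M M' hM hM' => ?_⟩
  · rcases key M hM with ⟨h1, -⟩ | ⟨h1, -⟩ | ⟨N, h1, rfl, h2, h3⟩
    · exact hh.2.1 M h1
    · exact hh.2.1 M h1
    · refine ⟨?_, fun h4 => ?_⟩
      · rcases h3 with rfl | h3
        · rwa [← Set.compl_eq_univ_sdiff]
        · exact hgap N h1 h3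
      · obtain ⟨b, hb⟩ := hB
        exact (h4 ▸ trivial : b ∈ N \ B).2 hb
  · rcases key M hM with ⟨h1, h1'⟩ | ⟨h1, h1', h1''⟩ | ⟨N, h1, rfl, h1', h1''⟩ <;>
      rcases key M' hM' with ⟨h2, h2'⟩ | ⟨h2, h2', h2''⟩ | ⟨N', h2, rfl, h2', h2''⟩
    · exact hh.2.2 M M' h1 h2
    · exact hh.2.2 M M' h1 h2
    · rcases h12 M N' h1 h1' h2 h2'' with h | h
      · exact .inl h
      · exact .inr (.inr h)
    · exact hh.2.2 M M' h1 h2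
    · exact hh.2.2 M M' h1 h2
    · exact .inr (.inl (h23 M N' h1 h1' h1'' h2 h2' h2''))
    · rcases h12 M' N h2 h2' h1 h1'' with h | h
      · exact .inr (.inl h)
      · exact .inr (.inr h.symm)
    · exact .inl (h23 M' N h2 h2' h2'' h1 h1' h1'')
    · rcases hnest N h1'' N' h2'' h1 h2 with h | h
      · exact .inl (Set.sdiff_subset_sdiff_left h)
      · exact .inr (.inl (Set.sdiff_subset_sdiff_left h))

lemma apply_le_norm (h : Set S → ℝ) (M : Set S) : h M ≤ ‖h‖ :=
  (Real.le_norm_self _).trans (norm_le_pi_norm h M)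

/-- An edge on the path is divided between `M` and `M \ B`, so one of the two parts has at least
half of its length. All other edges do not shrink. -/
lemma le_two_mul_norm_slide (hh : h ∈ treeCone S) (hB : B.Nonempty) (M : Set S) :
    h M ≤ 2 * ‖slide B t h‖ := by
  have h0 : 0 ≤ ‖slide B t h‖ := norm_nonneg _
  by_cases hM : B ⊂ M
  · by_cases hu : M = Set.univ
    · have : h M = 0 := by_contra fun h1 => (hh.2.1 M h1).2 hu
      linarith
    · have h1 := apply_le_norm (slide B t h) M
      have h2 := apply_le_norm (slide B t h) (M \ B)
      rw [slide_of_ssubset hM] at h1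
      rw [slide_sdiff hB hM hu] at h2
      have h3 := hh.1 (M \ B)
      have h4 : h M ≤ min (h M) (max 0 (pathBelow B h M + h M - t)) +
          min (max 0 (t - pathBelow B h M)) (h M) := by
        have := hh.1 M
        rcases le_total t (pathBelow B h M) with h5 | h5
        · rw [max_eq_right (by linarith), min_eq_left (by linarith : h M ≤ _)]
          linarith [le_min (le_max_left 0 (t - pathBelow B h M)) this]
        · rw [max_eq_right (by linarith : 0 ≤ t - pathBelow B h M)]
          rcases le_total t (pathBelow B h M + h M) with h6 | h6
          · rw [max_eq_right (by linarith), min_eq_right (by linarith), min_eq_left (by linarith)]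
            linarith
          · rw [min_eq_right (by linarith : h M ≤ t - _)]
            linarith [le_min this (le_max_left 0 (pathBelow B h M + h M - t))]
      linarith
  · have h1 := apply_le_norm (slide B t h) M
    have h2 : h M ≤ slide B t h M := by
      unfold slide
      rw [if_neg hM]
      split_ifs
      · linarith [le_max_left 0 (t - pathBelow B h Set.univ)]
      · linarith [le_min (le_max_left 0 (t - pathBelow B h (M ∪ B))) (hh.1 (M ∪ B))]
      · exact le_rfl
    linarith

lemma norm_le_slide (hh : h ∈ treeCone S) (hB : B.Nonempty) : ‖h‖ ≤ 2 * ‖slide B t h‖ :=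
  (norm_le_one_of_treeCone hh (by positivity)).2 (le_two_mul_norm_slide hh hB)

/-- The distance `t` is at most the length of the path plus that of the new edge at the root. The
path has at most `Fintype.card (Set S)` edges, each bounded by twice the new norm. Hence the tree
tends to infinity as `t` does. -/
lemma le_mul_norm_slide (hh : h ∈ treeCone S) (hB : B.Nonempty) (hne : B ≠ Set.univ) :
    t ≤ (4 * Fintype.card (Set S) : ℝ) * ‖slide B t h‖ := by
  have h0 : 0 ≤ ‖slide B t h‖ := norm_nonneg _
  have hcard : (1 : ℝ) ≤ Fintype.card (Set S) := by exact_mod_cast Fintype.card_pos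
  have h1 := apply_le_norm (slide B t h) Bᶜ
  rw [slide_compl hB hne] at h1
  have h2 := hh.1 Bᶜ
  have h3 := le_max_right 0 (t - pathBelow B h Set.univ)
  have h4 : pathBelow B h Set.univ ≤ Fintype.card (Set S) * (2 * ‖slide B t h‖) := by
    unfold pathBelow
    refine (Finset.sum_le_card_nsmul _ _ _ fun M _ => le_two_mul_norm_slide (t := t) hh hB M).trans ?_
    rw [nsmul_eq_mul]
    gcongr
    exact_mod_cast Finset.card_le_univ _
  nlinarith

end Slide

/-! ### Collapsing trees that miss a level -/

section Levels

variable {S : Type u} [Fintype S]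

open Classical in
/-- The length of the edge with exactly `j` twigs above it that include `s`. -/
def level (s : S) (j : ℕ) (h : Set S → ℝ) : ℝ := ∑ M with s ∈ M ∧ M.ncard = j, h M

variable {s : S} {j : ℕ} {h : Set S → ℝ}

lemma continuous_level (s : S) (j : ℕ) : Continuous (level s j) :=
  continuous_finsetSum _ fun M _ => continuous_apply M

lemma level_nonneg (hh : h ∈ treeCone S) : 0 ≤ level s j h := Finset.sum_nonneg fun M _ => hh.1 M

/-- Edges above which `s` lies are never disjoint, so they form a chain and are determined by their
size. Each level sum has at most one nonzero term. -/
lemma eq_of_level (hh : h ∈ treeCone S) {M M' : Set S} (hM : h M ≠ 0) (hM' : h M' ≠ 0)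
    (hs : s ∈ M) (hs' : s ∈ M') (hc : M.ncard = M'.ncard) : M = M' := by
  rcases hh.2.2 M M' hM hM' with h1 | h1 | h1
  · exact Set.eq_of_subset_of_ncard_le h1 hc.ge
  · exact (Set.eq_of_subset_of_ncard_le h1 hc.le).symm
  · exact absurd hs' (Set.disjoint_left.1 h1 hs)

lemma level_eq (hh : h ∈ treeCone S) {M : Set S} (hM : h M ≠ 0) (hs : s ∈ M) (hc : M.ncard = j) :
    level s j h = h M := by
  classical
  refine Finset.sum_eq_single_of_mem M (by simp [hs, hc]) fun M' hM' hne => ?_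
  by_contra h1
  have h2 := (Finset.mem_filter.1 hM').2
  exact hne (eq_of_level hh h1 hM h2.1 hs (h2.2.trans hc.symm))

lemma exists_of_level_pos (h0 : level s j h ≠ 0) : ∃ M, s ∈ M ∧ M.ncard = j ∧ h M ≠ 0 := by
  classical
  obtain ⟨M, hM, h1⟩ := Finset.exists_ne_zero_of_sum_ne_zero h0
  exact ⟨M, (Finset.mem_filter.1 hM).2.1, (Finset.mem_filter.1 hM).2.2, h1⟩

lemma le_level (hh : h ∈ treeCone S) {M : Set S} (hs : s ∈ M) (hc : M.ncard = j) :
    h M ≤ level s j h := by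
  classical
  exact Finset.single_le_sum (f := h) (fun M _ => hh.1 M) (by simp [hs, hc])

lemma level_smul (r : ℝ) : level s j (r • h) = r * level s j h := by
  classical
  simp [level, Finset.mul_sum]

open Classical in
/-- The edge with `j` twigs above it that include `s` is shortened. -/
def shorten (s : S) (j : ℕ) (a : ℝ) (h : Set S → ℝ) (M : Set S) : ℝ :=
  if s ∈ M ∧ M.ncard = j then max 0 (h M - a) else h M

lemma continuous_shorten (s : S) (j : ℕ) :
    Continuous fun p : ℝ × (Set S → ℝ) => shorten s j p.1 p.2 := by
  have h1 : ∀ M, Continuous fun p : ℝ × (Set S → ℝ) => p.2 M := fun M =>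
    (continuous_apply M).comp continuous_snd
  refine continuous_pi fun M => ?_
  unfold shorten
  split_ifs
  · exact continuous_const.max ((h1 M).sub continuous_fst)
  · exact h1 M

lemma shorten_ne_zero (hh : h ∈ treeCone S) {a : ℝ} (ha : 0 ≤ a) {M : Set S}
    (hM : shorten s j a h M ≠ 0) : h M ≠ 0 := by
  intro h0
  refine hM ?_
  unfold shorten
  rw [h0]
  split_ifs
  · exact max_eq_left (by linarith)
  · rfl

lemma shorten_mem (hh : h ∈ treeCone S) {a : ℝ} (ha : 0 ≤ a) :
    shorten s j a h ∈ treeCone S := by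
  refine ⟨fun M => ?_, fun M hM => hh.2.1 M (shorten_ne_zero hh ha hM), fun M M' hM hM' =>
    hh.2.2 M M' (shorten_ne_zero hh ha hM) (shorten_ne_zero hh ha hM')⟩
  unfold shorten
  split_ifs
  · exact le_max_left _ _
  · exact hh.1 M

lemma shorten_zero (hh : h ∈ treeCone S) : shorten s j 0 h = h := by
  funext M
  unfold shorten
  split_ifs
  · rw [sub_zero, max_eq_right (hh.1 M)]
  · rfl

lemma shorten_of_le (hh : h ∈ treeCone S) {a : ℝ} (ha : level s j h ≤ a) {M : Set S} (hs : s ∈ M)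
    (hc : M.ncard = j) : shorten s j a h M = 0 := by
  unfold shorten
  rw [if_pos ⟨hs, hc⟩, max_eq_left (by linarith [le_level hh hs hc])]

lemma norm_le_shorten (hh : h ∈ treeCone S) {a : ℝ} (ha : 0 ≤ a) :
    ‖h‖ ≤ ‖shorten s j a h‖ + a := by
  refine (norm_le_one_of_treeCone hh (by positivity)).2 fun M => ?_
  have h1 := apply_le_norm (shorten s j a h) M
  unfold shorten at h1 ⊢
  split_ifs at h1
  · linarith [le_max_right 0 (h M - a)]
  · linarith

lemma level_shorten {i : ℕ} (hi : i ≠ j) (a : ℝ) : level s i (shorten s j a h) = level s i h := by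
  classical
  refine Finset.sum_congr rfl fun M hM => ?_
  rw [shorten, if_neg]
  rintro ⟨-, h1⟩
  exact hi ((Finset.mem_filter.1 hM).2.2.symm.trans h1)

/-- A set containing `s` with at most as many elements as `B` is neither strictly larger than `B`
nor disjoint from it, so sliding leaves it alone. -/
lemma level_slide {B : Set S} (hs : s ∈ B) {i : ℕ} (hi : i ≤ B.ncard) (t : ℝ) :
    level s i (slide B t h) = level s i h := by
  classical
  refine Finset.sum_congr rfl fun M hM => ?_
  obtain ⟨h1, h2⟩ := (Finset.mem_filter.1 hM).2
  rw [slide, if_neg, if_neg]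
  · rintro ⟨-, h3⟩
    exact Set.disjoint_left.1 h3 h1 hs
  · intro h3
    have := Set.ncard_lt_ncard h3
    omega

lemma level_slide_eq_zero (hh : h ∈ treeCone S) {B : Set S} (hs : s ∈ B) {i : ℕ}
    (hi : level s i h = 0) (t : ℝ) : level s i (slide B t h) = 0 := by
  classical
  refine Finset.sum_eq_zero fun M hM => ?_
  obtain ⟨h1, h2⟩ := (Finset.mem_filter.1 hM).2
  have h3 : h M = 0 := le_antisymm ((le_level hh h1 h2).trans hi.le) (hh.1 M)
  rw [slide]
  split_ifs with h4 h5 h6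
  · rw [h3]
    exact min_eq_left (le_max_left _ _)
  · exact absurd hs (Set.disjoint_left.1 h5.2 h1)
  · exact absurd hs (Set.disjoint_left.1 h5.2 h1)
  · exact h3

/-- Trees in which the levels `2, …, j` are present; if `q` holds, level two has length one. -/
def openCone (s : S) (j : ℕ) (q : Prop) : Set (Set S → ℝ) :=
  Set.ofPred fun h => h ∈ treeCone S ∧ (q → level s 2 h = 1) ∧
    ∀ i ∈ Finset.Icc 2 j, 0 < level s i h

/-- A function that tends to zero at infinity. -/
def levelWeight (s : S) (j : ℕ) (h : Set S → ℝ) : ℝ :=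
  (1 + ‖h‖)⁻¹ * ∏ i ∈ Finset.Icc 2 j, min 1 (level s i h)

variable {q : Prop}

lemma continuous_levelWeight (s : S) (j : ℕ) : Continuous (levelWeight s j) := by
  refine Continuous.mul (Continuous.inv₀ (continuous_const.add continuous_norm) fun h => by
    positivity) (continuous_finsetProd _ fun i _ => continuous_const.min (continuous_level s i))

lemma prod_level_nonneg (hh : h ∈ treeCone S) (A : Finset ℕ) :
    0 ≤ ∏ i ∈ A, min 1 (level s i h) :=
  Finset.prod_nonneg fun i _ => le_min zero_le_one (level_nonneg hh)

lemma prod_level_le_one (hh : h ∈ treeCone S) (A : Finset ℕ) :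
    ∏ i ∈ A, min 1 (level s i h) ≤ 1 :=
  Finset.prod_le_one (fun i _ => le_min zero_le_one (level_nonneg hh)) fun i _ => min_le_left _ _

lemma levelWeight_pos (hh : h ∈ openCone s j q) : 0 < levelWeight s j h :=
  mul_pos (by positivity) (Finset.prod_pos fun i hi => lt_min one_pos (hh.2.2 i hi))

lemma levelWeight_le_inv (hh : h ∈ treeCone S) : levelWeight s j h ≤ (1 + ‖h‖)⁻¹ :=
  mul_le_of_le_one_right (by positivity) (prod_level_le_one hh _)

lemma inv_norm_le_one (h : Set S → ℝ) : (1 + ‖h‖)⁻¹ ≤ 1 :=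
  inv_le_one_of_one_le₀ (by linarith [norm_nonneg h])

lemma levelWeight_le_level (hh : h ∈ treeCone S) {i : ℕ} (hi : i ∈ Finset.Icc 2 j) :
    levelWeight s j h ≤ level s i h := by
  refine (mul_le_of_le_one_left (prod_level_nonneg hh _) (inv_norm_le_one h)).trans ?_
  rw [← Finset.mul_prod_erase _ _ hi]
  exact (mul_le_of_le_one_right (le_min zero_le_one (level_nonneg hh))
    (prod_level_le_one hh _)).trans (min_le_right _ _)

lemma levelWeight_succ_le (hh : h ∈ treeCone S) : levelWeight s (j + 1) h ≤ levelWeight s j h := by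
  refine mul_le_mul_of_nonneg_left ?_ (by positivity)
  rw [← Finset.prod_sdiff (Finset.Icc_subset_Icc_right (Nat.le_succ j) :
    Finset.Icc 2 j ⊆ Finset.Icc 2 (j + 1))]
  exact mul_le_of_le_one_left (prod_level_nonneg hh _) (prod_level_le_one hh _)

/-- A lower bound on the weight bounds the norm from above and all levels `2, …, j` away from zero.
So the set is closed and bounded in the ambient space, although `openCone` is not closed. -/
lemma isCompact_levelWeight (s : S) (j : ℕ) (q : Prop) {ε : ℝ} (hε : 0 < ε) :
    IsCompact (Set.ofPred fun h : openCone s j q => ε ≤ levelWeight s j h) := by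
  rw [Subtype.isCompact_iff]
  let K : Set (Set S → ℝ) := treeCone S ∩ ((Set.ofPred fun h => q → level s 2 h = 1) ∩
    Set.ofPred fun h => ε ≤ levelWeight s j h)
  have hK : IsCompact K := by
    refine Metric.isCompact_of_isClosed_isBounded ?_ ?_
    · exact (isClosed_treeCone S).inter ((isClosed_imp isOpen_const
        (isClosed_eq (continuous_level s 2) continuous_const)).inter
        (isClosed_le continuous_const (continuous_levelWeight s j)))
    · refine (Metric.isBounded_closedBall (x := 0) (r := ε⁻¹)).subset ?_
      rintro h ⟨h1, -, h2⟩
      have h2 : ε ≤ levelWeight s j h := h2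
      have h3 := h2.trans (levelWeight_le_inv h1)
      rw [mem_closedBall_zero_iff]
      have h4 := (le_inv_comm₀ hε (by positivity)).1 h3
      linarith
  convert! hK
  ext h
  constructor
  · rintro ⟨h, h1, rfl⟩
    exact ⟨h.2.1, h.2.2.1, h1⟩
  · rintro ⟨h1, h2, h3⟩
    refine ⟨⟨h, h1, h2, fun i hi => ?_⟩, h3, rfl⟩
    exact hε.trans_le (le_trans h3 (levelWeight_le_level h1 hi))

lemma locallyCompactSpace_openCone (s : S) (j : ℕ) (q : Prop) :
    LocallyCompactSpace (openCone s j q) := by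
  refine IsLocallyClosed.locallyCompactSpace ?_
  have : openCone s j q = (Set.ofPred fun h => ∀ i ∈ Finset.Icc 2 j, 0 < level s i h) ∩
      (treeCone S ∩ Set.ofPred fun h => q → level s 2 h = 1) := by
    ext h
    exact ⟨fun h1 => ⟨h1.2.2, h1.1, h1.2.1⟩, fun h1 => ⟨h1.2.1, h1.2.2, h1.1⟩⟩
  rw [this]
  refine IsOpen.isLocallyClosed ?_ |>.inter (IsClosed.isLocallyClosed ?_)
  · have : (Set.ofPred fun h : Set S → ℝ => ∀ i ∈ Finset.Icc 2 j, 0 < level s i h) =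
        ⋂ i ∈ Finset.Icc 2 j, Set.ofPred fun h => 0 < level s i h := by
      ext h
      simp
    rw [this]
    exact isOpen_biInter_finset fun i _ => isOpen_lt continuous_const (continuous_level s i)
  · exact (isClosed_treeCone S).inter (isClosed_imp isOpen_const
      (isClosed_eq (continuous_level s 2) continuous_const))

/-- The weight extended by zero to infinity. -/
def weightExt (s : S) (j : ℕ) (q : Prop) (p : OnePoint (openCone s j q)) : ℝ :=
  p.elim 0 fun h => levelWeight s j h

lemma continuousAt_weightExt (s : S) (j : ℕ) (q : Prop) :
    ContinuousAt (weightExt s j q) OnePoint.infty := by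
  rw [OnePoint.continuousAt_infty]
  intro t ht
  obtain ⟨ε, hε, h1⟩ := Metric.mem_nhds_iff.1 ht
  refine ⟨_, isClosed_le continuous_const
    ((continuous_levelWeight s j).comp continuous_subtype_val), isCompact_levelWeight s j q hε,
    fun h hh => h1 ?_⟩
  have hh : ¬ ε ≤ levelWeight s j h := hh
  change dist (levelWeight s j h) 0 < ε
  rw [Real.dist_0_eq_abs, abs_of_pos (levelWeight_pos h.2)]
  exact not_le.1 hh

/-- The set of twigs above the edge of level `j`. -/
def levelSet (s : S) (j : ℕ) (h : Set S → ℝ) : Set S :=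
  -- There is no edge of level one; the twig `s` itself is the subtree to be moved.
  Set.ofPred fun a => if j ≤ 1 then a = s else ∃ M, s ∈ M ∧ M.ncard = j ∧ h M ≠ 0 ∧ a ∈ M

lemma levelSet_one : levelSet s 1 h = {s} := by
  ext a
  simp [levelSet]

lemma levelSet_eq (hh : h ∈ treeCone S) (hj : 2 ≤ j) {M : Set S} (hM : h M ≠ 0) (hs : s ∈ M)
    (hc : M.ncard = j) : levelSet s j h = M := by
  have hj' : ¬ j ≤ 1 := by omega
  ext a
  simp only [levelSet, hj', if_false, Set.mem_ofPred_eq]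
  constructor
  · rintro ⟨M', h1, h2, h3, h4⟩
    rwa [eq_of_level hh hM h3 hs h1 (hc.trans h2.symm)]
  · exact fun ha => ⟨M, hs, hc, hM, ha⟩

lemma levelSet_cases (hh : h ∈ openCone s j q) (hj : 1 ≤ j) : s ∈ levelSet s j h ∧
    (levelSet s j h).ncard = j ∧ (j = 1 ∨ h (levelSet s j h) ≠ 0) := by
  by_cases h1 : j = 1
  · subst h1
    rw [levelSet_one]
    simp
  · obtain ⟨M, h2, h3, h4⟩ := exists_of_level_pos (hh.2.2 j (by simp; omega)).ne'
    rw [levelSet_eq hh.1 (by omega) h4 h2 h3]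
    exact ⟨h2, h3, .inr h4⟩

lemma levelSet_compat (hh : h ∈ openCone s j q) (hj : 1 ≤ j) (M : Set S) (hM : h M ≠ 0) :
    levelSet s j h ⊆ M ∨ M ⊆ levelSet s j h ∨ Disjoint (levelSet s j h) M := by
  by_cases h1 : j = 1
  · subst h1
    rw [levelSet_one]
    by_cases hs : s ∈ M
    · exact .inl (Set.singleton_subset_iff.2 hs)
    · exact .inr (.inr (Set.disjoint_singleton_left.2 hs))
  · obtain ⟨-, -, h2⟩ := levelSet_cases hh hj
    exact hh.1.2.2 _ _ (h2.resolve_left h1) hM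

/-- The edge of level `j` keeps a nonzero length nearby, and a level has room for only one edge. So
the sliding subtree is locally constant and the contraction is continuous. -/
lemma eventually_levelSet_eq (h₀ : openCone s j q) (hj : 1 ≤ j) :
    ∀ᶠ h : openCone s j q in nhds h₀, levelSet s j h = levelSet s j (h₀ : Set S → ℝ) := by
  by_cases h1 : j = 1
  · subst h1
    exact .of_forall fun h => by rw [levelSet_one, levelSet_one]
  · obtain ⟨h2, h3, h4⟩ := levelSet_cases h₀.2 hj
    have hc : Continuous fun h : openCone s j q =>
        (h : Set S → ℝ) (levelSet s j (h₀ : Set S → ℝ)) :=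
      (continuous_apply _).comp continuous_subtype_val
    filter_upwards [hc.continuousAt.eventually_ne (h4.resolve_left h1)] with h h5
    exact levelSet_eq h.2.1 (by omega) h5 h2 h3

/-- The homotopy that contracts trees without edge of level `j + 1` to infinity. -/
def contraction (s : S) (j : ℕ) (τ t : ℝ) (h : Set S → ℝ) : Set S → ℝ :=
  slide (levelSet s j h) t (shorten s (j + 1) τ h)

/-- Sliding starts only after level `j + 1` has been shortened to zero. Then every edge strictly
containing the `j` twigs of `B` contains at least two more, as sliding requires; `hjS` provides two
twigs for the new edge at the root. -/
lemma contraction_mem_treeCone (hj : 1 ≤ j) (hjS : j + 2 ≤ Nat.card S) (hh : h ∈ openCone s j q)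
    {τ t : ℝ} (hτ : 0 ≤ τ) (ht : 0 ≤ t) (hτt : t = 0 ∨ level s (j + 1) h ≤ τ) :
    contraction s j τ t h ∈ treeCone S := by
  obtain ⟨h1, h2, h3⟩ := levelSet_cases hh hj
  refine slide_mem_treeCone (shorten_mem hh.1 hτ) ⟨s, h1⟩ ?_
    (fun M hM => levelSet_compat hh hj M (shorten_ne_zero hh.1 hτ hM)) ht ?_
  · rw [← Set.one_lt_ncard_iff_nontrivial]
    have := Set.ncard_add_ncard_compl (levelSet s j h)
    omega
  · refine hτt.imp_right fun h4 N h5 h6 => ?_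
    rw [← Set.one_lt_ncard_iff_nontrivial, Set.ncard_sdiff h5.1, h2]
    have h7 := Set.ncard_lt_ncard h5
    have h8 : N.ncard ≠ j + 1 := fun h8 => h6 (shorten_of_le hh.1 h4 (h5.1 h1) h8)
    omega

lemma level_contraction (hj : 1 ≤ j) (hh : h ∈ openCone s j q) {i : ℕ} (hi : i ≤ j) (τ t : ℝ) :
    level s i (contraction s j τ t h) = level s i h := by
  obtain ⟨h1, h2, -⟩ := levelSet_cases hh hj
  rw [contraction, level_slide h1 (by omega), level_shorten (by omega)]

lemma level_contraction_succ (hj : 1 ≤ j) (hh : h ∈ openCone s j q)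
    (h0 : level s (j + 1) h = 0) {τ t : ℝ} (hτ : 0 ≤ τ) :
    level s (j + 1) (contraction s j τ t h) = 0 := by
  classical
  refine level_slide_eq_zero (shorten_mem hh.1 hτ) (levelSet_cases hh hj).1 ?_ t
  refine Finset.sum_eq_zero fun M hM => ?_
  obtain ⟨h1, h2⟩ := (Finset.mem_filter.1 hM).2
  exact shorten_of_le hh.1 (h0.le.trans hτ) h1 h2

lemma contraction_mem (hj : 1 ≤ j) (hq : q → 2 ≤ j) (hjS : j + 2 ≤ Nat.card S)
    (hh : h ∈ openCone s j q) {τ t : ℝ} (hτ : 0 ≤ τ) (ht : 0 ≤ t)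
    (hτt : t = 0 ∨ level s (j + 1) h ≤ τ) : contraction s j τ t h ∈ openCone s j q := by
  refine ⟨contraction_mem_treeCone hj hjS hh hτ ht hτt, fun h1 => ?_, fun i hi => ?_⟩
  · rw [level_contraction hj hh (hq h1)]
    exact hh.2.1 h1
  · rw [level_contraction hj hh (Finset.mem_Icc.1 hi).2]
    exact hh.2.2 i hi

lemma norm_le_contraction (hj : 1 ≤ j) (hh : h ∈ openCone s j q) {τ : ℝ} (hτ : 0 ≤ τ) (t : ℝ) :
    ‖h‖ ≤ 2 * ‖contraction s j τ t h‖ + τ :=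
  (norm_le_shorten hh.1 hτ).trans
    (add_le_add_left (norm_le_slide (shorten_mem hh.1 hτ) ⟨s, (levelSet_cases hh hj).1⟩) τ)

lemma le_norm_contraction (hj : 1 ≤ j) (hjS : j + 2 ≤ Nat.card S) (hh : h ∈ openCone s j q) {τ : ℝ}
    (hτ : 0 ≤ τ) (t : ℝ) : t ≤ (4 * Fintype.card (Set S) : ℝ) * ‖contraction s j τ t h‖ := by
  obtain ⟨h1, h2, -⟩ := levelSet_cases hh hj
  refine le_mul_norm_slide (shorten_mem hh.1 hτ) ⟨s, h1⟩ fun h3 => ?_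
  rw [h3, Set.ncard_univ] at h2
  omega

lemma contraction_zero (hh : h ∈ openCone s j q) : contraction s j 0 0 h = h := by
  rw [contraction, shorten_zero hh.1, slide_zero hh.1.1]

/-- The levels up to `j` do not change, and `1 + ‖h‖` shrinks at most by a factor two. This gives
continuity of the contraction at infinity, uniformly in the sliding distance. -/
lemma levelWeight_contraction_le (hj : 1 ≤ j) (hh : h ∈ openCone s j q) {τ : ℝ} (hτ : 0 ≤ τ)
    (hτ1 : τ ≤ 1) (t : ℝ) : levelWeight s j (contraction s j τ t h) ≤ 2 * levelWeight s j h := by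
  have h1 : ∏ i ∈ Finset.Icc 2 j, min 1 (level s i (contraction s j τ t h)) =
      ∏ i ∈ Finset.Icc 2 j, min 1 (level s i h) := Finset.prod_congr rfl fun i hi => by
    rw [level_contraction hj hh (Finset.mem_Icc.1 hi).2]
  rw [levelWeight, levelWeight, h1, ← mul_assoc]
  refine mul_le_mul_of_nonneg_right ?_ (prod_level_nonneg hh.1 _)
  have h2 := norm_le_contraction hj hh hτ t
  have h3 : 0 < 1 + ‖contraction s j τ t h‖ := by positivity
  have h4 : 0 < 1 + ‖h‖ := by positivity
  rw [← div_eq_mul_inv, inv_eq_one_div, div_le_div_iff₀ h3 h4]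
  linarith

lemma continuousAt_contraction (hj : 1 ≤ j) (h₀ : openCone s j q) (τ₀ t₀ : ℝ) :
    ContinuousAt (fun p : openCone s j q × (ℝ × ℝ) => contraction s j p.2.1 p.2.2 p.1)
      (h₀, (τ₀, t₀)) := by
  have h1 : ∀ᶠ p : openCone s j q × (ℝ × ℝ) in nhds (h₀, (τ₀, t₀)),
      contraction s j p.2.1 p.2.2 p.1 =
        slide (levelSet s j (h₀ : Set S → ℝ)) p.2.2 (shorten s (j + 1) p.2.1 p.1) := by
    have h2 := (continuous_fst (X := openCone s j q) (Y := ℝ × ℝ)).continuousAt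
      (x := (h₀, (τ₀, t₀))) |>.eventually (eventually_levelSet_eq h₀ hj)
    filter_upwards [h2] with p hp
    rw [contraction, hp]
  refine ContinuousAt.congr ?_ (h1.mono fun _ => Eq.symm)
  refine Continuous.continuousAt ?_
  exact (continuous_slide _).comp (.prodMk (by fun_prop)
    ((continuous_shorten s (j + 1)).comp (.prodMk (by fun_prop) (by fun_prop))))

end Levels

/-! ### Homotopy equivalences given by collapsing contractible subspaces -/

section Collapse

open unitInterval

/-- The map `q` collapses exactly `A`. The end of `Ψ` is constant on `A`, hence factors through `q`
and provides the inverse; `Ψ` itself and the homotopy it induces on `X'` are the two homotopies.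
Compactness makes `q` and its product with the interval closed, hence quotient maps. -/
theorem homotopyEquiv_of_collapse {X X' : Type*} [TopologicalSpace X] [TopologicalSpace X']
    [CompactSpace X] [T2Space X'] (q : C(X, X')) (hsurj : Function.Surjective q) (A : Set X)
    (hq : ∀ x y, q x = q y → x = y ∨ x ∈ A ∧ y ∈ A) (hA : ∀ x ∈ A, ∀ y ∈ A, q x = q y)
    (Ψ : C(X × I, X)) (h0 : ∀ x, Ψ (x, 0) = x) (hΨ : ∀ x ∈ A, ∀ t, Ψ (x, t) ∈ A)
    (h1 : ∀ x ∈ A, ∀ y ∈ A, Ψ (x, 1) = Ψ (y, 1)) :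
    Nonempty (ContinuousMap.HomotopyEquiv X X') := by
  have hquot := q.continuous.isClosedMap.isQuotientMap q.continuous hsurj
  let q' : I × X → I × X' := Prod.map id q
  have hq'c : Continuous q' := continuous_id.prodMap q.continuous
  have hquot' := hq'c.isClosedMap.isQuotientMap hq'c (Function.surjective_id.prodMap hsurj)
  let g : X' → X := fun x' => Ψ (Function.surjInv hsurj x', 1)
  have hg : ∀ x, g (q x) = Ψ (x, 1) := by
    intro x
    rcases hq _ _ (Function.surjInv_eq hsurj (q x)) with h | ⟨h, h'⟩
    · change Ψ (_, 1) = _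
      rw [h]
    · exact h1 _ h _ h'
  have hgc : Continuous g := by
    rw [hquot.continuous_iff]
    exact (Ψ.continuous.comp (Continuous.prodMk_left 1)).congr fun x => (hg x).symm
  let k : I × X' → X' := fun p => q (Ψ (Function.surjInv hsurj p.2, p.1))
  have hk : ∀ t x, k (t, q x) = q (Ψ (x, t)) := by
    intro t x
    rcases hq _ _ (Function.surjInv_eq hsurj (q x)) with h | ⟨h, h'⟩
    · change q (Ψ (_, t)) = _
      rw [h]
    · exact hA _ (hΨ _ h t) _ (hΨ _ h' t)
  have hkc : Continuous k := by
    rw [hquot'.continuous_iff]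
    exact (q.continuous.comp (Ψ.continuous.comp continuous_swap)).congr fun p => (hk p.1 p.2).symm
  refine ⟨⟨q, ⟨g, hgc⟩, ⟨ContinuousMap.Homotopy.symm ⟨Ψ.comp ⟨_, continuous_swap⟩, h0, fun x => ?_⟩⟩,
    ⟨ContinuousMap.Homotopy.symm ⟨⟨k, hkc⟩, fun x => ?_, fun x => ?_⟩⟩⟩⟩
  · exact (hg x).symm
  · obtain ⟨x, rfl⟩ := hsurj x
    exact (hk 0 x).trans (congrArg q (h0 x))
  · obtain ⟨x, rfl⟩ := hsurj x
    exact (hk 1 x).trans (congrArg q (hg x).symm)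

lemma continuousAt_elim_prod {C T Y : Type*} [TopologicalSpace C] [TopologicalSpace T]
    [TopologicalSpace Y] {g : C × T → Y} (y : T → Y) {p : C × T} (hg : ContinuousAt g p) :
    ContinuousAt (fun x : OnePoint C × T => x.1.elim (y x.2) fun h => g (h, x.2))
      ((p.1 : OnePoint C), p.2) := by
  have he := (OnePoint.isOpenEmbedding_coe (X := C)).prodMap (Topology.IsOpenEmbedding.id (X := T))
  have h2 := he.continuousAt_iff
    (g := fun x : OnePoint C × T => x.1.elim (y x.2) fun h => g (h, x.2)) (x := p)
  exact h2.1 hg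

end Collapse

/-! ### Collapsing the trees without edge of one more level -/

section Steps

open unitInterval

variable {S : Type u} [Fintype S] {s : S} {j : ℕ} {q : Prop}

lemma mem_openCone_succ (hj : 1 ≤ j) {h : Set S → ℝ} :
    h ∈ openCone s (j + 1) q ↔ h ∈ openCone s j q ∧ 0 < level s (j + 1) h := by
  constructor
  · intro hh
    exact ⟨⟨hh.1, hh.2.1, fun i hi => hh.2.2 i (Finset.Icc_subset_Icc_right (Nat.le_succ j) hi)⟩,
      hh.2.2 _ (by simp; omega)⟩
  · rintro ⟨hh, h1⟩
    refine ⟨hh.1, hh.2.1, fun i hi => ?_⟩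
    by_cases h2 : i = j + 1
    · rwa [h2]
    · exact hh.2.2 i (by simp at hi ⊢; omega)

open Classical in
/-- The collapse of trees without edge of level `j + 1`. -/
def forgetLevel (hj : 1 ≤ j) (p : OnePoint (openCone s j q)) : OnePoint (openCone s (j + 1) q) :=
  p.elim OnePoint.infty fun h => if h1 : 0 < level s (j + 1) (h : Set S → ℝ) then
    ((⟨h, (mem_openCone_succ hj).2 ⟨h.2, h1⟩⟩ : openCone s (j + 1) q) : OnePoint _)
  else OnePoint.infty

/-- Near a tree without edge of level `j + 1` the new weight is bounded by the length of that edge,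
near infinity by the old weight. -/
lemma continuous_forgetLevel (hj : 1 ≤ j) : Continuous (forgetLevel (s := s) (q := q) hj) := by
  have hc : Continuous fun h : openCone s j q => level s (j + 1) (h : Set S → ℝ) :=
    (continuous_level s (j + 1)).comp continuous_subtype_val
  refine continuous_onePoint _ ((↑) '' Set.ofPred fun h : openCone s j q =>
      0 < level s (j + 1) (h : Set S → ℝ)) ?_
    (fun p => p.elim 0 Subtype.val) ?_ ?_ ?_ (fun y => levelWeight s (j + 1) y)
    ((continuous_levelWeight s _).comp continuous_subtype_val) (fun y => levelWeight_pos y.2) ?_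
  · exact OnePoint.isOpenEmbedding_coe.isOpenMap _ (isOpen_lt continuous_const hc)
  · rintro _ ⟨h, -, rfl⟩
    refine ContinuousAt.continuousWithinAt ?_
    rw [OnePoint.continuousAt_coe]
    exact continuous_subtype_val.continuousAt
  · rintro _ ⟨h, h1, rfl⟩
    exact ⟨(mem_openCone_succ hj).2 ⟨h.2, h1⟩, dif_pos h1⟩
  · intro p hp
    induction p using OnePoint.rec with
    | infty => rfl
    | coe h => exact dif_neg fun h1 => hp ⟨h, h1, rfl⟩
  · intro p hp
    induction p using OnePoint.rec with
    | infty =>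
      refine ⟨weightExt s j q, continuousAt_weightExt s j q, le_rfl, ?_⟩
      rintro _ ⟨h, -, rfl⟩ h1
      exact levelWeight_succ_le h.2.1
    | coe h =>
      refine ⟨fun p => p.elim 0 fun h => level s (j + 1) (h : Set S → ℝ), ?_, ?_, ?_⟩
      · rw [OnePoint.continuousAt_coe]
        exact hc.continuousAt
      · exact not_lt.1 fun h1 => hp ⟨h, h1, rfl⟩
      · rintro _ ⟨h, h1, rfl⟩ h2
        exact levelWeight_le_level h.2.1 (by simp; omega)

/-- The parameter of the contraction. -/
def contractionTime (s : S) (j : ℕ) (τ : ℝ) (h : Set S → ℝ) : ℝ := max 0 (τ - level s (j + 1) h)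

lemma contractionTime_nonneg (τ : ℝ) (h : Set S → ℝ) : 0 ≤ contractionTime s j τ h :=
  le_max_left _ _

lemma contractionTime_spec (τ : ℝ) (h : Set S → ℝ) (hr : contractionTime s j τ h < 1) :
    0 ≤ contractionTime s j τ h / (1 - contractionTime s j τ h) ∧
    (contractionTime s j τ h / (1 - contractionTime s j τ h) = 0 ∨ level s (j + 1) h ≤ τ) := by
  refine ⟨div_nonneg (contractionTime_nonneg τ h) (by linarith), ?_⟩
  by_cases h1 : level s (j + 1) h ≤ τ
  · exact .inr h1
  · left
    rw [contractionTime, max_eq_left (by linarith), zero_div]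

open Classical in
/-- The contraction of trees without edge of level `j + 1` to infinity. -/
def contractLevel (hj : 1 ≤ j) (hq : q → 2 ≤ j) (hjS : j + 2 ≤ Nat.card S)
    (p : OnePoint (openCone s j q) × I) : OnePoint (openCone s j q) :=
  -- Until time equals the length of level `j + 1` that edge is shortened. The time left over, `r`,
  -- gives the sliding distance `r / (1 - r)`, which becomes infinite at `r = 1`.
  p.1.elim OnePoint.infty fun h => if hr : contractionTime s j p.2 h < 1 then
    ((⟨_, contraction_mem hj hq hjS h.2 p.2.2.1 (contractionTime_spec _ _ hr).1
      (contractionTime_spec _ _ hr).2⟩ : openCone s j q) : OnePoint _)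
  else OnePoint.infty

lemma continuous_contractionTime (s : S) (j : ℕ) :
    Continuous fun p : openCone s j q × I => contractionTime s j p.2 (p.1 : Set S → ℝ) :=
  continuous_const.max ((continuous_subtype_val.comp continuous_snd).sub
    ((continuous_level s (j + 1)).comp (continuous_subtype_val.comp continuous_fst)))

/-- Infinity is approached in two ways. If the tree itself goes to infinity, the weight at most
doubles. If `r` tends to one, the sliding distance forces the norm to grow, and the weight is at
most a multiple of `1 - r`. -/
lemma continuous_contractLevel (hj : 1 ≤ j) (hq : q → 2 ≤ j) (hjS : j + 2 ≤ Nat.card S) :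
    Continuous (contractLevel (s := s) hj hq hjS) := by
  have hc := continuous_contractionTime (q := q) s j
  let r : openCone s j q × I → ℝ := fun p => contractionTime s j p.2 (p.1 : Set S → ℝ)
  have hr1 : ∀ p, r p < 1 → 0 < 1 - r p := fun p h => sub_pos.2 h
  let e : openCone s j q × I → OnePoint (openCone s j q) × I := Prod.map (↑) id
  have he : Topology.IsOpenEmbedding e :=
    OnePoint.isOpenEmbedding_coe.prodMap Topology.IsOpenEmbedding.id
  have hcard : (1 : ℝ) ≤ Fintype.card (Set S) := by exact_mod_cast Fintype.card_pos
  refine continuous_onePoint _ (e '' Set.ofPred fun p => r p < 1) ?_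
    (fun p => p.1.elim 0 fun h => contraction s j p.2 (r (h, p.2) / (1 - r (h, p.2))) h) ?_ ?_ ?_
    (fun y => levelWeight s j y)
    ((continuous_levelWeight s _).comp continuous_subtype_val) (fun y => levelWeight_pos y.2) ?_
  · exact he.isOpenMap _ (isOpen_lt hc continuous_const)
  · rintro _ ⟨p, h1, rfl⟩
    refine ContinuousAt.continuousWithinAt ?_
    refine continuousAt_elim_prod (g := fun p : openCone s j q × I =>
      contraction s j p.2 (r p / (1 - r p)) p.1) (fun _ => 0) ?_
    have h2 : ContinuousAt (fun p : openCone s j q × I => r p / (1 - r p)) p :=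
      hc.continuousAt.div (continuousAt_const.sub hc.continuousAt) (hr1 p h1).ne'
    exact (continuousAt_contraction hj p.1 p.2 (r p / (1 - r p))).comp
      (f := fun p : openCone s j q × I => (p.1, ((p.2 : ℝ), r p / (1 - r p)))) (x := p)
      (continuousAt_fst.prodMk ((continuous_subtype_val.comp continuous_snd).continuousAt.prodMk h2))
  · rintro _ ⟨p, h1, rfl⟩
    exact ⟨contraction_mem hj hq hjS p.1.2 p.2.2.1 (contractionTime_spec _ _ h1).1
      (contractionTime_spec _ _ h1).2, dif_pos h1⟩
  · rintro ⟨p, t⟩ hp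
    induction p using OnePoint.rec with
    | infty => rfl
    | coe h => exact dif_neg fun h1 => hp ⟨(h, t), h1, rfl⟩
  · rintro ⟨p, t⟩ hp
    induction p using OnePoint.rec with
    | infty =>
      refine ⟨fun p => 2 * weightExt s j q p.1, ?_, ?_, ?_⟩
      · exact continuousAt_const.mul ((continuousAt_weightExt s j q).comp
          (f := Prod.fst) (x := (OnePoint.infty, t)) continuousAt_fst)
      · exact (mul_zero _).le
      · rintro _ ⟨p, -, rfl⟩ h1
        exact levelWeight_contraction_le hj p.1.2 p.2.2.1 p.2.2.2 _
    | coe h =>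
      refine ⟨fun p => p.1.elim 0 fun h => (4 * Fintype.card (Set S) : ℝ) * (1 - r (h, p.2)),
        ?_, ?_, ?_⟩
      · exact continuousAt_elim_prod (g := fun p : openCone s j q × I =>
          (4 * Fintype.card (Set S) : ℝ) * (1 - r p)) (p := (h, t)) (fun _ => 0)
          (continuousAt_const.mul (continuousAt_const.sub hc.continuousAt))
      · refine mul_nonpos_of_nonneg_of_nonpos (by positivity) ?_
        exact sub_nonpos.2 (not_lt.1 fun h1 => hp ⟨(h, t), h1, rfl⟩)
      · rintro _ ⟨p, h1, rfl⟩ h2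
        have h1 := hr1 p h1
        refine (levelWeight_le_inv h2.1).trans ?_
        have h3 := le_norm_contraction hj hjS p.1.2 p.2.2.1 (r p / (1 - r p))
        rw [div_le_iff₀ h1] at h3
        change (1 + ‖contraction s j p.2 (r p / (1 - r p)) p.1‖)⁻¹ ≤
          (4 * Fintype.card (Set S) : ℝ) * (1 - r p)
        rw [inv_le_iff_one_le_mul₀ (by positivity)]
        nlinarith

instance : CompactSpace (OnePoint (openCone s j q)) := inferInstance

/-- The collapsed subspace consists of infinity and the trees without edge of level `j + 1`. The
contraction preserves it, since a missing level stays missing, and moves it to infinity at time one.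
-/
theorem onePoint_step (s : S) (hj : 1 ≤ j) (hq : q → 2 ≤ j) (hjS : j + 2 ≤ Nat.card S) :
    Nonempty (ContinuousMap.HomotopyEquiv (OnePoint (openCone s j q))
      (OnePoint (openCone s (j + 1) q))) := by
  have := locallyCompactSpace_openCone s (j + 1) q
  have hpos : ∀ h : openCone s j q, 0 < level s (j + 1) (h : Set S → ℝ) →
      ∃ h1, forgetLevel hj (h : OnePoint (openCone s j q)) =
        ((⟨h, h1⟩ : openCone s (j + 1) q) : OnePoint _) := fun h h1 =>
    ⟨(mem_openCone_succ hj).2 ⟨h.2, h1⟩, dif_pos h1⟩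
  have hneg : ∀ h : openCone s j q, ¬ 0 < level s (j + 1) (h : Set S → ℝ) →
      forgetLevel hj (h : OnePoint (openCone s j q)) = OnePoint.infty := fun h h1 => dif_neg h1
  have hinf : forgetLevel hj (OnePoint.infty : OnePoint (openCone s j q)) = OnePoint.infty := rfl
  let A : Set (OnePoint (openCone s j q)) := Set.ofPred fun p =>
    forgetLevel hj p = OnePoint.infty
  have hAc : ∀ h : openCone s j q, (h : OnePoint (openCone s j q)) ∈ A →
      level s (j + 1) (h : Set S → ℝ) = 0 := by
    intro h hh
    by_contra h1
    obtain ⟨h2, h3⟩ := hpos h (lt_of_le_of_ne (level_nonneg h.2.1) (Ne.symm h1))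
    exact OnePoint.coe_ne_infty _ (h3.symm.trans hh)
  refine homotopyEquiv_of_collapse ⟨_, continuous_forgetLevel hj⟩ ?_ A ?_ ?_
    ⟨_, continuous_contractLevel hj hq hjS⟩ ?_ ?_ ?_
  · intro y
    induction y using OnePoint.rec with
    | infty => exact ⟨OnePoint.infty, rfl⟩
    | coe y =>
      have h1 := (mem_openCone_succ hj).1 y.2
      exact ⟨((⟨y, h1.1⟩ : openCone s j q) : OnePoint _), (hpos ⟨y, h1.1⟩ h1.2).2⟩
  · intro x y hxy
    have hxy : forgetLevel hj x = forgetLevel hj y := hxy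
    by_cases hx : forgetLevel hj x = OnePoint.infty
    · exact .inr ⟨hx, hxy.symm.trans hx⟩
    · left
      induction x using OnePoint.rec with
      | infty => exact absurd hinf hx
      | coe x =>
        induction y using OnePoint.rec with
        | infty => exact absurd (hxy.trans hinf) hx
        | coe y =>
          obtain ⟨h1, h2⟩ := hpos x (not_not.1 fun h => hx (hneg x h))
          obtain ⟨h3, h4⟩ := hpos y (not_not.1 fun h => hx (hxy.trans (hneg y h)))
          rw [h2, h4] at hxy
          have h5 := OnePoint.coe_injective hxy
          exact congrArg _ (Subtype.ext (Subtype.mk.inj h5))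
  · intro x hx y hy
    exact Eq.trans hx (Eq.symm hy)
  · intro x
    induction x using OnePoint.rec with
    | infty => rfl
    | coe h =>
      have h1 : contractionTime s j (0 : I) h = 0 :=
        max_eq_left (by simpa using level_nonneg h.2.1)
      have h2 : contractionTime s j (0 : I) h < 1 := by rw [h1]; exact one_pos
      refine (dif_pos h2).trans (congrArg _ (Subtype.ext ?_))
      simp only [h1, zero_div]
      exact contraction_zero h.2
  · intro x hx t
    induction x using OnePoint.rec with
    | infty => exact hinf
    | coe h =>
      by_cases h2 : contractionTime s j t h < 1
      · have h3 : contractLevel hj hq hjS ((h : OnePoint (openCone s j q)), t) =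
            ((⟨_, contraction_mem hj hq hjS h.2 t.2.1 (contractionTime_spec _ _ h2).1
              (contractionTime_spec _ _ h2).2⟩ : openCone s j q) : OnePoint _) := dif_pos h2
        refine Eq.trans (congrArg (forgetLevel hj) h3) (hneg _ ?_)
        exact not_lt.2 (level_contraction_succ hj h.2 (hAc h hx) t.2.1).le
      · have h3 : contractLevel hj hq hjS ((h : OnePoint (openCone s j q)), t) = OnePoint.infty :=
          dif_neg h2
        exact (congrArg (forgetLevel hj) h3).trans hinf
  · have key : ∀ x ∈ A, contractLevel hj hq hjS (x, 1) = OnePoint.infty := by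
      intro x hx
      induction x using OnePoint.rec with
      | infty => rfl
      | coe h =>
        refine dif_neg (not_lt.2 ?_)
        rw [contractionTime, hAc h hx]
        simp
    intro x hx y hy
    exact (key x hx).trans (key y hy).symm

end Steps

/-! ### Collapsing the trees in the link without edge of level two -/

section Link

open unitInterval

variable {S : Type u} [Fintype S] {s : S}

lemma compactSpace_treeLink (S : Type u) [Fintype S] : CompactSpace (treeLink S) := by
  refine isCompact_iff_compactSpace.1 (Metric.isCompact_of_isClosed_isBounded ?_ ?_)
  · exact (isClosed_treeCone S).inter (isClosed_eq continuous_norm continuous_const)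
  · refine (Metric.isBounded_closedBall (x := 0) (r := 1)).subset ?_
    rintro h ⟨-, h2⟩
    rw [mem_closedBall_zero_iff]
    exact h2.le

lemma smul_level_mem {h : Set S → ℝ} (hh : h ∈ treeCone S) (h1 : 0 < level s 2 h) :
    (level s 2 h)⁻¹ • h ∈ openCone s 2 True := by
  refine ⟨smul_mem_treeCone hh (inv_nonneg.2 h1.le), fun _ => ?_, fun i hi => ?_⟩
  · rw [level_smul, inv_mul_cancel₀ h1.ne']
  · have : i = 2 := by
      simp at hi
      omega
    rw [this, level_smul, inv_mul_cancel₀ h1.ne']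
    exact one_pos

open Classical in
/-- Trees are rescaled to make the length of the edge of level two equal to one. -/
def rescale (s : S) (h : treeLink S) : OnePoint (openCone s 2 True) :=
  if h1 : 0 < level s 2 (h : Set S → ℝ) then
    ((⟨_, smul_level_mem h.2.1 h1⟩ : openCone s 2 True) : OnePoint _)
  else OnePoint.infty

/-- A tree in the link has norm one, so rescaling makes the norm the inverse of the length of level
two; the weight is then bounded by that length. -/
lemma continuous_rescale (s : S) : Continuous (rescale s) := by
  have hc : Continuous fun h : treeLink S => level s 2 (h : Set S → ℝ) :=
    (continuous_level s 2).comp continuous_subtype_val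
  refine continuous_onePoint _ (Set.ofPred fun h : treeLink S => 0 < level s 2 (h : Set S → ℝ))
    (isOpen_lt continuous_const hc) (fun h => (level s 2 (h : Set S → ℝ))⁻¹ • (h : Set S → ℝ))
    ?_ (fun h h1 => ⟨smul_level_mem h.2.1 h1, dif_pos h1⟩) (fun h h1 => dif_neg h1)
    (fun y => levelWeight s 2 y) ((continuous_levelWeight s _).comp continuous_subtype_val)
    (fun y => levelWeight_pos y.2) ?_
  · exact (hc.continuousOn.inv₀ fun h h1 => ne_of_gt h1).smul continuous_subtype_val.continuousOn
  · intro h h1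
    refine ⟨fun h => level s 2 (h : Set S → ℝ), hc.continuousAt, not_lt.1 h1, ?_⟩
    intro h (h1 : 0 < level s 2 (h : Set S → ℝ)) h2
    refine (levelWeight_le_inv h2.1).trans ?_
    rw [norm_smul, h.2.2, mul_one, norm_inv, Real.norm_of_nonneg h1.le]
    rw [inv_le_comm₀ (by positivity) h1]
    linarith

/-- The contraction of trees without edge of level two, up to rescaling. -/
def linkContraction (s : S) (t : ℝ) (h : Set S → ℝ) : Set S → ℝ :=
  -- With `r` the time left after level two has vanished, the tree is shrunk by `1 - 2r` while the
  -- twig `s` slides by `2r`. If level two was absent, at time one only the single edge created by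
  -- the slide remains.
  slide {s} (2 * contractionTime s 1 (t / 2) h)
    ((1 - 2 * contractionTime s 1 (t / 2) h) • shorten s 2 (t / 2) h)

/-- The result can be normalized back to the link. If it were zero, the sliding distance would be
zero, so the tree would only have been shortened by at most `1 / 2`, which cannot annihilate norm
one. -/
lemma linkContraction_spec (hS : 3 ≤ Nat.card S) {h : Set S → ℝ} (hh : h ∈ treeLink S) {t : ℝ}
    (ht : 0 ≤ t) (ht1 : t ≤ 1) :
    linkContraction s t h ∈ treeCone S ∧ linkContraction s t h ≠ 0 := by
  have hr0 := contractionTime_nonneg (s := s) (j := 1) (t / 2) h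
  have hr1 : 2 * contractionTime s 1 (t / 2) h ≤ 1 := by
    have : contractionTime s 1 (t / 2) h ≤ 1 / 2 :=
      max_le (by norm_num) (by linarith [level_nonneg (s := s) (j := 2) hh.1])
    linarith
  have ht2 : 0 ≤ t / 2 := by linarith
  have h1 : (1 - 2 * contractionTime s 1 (t / 2) h) • shorten s 2 (t / 2) h ∈ treeCone S :=
    smul_mem_treeCone (shorten_mem hh.1 ht2) (by linarith)
  have hsc : ({s} : Set S).ncard = 1 := Set.ncard_singleton s
  have hgap : 2 * contractionTime s 1 (t / 2) h = 0 ∨ level s 2 h ≤ t / 2 := by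
    by_cases h2 : level s 2 h ≤ t / 2
    · exact .inr h2
    · left
      rw [contractionTime, max_eq_left (by linarith), mul_zero]
  refine ⟨slide_mem_treeCone h1 ⟨s, rfl⟩ ?_ (fun M _ => ?_) (by linarith)
    (hgap.imp_right fun h2 N h5 h6 => ?_), fun h0 => ?_⟩
  · rw [← Set.one_lt_ncard_iff_nontrivial]
    have := Set.ncard_add_ncard_compl ({s} : Set S)
    omega
  · by_cases hs : s ∈ M
    · exact .inl (Set.singleton_subset_iff.2 hs)
    · exact .inr (.inr (Set.disjoint_singleton_left.2 hs))
  · rw [← Set.one_lt_ncard_iff_nontrivial, Set.ncard_sdiff h5.1, hsc]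
    have h7 := Set.ncard_lt_ncard h5
    have h8 : N.ncard ≠ 2 := fun h8 => h6 (by
      rw [Pi.smul_apply, shorten_of_le hh.1 h2 (h5.1 rfl) h8, smul_zero])
    omega
  · have h2 := le_mul_norm_slide (B := {s}) (t := 2 * contractionTime s 1 (t / 2) h) h1 ⟨s, rfl⟩
      (fun h3 => by rw [h3, Set.ncard_univ] at hsc; omega)
    change _ ≤ _ * ‖linkContraction s t h‖ at h2
    rw [h0, norm_zero, mul_zero] at h2
    have h3 : contractionTime s 1 (t / 2) h = 0 := le_antisymm (by linarith) hr0
    rw [linkContraction, h3, mul_zero, sub_zero, one_smul,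
      slide_zero (shorten_mem hh.1 ht2).1] at h0
    have h4 := norm_le_shorten (s := s) (j := 2) hh.1 ht2
    rw [h0, norm_zero, hh.2] at h4
    linarith

lemma continuous_linkContraction (s : S) :
    Continuous fun p : treeLink S × I => linkContraction s p.2 p.1 := by
  have h1 : Continuous fun p : treeLink S × I => contractionTime s 1 ((p.2 : ℝ) / 2) p.1 :=
    continuous_const.max (Continuous.sub (by fun_prop)
      ((continuous_level s 2).comp (by fun_prop)))
  have h2 : Continuous fun p : treeLink S × I => shorten s 2 ((p.2 : ℝ) / 2) p.1 :=
    (continuous_shorten s 2).comp (.prodMk (by fun_prop) (by fun_prop))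
  exact (continuous_slide {s}).comp (.prodMk (continuous_const.mul h1)
    ((continuous_const.sub (continuous_const.mul h1)).smul h2))

/-- The link has no base point, so the trees without edge of level two are contracted to an actual
tree, whose only edge is the complement of `s`. On the remaining trees, setting the length of level
two to one replaces the normalization of the norm. -/
theorem treeLink_step (s : S) (hS : 3 ≤ Nat.card S) :
    Nonempty (ContinuousMap.HomotopyEquiv (treeLink S) (OnePoint (openCone s 2 True))) := by
  classical
  have := compactSpace_treeLink S
  have := locallyCompactSpace_openCone s 2 True
  have hmem : ∀ p : treeLink S × I, ‖linkContraction s p.2 p.1‖⁻¹ • linkContraction s p.2 p.1 ∈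
      treeLink S := by
    intro p
    obtain ⟨h1, h2⟩ := linkContraction_spec (s := s) hS p.1.2 p.2.2.1 p.2.2.2
    refine ⟨smul_mem_treeCone h1 (by positivity), ?_⟩
    rw [norm_smul, norm_inv, norm_norm, inv_mul_cancel₀ (norm_ne_zero_iff.2 h2)]
  have hpos : ∀ h : treeLink S, ∀ h1 : 0 < level s 2 (h : Set S → ℝ),
      rescale s h = ((⟨_, smul_level_mem h.2.1 h1⟩ : openCone s 2 True) : OnePoint _) :=
    fun h h1 => dif_pos h1
  have hneg : ∀ h : treeLink S, level s 2 (h : Set S → ℝ) = 0 → rescale s h = OnePoint.infty :=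
    fun h h1 => dif_neg (not_lt.2 h1.le)
  have hzero : ∀ h : treeLink S, ¬ 0 < level s 2 (h : Set S → ℝ) →
      level s 2 (h : Set S → ℝ) = 0 := fun h h1 => le_antisymm (not_lt.1 h1) (level_nonneg h.2.1)
  have hcont : Continuous fun p : treeLink S × I =>
      ‖linkContraction s p.2 p.1‖⁻¹ • linkContraction s p.2 p.1 :=
    ((continuous_linkContraction s).norm.inv₀ fun p => norm_ne_zero_iff.2
      (linkContraction_spec (s := s) hS p.1.2 p.2.2.1 p.2.2.2).2).smul
      (continuous_linkContraction s)
  refine homotopyEquiv_of_collapse ⟨_, continuous_rescale s⟩ ?_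
    (Set.ofPred fun h : treeLink S => level s 2 (h : Set S → ℝ) = 0) ?_ ?_
    ⟨fun p => ⟨_, hmem p⟩, hcont.subtype_mk _⟩ ?_ ?_ ?_
  · intro y
    induction y using OnePoint.rec with
    | infty =>
      have hsc : ({s} : Set S).ncard = 1 := Set.ncard_singleton s
      have hcard := Set.ncard_add_ncard_compl ({s} : Set S)
      -- A tree in the link without edge below `s`, so infinity is attained; three twigs are needed
      -- for the complement of `s` to be an edge.
      let h : Set S → ℝ := fun M => if M = {s}ᶜ then 1 else 0
      have h0 : ∀ M, h M ≠ 0 → M = {s}ᶜ := fun M hM => by_contra fun h1 => hM (if_neg h1)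
      have hh : h ∈ treeCone S := by
        refine ⟨fun M => ?_, fun M hM => ?_, fun M M' hM hM' => ?_⟩
        · change (0 : ℝ) ≤ if M = {s}ᶜ then 1 else 0
          split_ifs <;> norm_num
        · rw [h0 M hM]
          refine ⟨Set.one_lt_ncard_iff_nontrivial.1 (by omega), fun h1 => ?_⟩
          exact (h1 ▸ trivial : s ∈ ({s}ᶜ : Set S)) rfl
        · rw [h0 M hM, h0 M' hM']
          exact .inl subset_rfl
      have h1 : ‖h‖ = 1 := by
        refine le_antisymm ((norm_le_one_of_treeCone hh zero_le_one).2 fun M => ?_) ?_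
        · change (if M = {s}ᶜ then 1 else 0) ≤ (1 : ℝ)
          split_ifs <;> norm_num
        · have := apply_le_norm h {s}ᶜ
          rwa [show h {s}ᶜ = 1 from if_pos rfl] at this
      refine ⟨⟨h, hh, h1⟩, hneg _ (Finset.sum_eq_zero fun M hM => ?_)⟩
      refine if_neg ?_
      rintro rfl
      exact (Finset.mem_filter.1 hM).2.1 rfl
    | coe y =>
      have hl : level s 2 (y : Set S → ℝ) = 1 := y.2.2.1 trivial
      have hy : (y : Set S → ℝ) ≠ 0 := by
        intro h0
        rw [h0, ← zero_smul ℝ (0 : Set S → ℝ), level_smul, zero_mul] at hl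
        exact zero_ne_one hl
      have hy' : 0 < ‖(y : Set S → ℝ)‖ := norm_pos_iff.2 hy
      have h1 : ‖(y : Set S → ℝ)‖⁻¹ • (y : Set S → ℝ) ∈ treeLink S :=
        ⟨smul_mem_treeCone y.2.1 (by positivity), by
          rw [norm_smul, norm_inv, norm_norm, inv_mul_cancel₀ hy'.ne']⟩
      have h2 : level s 2 (‖(y : Set S → ℝ)‖⁻¹ • (y : Set S → ℝ)) = ‖(y : Set S → ℝ)‖⁻¹ := by
        rw [level_smul, hl, mul_one]
      refine ⟨⟨_, h1⟩, (hpos ⟨_, h1⟩ (by rw [h2]; positivity)).trans (congrArg _ (Subtype.ext ?_))⟩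
      simp only
      rw [h2, smul_smul, inv_inv, mul_inv_cancel₀ hy'.ne', one_smul]
  · intro x y hxy
    have hxy : rescale s x = rescale s y := hxy
    by_cases hx : 0 < level s 2 (x : Set S → ℝ)
    · by_cases hy : 0 < level s 2 (y : Set S → ℝ)
      · left
        rw [hpos x hx, hpos y hy] at hxy
        have h1 := Subtype.mk.inj (OnePoint.coe_injective hxy)
        have h2 := congrArg norm h1
        rw [norm_smul, norm_smul, x.2.2, y.2.2, mul_one, mul_one,
          Real.norm_of_nonneg (inv_nonneg.2 hx.le), Real.norm_of_nonneg (inv_nonneg.2 hy.le)] at h2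
        rw [h2] at h1
        exact Subtype.ext (smul_right_injective _ (inv_ne_zero hy.ne') h1)
      · rw [hpos x hx, hneg y (hzero y hy)] at hxy
        exact absurd hxy (OnePoint.coe_ne_infty _)
    · by_cases hy : 0 < level s 2 (y : Set S → ℝ)
      · rw [hpos y hy, hneg x (hzero x hx)] at hxy
        exact absurd hxy (OnePoint.infty_ne_coe _)
      · exact .inr ⟨hzero x hx, hzero y hy⟩
  · intro x hx y hy
    exact (hneg x hx).trans (hneg y hy).symm
  · intro x
    have h1 : contractionTime s 1 (((0 : I) : ℝ) / 2) (x : Set S → ℝ) = 0 :=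
      max_eq_left (by simpa using level_nonneg x.2.1)
    have h2 : linkContraction s ((0 : I) : ℝ) (x : Set S → ℝ) = x := by
      rw [linkContraction, h1, mul_zero, sub_zero, one_smul]
      simp only [Set.Icc.coe_zero, zero_div]
      rw [shorten_zero x.2.1, slide_zero x.2.1.1]
    refine Subtype.ext ?_
    change ‖linkContraction s ((0 : I) : ℝ) (x : Set S → ℝ)‖⁻¹ •
      linkContraction s ((0 : I) : ℝ) (x : Set S → ℝ) = x
    rw [h2, x.2.2, inv_one, one_smul]
  · intro x (hx : level s 2 (x : Set S → ℝ) = 0) t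
    change level s 2 (_ • linkContraction s t x) = 0
    have ht : 0 ≤ (t : ℝ) / 2 := by linarith [t.2.1]
    rw [level_smul, linkContraction]
    have hr : 2 * contractionTime s 1 ((t : ℝ) / 2) (x : Set S → ℝ) ≤ 1 := by
      have : contractionTime s 1 ((t : ℝ) / 2) (x : Set S → ℝ) ≤ 1 / 2 :=
        max_le (by norm_num) (by linarith [level_nonneg (s := s) (j := 2) x.2.1, t.2.2])
      linarith
    rw [level_slide_eq_zero (smul_mem_treeCone (shorten_mem x.2.1 ht) (by linarith))
      (Set.mem_singleton s), mul_zero]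
    rw [level_smul]
    refine mul_eq_zero_of_right _ (Finset.sum_eq_zero fun M hM => ?_)
    have hM := (Finset.mem_filter.1 hM).2
    exact shorten_of_le x.2.1 (hx.le.trans ht) hM.1 hM.2
  -- At time one the factor `1 - 2r` is zero, so the end of the contraction is the star tree slid by
  -- one, whatever `x` was.
  · have key : ∀ x : treeLink S, level s 2 (x : Set S → ℝ) = 0 →
        linkContraction s ((1 : I) : ℝ) (x : Set S → ℝ) = slide {s} 1 0 := by
      intro x hx
      have : contractionTime s 1 (((1 : I) : ℝ) / 2) (x : Set S → ℝ) = 1 / 2 := by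
        rw [contractionTime, hx]
        simp
      rw [linkContraction, this]
      norm_num
    intro x hx y hy
    refine Subtype.ext ?_
    change _ • linkContraction s ((1 : I) : ℝ) (x : Set S → ℝ) =
      _ • linkContraction s ((1 : I) : ℝ) (y : Set S → ℝ)
    rw [key x hx, key y hy]

end Link

/-! ### Words and chains of their initial sets -/

section Words

variable {S : Type u} {m : ℕ}

/-- The set of the letters of the word `w` in the positions `0, …, k`. -/
def initialSet (w : Fin (m + 2) ≃ S) (k : ℕ) : Set S := Set.ofPred fun a => (w.symm a).val ≤ k

lemma mem_initialSet {w : Fin (m + 2) ≃ S} {k : ℕ} {a : S} :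
    a ∈ initialSet w k ↔ (w.symm a).val ≤ k := Iff.rfl

lemma apply_mem_initialSet {w : Fin (m + 2) ≃ S} {k : ℕ} {i : Fin (m + 2)} :
    w i ∈ initialSet w k ↔ i.val ≤ k := by
  rw [mem_initialSet, w.symm_apply_apply]

lemma initialSet_mono (w : Fin (m + 2) ≃ S) {k l : ℕ} (h : k ≤ l) :
    initialSet w k ⊆ initialSet w l := fun _ ha => le_trans ha h

lemma ncard_initialSet (w : Fin (m + 2) ≃ S) {k : ℕ} (hk : k ≤ m + 1) :
    (initialSet w k).ncard = k + 1 := by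
  have h1 : initialSet w k = w '' (Finset.Iic (⟨k, by omega⟩ : Fin (m + 2)) : Finset _) := by
    ext a
    rw [w.image_eq_preimage_symm]
    simp [mem_initialSet, Fin.le_def]
  rw [h1, Set.ncard_image_of_injective _ w.injective, Set.ncard_coe_finset, Fin.card_Iic]

lemma initialSet_zero (w : Fin (m + 2) ≃ S) : initialSet w 0 = {w 0} := by
  ext a
  rw [mem_initialSet, Set.mem_singleton_iff, ← w.symm_apply_eq, Fin.ext_iff, Fin.val_zero]
  omega

lemma word_ext {w w' : Fin (m + 2) ≃ S}
    (h : ∀ k ≤ m + 1, initialSet w k = initialSet w' k) : w = w' := by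
  have key : ∀ a, w.symm a = w'.symm a := by
    intro a
    have h1 : ∀ k ≤ m + 1, (w.symm a).val ≤ k ↔ (w'.symm a).val ≤ k := fun k hk => by
      rw [← mem_initialSet, h k hk, mem_initialSet]
    refine Fin.ext (le_antisymm ?_ ?_)
    · exact (h1 _ (by omega)).2 le_rfl
    · exact (h1 _ (by omega)).1 le_rfl
  exact Equiv.symm_bijective.injective (Equiv.ext key)

lemma isProper_initialSet (w : Fin (m + 2) ≃ S) {k : ℕ} (h0 : 1 ≤ k) (hk : k ≤ m) :
    IsProper (initialSet w k) := by
  have : Finite S := .of_equiv _ w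
  refine ⟨Set.one_lt_ncard_iff_nontrivial.1 (by rw [ncard_initialSet w (by omega)]; omega),
    fun h => ?_⟩
  have h1 := ncard_initialSet w (show k ≤ m + 1 by omega)
  rw [h, Set.ncard_univ, ← Nat.card_congr w, Nat.card_fin] at h1
  omega

/-- A chain of sets that grow by one element at a time consists of the initial sets of a word. -/
lemma exists_word [Finite S] (hS : Nat.card S = m + 2) (L : ℕ → Set S)
    (hL : ∀ k ≤ m + 1, (L k).ncard = k + 1) (hmono : ∀ k ≤ m, L k ⊆ L (k + 1)) :
    ∃ w : Fin (m + 2) ≃ S, ∀ k ≤ m + 1, initialSet w k = L k := by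
  classical
  have := Fintype.ofFinite S
  have hle : ∀ k l, k ≤ l → l ≤ m + 1 → L k ⊆ L l := by
    intro k l hkl
    induction l, hkl using Nat.le_induction with
    | base => exact fun _ => subset_rfl
    | succ l _ ih => exact fun h => (ih (by omega)).trans (hmono l (by omega))
  have htop : ∀ a, a ∈ L (m + 1) := by
    intro a
    have h1 : L (m + 1) = Set.univ := Set.eq_of_subset_of_ncard_le (Set.subset_univ _)
      (by rw [hL _ le_rfl, Set.ncard_univ, hS])
    exact h1 ▸ trivial
  have hex : ∀ a, ∃ k, a ∈ L k := fun a => ⟨_, htop a⟩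
  have hfind : ∀ a, Nat.find (hex a) < m + 2 := fun a =>
    (Nat.find_min' (hex a) (htop a)).trans_lt (Nat.lt_succ_self _)
  let f : S → Fin (m + 2) := fun a => ⟨Nat.find (hex a), hfind a⟩
  have hf : ∀ a, ∀ k ≤ m + 1, (f a).val ≤ k ↔ a ∈ L k := fun a k hk =>
    ⟨fun h => hle _ _ h hk (Nat.find_spec (hex a)), fun h => Nat.find_min' _ h⟩
  have hinj : Function.Injective f := by
    intro a b hab
    have hk := (f a).2
    have ha : a ∈ L (f a).val := (hf a _ (by omega)).1 le_rfl
    have hb : b ∈ L (f a).val := (hf b _ (by omega)).1 (by rw [hab])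
    rcases Nat.eq_zero_or_eq_succ_pred (f a).val with h0 | h0
    · rw [h0] at ha hb
      obtain ⟨c, hc⟩ := Set.ncard_eq_one.1 (hL 0 (by omega))
      rw [hc] at ha hb
      exact ha.trans hb.symm
    · set k := (f a).val.pred
      have ha' : a ∉ L k := fun h => by have := (hf a k (by omega)).2 h; omega
      have hb' : b ∉ L k := fun h => by have := (hf b k (by omega)).2 h; rw [← hab] at this; omega
      have h1 : (L (k + 1) \ L k).ncard = 1 := by
        rw [Set.ncard_sdiff (hmono k (by omega)), hL _ (by omega), hL _ (by omega)]
        omega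
      obtain ⟨c, hc⟩ := Set.ncard_eq_one.1 h1
      rw [h0] at ha hb
      have ha'' : a ∈ L (k + 1) \ L k := ⟨ha, ha'⟩
      have hb'' : b ∈ L (k + 1) \ L k := ⟨hb, hb'⟩
      rw [hc] at ha'' hb''
      exact ha''.trans hb''.symm
  have hbij : Function.Bijective f := (Fintype.bijective_iff_injective_and_card f).2
    ⟨hinj, by rw [← Nat.card_eq_fintype_card, hS, Fintype.card_fin]⟩
  refine ⟨(Equiv.ofBijective f hbij).symm, fun k hk => ?_⟩
  ext a
  rw [← hf a k hk]
  rfl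

/-- The words that start with the letter `s`. -/
abbrev WordsFrom (s : S) (m : ℕ) := {w : Fin (m + 2) ≃ S // w 0 = s}

lemma exists_wordsFrom [Finite S] (hS : Nat.card S = m + 2) (s : S) : Nonempty (WordsFrom s m) := by
  let e : Fin (m + 2) ≃ S := (Finite.equivFinOfCardEq hS).symm
  exact ⟨⟨(Equiv.swap 0 (e.symm s)).trans e, by simp⟩⟩

lemma card_wordsFrom [Finite S] (hS : Nat.card S = m + 2) (s : S) :
    Nat.card (WordsFrom s m) = (m + 1).factorial := by
  obtain ⟨w₀, hw₀⟩ := exists_wordsFrom hS s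
  have e : WordsFrom s m ≃ {f : Equiv.Perm (Fin (m + 2)) // ∀ a, ¬ a ≠ 0 → f a = a} :=
    (Equiv.equivCongr (Equiv.refl _) w₀.symm).subtypeEquiv fun w => by
      simp [Equiv.equivCongr, Equiv.symm_apply_eq, hw₀]
  rw [Nat.card_congr e, ← Nat.card_congr (Equiv.Perm.subtypeEquivSubtypePerm fun a => a ≠ 0),
    Nat.card_perm]
  simp

end Words

/-! ### Combs as open cells -/

section Cells

open Classical in
/-- The coordinates of a cell. -/
abbrev CellIndex (m : ℕ) (q : Prop) := {i : Fin m // q → i.val ≠ 0}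

open Classical in
/-- The length of the `i`th edge of a comb. -/
def cellWeight {m : ℕ} {q : Prop} (y : CellIndex m q → ℝ) (i : Fin m) : ℝ :=
  -- The exponential turns positive lengths into Euclidean coordinates. The coordinate left out when
  -- `q` holds is level two, whose length is one.
  if h : q → i.val ≠ 0 then Real.exp (y ⟨i, h⟩) else 1

lemma cellWeight_pos {m : ℕ} {q : Prop} (y : CellIndex m q → ℝ) (i : Fin m) :
    0 < cellWeight y i := by
  unfold cellWeight
  split_ifs
  · exact Real.exp_pos _
  · exact one_pos

variable {S : Type u} {m : ℕ} {q : Prop}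

open Classical in
/-- The comb of the word `w` with given edge lengths. -/
def comb (w : Fin (m + 2) ≃ S) (y : CellIndex m q → ℝ) (M : Set S) : ℝ :=
  ∑ i : Fin m, if M = initialSet w (i + 1) then cellWeight y i else 0

lemma initialSet_inj (w : Fin (m + 2) ≃ S) {k l : ℕ} (hk : k ≤ m + 1) (hl : l ≤ m + 1)
    (h : initialSet w k = initialSet w l) : k = l := by
  have := congrArg Set.ncard h
  rw [ncard_initialSet w hk, ncard_initialSet w hl] at this
  omega

lemma comb_initialSet (w : Fin (m + 2) ≃ S) (y : CellIndex m q → ℝ) (i : Fin m) :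
    comb w y (initialSet w (i + 1)) = cellWeight y i := by
  classical
  rw [comb, Finset.sum_eq_single i, if_pos rfl]
  · intro j _ hj
    rw [if_neg]
    intro h
    have := initialSet_inj w (by omega) (by omega) h
    exact hj (Fin.ext (by omega))
  · simp

lemma exists_of_comb_ne_zero {w : Fin (m + 2) ≃ S} {y : CellIndex m q → ℝ} {M : Set S}
    (h : comb w y M ≠ 0) : ∃ i : Fin m, M = initialSet w (i + 1) := by
  obtain ⟨i, _, hi⟩ := Finset.exists_ne_zero_of_sum_ne_zero h
  exact ⟨i, by_contra fun h1 => hi (if_neg h1)⟩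

lemma continuous_comb (w : Fin (m + 2) ≃ S) :
    Continuous (comb w : (CellIndex m q → ℝ) → Set S → ℝ) := by
  refine continuous_pi fun M => continuous_finsetSum _ fun i _ => ?_
  split_ifs
  · unfold cellWeight
    split_ifs
    · fun_prop
    · exact continuous_const
  · exact continuous_const

lemma comb_mem_treeCone (w : Fin (m + 2) ≃ S) (y : CellIndex m q → ℝ) :
    comb w y ∈ treeCone S := by
  refine ⟨fun M => Finset.sum_nonneg fun i _ => ?_, fun M hM => ?_, fun M M' hM hM' => ?_⟩
  · split_ifs
    · exact (cellWeight_pos y i).le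
    · exact le_rfl
  · obtain ⟨i, rfl⟩ := exists_of_comb_ne_zero hM
    exact isProper_initialSet w (by omega) (by omega)
  · obtain ⟨i, rfl⟩ := exists_of_comb_ne_zero hM
    obtain ⟨j, rfl⟩ := exists_of_comb_ne_zero hM'
    rcases le_total i j with h | h
    · exact .inl (initialSet_mono w (by simpa using h))
    · exact .inr (.inl (initialSet_mono w (by simpa using h)))

variable [Fintype S] {s : S}

lemma level_comb {w : Fin (m + 2) ≃ S} (hw : w 0 = s) (y : CellIndex m q → ℝ) (i : Fin m) :
    level s (i + 2) (comb w y) = cellWeight y i := by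
  rw [level_eq (comb_mem_treeCone w y) (M := initialSet w (i + 1)), comb_initialSet]
  · rw [comb_initialSet]
    exact (cellWeight_pos y i).ne'
  · rw [← hw, apply_mem_initialSet]
    simp
  · rw [ncard_initialSet w (by omega)]

lemma comb_mem {w : Fin (m + 2) ≃ S} (hw : w 0 = s) (hm : q → 1 ≤ m) (y : CellIndex m q → ℝ) :
    comb w y ∈ openCone s (m + 1) q := by
  refine ⟨comb_mem_treeCone w y, fun hq => ?_, fun i hi => ?_⟩
  · rw [show 2 = (⟨0, hm hq⟩ : Fin m).val + 2 from rfl, level_comb hw]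
    exact dif_neg fun h => h hq rfl
  · obtain ⟨h1, h2⟩ := Finset.mem_Icc.1 hi
    obtain ⟨j, rfl⟩ := Nat.exists_eq_add_of_le' h1
    rw [show j = (⟨j, by omega⟩ : Fin m).val from rfl, level_comb hw]
    exact cellWeight_pos _ _

/-- If all levels are present, the sets of levels `1, 2, …` grow by one twig at a time, and the
order in which the twigs appear is the word. -/
lemma exists_word_of_mem (hS : Nat.card S = m + 2) {h : Set S → ℝ}
    (hh : h ∈ openCone s (m + 1) q) : ∃ w : WordsFrom s m,
      ∀ k ≤ m, initialSet w.1 k = levelSet s (k + 1) h := by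
  have hcase : ∀ k ≤ m, s ∈ levelSet s (k + 1) h ∧ (levelSet s (k + 1) h).ncard = k + 1 ∧
      (k = 0 ∨ h (levelSet s (k + 1) h) ≠ 0) := fun k hk => by
    have := levelSet_cases (j := k + 1) (s := s) (h := h) (q := False)
      ⟨hh.1, fun h => h.elim, fun i hi => hh.2.2 i (Finset.Icc_subset_Icc_right (by omega) hi)⟩
      (by omega)
    simpa using this
  obtain ⟨w, hw⟩ := exists_word hS
    (fun k => if k ≤ m then levelSet s (k + 1) h else Set.univ) (fun k hk => by
      split_ifs with h1
      · exact (hcase k h1).2.1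
      · rw [Set.ncard_univ, hS]; omega) (fun k hk => by
      rw [if_pos hk]
      split_ifs with h1
      · obtain ⟨h2, h3, h4⟩ := hcase k hk
        obtain ⟨h5, h6, h7⟩ := hcase (k + 1) h1
        have h7 := h7.resolve_left (by omega)
        rcases h4 with rfl | h4
        · rw [levelSet_one]
          exact Set.singleton_subset_iff.2 h5
        rcases hh.1.2.2 _ _ h4 h7 with h8 | h8 | h8
        · exact h8
        · have := Set.ncard_le_ncard h8
          omega
        · exact absurd h5 (Set.disjoint_left.1 h8 h2)
      · exact Set.subset_univ _)
  have hw' : ∀ k ≤ m, initialSet w k = levelSet s (k + 1) h := fun k hk => by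
    rw [hw k (by omega), if_pos hk]
  refine ⟨⟨w, ?_⟩, hw'⟩
  have := hw' 0 (Nat.zero_le _)
  rw [initialSet_zero, levelSet_one] at this
  exact Set.singleton_injective this

/-- A comb is already a full binary tree, so no further edge fits: an edge through `s` is determined
by its size, and one avoiding `s` would cross an initial set. -/
lemma eq_comb (hh : h ∈ openCone s (m + 1) q) {w : Fin (m + 2) ≃ S} (hw0 : w 0 = s)
    (hw : ∀ k ≤ m, initialSet w k = levelSet s (k + 1) h) :
    h = comb w (fun i : CellIndex m q => Real.log (level s (i.1 + 2) h)) := by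
  set y := fun i : CellIndex m q => Real.log (level s (i.1 + 2) h)
  have hpos : ∀ i : Fin m, 0 < level s (i + 2) h := fun i =>
    hh.2.2 _ (Finset.mem_Icc.2 ⟨by omega, by omega⟩)
  have hval : ∀ i : Fin m, h (initialSet w (i + 1)) ≠ 0 ∧
      h (initialSet w (i + 1)) = level s (i + 2) h := fun i => by
    obtain ⟨M, h1, h2, h3⟩ := exists_of_level_pos (hpos i).ne'
    have : initialSet w (i + 1) = M := by
      rw [hw _ (by omega)]
      exact levelSet_eq hh.1 (by omega) h3 h1 h2
    rw [this]
    exact ⟨h3, (level_eq hh.1 h3 h1 h2).symm⟩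
  have hweight : ∀ i : Fin m, cellWeight y i = level s (i + 2) h := fun i => by
    unfold cellWeight
    split_ifs with h1
    · exact Real.exp_log (hpos i)
    · push Not at h1
      have h2 := hh.2.1 h1.1
      rw [h1.2, h2]
  funext M
  by_cases hM : ∃ i : Fin m, M = initialSet w (i + 1)
  · obtain ⟨i, rfl⟩ := hM
    rw [comb_initialSet, hweight, (hval i).2]
  · have h1 : comb w y M = 0 := by_contra fun h => hM (exists_of_comb_ne_zero h)
    rw [h1]
    by_contra h0
    have hprop := hh.1.2.1 M h0
    have hcard : Nat.card S = m + 2 := by rw [← Nat.card_congr w, Nat.card_fin]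
    have hlt := Set.ncard_lt_ncard (Set.ssubset_univ_iff.2 hprop.2)
    rw [Set.ncard_univ, hcard] at hlt
    have hgt := Set.one_lt_ncard_iff_nontrivial.2 hprop.1
    by_cases hs : s ∈ M
    · refine hM ⟨⟨M.ncard - 2, by omega⟩, ?_⟩
      refine eq_of_level hh.1 h0 (hval _).1 hs (by rw [← hw0, apply_mem_initialSet]; simp) ?_
      rw [ncard_initialSet w (by simp only; omega)]
      simp only
      omega
    · obtain ⟨a, ha, b, hb, hab⟩ := hprop.1
      -- Let `a` come before `b`. The initial set ending with `a` contains `s` and `a` but not `b`,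
      -- so it crosses an edge that contains `a` and `b` but not `s`.
      wlog hlt' : w.symm a < w.symm b generalizing a b
      · exact this b hb a ha hab.symm (lt_of_le_of_ne (not_lt.1 hlt')
          (fun h => hab (w.symm.injective h.symm)))
      have ha0 : (w.symm a).val ≠ 0 := by
        intro h2
        refine hs ?_
        rw [← hw0, show (0 : Fin (m + 2)) = w.symm a from Fin.ext h2.symm, w.apply_symm_apply]
        exact ha
      have hb' := (w.symm b).2
      obtain ⟨k, hk⟩ := Nat.exists_eq_succ_of_ne_zero ha0
      have hkm : k < m := by omega
      rcases hh.1.2.2 _ _ (hval ⟨k, hkm⟩).1 h0 with h2 | h2 | h2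
      · exact hs (h2 (by rw [← hw0, apply_mem_initialSet]; simp))
      · have : (w.symm b).val ≤ k + 1 := h2 hb
        omega
      · exact Set.disjoint_left.1 h2 (show (w.symm a).val ≤ k + 1 by omega) ha

/-- The open part of the cone is a disjoint union of cells. -/
theorem openCone_homeomorph (hS : Nat.card S = m + 2) (hm : q → 1 ≤ m) :
    Nonempty ((Fin (m + 1).factorial × (CellIndex m q → ℝ)) ≃ₜ openCone s (m + 1) q) := by
  classical
  have e : Fin (m + 1).factorial ≃ WordsFrom s m :=
    (Finite.equivFinOfCardEq (card_wordsFrom hS s)).symm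
  choose g hg using fun h : openCone s (m + 1) q => exists_word_of_mem hS h.2
  have huniq : ∀ w w' : WordsFrom s m, (∀ k ≤ m, initialSet w.1 k = initialSet w'.1 k) →
      w = w' := fun w w' h => Subtype.ext (word_ext fun k hk => by
    rcases Nat.lt_or_ge m k with h1 | h1
    · ext a
      rw [mem_initialSet, mem_initialSet]
      constructor <;> intro _ <;> omega
    · exact h k h1)
  refine ⟨{
    toFun := fun p => ⟨comb (e p.1).1 p.2, comb_mem (e p.1).2 hm p.2⟩
    invFun := fun h => (e.symm (g h), fun i => Real.log (level s (i.1 + 2) (h : Set S → ℝ)))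
    left_inv := ?_
    right_inv := ?_
    continuous_toFun := ?_
    continuous_invFun := ?_ }⟩
  · rintro ⟨r, y⟩
    refine Prod.ext ?_ (funext fun i => ?_)
    · rw [Equiv.symm_apply_eq]
      refine huniq _ _ fun k hk => ?_
      rw [hg _ k hk]
      rcases Nat.eq_zero_or_pos k with rfl | h0
      · rw [levelSet_one, initialSet_zero, (e r).2]
      · obtain ⟨k, rfl⟩ := Nat.exists_eq_succ_of_ne_zero h0.ne'
        refine levelSet_eq (comb_mem_treeCone _ _) (by omega) ?_ ?_
          (ncard_initialSet _ (by omega))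
        · have := comb_initialSet (e r).1 y ⟨k, hk⟩
          rw [this]
          exact (cellWeight_pos _ _).ne'
        · exact (congrArg (· ∈ initialSet (e r).1 (k + 1)) (e r).2).mp
            (apply_mem_initialSet.2 (Nat.zero_le _))
    · change Real.log (level s (i.1 + 2) (comb (e r).1 y)) = y i
      rw [level_comb (e r).2, cellWeight, dif_pos i.2, Real.log_exp]
  · intro h
    refine Subtype.ext ?_
    simp only [Equiv.apply_symm_apply]
    exact (eq_comb h.2 (g h).2 (hg h)).symm
  · refine Continuous.subtype_mk ?_ _
    refine continuous_prod_of_discrete_left.2 fun r => ?_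
    exact continuous_comb (q := q) (e r).1
  · refine Continuous.prodMk ?_ (continuous_pi fun i => ?_)
    -- The word is determined by the level sets, which are locally constant, so different words give
    -- disjoint open cells.
    · refine (IsLocallyConstant.iff_eventually_eq _).2 (fun h₀ => ?_) |>.continuous
      have h1 : ∀ᶠ h : openCone s (m + 1) q in nhds h₀, ∀ k : Fin (m + 1),
          levelSet s (k + 1) (h : Set S → ℝ) = levelSet s (k + 1) (h₀ : Set S → ℝ) := by
        refine Filter.eventually_all.2 fun k => ?_
        have hinc : openCone s (m + 1) q ⊆ openCone s (k + 1) False := fun h hh =>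
          ⟨hh.1, fun h => h.elim,
            fun i hi => hh.2.2 i (Finset.Icc_subset_Icc_right (by omega) hi)⟩
        exact (continuous_inclusion hinc).continuousAt.eventually
          (eventually_levelSet_eq (q := False) (Set.inclusion hinc h₀) (by omega))
      filter_upwards [h1] with h h2
      refine congrArg e.symm (huniq _ _ fun k hk => ?_)
      rw [hg h k hk, hg h₀ k hk]
      exact h2 ⟨k, by omega⟩
    · refine Continuous.log ((continuous_level s _).comp continuous_subtype_val) fun h => ?_
      exact (h.2.2.2 _ (Finset.mem_Icc.2 ⟨by omega, by omega⟩)).ne'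

end Cells

/-! ### Wedges of spheres as one-point compactifications -/

section Wedge

/-- Stereographic projection from the base point, followed by a linear identification of the
hyperplane. -/
lemma exists_sphere_homeomorph (d : ℕ) : ∃ e : Sphere d ≃ₜ OnePoint (Fin d → ℝ),
    e (Sphere.base d) = OnePoint.infty := by
  let v : EuclideanSpace ℝ (Fin (d + 1)) := EuclideanSpace.single 0 1
  have hv : ‖v‖ = 1 := by simp [v]
  have : Fact (Module.finrank ℝ (EuclideanSpace ℝ (Fin (d + 1))) = d + 1) := ⟨by simp⟩
  have hd : Module.finrank ℝ ↥(ℝ ∙ v)ᗮ = Module.finrank ℝ (Fin d → ℝ) := by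
    rw [Submodule.finrank_orthogonal_span_singleton (n := d) (by intro h; simp [h] at hv)]
    simp
  obtain ⟨l⟩ := FiniteDimensional.nonempty_continuousLinearEquiv_of_finrank_eq hd
  refine ⟨(onePointHyperplaneHomeoUnitSphere hv).symm.trans l.toHomeomorph.onePointCongr, ?_⟩
  have h1 : (onePointHyperplaneHomeoUnitSphere hv).symm (Sphere.base d) = OnePoint.infty := by
    rw [Homeomorph.symm_apply_eq]
    rfl
  rw [Homeomorph.trans_apply, h1]
  rfl

/-- The one-point compactification of a finite disjoint union of cells. -/
theorem onePoint_homeomorph_wedge (r d : ℕ) :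
    Nonempty (WedgeOfSpheres r d ≃ₜ OnePoint (Fin r × (Fin d → ℝ))) := by
  obtain ⟨e, he⟩ := exists_sphere_homeomorph d
  let f : Fin r → OnePoint (Fin d → ℝ) → OnePoint (Fin r × (Fin d → ℝ)) :=
    fun i => OnePoint.map fun x => (i, x)
  have hf : ∀ i, Continuous (f i) := by
    intro i
    refine OnePoint.continuous_map (by fun_prop) ?_
    rw [Filter.coclosedCompact_eq_cocompact, Filter.coclosedCompact_eq_cocompact]
    exact (Topology.IsClosedEmbedding.of_continuous_injective_isClosedMap (by fun_prop)
      (fun x y h => congrArg Prod.snd h)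
      (fun K hK => by
        rw [show (fun x : Fin d → ℝ => (i, x)) '' K = {i} ×ˢ K from Set.singleton_prod.symm]
        exact isClosed_singleton.prod hK)).tendsto_cocompact
  let F : PUnit.{1} ⊕ (Σ _ : Fin r, Sphere d) → OnePoint (Fin r × (Fin d → ℝ)) :=
    Sum.elim (fun _ => OnePoint.infty) fun p => f p.1 (e p.2)
  have hF : Continuous F := continuous_sum_dom.2 ⟨continuous_const,
    continuous_sigma fun i => (hf i).comp e.continuous⟩
  have hrel : ∀ a b, WedgeRel r d a b → F a = F b := by
    rintro _ _ ⟨i⟩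
    change OnePoint.infty = f i (e (Sphere.base d))
    rw [he]
    rfl
  let Q : WedgeOfSpheres r d → OnePoint (Fin r × (Fin d → ℝ)) := Quot.lift F hrel
  have hQ : Continuous Q := continuous_quot_lift _ hF
  have hbase : ∀ p : Σ _ : Fin r, Sphere d, F (.inr p) = OnePoint.infty →
      Quot.mk (WedgeRel r d) (.inr p) = Quot.mk _ (.inl .unit) := by
    rintro ⟨i, x⟩ h
    have : e x = OnePoint.infty := by
      have h' : f i (e x) = OnePoint.infty := h
      induction hx : e x using OnePoint.rec with
      | infty => rfl
      | coe y => rw [hx] at h'; exact absurd h' (OnePoint.coe_ne_infty _)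
    rw [← he] at this
    rw [e.injective this]
    exact (Quot.sound (.base i)).symm
  have hbij : Function.Bijective Q := by
    constructor
    · intro a b hab
      induction a using Quot.ind with | mk a => ?_
      induction b using Quot.ind with | mk b => ?_
      have hab : F a = F b := hab
      rcases a with _ | ⟨i, x⟩ <;> rcases b with _ | ⟨j, y⟩
      · rfl
      · exact (hbase _ hab.symm).symm
      · exact hbase _ hab
      · have h1 : f i (e x) = f j (e y) := hab
        induction hx : e x using OnePoint.rec with
        | infty =>
          have h2 : f i (e x) = OnePoint.infty := by rw [hx]; rfl
          rw [hbase ⟨i, x⟩ h2, hbase ⟨j, y⟩ (h1.symm.trans h2)]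
        | coe x' =>
          induction hy : e y using OnePoint.rec with
          | infty =>
            have h2 : f j (e y) = OnePoint.infty := by rw [hy]; rfl
            rw [hbase ⟨i, x⟩ (h1.trans h2), hbase ⟨j, y⟩ h2]
          | coe y' =>
            rw [hx, hy] at h1
            have h2 := OnePoint.coe_injective (X := Fin r × (Fin d → ℝ)) h1
            have h3 := congrArg Prod.fst h2
            have h4 := congrArg Prod.snd h2
            simp only at h3 h4
            subst h3 h4
            rw [e.injective (hx.trans hy.symm)]
    · intro z
      induction z using OnePoint.rec with
      | infty => exact ⟨Quot.mk _ (.inl .unit), rfl⟩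
      | coe z =>
        refine ⟨Quot.mk _ (.inr ⟨z.1, e.symm z.2⟩), ?_⟩
        change f z.1 (e (e.symm z.2)) = z
        rw [e.apply_symm_apply]
        rfl
  exact ⟨Continuous.homeoOfEquivCompactToT2 (f := Equiv.ofBijective Q hbij) hQ⟩

end Wedge

/-! ### Homotopy types of the boundary and of the quotient -/

section Sphere

variable {S : Type u} [Fintype S] {m : ℕ} {q : Prop}

lemma onePoint_iterate (s : S) {i : ℕ} (hi : 1 ≤ i) (hq : q → 2 ≤ i) {j : ℕ} (hij : i ≤ j)
    (hj : j + 1 ≤ Nat.card S) :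
    Nonempty (ContinuousMap.HomotopyEquiv (OnePoint (openCone s i q))
      (OnePoint (openCone s j q))) := by
  induction j, hij using Nat.le_induction with
  | base => exact ⟨.refl _⟩
  | succ j hij ih =>
    obtain ⟨e⟩ := ih (by omega)
    obtain ⟨f⟩ := onePoint_step s (hi.trans hij) (fun h => (hq h).trans hij) hj
    exact ⟨e.trans f⟩

lemma onePoint_cells (s : S) (hS : Nat.card S = m + 2) (hm : q → 1 ≤ m) {d : ℕ}
    (hd : Nat.card (CellIndex m q) = d) :
    Nonempty (OnePoint (openCone s (m + 1) q) ≃ₜ WedgeOfSpheres (m + 1).factorial d) := by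
  obtain ⟨e⟩ := openCone_homeomorph (s := s) hS hm
  obtain ⟨f⟩ := onePoint_homeomorph_wedge (m + 1).factorial d
  let c : CellIndex m q ≃ Fin d := Finite.equivFinOfCardEq hd
  exact ⟨e.symm.onePointCongr.trans ((Homeomorph.onePointCongr (Homeomorph.prodCongr (.refl _)
    (Homeomorph.piCongrLeft (Y := fun _ => ℝ) c))).trans f.symm)⟩

theorem boundary_wedge (hS : 3 ≤ Nat.card S) : Nonempty (ContinuousMap.HomotopyEquiv
    (SSet.toTop.obj (treeOperad.boundary S).toSSet)
    (WedgeOfSpheres (Nat.card S - 1).factorial (Nat.card S - 3))) := by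
  obtain ⟨m, hm⟩ := Nat.exists_eq_add_of_le' (show 2 ≤ Nat.card S by omega)
  have : Nonempty S := (Nat.card_pos_iff.1 (by omega)).1
  let s : S := Classical.arbitrary S
  obtain ⟨e1⟩ := (treeOperad_pair S).1
  obtain ⟨e2⟩ := boundary_homeomorph (S := S) (by omega)
  obtain ⟨e3⟩ := treeLink_step s hS
  obtain ⟨e4⟩ := onePoint_iterate s (q := True) (i := 2) (by omega) (fun _ => le_rfl)
    (j := m + 1) (by omega) (by omega)
  -- A comb has `m = n - 2` edges; normalizing level two removes one coordinate, which leaves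
  -- dimension `n - 3`.
  have hd : Nat.card (CellIndex m True) = m - 1 := by
    obtain ⟨l, rfl⟩ := Nat.exists_eq_succ_of_ne_zero (show m ≠ 0 by omega)
    have c : CellIndex (l + 1) True ≃ {i : Fin (l + 1) // i ≠ 0} :=
      Equiv.subtypeEquivRight fun i => ⟨fun h h1 => h trivial (congrArg Fin.val h1),
        fun h _ h1 => h (Fin.ext h1)⟩
    rw [Nat.card_congr (c.trans (finSuccAboveEquiv 0).symm)]
    simp
  obtain ⟨e5⟩ := onePoint_cells s hm (q := True) (fun _ => by omega) hd
  rw [show Nat.card S - 1 = m + 1 by omega, show Nat.card S - 3 = m - 1 by omega]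
  exact ⟨(((e1.trans e2.toHomotopyEquiv).trans e3).trans e4).trans e5.toHomotopyEquiv⟩

theorem quotient_wedge (hS : 2 ≤ Nat.card S) : Nonempty (ContinuousMap.HomotopyEquiv
    (SSet.toTop.obj (collapseSubcomplex (treeOperad.boundary S)))
    (WedgeOfSpheres (Nat.card S - 1).factorial (Nat.card S - 2))) := by
  obtain ⟨m, hm⟩ := Nat.exists_eq_add_of_le' hS
  have : Nonempty S := (Nat.card_pos_iff.1 (by omega)).1
  let s : S := Classical.arbitrary S
  obtain ⟨e1⟩ := (treeOperad_pair S).2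
  obtain ⟨e2⟩ := collapse_homeomorph (S := S) hS
  -- For `j = 1` no level is prescribed, so the iteration starts with the whole cone.
  have h3 : treeCone S = openCone s 1 False := by
    ext h
    exact ⟨fun hh => ⟨hh, fun h => h.elim, fun i hi => by simp at hi⟩, fun hh => hh.1⟩
  obtain ⟨e4⟩ := onePoint_iterate s (q := False) (i := 1) le_rfl (fun h => h.elim)
    (j := m + 1) (by omega) (by omega)
  have hd : Nat.card (CellIndex m False) = m := by
    rw [Nat.card_congr (Equiv.subtypeUnivEquiv fun _ h => h.elim), Nat.card_fin]
  obtain ⟨e5⟩ := onePoint_cells s hm (q := False) (fun h => h.elim) hd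
  rw [show Nat.card S - 1 = m + 1 by omega, show Nat.card S - 2 = m by omega]
  exact ⟨((e1.trans (e2.trans (Homeomorph.setCongr h3).onePointCongr).toHomotopyEquiv).trans
    e4).trans e5.toHomotopyEquiv⟩

end Sphere

/-! ### Homotopy invariance and normalization of cochains -/

section ChainHomotopy

open AlgebraicTopology SimplicialObject

variable {X Y : SSet.{u}}

/-- The simplicial free abelian group on a simplicial set. -/
abbrev freeSimplicial (X : SSet.{u}) : SimplicialObject AddCommGrpCat.{u} :=
  ((SimplicialObject.whiskering _ _).obj AddCommGrpCat.free).obj X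

/-- The chains on a simplicial set. -/
abbrev freeChains (X : SSet.{u}) : ChainComplex AddCommGrpCat.{u} ℕ :=
  AlternatingFaceMapComplex.obj (freeSimplicial X)

/-- The linear extension of a cochain. -/
def evalChain {n : ℕ} (c : RedCochain X (n + 1)) : ((freeChains X).X n : Type u) →+ ℤ :=
  FreeAbelianGroup.lift (c : X.obj (op (SimplexCategory.mk n)) → ℤ)

/-- A simplex as a chain. -/
def chainSingle {n : ℕ} (x : X.obj (op (SimplexCategory.mk n))) : ((freeChains X).X n : Type u) :=
  FreeAbelianGroup.of (α := X.obj (op (SimplexCategory.mk n))) x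

lemma evalChain_single {n : ℕ} (c : RedCochain X (n + 1))
    (x : X.obj (op (SimplexCategory.mk n))) : evalChain c (chainSingle x) = c x :=
  FreeAbelianGroup.lift_apply_of _ x

lemma chain_hom_ext {n : ℕ} {f g : ((freeChains X).X n : Type u) →+ ℤ}
    (h : ∀ x, f (chainSingle x) = g (chainSingle x)) : f = g :=
  FreeAbelianGroup.lift_ext _ _ h

lemma freeChains_d_single {n : ℕ} (x : X.obj (op (SimplexCategory.mk (n + 1)))) :
    ((freeChains X).d (n + 1) n).hom (chainSingle x) =
      ∑ i : Fin (n + 2), (-1 : ℤ) ^ (i : ℕ) • chainSingle (X.δ i x) := by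
  rw [AlternatingFaceMapComplex.obj_d_eq]
  refine (DFunLike.congr_fun (map_sum AddCommGrpCat.homAddEquiv _ _) (chainSingle x)).trans ?_
  rw [AddMonoidHom.finsetSum_apply]
  refine Finset.sum_congr rfl fun i _ => ?_
  refine (DFunLike.congr_fun (map_zsmul AddCommGrpCat.homAddEquiv _ _) (chainSingle x)).trans ?_
  refine congrArg (fun z : ((freeChains X).X n : Type u) => (-1 : ℤ) ^ (i : ℕ) • z) ?_
  exact FreeAbelianGroup.map_of_apply _

lemma evalChain_d {n : ℕ} (c : RedCochain X (n + 1)) :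
    (evalChain c).comp ((freeChains X).d (n + 1) n).hom = evalChain (redCochainD X (n + 1) c) := by
  refine chain_hom_ext fun x => ?_
  rw [AddMonoidHom.comp_apply, freeChains_d_single, map_sum, evalChain_single]
  refine Finset.sum_congr rfl fun i _ => ?_
  rw [map_zsmul, evalChain_single, smul_eq_mul]
  rfl

/-- The pullback of a cochain along a chain map. -/
def pullCochain {n : ℕ} (φ : freeChains X ⟶ freeChains Y) (c : RedCochain Y (n + 1)) :
    RedCochain X (n + 1) := fun x => evalChain c ((φ.f n).hom (chainSingle x))

/-- Pullbacks of a cocycle along homotopic chain maps are cohomologous. -/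
theorem pullCochain_sub_mem {φ ψ : freeChains X ⟶ freeChains Y} (H : Homotopy φ ψ) {n : ℕ}
    (c : RedCochain Y (n + 1)) (hc : c ∈ redCocycle Y (n + 1)) :
    pullCochain φ c - pullCochain ψ c ∈ redCoboundary X (n + 1) := by
  have hc' : redCochainD Y (n + 1) c = 0 := hc
  have hd : (evalChain c).comp ((freeChains Y).d (n + 1) n).hom = 0 := by
    rw [evalChain_d, hc']
    refine chain_hom_ext fun x => ?_
    rw [evalChain_single]
    rfl
  cases n with
  -- In degree zero the chain complex has no lower term, so the cocycle condition alone gives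
  -- equality of the pullbacks, without a coboundary.
  | zero =>
    convert Submodule.zero_mem _ using 1
    funext x
    have h := congrArg (fun f => evalChain c (f.hom (chainSingle x))) (H.comm 0)
    simp only [Homotopy.dNext_zero_chainComplex, Homotopy.prevD_chainComplex, zero_add,
      AddCommGrpCat.hom_add, AddMonoidHom.add_apply, map_add, AddCommGrpCat.hom_comp,
      AddMonoidHom.comp_apply] at h
    have h2 := DFunLike.congr_fun hd ((H.hom 0 1).hom (chainSingle x))
    rw [AddMonoidHom.comp_apply] at h2
    rw [h2, AddMonoidHom.zero_apply, zero_add] at h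
    exact sub_eq_zero.2 h
  | succ n =>
    refine ⟨fun x => evalChain c ((H.hom n (n + 1)).hom (chainSingle x)), funext fun x => ?_⟩
    have h := congrArg (fun f => evalChain c (f.hom (chainSingle x))) (H.comm (n + 1))
    simp only [Homotopy.dNext_succ_chainComplex, Homotopy.prevD_chainComplex,
      AddCommGrpCat.hom_add, AddMonoidHom.add_apply, map_add, AddCommGrpCat.hom_comp,
      AddMonoidHom.comp_apply] at h
    have h2 := DFunLike.congr_fun hd ((H.hom (n + 1) (n + 2)).hom (chainSingle x))
    rw [AddMonoidHom.comp_apply] at h2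
    rw [h2, AddMonoidHom.zero_apply, add_zero] at h
    refine Eq.trans ?_ (sub_eq_of_eq_add h).symm
    refine Eq.trans ?_ (congrArg (fun z => evalChain c ((H.hom n (n + 1)).hom z))
      (freeChains_d_single (X := X) (n := n) x)).symm
    have hF : ∀ F : ((freeChains X).X n : Type u) →+ ℤ,
        F (∑ i : Fin (n + 2), (-1 : ℤ) ^ (i : ℕ) • chainSingle (X.δ i x)) =
          ∑ i : Fin (n + 2), (-1 : ℤ) ^ (i : ℕ) * F (chainSingle (X.δ i x)) := fun F => by
      rw [map_sum]
      exact Finset.sum_congr rfl fun i _ => by rw [map_zsmul, smul_eq_mul]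
    exact (hF ((evalChain c).comp (H.hom n (n + 1)).hom)).symm

lemma pullCochain_map {n : ℕ} (f : X ⟶ Y) (c : RedCochain Y (n + 1)) :
    pullCochain ((alternatingFaceMapComplex _).map
      (((SimplicialObject.whiskering _ _).obj AddCommGrpCat.free).map f)) c =
      redCochainMap f (n + 1) c := by
  funext x
  refine (congrArg (evalChain c) (?_ : _ = chainSingle (f.app _ x))).trans (evalChain_single c _)
  exact FreeAbelianGroup.map_of_apply _

lemma pullCochain_id {n : ℕ} (c : RedCochain X (n + 1)) :
    pullCochain (𝟙 (freeChains X)) c = c := funext fun x => evalChain_single c x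

/-- Simplicially homotopic maps induce the same map in reduced cohomology. -/
theorem redCohomologyMap_eq {f g : X ⟶ Y} (H : SSet.Homotopy f g) (j : ℕ) :
    redCohomologyMap f j = redCohomologyMap g j := by
  refine LinearMap.ext fun a => ?_
  induction a using Submodule.Quotient.induction_on with
  | H c =>
    cases j with
    | zero => rfl
    | succ n =>
      refine (Submodule.Quotient.eq _).2 ?_
      have := pullCochain_sub_mem
        (H.toSimplicialObjectHomotopy.whiskerRight AddCommGrpCat.free).toChainHomotopy c.1 c.2
      erw [pullCochain_map, pullCochain_map] at this
      exact this

/-- Each cocycle is cohomologous to one that vanishes on the degenerate simplices. -/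
theorem exists_normalized (j : ℕ) (c : RedCochain X j) (hc : c ∈ redCocycle X j) :
    ∃ c', c - c' ∈ redCoboundary X j ∧ ∀ (n : ℕ) (hn : j = n + 2) (i : Fin (n + 1))
      (x : X.obj (op (SimplexCategory.mk n))), (hn ▸ c' : RedCochain X (n + 2)) (X.σ i x) = 0 := by
  rcases j with _ | _ | n
  · exact ⟨c, by rw [sub_self]; exact Submodule.zero_mem _, fun n hn => by omega⟩
  · exact ⟨c, by rw [sub_self]; exact Submodule.zero_mem _, fun n hn => by omega⟩
  -- The Dold–Kan projection to the normalized complex is chain homotopic to the identity and kills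
  -- degenerate simplices. The smaller indices need no change, as there are no degenerate simplices
  -- in dimensions `-1` and `0`.
  · refine ⟨pullCochain (DoldKan.PInfty (X := freeSimplicial X)) c, ?_, ?_⟩
    · have := pullCochain_sub_mem (DoldKan.homotopyPInftyToId (freeSimplicial X)).symm c hc
      rwa [pullCochain_id] at this
    · intro n' hn i x
      obtain rfl : n' = n := by omega
      have h := congrArg (fun f => evalChain c (f.hom (chainSingle x)))
        (DoldKan.σ_comp_PInfty (freeSimplicial X) i)
      refine Eq.trans ?_ (h.trans (map_zero _))
      refine congrArg (fun z => evalChain c (((DoldKan.PInfty (X := freeSimplicial X)).f (n' + 1)).hom z)) ?_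
      exact (FreeAbelianGroup.map_of_apply (f := X.σ i) x).symm

end ChainHomotopy

/-! ### Reduction of the cohomology to chains of trees -/

section TreeCohomology

open Simplicial

variable (S : Type u)

/-- The simplicial set of chains of trees with internal edges. -/
abbrev TreeChains : SSet.{u} := (treeBoundary S).toSSet

variable {S}

/-- Relabelling of chains of trees. -/
def treeChainsMap (σ : Equiv.Perm S) : TreeChains S ⟶ TreeChains S :=
  restrictMap (nerveMap (Monotone.functor (f := LabelledTree.map σ) (by
    rintro x y h _ ⟨B, hB, rfl⟩
    exact ⟨B, h hB, rfl⟩))) (by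
    rintro k x ⟨B, hB⟩
    exact ⟨_, B, hB, rfl⟩)

variable [Finite S]

/-- The projection of the boundary to chains of trees. -/
def boundaryProj (S : Type u) [Finite S] : (treeOperad.boundary S).toSSet ⟶ TreeChains S :=
  restrictMap (treeProj S) boundary_le_preimage

/-- The section of the projection of the boundary. -/
def boundarySection (S : Type u) [Finite S] : TreeChains S ⟶ (treeOperad.boundary S).toSSet :=
  restrictMap (treeSection S) treeBoundary_le_preimage

/-- Forgetting orderings commutes strictly with relabelling, whereas the section, which chooses
orderings, need not. So equivariance is tested on the projection. -/
lemma boundaryMap_proj (σ : Equiv.Perm S) :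
    treeOperad.boundaryMap σ ≫ boundaryProj S = boundaryProj S ≫ treeChainsMap σ := rfl

lemma boundarySection_proj : boundarySection S ≫ boundaryProj S = 𝟙 _ := by
  rw [← cancel_mono (treeBoundary S).ι]
  rfl

/-- The homotopy of the boundary that replaces the orderings by compatible ones. -/
def boundaryOrderHomotopy (S : Type u) [Finite S] :
    (treeOperad.boundary S).toSSet ⊗ Δ[1] ⟶ (treeOperad.boundary S).toSSet :=
  SSet.Subcomplex.lift ((treeOperad.boundary S).ι ▷ Δ[1] ≫ orderHomotopy S) (by
    rintro k _ ⟨x, rfl⟩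
    exact orderHomotopy_mem _ _ x.1.2)

lemma boundaryOrderHomotopy_ι : boundaryOrderHomotopy S ≫ (treeOperad.boundary S).ι =
    (treeOperad.boundary S).ι ▷ Δ[1] ≫ orderHomotopy S := rfl

lemma boundaryOrderHomotopy_zero :
    SSet.ι₀ ≫ boundaryOrderHomotopy S = boundaryProj S ≫ boundarySection S := by
  rw [← cancel_mono (treeOperad.boundary S).ι, Category.assoc, boundaryOrderHomotopy_ι,
    ← Category.assoc, SSet.ι₀_comp, Category.assoc, orderHomotopy_zero]
  rfl

lemma boundaryOrderHomotopy_one : SSet.ι₁ ≫ boundaryOrderHomotopy S = 𝟙 _ := by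
  rw [← cancel_mono (treeOperad.boundary S).ι, Category.assoc, boundaryOrderHomotopy_ι,
    ← Category.assoc, SSet.ι₁_comp, Category.assoc, orderHomotopy_one]
  rfl

/-- The projection and the section are inverse to each other up to homotopy. -/
def boundaryHomotopy (S : Type u) [Finite S] :
    SSet.Homotopy (boundaryProj S ≫ boundarySection S) (𝟙 _) where
  h := boundaryOrderHomotopy S
  h₀ := boundaryOrderHomotopy_zero
  h₁ := boundaryOrderHomotopy_one
  rel := by
    ext k x
    exact x.1.2.elim

/-- The cohomology of the boundary is the cohomology of the poset of trees. -/
def boundaryCohomologyEquiv (S : Type u) [Finite S] (j : ℕ) :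
    RedCohomology (TreeChains S) j ≃ₗ[ℤ] RedCohomology (treeOperad.boundary S).toSSet j :=
  LinearEquiv.ofLinearMap (redCohomologyMap (boundaryProj S) j)
    (redCohomologyMap (boundarySection S) j)
    (by rw [← redCohomologyMap_comp, redCohomologyMap_eq (boundaryHomotopy S),
      redCohomologyMap_id])
    (by rw [← redCohomologyMap_comp, boundarySection_proj, redCohomologyMap_id])

lemma boundaryCohomologyEquiv_map (σ : Equiv.Perm S) (j : ℕ)
    (a : RedCohomology (TreeChains S) j) :
    boundaryCohomologyEquiv S j (redCohomologyMap (treeChainsMap σ) j a) =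
      treeOperad.boundaryCohomologyRep S j σ (boundaryCohomologyEquiv S j a) := by
  change (redCohomologyMap _ j ∘ₗ redCohomologyMap _ j) a =
    (redCohomologyMap _ j ∘ₗ redCohomologyMap _ j) a
  rw [← redCohomologyMap_comp, ← redCohomologyMap_comp, boundaryMap_proj]

end TreeCohomology

/-! ### Simplices as increasing sequences of edge sets -/

section AugEdges

variable {S : Type u}

/-- The sets of internal edges of the trees of a chain. -/
def augEdges : {j : ℕ} → AugSimplex (TreeChains S) j → Fin j → Set (Set S)
  | 0 => fun _ => Fin.elim0
  | _ + 1 => fun x i => (nerveVertex x.1 i).edges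

lemma augEdges_injective : ∀ {j : ℕ} {x y : AugSimplex (TreeChains S) j},
    augEdges x = augEdges y → x = y
  | 0, _, _, _ => rfl
  | _ + 1, _, _, h => Subtype.ext (nerveVertex_ext (funext fun i =>
      LabelledTree.ext (congrFun h i)))

lemma augEdges_mono : ∀ {j : ℕ} (x : AugSimplex (TreeChains S) j), Monotone (augEdges x)
  | 0, _ => fun i => i.elim0
  | _ + 1, x => fun _ _ h => nerveVertex_mono x.1 h

/-- A set of internal edges of a tree. -/
def IsNest (E : Set (Set S)) : Prop :=
  (∀ A ∈ E, IsProper A) ∧ ∀ A ∈ E, ∀ B ∈ E, A ⊆ B ∨ B ⊆ A ∨ Disjoint A B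

lemma IsNest.mono {E F : Set (Set S)} (hF : IsNest F) (h : E ⊆ F) : IsNest E :=
  ⟨fun A hA => hF.1 A (h hA), fun A hA B hB => hF.2 A (h hA) B (h hB)⟩

lemma isNest_augEdges : ∀ {j : ℕ} (x : AugSimplex (TreeChains S) j) (i : Fin j),
    IsNest (augEdges x i)
  | 0, _ => fun i => i.elim0
  | _ + 1, x => fun i => ⟨fun A hA => ⟨(nerveVertex x.1 i).nontrivial_of_mem A hA,
      (nerveVertex x.1 i).ne_univ_of_mem A hA⟩, (nerveVertex x.1 i).nested_or_disjoint⟩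

lemma augEdges_nonempty : ∀ {j : ℕ} (x : AugSimplex (TreeChains S) j) (i : Fin j),
    (augEdges x i).Nonempty
  | 0, _ => fun i => i.elim0
  | _ + 1, x => fun i => x.2.mono (nerveVertex_mono x.1 (Fin.zero_le i))

lemma exists_augEdges (hS : 2 ≤ Nat.card S) : ∀ {j : ℕ} (E : Fin j → Set (Set S))
    (_ : Monotone E) (_ : ∀ i, (E i).Nonempty) (_ : ∀ i, IsNest (E i)),
    ∃ x : AugSimplex (TreeChains S) j, augEdges x = E
  | 0, _, _, _, _ => ⟨PUnit.unit, funext fun i => i.elim0⟩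
  | k + 1, E, hE, h0, h1 => by
    let f : Fin (k + 1) → LabelledTree S := fun i =>
      ⟨hS, E i, fun A hA => ((h1 i).1 A hA).1, fun A hA => ((h1 i).1 A hA).2, (h1 i).2⟩
    have hf : Monotone f := fun _ _ h => hE h
    exact ⟨⟨nerveMk f hf, h0 0⟩, rfl⟩

lemma augEdges_face : ∀ (j : ℕ) (i : Fin (j + 1)) (x : AugSimplex (TreeChains S) (j + 1)),
    augEdges (augFace (TreeChains S) j i x) = fun l => augEdges x (i.succAbove l)
  | 0, _, _ => funext fun l => l.elim0
  | _ + 1, _, _ => rfl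

lemma augEdges_map (σ : Equiv.Perm S) : ∀ {j : ℕ} (x : AugSimplex (TreeChains S) j) (i : Fin j),
    augEdges (AugSimplex.map (treeChainsMap σ) j x) i =
      Set.ofPred fun A => ∃ B ∈ augEdges x i, A = σ ⁻¹' B
  | 0, _ => fun i => i.elim0
  | _ + 1, _ => fun _ => rfl

/-- A chain with a repetition is degenerate. -/
lemma exists_degenerate {n : ℕ} (x : AugSimplex (TreeChains S) (n + 2)) (i : Fin (n + 1))
    (h : augEdges x i.castSucc = augEdges x i.succ) :
    ∃ y : (TreeChains S).obj (op (SimplexCategory.mk n)), x = (TreeChains S).σ i y := by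
  refine ⟨(TreeChains S).δ i.succ x, augEdges_injective ?_⟩
  have h1 : ∀ l : Fin (n + 2), augEdges x (i.succ.succAbove (i.predAbove l)) = augEdges x l := by
    intro l
    rcases lt_trichotomy l i.succ with hl | rfl | hl
    · have hl' : l ≤ i.castSucc := Fin.le_castSucc_iff.2 hl
      rw [Fin.predAbove_of_le_castSucc _ _ hl', Fin.succAbove_of_castSucc_lt]
      · simp
      · simpa using hl
    · rw [Fin.predAbove_succ_self, Fin.succAbove_succ_self, h]
    · have hl' : i.castSucc < l := (Fin.castSucc_lt_succ (i := i)).trans hl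
      rw [Fin.predAbove_of_castSucc_lt _ _ hl', Fin.succAbove_of_le_castSucc]
      · simp
      · rw [← Fin.succ_le_succ_iff, Fin.le_def] at *
        simp [Fin.lt_def] at *
        omega
  exact funext fun l => (h1 l).symm

end AugEdges

/-! ### Bound on the number of internal edges -/

section NestBound

variable {S : Type u} [Finite S]

/-- Induction: drop a smallest member `A` and delete one of its points `a` from the others. A member
containing `a` contains `A` strictly, so it stays nontrivial. Two members cannot become equal, since
the one without `a` would meet `A` without being nested with it. -/
lemma card_laminar_lt (F : Finset (Set S)) (U : Set S) (hU : U.Nonempty)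
    (h1 : ∀ A ∈ F, A ⊆ U ∧ A.Nontrivial)
    (h2 : ∀ A ∈ F, ∀ B ∈ F, A ⊆ B ∨ B ⊆ A ∨ Disjoint A B) : F.card < U.ncard := by
  classical
  induction hn : F.card generalizing F U with
  | zero => exact (Set.ncard_pos).2 hU
  | succ n ih =>
    obtain ⟨A, hA, hmin⟩ := Finset.exists_min_image F Set.ncard (Finset.card_pos.1 (by omega))
    obtain ⟨a, ha, a', ha', hne⟩ := (h1 A hA).2
    have hsub : ∀ B ∈ F.erase A, a ∈ B → A ⊆ B ∧ A.ncard < B.ncard := by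
      intro B hB haB
      obtain ⟨hBA, hB⟩ := Finset.mem_erase.1 hB
      rcases h2 A hA B hB with h | h | h
      · exact ⟨h, Set.ncard_lt_ncard (lt_of_le_of_ne h hBA.symm)⟩
      · exact absurd (Set.eq_of_subset_of_ncard_le h (hmin B hB)) hBA
      · exact absurd haB (Set.disjoint_left.1 h ha)
    have hlt : ∀ B ∈ F.erase A, ∀ C ∈ F.erase A, B \ {a} = C \ {a} → a ∈ B → a ∈ C := by
      intro B hB C hC h haB
      by_contra haC
      have h3 : C = B \ {a} := by rw [h, Set.sdiff_singleton_eq_self haC]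
      obtain ⟨hAB, -⟩ := hsub B hB haB
      have ha'C : a' ∈ C := h3 ▸ ⟨hAB ha', hne.symm⟩
      obtain ⟨hCA, hC⟩ := Finset.mem_erase.1 hC
      rcases h2 A hA C hC with h | h | h
      · exact haC (h ha)
      · exact hCA (Set.eq_of_subset_of_ncard_le h (hmin C hC))
      · exact Set.disjoint_left.1 h ha' ha'C
    have hinj : Set.InjOn (fun B : Set S => B \ {a}) (F.erase A : Finset (Set S)) := by
      intro B hB C hC h
      have h3 : a ∈ B ↔ a ∈ C := ⟨hlt B hB C hC h, hlt C hC B hB h.symm⟩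
      ext b
      by_cases hb : b = a
      · rw [hb, h3]
      · have := congrArg (b ∈ ·) h
        simpa [hb] using this
    have hcard := ih ((F.erase A).image fun B => B \ {a}) (U \ {a})
      ⟨a', (h1 A hA).1 ha', hne.symm⟩ ?_ ?_
      (by rw [Finset.card_image_of_injOn hinj, Finset.card_erase_of_mem hA, hn]; rfl)
    · rw [Set.ncard_sdiff_singleton_of_mem ((h1 A hA).1 ha)] at hcard
      omega
    · intro B hB
      obtain ⟨B, hB', rfl⟩ := Finset.mem_image.1 hB
      have h3 := h1 B (Finset.mem_of_mem_erase hB')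
      refine ⟨Set.sdiff_subset_sdiff_left h3.1, ?_⟩
      by_cases haB : a ∈ B
      · have h4 := (hsub B hB' haB).2
        have h5 := Set.one_lt_ncard_iff_nontrivial.2 (h1 A hA).2
        rw [← Set.one_lt_ncard_iff_nontrivial, Set.ncard_sdiff_singleton_of_mem haB]
        omega
      · rw [Set.sdiff_singleton_eq_self haB]
        exact h3.2
    · intro B hB C hC
      obtain ⟨B, hB', rfl⟩ := Finset.mem_image.1 hB
      obtain ⟨C, hC', rfl⟩ := Finset.mem_image.1 hC
      rcases h2 B (Finset.mem_of_mem_erase hB') C (Finset.mem_of_mem_erase hC') with h | h | h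
      · exact .inl (Set.sdiff_subset_sdiff_left h)
      · exact .inr (.inl (Set.sdiff_subset_sdiff_left h))
      · exact .inr (.inr (h.mono Set.sdiff_subset Set.sdiff_subset))

lemma IsNest.ncard_le {E : Set (Set S)} (hE : IsNest E) {m : ℕ} (hS : Nat.card S = m + 2) :
    E.ncard ≤ m := by
  classical
  have := Fintype.ofFinite S
  have hnt : (Set.univ : Set S).Nontrivial := by
    rw [← Set.one_lt_ncard_iff_nontrivial, Set.ncard_univ]
    omega
  have hmem : ∀ A, A ∈ insert Set.univ (Set.toFinite E).toFinset ↔ A = Set.univ ∨ A ∈ E := by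
    simp
  have h := card_laminar_lt (insert Set.univ (Set.toFinite E).toFinset) Set.univ hnt.nonempty
    (fun A hA => ⟨Set.subset_univ _, by
      rcases (hmem A).1 hA with rfl | h
      · exact hnt
      · exact (hE.1 A h).1⟩)
    (fun A hA B hB => by
      rcases (hmem A).1 hA with rfl | h
      · exact .inr (.inl (Set.subset_univ _))
      rcases (hmem B).1 hB with rfl | h'
      · exact .inl (Set.subset_univ _)
      exact hE.2 A h B h')
  rw [Finset.card_insert_of_notMem (by
    simpa using fun h => (hE.1 _ h).2 rfl), Set.ncard_univ, hS,
    ← Set.ncard_eq_toFinset_card E] at h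
  omega

end NestBound

lemma eq_of_strictMono {m : ℕ} (f : Fin m → ℕ) (hf : StrictMono f) (h0 : ∀ i, 0 < f i)
    (h1 : ∀ i, f i ≤ m) (i : Fin m) : f i = i + 1 := by
  let g : Fin m → Fin m := fun i => ⟨f i - 1, by have := h0 i; have := h1 i; omega⟩
  have hg : StrictMono g := fun i j hij => by
    have h2 := hf hij
    have h3 := h0 i
    simp only [g, Fin.lt_def]
    omega
  have h2 : g = id := hg.range_inj strictMono_id |>.1 (by
    rw [Set.range_id, (Finite.injective_iff_surjective.1 hg.injective).range_eq])
  have h3 := congrArg Fin.val (congrFun h2 i)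
  have h4 := h0 i
  simp only [g, id] at h3
  omega

lemma exists_seq_of_chain {α : Type*} [Finite α] {m : ℕ} (L : Fin m → Set α) (hL : Monotone L)
    (hcard : ∀ i, (L i).ncard = i + 1) :
    ∃ Y : Fin m → α, Function.Injective Y ∧ ∀ i, L i = Y '' Set.Iic i := by
  have h1 : ∀ i, ∃ a ∈ L i, ∀ j < i, a ∉ L j := by
    intro i
    by_cases h0 : i.val = 0
    · obtain ⟨a, ha⟩ := (Set.ncard_pos (s := L i)).1 (by rw [hcard]; omega)
      exact ⟨a, ha, fun j hj => by rw [Fin.lt_def] at hj; omega⟩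
    · obtain ⟨a, ha, ha'⟩ := Set.exists_mem_notMem_of_ncard_lt_ncard
        (s := L ⟨i - 1, by omega⟩) (t := L i) (by rw [hcard, hcard]; simp only; omega)
      refine ⟨a, ha, fun j hj h => ha' (hL ?_ h)⟩
      rw [Fin.lt_def] at hj
      rw [Fin.le_def]
      simp only
      omega
  choose Y hY hY' using h1
  have hinj : Function.Injective Y := by
    intro i j hij
    by_contra hne
    rcases lt_or_gt_of_ne hne with h | h
    · exact hY' j i h (hij ▸ hY i)
    · exact hY' i j h (hij ▸ hY j)
  refine ⟨Y, hinj, fun i => (Set.eq_of_subset_of_ncard_le ?_ ?_).symm⟩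
  · rintro _ ⟨j, hj, rfl⟩
    exact hL hj (hY j)
  · rw [hcard, Set.ncard_image_of_injective _ hinj, ← Finset.coe_Iic, Set.ncard_coe_finset,
      Fin.card_Iic]

/-- The coboundary of a cochain that vanishes on degenerate simplices vanishes on degenerate
simplices. -/
lemma redCochainD_eq_zero {S : Type u} {j : ℕ} {b : RedCochain (TreeChains S) j}
    (hb : ∀ z, ¬ StrictMono (augEdges z) → b z = 0) {x : AugSimplex (TreeChains S) (j + 1)}
    (hx : ¬ StrictMono (augEdges x)) : redCochainD (TreeChains S) j b x = 0 := by
  have h1 : ∃ i₀ : Fin j, augEdges x i₀.castSucc = augEdges x i₀.succ := by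
    by_contra h2
    push Not at h2
    exact hx (Fin.strictMono_iff_lt_succ.2 fun i => lt_of_le_of_ne
      (augEdges_mono x Fin.castSucc_lt_succ.le) (h2 i))
  obtain ⟨i₀, hi₀⟩ := h1
  have hswap : ∀ l, augEdges x (i₀.castSucc.succAbove l) =
      augEdges x (i₀.succ.succAbove l) := by
    intro l
    rcases lt_trichotomy l i₀ with hl | rfl | hl
    · rw [Fin.succAbove_of_castSucc_lt _ _ (by simpa using hl),
        Fin.succAbove_of_castSucc_lt _ _ (by
          rw [Fin.lt_def] at hl ⊢; simp; omega)]
    · rw [Fin.succAbove_castSucc_self, Fin.succAbove_succ_self, hi₀]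
    · rw [Fin.succAbove_of_le_castSucc _ _ (by simpa using hl.le),
        Fin.succAbove_of_le_castSucc _ _ (by
          rw [Fin.lt_def] at hl; rw [Fin.le_def]; simp; omega)]
  have hface : augFace (TreeChains S) j i₀.castSucc x = augFace (TreeChains S) j i₀.succ x :=
    augEdges_injective (by rw [augEdges_face, augEdges_face, funext hswap])
  change ∑ i : Fin (j + 1), (-1 : ℤ) ^ (i : ℕ) * b (augFace (TreeChains S) j i x) = 0
  -- The two faces that omit one of the repeated vertices agree and have opposite signs; every other
  -- face still contains the repetition.
  rw [Finset.sum_eq_add_of_mem i₀.castSucc i₀.succ (Finset.mem_univ _) (Finset.mem_univ _)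
    Fin.castSucc_lt_succ.ne]
  · rw [hface, Fin.val_succ, Fin.val_castSucc, pow_succ]
    ring
  · intro i _ hi
    rw [hb _ fun h => ?_, mul_zero]
    rw [augEdges_face] at h
    obtain ⟨l₁, hl₁⟩ := Fin.exists_succAbove_eq hi.1.symm
    obtain ⟨l₂, hl₂⟩ := Fin.exists_succAbove_eq hi.2.symm
    have h2 : l₁ = l₂ := h.injective (by simp only [hl₁, hl₂, hi₀])
    rw [h2, hl₂] at hl₁
    exact Fin.castSucc_lt_succ.ne hl₁.symm

/-! ### Flags: maximal strict chains of trees -/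

section Flags

variable {S : Type u} {m : ℕ}

/-- A tree with internal edges `Y 0, …, Y (m - 1)`. -/
def IsFlag (Y : Fin m → Set S) : Prop := Function.Injective Y ∧ IsNest (Set.range Y)

lemma IsFlag.comp {Y : Fin m → Set S} (hY : IsFlag Y) (π : Equiv.Perm (Fin m)) :
    IsFlag (Y ∘ π) :=
  ⟨hY.1.comp π.injective, by rw [π.surjective.range_comp]; exact hY.2⟩

open Classical in
/-- The indicator function of the chain of trees in which the edges `Y 0, Y 1, …` are added one
after the other. -/
def flagCochain (Y : Fin m → Set S) : RedCochain (TreeChains S) m :=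
  fun x => if augEdges x = fun i => Y '' Set.Iic i then 1 else 0

lemma eq_of_image_Iic {Y Y' : Fin m → Set S} (hY : Function.Injective Y)
    (h : (fun i => Y '' Set.Iic i) = fun i => Y' '' Set.Iic i) : Y = Y' := by
  funext i
  have h1 : Y i ∈ Y' '' Set.Iic i := congrFun h i ▸ ⟨i, Set.self_mem_Iic, rfl⟩
  obtain ⟨j, hj, hij⟩ := h1
  rcases (show j ≤ i from hj).lt_or_eq with h2 | h2
  · have h3 : Y i ∈ Y '' Set.Iic j := by
      rw [congrFun h j, ← hij]
      exact ⟨j, Set.self_mem_Iic, rfl⟩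
    obtain ⟨l, hl, hli⟩ := h3
    have hl : l ≤ j := hl
    rw [hY hli] at hl
    exact absurd (hl.trans_lt h2) (lt_irrefl _)
  · rw [← hij, h2]

lemma strictMono_image_Iic {Y : Fin m → Set S} (hY : Function.Injective Y) :
    StrictMono fun i => Y '' Set.Iic i := fun i j hij =>
  hY.image_strictMono (Set.Iic_ssubset_Iic.2 hij)

lemma ncard_image_Iic {Y : Fin m → Set S} (hY : Function.Injective Y) (i : Fin m) :
    (Y '' Set.Iic i).ncard = i + 1 := by
  rw [Set.ncard_image_of_injective _ hY, ← Finset.coe_Iic, Set.ncard_coe_finset, Fin.card_Iic]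

variable [Finite S] (hS : Nat.card S = m + 2)
include hS

lemma ncard_augEdges {x : AugSimplex (TreeChains S) m} (hx : StrictMono (augEdges x))
    (i : Fin m) : (augEdges x i).ncard = i + 1 :=
  eq_of_strictMono (fun i => (augEdges x i).ncard)
    (fun _ _ h => Set.ncard_lt_ncard (hx h)) (fun i => (Set.ncard_pos).2 (augEdges_nonempty x i))
    (fun i => (isNest_augEdges x i).ncard_le hS) i

lemma exists_flag {x : AugSimplex (TreeChains S) m} (hx : StrictMono (augEdges x)) :
    ∃ Y : Fin m → Set S, IsFlag Y ∧ augEdges x = fun i => Y '' Set.Iic i := by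
  obtain ⟨Y, hY, h⟩ := exists_seq_of_chain (augEdges x) hx.monotone (ncard_augEdges hS hx)
  refine ⟨Y, ⟨hY, ?_⟩, funext h⟩
  cases m with
  | zero => exact ⟨by rintro _ ⟨i, -⟩; exact i.elim0, by rintro _ ⟨i, -⟩; exact i.elim0⟩
  | succ m =>
    refine (isNest_augEdges x (Fin.last m)).mono ?_
    rw [h]
    rintro _ ⟨i, rfl⟩
    exact ⟨i, Fin.le_last i, rfl⟩

/-- Cochains of top degree that vanish on degenerate simplices are cocycles. -/
lemma flagCochain_mem_redCocycle {Y : Fin m → Set S} (hY : Function.Injective Y) :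
    flagCochain Y ∈ redCocycle (TreeChains S) m := by
  refine LinearMap.mem_ker.2 (funext fun x => redCochainD_eq_zero (fun z hz => ?_) fun h => ?_)
  · refine if_neg fun h => hz ?_
    rw [h]
    exact strictMono_image_Iic hY
  -- A strict chain of `m + 1` trees would have `m + 1` different numbers of edges between `1` and
  -- `m`. So the coboundary, being zero on other chains, vanishes.
  · let f : Fin (m + 1) → Fin m := fun i => ⟨(augEdges x i).ncard - 1, by
      have := (isNest_augEdges x i).ncard_le hS
      have := (Set.ncard_pos).2 (augEdges_nonempty x i)
      omega⟩
    have hf : StrictMono f := fun i _ hij => by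
      have h1 := Set.ncard_lt_ncard (h hij)
      have h2 := (Set.ncard_pos).2 (augEdges_nonempty x i)
      simp only [f, Fin.lt_def]
      omega
    have := Fintype.card_le_of_injective f hf.injective
    simp at this

end Flags

/-! ### Relations between flags given by coboundaries -/

section Relations

variable {S : Type u} [Finite S] {j : ℕ} (hS : Nat.card S = j + 3)
include hS

/-- The trees that contain all edges but one of a binary tree. -/
theorem flagCochain_mem_of_relation (N : Submodule ℤ (RedCochain (TreeChains S) (j + 1)))
    (hN : redCoboundary (TreeChains S) (j + 1) ≤ N) (k : Fin (j + 1)) {Y : Fin (j + 1) → Set S}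
    (hY : IsFlag Y) (h : ∀ Y' : Fin (j + 1) → Set S, IsFlag Y' →
      (∀ i, i ≠ k → Y' '' Set.Iic i = Y '' Set.Iic i) → Y' ≠ Y → flagCochain Y' ∈ N) :
    flagCochain Y ∈ N := by
  classical
  have := Fintype.ofFinite S
  let T : Finset (Fin (j + 1) → Set S) := Finset.univ.filter fun Y' => IsFlag Y' ∧
    ∀ i, i ≠ k → Y' '' Set.Iic i = Y '' Set.Iic i
  have hT : ∀ Y', Y' ∈ T ↔ IsFlag Y' ∧ ∀ i, i ≠ k → Y' '' Set.Iic i = Y '' Set.Iic i := by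
    intro Y'
    simp [T]
  -- The indicator of the flag `Y` with its `k`th member omitted. Its coboundary is, up to sign, the
  -- sum of all flags that fill this gap.
  let b : RedCochain (TreeChains S) j := fun z =>
    if augEdges z = fun l => Y '' Set.Iic (k.succAbove l) then 1 else 0
  have hne : ∀ {l : Fin j}, k.succAbove l ≠ k := fun {l} => Fin.succAbove_ne k l
  have key : redCochainD (TreeChains S) j b = (-1 : ℤ) ^ (k : ℕ) • ∑ Y' ∈ T, flagCochain Y' := by
    funext x
    have hL : redCochainD (TreeChains S) j b x = ∑ i : Fin (j + 1), (-1 : ℤ) ^ (i : ℕ) *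
        if (fun l => augEdges x (i.succAbove l)) = fun l => Y '' Set.Iic (k.succAbove l)
          then 1 else 0 := by
      change ∑ i : Fin (j + 1), (-1 : ℤ) ^ (i : ℕ) * b (augFace (TreeChains S) j i x) = _
      refine Finset.sum_congr rfl fun i _ => ?_
      change (-1 : ℤ) ^ (i : ℕ) * (if augEdges (augFace (TreeChains S) j i x) = _ then 1 else 0) = _
      rw [augEdges_face]
    have hR : ((-1 : ℤ) ^ (k : ℕ) • ∑ Y' ∈ T, flagCochain Y') x =
        (-1) ^ (k : ℕ) * ∑ Y' ∈ T, if augEdges x = (fun i => Y' '' Set.Iic i) then 1 else 0 := by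
      rw [Pi.smul_apply, Finset.sum_apply, smul_eq_mul]
      rfl
    rw [hL, hR]
    by_cases hx : StrictMono (augEdges x)
    · obtain ⟨Z, hZ, hxZ⟩ := exists_flag hS hx
      -- The members of a flag have `1, 2, …` edges, so by counting edges only the `k`th face can be
      -- the given chain with a gap at `k`.
      rw [Finset.sum_eq_single k]
      · congr 1
        by_cases hZT : Z ∈ T
        · rw [if_pos, Finset.sum_eq_single Z, if_pos hxZ]
          · intro Y' hY' hne'
            rw [if_neg]
            rw [hxZ]
            intro h'
            exact hne' (eq_of_image_Iic hZ.1 h').symm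
          · exact fun h' => absurd hZT h'
          · funext l
            rw [hxZ]
            exact ((hT Z).1 hZT).2 _ hne
        · rw [if_neg, Finset.sum_eq_zero]
          · intro Y' hY'
            rw [if_neg]
            rw [hxZ]
            intro h'
            rw [eq_of_image_Iic hZ.1 h'] at hZT
            exact hZT hY'
          · intro h'
            refine hZT ((hT Z).2 ⟨hZ, fun i hi => ?_⟩)
            obtain ⟨l, rfl⟩ := Fin.exists_succAbove_eq hi
            rw [← congrFun h' l, hxZ]
      · intro i _ hi
        rw [if_neg, mul_zero]
        intro h'
        refine hi (Fin.succAbove_left_injective (funext fun l => ?_))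
        have h2 := congrArg Set.ncard (congrFun h' l)
        rw [hxZ] at h2
        rw [ncard_image_Iic hZ.1, ncard_image_Iic hY.1] at h2
        exact Fin.ext (by omega)
      · simp
    · have hright : ∑ Y' ∈ T, (if augEdges x = (fun i => Y' '' Set.Iic i) then (1 : ℤ) else 0) =
          0 := by
        refine Finset.sum_eq_zero fun Y' hY' => if_neg fun h' => hx ?_
        rw [h']
        exact strictMono_image_Iic ((hT Y').1 hY').1.1
      rw [← hL, hright, mul_zero]
      refine redCochainD_eq_zero (fun z hz => if_neg fun h' => hz ?_) hx
      rw [h']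
      exact (strictMono_image_Iic hY.1).comp (Fin.strictMono_succAbove k)
  have hYT : Y ∈ T := (hT Y).2 ⟨hY, fun _ _ => rfl⟩
  have hsum : ∑ Y' ∈ T, flagCochain Y' ∈ N := by
    have h1 : (-1 : ℤ) ^ (k : ℕ) • redCochainD (TreeChains S) j b ∈ N :=
      N.smul_mem _ (hN ⟨b, rfl⟩)
    rwa [key, smul_smul, ← mul_pow, neg_one_mul, neg_neg, one_pow, one_smul] at h1
  rw [← Finset.add_sum_erase T _ hYT] at hsum
  refine (N.add_mem_iff_left (N.sum_mem fun Y' hY' => ?_)).1 hsum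
  obtain ⟨h1, h2⟩ := Finset.mem_erase.1 hY'
  exact h Y' ((hT Y').1 h2).1 ((hT Y').1 h2).2 h1

end Relations

/-! ### Combs span the cohomology -/

section Spanning

variable {S : Type u}

/-- The internal edges of the comb given by a word, from top to bottom. -/
def combFlag {m : ℕ} (w : Fin (m + 2) ≃ S) (i : Fin m) : Set S := initialSet w (i + 1)

lemma isFlag_combFlag {m : ℕ} (w : Fin (m + 2) ≃ S) : IsFlag (combFlag w) := by
  refine ⟨fun i j h => ?_, ?_, ?_⟩
  · have := initialSet_inj w (by omega) (by omega) h
    exact Fin.ext (by omega)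
  · rintro _ ⟨i, rfl⟩
    exact isProper_initialSet w (by omega) (by omega)
  · rintro _ ⟨i, rfl⟩ _ ⟨j, rfl⟩
    rcases le_total i j with h | h
    · exact .inl (initialSet_mono w (by simpa using h))
    · exact .inr (.inl (initialSet_mono w (by simpa using h)))

/-- A gap that is not at the end lies between two sets of edges that differ by two edges. It can be
filled in two ways only, according to which edge is added earlier. -/
lemma eq_comp_swap {j : ℕ} {Y Y' : Fin (j + 1) → Set S} (hY : Function.Injective Y)
    (hY' : Function.Injective Y') (k : Fin j)
    (h : ∀ i, i ≠ k.castSucc → Y' '' Set.Iic i = Y '' Set.Iic i) (hne : Y' ≠ Y) :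
    Y' = Y ∘ Equiv.swap k.castSucc k.succ := by
  have hpq : k.succ ≠ k.castSucc := Fin.castSucc_lt_succ.ne'
  have hle : ∀ a c, c ≠ k.castSucc → a ≤ c → ∃ b, b ≤ c ∧ Y' a = Y b := fun a c hc hac => by
    have h1 : Y' a ∈ Y '' Set.Iic c := h c hc ▸ ⟨a, hac, rfl⟩
    obtain ⟨b, hb, h2⟩ := h1
    exact ⟨b, hb, h2.symm⟩
  have hge : ∀ i b c, c ≠ k.castSucc → b ≤ c → Y' i = Y b → i ≤ c := fun i b c hc hbc hib => by
    have h1 : Y b ∈ Y' '' Set.Iic c := h c hc ▸ ⟨b, hbc, rfl⟩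
    obtain ⟨a, ha, h2⟩ := h1
    rw [← hY' (h2.trans hib.symm)]
    exact ha
  have hother : ∀ i, i ≠ k.castSucc → i ≠ k.succ → Y' i = Y i := by
    intro i hi hi'
    obtain ⟨b, hb, h1⟩ := hle i i hi le_rfl
    by_cases hbp : b = k.castSucc
    · have h2 := hge i b k.succ hpq (hbp ▸ Fin.castSucc_lt_succ.le) h1
      rw [hbp] at hb
      exfalso
      rw [Fin.le_def, Fin.val_succ] at h2
      rw [Fin.le_def, Fin.val_castSucc] at hb
      rw [ne_eq, Fin.ext_iff, Fin.val_castSucc] at hi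
      rw [ne_eq, Fin.ext_iff, Fin.val_succ] at hi'
      omega
    · rw [h1, le_antisymm hb (hge i b b hbp le_rfl h1)]
  have hq : Y' k.succ = Y k.castSucc ∨ Y' k.succ = Y k.succ := by
    obtain ⟨b, hb, h1⟩ := hle k.succ k.succ hpq le_rfl
    by_cases hbp : b = k.castSucc
    · exact .inl (hbp ▸ h1)
    · right
      rw [h1, le_antisymm hb (hge _ b b hbp le_rfl h1)]
  have hp : Y' k.castSucc = Y k.castSucc ∨ Y' k.castSucc = Y k.succ := by
    obtain ⟨b, hb, h1⟩ := hle k.castSucc k.succ hpq Fin.castSucc_lt_succ.le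
    by_cases hbp : b = k.castSucc
    · exact .inl (hbp ▸ h1)
    · right
      have h2 := lt_of_le_of_ne (hge _ b b hbp le_rfl h1) (Ne.symm hbp)
      rw [h1, le_antisymm hb (Fin.castSucc_lt_iff_succ_le.1 h2)]
  have hp' : Y' k.castSucc = Y k.succ := hp.resolve_left fun h1 => hne <| by
    have h2 : Y' k.succ = Y k.succ := hq.resolve_left fun h2 => hpq (hY' (h2.trans h1.symm))
    funext i
    by_cases hi : i = k.castSucc
    · rw [hi, h1]
    · by_cases hi' : i = k.succ
      · rw [hi', h2]
      · exact hother i hi hi'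
  have hq' : Y' k.succ = Y k.castSucc :=
    hq.resolve_right fun h2 => hpq (hY' (h2.trans hp'.symm))
  funext i
  rw [Function.comp_apply]
  by_cases hi : i = k.castSucc
  · rw [hi, Equiv.swap_apply_left, hp']
  · by_cases hi' : i = k.succ
    · rw [hi', Equiv.swap_apply_right, hq']
    · rw [Equiv.swap_apply_of_ne_of_ne hi hi', hother i hi hi']

variable [Finite S]

/-- For a gap before the end the relation has two terms, so interchanging two consecutive edges
changes the sign modulo coboundaries. These transpositions generate all reorderings. -/
lemma flagCochain_mem_of_comp {j : ℕ} (hS : Nat.card S = j + 3)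
    (N : Submodule ℤ (RedCochain (TreeChains S) (j + 1)))
    (hN : redCoboundary (TreeChains S) (j + 1) ≤ N) (π : Equiv.Perm (Fin (j + 1))) :
    ∀ Y : Fin (j + 1) → Set S, IsFlag Y → flagCochain (Y ∘ π) ∈ N → flagCochain Y ∈ N := by
  have hπ : π ∈ Submonoid.closure
      (Set.range fun i : Fin j => Equiv.swap i.castSucc i.succ) := by
    rw [Equiv.Perm.mclosure_swap_castSucc_succ]
    trivial
  induction hπ using Submonoid.closure_induction with
  | mem π hπ =>
    obtain ⟨k, rfl⟩ := hπ
    intro Y hY hmem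
    refine flagCochain_mem_of_relation hS N hN k.castSucc hY fun Y' hY' h hne => ?_
    rwa [eq_comp_swap hY.1 hY'.1 k h hne]
  | one => exact fun Y _ h => h
  | mul π π' _ _ ih ih' =>
    intro Y hY h
    exact ih Y hY (ih' _ (hY.comp π) h)

/-- A tree all of whose internal edges lie below the twig `s` is a comb. -/
lemma exists_combFlag {m : ℕ} (hS : Nat.card S = m + 2) {s : S} {Y : Fin m → Set S}
    (hY : IsFlag Y) (hs : ∀ i, s ∈ Y i) :
    ∃ (π : Equiv.Perm (Fin m)) (w : WordsFrom s m), Y ∘ π = combFlag w.1 := by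
  have hprop : ∀ i, IsProper (Y i) := fun i => hY.2.1 _ ⟨i, rfl⟩
  have hgt : ∀ i, 1 < (Y i).ncard := fun i => Set.one_lt_ncard_iff_nontrivial.2 (hprop i).1
  have hlt : ∀ i, (Y i).ncard < m + 2 := fun i => by
    rw [← hS, ← Set.ncard_univ]
    exact Set.ncard_lt_ncard (Set.ssubset_univ_iff.2 (hprop i).2)
  have hlam : ∀ i j, (Y i).ncard ≤ (Y j).ncard → Y i ⊆ Y j := fun i j h => by
    rcases hY.2.2 _ ⟨i, rfl⟩ _ ⟨j, rfl⟩ with h1 | h1 | h1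
    · exact h1
    · rw [Set.eq_of_subset_of_ncard_le h1 h]
    · exact absurd (hs j) (Set.disjoint_left.1 h1 (hs i))
  let f : Fin m → Fin m := fun i => ⟨(Y i).ncard - 2, by have := hgt i; have := hlt i; omega⟩
  have hf : Function.Injective f := fun i j hij => by
    have h1 := congrArg Fin.val hij
    have h2 := hgt i
    have h3 := hgt j
    simp only [f] at h1
    exact hY.1 ((hlam i j (by omega)).antisymm (hlam j i (by omega)))
  let φ : Equiv.Perm (Fin m) := Equiv.ofBijective f ⟨hf, Finite.injective_iff_surjective.1 hf⟩
  have hφ : ∀ i, (Y (φ.symm i)).ncard = i + 2 := fun i => by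
    have h1 : (f (φ.symm i)).val = i := congrArg Fin.val (φ.apply_symm_apply i)
    have h2 := hgt (φ.symm i)
    simp only [f] at h1
    omega
  obtain ⟨w, hw⟩ := exists_word hS (fun k => if k = 0 then {s} else
      if h : k - 1 < m then Y (φ.symm ⟨k - 1, h⟩) else Set.univ)
    (fun k hk => by
      split_ifs with h1 h2
      · rw [h1, Set.ncard_singleton]
      · rw [hφ]
        simp only
        omega
      · rw [Set.ncard_univ, hS]
        omega)
    (fun k hk => by
      rw [if_neg (Nat.succ_ne_zero k)]
      split_ifs with h1 h2 h2 h3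
      · exact Set.singleton_subset_iff.2 (hs _)
      · exact Set.subset_univ _
      · refine hlam _ _ ?_
        rw [hφ, hφ]
        simp only
        omega
      · exact Set.subset_univ _
      · omega
      · exact Set.subset_univ _)
  refine ⟨φ.symm, ⟨w, ?_⟩, funext fun i => ?_⟩
  · have := hw 0 (Nat.zero_le _)
    rw [initialSet_zero, if_pos rfl] at this
    exact Set.singleton_injective this
  · rw [combFlag, hw _ (by omega), if_neg (by omega), dif_pos (by omega)]
    rfl

/-- All flags are integral combinations of combs, up to coboundaries. -/
theorem flagCochain_mem {m : ℕ} (hS : Nat.card S = m + 2) (s : S)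
    (N : Submodule ℤ (RedCochain (TreeChains S) m))
    (hN : redCoboundary (TreeChains S) m ≤ N)
    (hN' : ∀ w : WordsFrom s m, flagCochain (combFlag w.1) ∈ N) {Y : Fin m → Set S}
    (hY : IsFlag Y) : flagCochain Y ∈ N := by
  classical
  have hmain : ∀ Y : Fin m → Set S, IsFlag Y → (∀ i, s ∈ Y i) → ∃ π : Equiv.Perm (Fin m),
      flagCochain (Y ∘ π) ∈ N := fun Y hY hs => by
    obtain ⟨π, w, h⟩ := exists_combFlag hS hY hs
    exact ⟨π, h ▸ hN' w⟩
  rcases m with _ | j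
  · obtain ⟨π, h⟩ := hmain Y hY fun i => i.elim0
    rwa [show Y ∘ π = Y from funext fun i => i.elim0] at h
  have hcomp := flagCochain_mem_of_comp (j := j) hS N hN
  -- Induction on the number of edges that avoid `s`; if there are none, the tree is a comb.
  induction hn : (Finset.univ.filter fun i => s ∉ Y i).card using Nat.strong_induction_on
    generalizing Y with
  | _ n ih =>
    by_cases hs : ∀ i, s ∈ Y i
    · obtain ⟨π, h⟩ := hmain Y hY hs
      exact hcomp π Y hY h
    push Not at hs
    -- A largest edge `A` avoiding `s` is moved to the end of the flag. The relation for the last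
    -- gap then replaces `A` by other edges `B` compatible with the remaining ones.
    obtain ⟨i₀, hi₀, hmax⟩ := Finset.exists_max_image (Finset.univ.filter fun i => s ∉ Y i)
      (fun i => (Y i).ncard) (by obtain ⟨i, hi⟩ := hs; exact ⟨i, by simpa using hi⟩)
    have hi₀ : s ∉ Y i₀ := (Finset.mem_filter.1 hi₀).2
    have hmax : ∀ i, s ∉ Y i → (Y i).ncard ≤ (Y i₀).ncard := fun i hi =>
      hmax i (by simpa using hi)
    let π : Equiv.Perm (Fin (j + 1)) := Equiv.swap i₀ (Fin.last j)
    have hπ : π (Fin.last j) = i₀ := Equiv.swap_apply_right _ _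
    refine hcomp π Y hY ?_
    have hYπ := hY.comp π
    refine flagCochain_mem_of_relation hS N hN (Fin.last j) hYπ fun Z hZ hZY hne => ?_
    have hlt : ∀ i, i ≠ Fin.last j → Z i = Y (π i) := by
      intro i hi
      obtain ⟨i, rfl⟩ := Fin.exists_castSucc_eq.2 hi
      have h1 : (fun l : Fin j => (Z ∘ Fin.castSucc) '' Set.Iic l) =
          fun l => ((Y ∘ π) ∘ Fin.castSucc) '' Set.Iic l := funext fun l => by
        have h2 := hZY l.castSucc (Fin.castSucc_lt_last l).ne
        have h3 : Fin.castSucc '' Set.Iic l = Set.Iic l.castSucc := by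
          ext c
          constructor
          · rintro ⟨c, hc, rfl⟩
            exact Fin.castSucc_le_castSucc_iff.2 hc
          · intro hc
            have hc : c ≤ l.castSucc := hc
            obtain ⟨c, rfl⟩ := Fin.exists_castSucc_eq.2 (hc.trans_lt (Fin.castSucc_lt_last l)).ne
            exact ⟨c, Fin.castSucc_le_castSucc_iff.1 hc, rfl⟩
        rw [Set.image_comp Z, Set.image_comp (Y ∘ π), h3, h2]
      exact congrFun (eq_of_image_Iic (hZ.1.comp (Fin.castSucc_injective _)) h1) i
    have hYZ : ∀ i, i ≠ i₀ → Y i = Z (π i) := fun i hi => by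
      have h1 : π i ≠ Fin.last j := fun h =>
        hi (π.injective (h.trans (Equiv.swap_apply_left i₀ (Fin.last j)).symm))
      rw [hlt (π i) h1, Equiv.swap_apply_self]
    set A := Y i₀
    set B := Z (Fin.last j)
    have hBA : B ≠ A := by
      intro h
      refine hne (funext fun i => ?_)
      by_cases hi : i = Fin.last j
      · rw [hi, Function.comp_apply, hπ]
        exact h
      · exact hlt i hi
    have hBY : ∀ i, B ≠ Y i := fun i h => by
      by_cases hi : i = i₀
      · rw [hi] at h
        exact hBA h
      · rw [hYZ i hi] at h
        have h1 := hZ.1 h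
        rw [← (Equiv.swap_apply_left i₀ (Fin.last j) : π i₀ = _)] at h1
        exact hi (π.injective h1).symm
    have hBlam : ∀ i, i ≠ i₀ → Y i ⊆ B ∨ B ⊆ Y i ∨ Disjoint (Y i) B := fun i hi => by
      rw [hYZ i hi]
      exact hZ.2.2 _ ⟨_, rfl⟩ _ ⟨_, rfl⟩
    have hBprop : IsProper B := hZ.2.1 _ ⟨_, rfl⟩
    -- a further edge that is compatible with all edges of `Y` belongs to `Y`
    have hfull : ∀ C : Set S, IsProper C → (∀ i, Y i ⊆ C ∨ C ⊆ Y i ∨ Disjoint (Y i) C) →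
        ∃ i, C = Y i := by
      intro C hC hlam
      by_contra hnot
      push Not at hnot
      have hnest : IsNest (insert C (Set.range Y)) := by
        refine ⟨?_, ?_⟩
        · rintro D (rfl | hD)
          · exact hC
          · exact hY.2.1 D hD
        · rintro D (rfl | hD) E (rfl | hE)
          · exact .inl subset_rfl
          · obtain ⟨i, rfl⟩ := hE
            rcases hlam i with h | h | h
            · exact .inr (.inl h)
            · exact .inl h
            · exact .inr (.inr h.symm)
          · obtain ⟨i, rfl⟩ := hD
            exact hlam i
          · exact hY.2.2 D hD E hE
      have h1 := hnest.ncard_le hS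
      rw [Set.ncard_insert_of_notMem (by rintro ⟨i, hi⟩; exact hnot i hi.symm),
        ← Set.image_univ, Set.ncard_image_of_injective _ hY.1, Set.ncard_univ, Nat.card_fin] at h1
      omega
    -- If `B` avoided `s`, it would cross `A`, as the tree `Y` is full. Then `A ∪ B` would be
    -- compatible with all edges of `Y`, hence an edge of `Y` avoiding `s` and larger than `A`.
    have hsB : s ∈ B := by
      by_contra hsB
      have hcross : ¬ (A ⊆ B ∨ B ⊆ A ∨ Disjoint A B) := fun hAB => by
        obtain ⟨i, hi⟩ := hfull B hBprop fun i => by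
          by_cases hi : i = i₀
          · rw [hi]
            exact hAB
          · exact hBlam i hi
        exact hBY i hi
      push Not at hcross
      obtain ⟨hc1, hc2, hc3⟩ := hcross
      have hAprop : IsProper A := hY.2.1 _ ⟨i₀, rfl⟩
      obtain ⟨i, hi⟩ := hfull (A ∪ B) ⟨hAprop.1.mono Set.subset_union_left, fun h => by
          have : s ∈ A ∪ B := h ▸ trivial
          exact this.elim hi₀ hsB⟩ fun i => by
        by_cases hi : i = i₀
        · rw [hi]
          exact .inl Set.subset_union_left
        rcases hY.2.2 _ ⟨i, rfl⟩ A ⟨i₀, rfl⟩ with h1 | h1 | h1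
        · exact .inl (h1.trans Set.subset_union_left)
        · rcases hBlam i hi with h2 | h2 | h2
          · exact .inl (h2.trans Set.subset_union_right)
          · exact .inr (.inl (Set.union_subset h1 h2))
          · exact absurd (h2.mono_left h1) hc3
        · rcases hBlam i hi with h2 | h2 | h2
          · exact .inl (h2.trans Set.subset_union_right)
          · exact absurd (h1.symm.mono_right h2) hc3
          · exact .inr (.inr (Set.disjoint_union_right.2 ⟨h1, h2⟩))
      have h1 := hmax i (hi ▸ fun h => h.elim hi₀ hsB)
      rw [← hi] at h1
      have h2 := Set.eq_of_subset_of_ncard_le (Set.subset_union_left (s := A) (t := B)) h1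
      exact hc2 (h2 ▸ Set.subset_union_right)
    -- Replacing `A` by an edge through `s` lowers the number of edges that avoid `s`.
    refine ih _ ?_ hZ rfl
    rw [← hn]
    refine lt_of_lt_of_le (b := ((Finset.univ.filter fun i => s ∉ Y i).erase i₀).card + 1)
      (Nat.lt_succ_of_le (Finset.card_le_card_of_injOn π (fun i hi => ?_) π.injective.injOn))
      (Finset.card_erase_add_one (by simpa using hi₀)).le
    have hi : s ∉ Z i := by simpa using hi
    have hil : i ≠ Fin.last j := fun h => hi (h ▸ hsB)
    rw [hlt i hil] at hi
    simp only [Finset.coe_erase, Finset.coe_filter, Finset.mem_univ, true_and]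
    exact ⟨hi, fun h => hil (π.injective (h.trans hπ.symm))⟩

/-- Each cocycle of top degree is a combination of flags, up to coboundaries. -/
theorem cocycle_mem {m : ℕ} (hS : Nat.card S = m + 2) (s : S)
    (N : Submodule ℤ (RedCochain (TreeChains S) m))
    (hN : redCoboundary (TreeChains S) m ≤ N)
    (hN' : ∀ w : WordsFrom s m, flagCochain (combFlag w.1) ∈ N)
    {c : RedCochain (TreeChains S) m} (hc : c ∈ redCocycle (TreeChains S) m) : c ∈ N := by
  classical
  have := Fintype.ofFinite S
  obtain ⟨c', hcc', hdeg⟩ := exists_normalized m c hc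
  refine (N.sub_mem_iff_left ?_).1 (hN hcc')
  -- A normalized cocycle vanishes on chains with repetitions, and the strict chains of this length
  -- are flags; so it is the sum of the indicators of flags weighted by its values.
  have key : c' = ∑ Y : Fin m → Set S, if h : IsFlag Y ∧ ∃ x : AugSimplex (TreeChains S) m,
      augEdges x = fun i => Y '' Set.Iic i then c' h.2.choose • flagCochain Y else 0 := by
    funext x
    rw [Finset.sum_apply]
    by_cases hx : StrictMono (augEdges x)
    · obtain ⟨Y, hY, hxY⟩ := exists_flag hS hx
      have hex : ∃ x : AugSimplex (TreeChains S) m, augEdges x = fun i => Y '' Set.Iic i :=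
        ⟨x, hxY⟩
      rw [Finset.sum_eq_single Y, dif_pos ⟨hY, hex⟩]
      · rw [Pi.smul_apply, flagCochain, if_pos hxY, smul_eq_mul, mul_one]
        exact congrArg c' (augEdges_injective (hxY.trans hex.choose_spec.symm))
      · intro Y' _ hne
        split_ifs with h
        · rw [Pi.smul_apply, flagCochain, if_neg, smul_zero]
          rw [hxY]
          exact fun h' => hne (eq_of_image_Iic hY.1 h').symm
        · rfl
      · simp
    · rw [Finset.sum_eq_zero]
      · rcases m with _ | _ | n
        · exact absurd (fun i => i.elim0) hx
        · exact absurd (fun i j hij => absurd (Fin.lt_def.1 hij) (by omega)) hx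
        · have h1 : ∃ i : Fin (n + 1), augEdges x i.castSucc = augEdges x i.succ := by
            by_contra h2
            push Not at h2
            exact hx (Fin.strictMono_iff_lt_succ.2 fun i => lt_of_le_of_ne
              (augEdges_mono x Fin.castSucc_lt_succ.le) (h2 i))
          obtain ⟨i, hi⟩ := h1
          obtain ⟨y, rfl⟩ := exists_degenerate x i hi
          exact hdeg n rfl i y
      · intro Y _
        split_ifs with h
        · rw [Pi.smul_apply, flagCochain, if_neg, smul_zero]
          intro h'
          exact hx (h' ▸ strictMono_image_Iic h.1.1)
        · rfl
  rw [key]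
  refine N.sum_mem fun Y _ => ?_
  split_ifs with h
  · exact N.smul_mem _ (flagCochain_mem hS s N hN hN' h.1)
  · exact N.zero_mem

end Spanning

/-! ### The sphere of bracketings of a word -/

section Blocks

variable {S : Type u} {m : ℕ}

/-- All gaps between the positions `i` and `j` belong to `G`. -/
def Linked (G : Set (Fin (m + 1))) (i j : Fin (m + 2)) : Prop :=
  ∀ g : Fin (m + 1), min i.val j.val ≤ g.val → g.val < max i.val j.val → g ∈ G

lemma Linked.refl (G : Set (Fin (m + 1))) (i : Fin (m + 2)) : Linked G i i := by
  intro g h1 h2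
  omega

lemma Linked.symm {G : Set (Fin (m + 1))} {i j : Fin (m + 2)} (h : Linked G i j) :
    Linked G j i := fun g h1 h2 => h g (by omega) (by omega)

lemma Linked.trans {G : Set (Fin (m + 1))} {i j l : Fin (m + 2)} (h : Linked G i j)
    (h' : Linked G j l) : Linked G i l := fun g h1 h2 => by
  by_cases h3 : min i.val j.val ≤ g.val ∧ g.val < max i.val j.val
  · exact h g h3.1 h3.2
  · exact h' g (by omega) (by omega)

lemma Linked.mono {G G' : Set (Fin (m + 1))} (hG : G ⊆ G') {i j : Fin (m + 2)}
    (h : Linked G i j) : Linked G' i j := fun g h1 h2 => hG (h g h1 h2)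

lemma linked_castSucc_succ {G : Set (Fin (m + 1))} {g : Fin (m + 1)} :
    Linked G g.castSucc g.succ ↔ g ∈ G := by
  refine ⟨fun h => h g (by simp) (by simp), fun h g' h1 h2 => ?_⟩
  simp only [Fin.val_castSucc, Fin.val_succ] at h1 h2
  rwa [show g' = g from Fin.ext (by omega)]

/-- The set of letters that are linked to position `i`. -/
def block (w : Fin (m + 2) ≃ S) (G : Set (Fin (m + 1))) (i : Fin (m + 2)) : Set S :=
  Set.ofPred fun a => Linked G i (w.symm a)

/-- The nontrivial blocks of the partition in which neighbours across gaps in `G` are joined. -/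
def blocks (w : Fin (m + 2) ≃ S) (G : Set (Fin (m + 1))) : Set (Set S) :=
  Set.ofPred fun A => A.Nontrivial ∧ ∃ i, A = block w G i

variable {w : Fin (m + 2) ≃ S} {G G' : Set (Fin (m + 1))}

lemma apply_mem_block {i j : Fin (m + 2)} : w j ∈ block w G i ↔ Linked G i j := by
  change Linked G i (w.symm (w j)) ↔ _
  rw [w.symm_apply_apply]

lemma block_mem_blocks {g : Fin (m + 1)} (hg : g ∈ G) : block w G g.castSucc ∈ blocks w G :=
  ⟨⟨w g.castSucc, apply_mem_block.2 (.refl _ _), w g.succ,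
    apply_mem_block.2 (linked_castSucc_succ.2 hg),
    fun h => Fin.castSucc_lt_succ.ne (w.injective h)⟩, _, rfl⟩

lemma subset_or_disjoint_of_blocks (hG : G ⊆ G') {A B : Set S} (hA : A ∈ blocks w G)
    (hB : B ∈ blocks w G') : A ⊆ B ∨ Disjoint A B := by
  obtain ⟨-, i, rfl⟩ := hA
  obtain ⟨-, j, rfl⟩ := hB
  by_cases h : Linked G' i j
  · exact .inl fun a ha => h.symm.trans (Linked.mono hG ha)
  · refine .inr (Set.disjoint_left.2 fun a ha hb => h ?_)
    exact (Linked.mono hG ha).trans (Linked.symm hb)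

lemma isProper_of_mem_blocks (hG : G ≠ Set.univ) {A : Set S} (hA : A ∈ blocks w G) :
    IsProper A := by
  obtain ⟨h1, i, rfl⟩ := hA
  refine ⟨h1, fun h2 => hG (Set.eq_univ_of_forall fun g => linked_castSucc_succ.1 ?_)⟩
  have h3 : ∀ j, Linked G i j := fun j => apply_mem_block.1 (h2 ▸ Set.mem_univ (w j))
  exact (h3 _).symm.trans (h3 _)

/-- The first `q + 1` gaps in the order given by `ρ`. -/
def gapSet (ρ : Equiv.Perm (Fin (m + 1))) (q : ℕ) : Set (Fin (m + 1)) :=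
  Set.ofPred fun g => (ρ.symm g).val ≤ q

lemma gapSet_mono (ρ : Equiv.Perm (Fin (m + 1))) {q q' : ℕ} (h : q ≤ q') :
    gapSet ρ q ⊆ gapSet ρ q' := fun _ hg => le_trans hg h

lemma gapSet_ne_univ (ρ : Equiv.Perm (Fin (m + 1))) {q : ℕ} (h : q < m) :
    gapSet ρ q ≠ Set.univ := fun h1 => by
  have h2 : ρ (Fin.last m) ∈ gapSet ρ q := h1 ▸ Set.mem_univ _
  change (ρ.symm (ρ (Fin.last m))).val ≤ q at h2
  rw [ρ.symm_apply_apply, Fin.val_last] at h2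
  omega

lemma apply_mem_gapSet {ρ : Equiv.Perm (Fin (m + 1))} {q : ℕ} {i : Fin (m + 1)} :
    ρ i ∈ gapSet ρ q ↔ i.val ≤ q := by
  change (ρ.symm (ρ i)).val ≤ q ↔ _
  rw [ρ.symm_apply_apply]

/-- The chain of trees whose edges are the blocks of the partitions that belong to the sets
`gapSet ρ (τ 0)`, `gapSet ρ (τ 1)`, …. -/
def wordFlag (w : Fin (m + 2) ≃ S) (ρ : Equiv.Perm (Fin (m + 1))) (τ : Equiv.Perm (Fin m))
    (k : Fin m) : Set (Set S) :=
  Set.ofPred fun A => ∃ i ≤ k, A ∈ blocks w (gapSet ρ (τ i))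

lemma exists_wordSimplex (w : Fin (m + 2) ≃ S) (ρ : Equiv.Perm (Fin (m + 1)))
    (τ : Equiv.Perm (Fin m)) :
    ∃ x : AugSimplex (TreeChains S) m, augEdges x = wordFlag w ρ τ := by
  refine exists_augEdges (by rw [← Nat.card_congr w, Nat.card_fin]; omega) _ ?_ ?_ ?_
  · rintro k l hkl A ⟨i, hi, hA⟩
    exact ⟨i, hi.trans hkl, hA⟩
  · exact fun k => ⟨_, k, le_rfl, block_mem_blocks (apply_mem_gapSet.2 (Nat.zero_le _) :
      ρ 0 ∈ gapSet ρ (τ k))⟩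
  · refine fun k => ⟨?_, ?_⟩
    · rintro A ⟨i, -, hA⟩
      exact isProper_of_mem_blocks (gapSet_ne_univ ρ (τ i).2) hA
    · rintro A ⟨i, -, hA⟩ B ⟨j, -, hB⟩
      rcases le_total (τ i) (τ j) with h | h
      · exact (subset_or_disjoint_of_blocks (gapSet_mono ρ h) hA hB).imp_right .inr
      · exact .inr ((subset_or_disjoint_of_blocks (gapSet_mono ρ h) hB hA).imp_right
          fun h => h.symm)

/-- The chain `wordFlag w ρ τ` as an augmented simplex. -/
def wordSimplex (w : Fin (m + 2) ≃ S) (ρ : Equiv.Perm (Fin (m + 1))) (τ : Equiv.Perm (Fin m)) :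
    AugSimplex (TreeChains S) m := (exists_wordSimplex w ρ τ).choose

lemma augEdges_wordSimplex (w : Fin (m + 2) ≃ S) (ρ : Equiv.Perm (Fin (m + 1)))
    (τ : Equiv.Perm (Fin m)) : augEdges (wordSimplex w ρ τ) = wordFlag w ρ τ :=
  (exists_wordSimplex w ρ τ).choose_spec

/-- Evaluation on the fundamental class of the sphere of bracketings of the word `w`. -/
def wordPairing (w : Fin (m + 2) ≃ S) : RedCochain (TreeChains S) m →ₗ[ℤ] ℤ where
  toFun c := ∑ ρ : Equiv.Perm (Fin (m + 1)), ∑ τ : Equiv.Perm (Fin m),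
    (Equiv.Perm.sign ρ * Equiv.Perm.sign τ : ℤ) * c (wordSimplex w ρ τ)
  map_add' c c' := by simp only [Pi.add_apply, mul_add, Finset.sum_add_distrib]
  map_smul' a c := by
    simp only [Pi.smul_apply, smul_eq_mul, Finset.mul_sum, RingHom.id_apply, mul_left_comm a]

lemma wordPairing_apply (w : Fin (m + 2) ≃ S) (c : RedCochain (TreeChains S) m) :
    wordPairing w c = ∑ ρ : Equiv.Perm (Fin (m + 1)), ∑ τ : Equiv.Perm (Fin m),
      (Equiv.Perm.sign ρ * Equiv.Perm.sign τ : ℤ) * c (wordSimplex w ρ τ) := rfl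

lemma sum_sign_eq_zero {n : ℕ} (f : Equiv.Perm (Fin n) → ℤ) (a b : Fin n) (hab : a ≠ b)
    (hf : ∀ τ, f (τ * Equiv.swap a b) = f τ) :
    ∑ τ : Equiv.Perm (Fin n), (Equiv.Perm.sign τ : ℤ) * f τ = 0 := by
  have h := Equiv.sum_comp (Equiv.mulRight (Equiv.swap a b))
    fun τ : Equiv.Perm (Fin n) => (Equiv.Perm.sign τ : ℤ) * f τ
  simp only [Equiv.coe_mulRight, hf, Equiv.Perm.sign_mul, Equiv.Perm.sign_swap hab, mul_neg,
    mul_one, Units.val_neg, neg_mul, Finset.sum_neg_distrib] at h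
  omega

/-- The evaluation vanishes on coboundaries. -/
theorem wordPairing_coboundary (w : Fin (m + 2) ≃ S) {c : RedCochain (TreeChains S) m}
    (hc : c ∈ redCoboundary (TreeChains S) m) : wordPairing w c = 0 := by
  rcases m with _ | j
  · have h : c = 0 := hc
    rw [h, map_zero]
  obtain ⟨b, rfl⟩ := hc
  have h1 : ∀ i : Fin (j + 1), ∑ ρ : Equiv.Perm (Fin (j + 2)), ∑ τ : Equiv.Perm (Fin (j + 1)),
      (Equiv.Perm.sign ρ * Equiv.Perm.sign τ : ℤ) *
        b (augFace (TreeChains S) j i (wordSimplex w ρ τ)) = 0 := by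
    intro i
    have hface : ∀ (ρ ρ' : Equiv.Perm (Fin (j + 2))) (τ τ' : Equiv.Perm (Fin (j + 1))),
        (∀ l, l ≠ i → wordFlag w ρ τ l = wordFlag w ρ' τ' l) →
        b (augFace (TreeChains S) j i (wordSimplex w ρ τ)) =
          b (augFace (TreeChains S) j i (wordSimplex w ρ' τ')) := fun ρ ρ' τ τ' h => by
      refine congrArg b (augEdges_injective ?_)
      rw [augEdges_face, augEdges_face, augEdges_wordSimplex, augEdges_wordSimplex]
      exact funext fun l => h _ (Fin.succAbove_ne i l)
    by_cases hi : i = Fin.last j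
    -- The last face forgets the partition with index `τ i`. Interchanging the gaps in positions `τ
    -- i` and `τ i + 1` of `ρ` affects this partition only, so the terms cancel in pairs.
    · rw [Finset.sum_comm]
      refine Finset.sum_eq_zero fun τ _ => ?_
      have h2 := sum_sign_eq_zero (fun ρ => (Equiv.Perm.sign τ : ℤ) *
        b (augFace (TreeChains S) j i (wordSimplex w ρ τ)))
        (τ i).castSucc (τ i).succ Fin.castSucc_lt_succ.ne
        fun ρ => by
          refine congrArg _ (hface _ _ _ _ fun l hl => ?_)
          have h3 : ∀ a ≤ l, gapSet (ρ * Equiv.swap (τ i).castSucc (τ i).succ) (τ a) =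
              gapSet ρ (τ a) := by
            intro a ha
            have hne : τ a ≠ τ i := fun h => by
              rw [τ.injective h, hi] at ha
              exact hl (hi ▸ Fin.last_le_iff.1 ha)
            have hne' : (τ a).val ≠ (τ i).val := fun h => hne (Fin.ext h)
            ext g
            change (Equiv.swap (τ i).castSucc (τ i).succ (ρ.symm g)).val ≤ _ ↔
              (ρ.symm g).val ≤ _
            rcases eq_or_ne (ρ.symm g) (τ i).castSucc with h4 | h4
            · rw [h4, Equiv.swap_apply_left, Fin.val_castSucc, Fin.val_succ]
              omega
            rcases eq_or_ne (ρ.symm g) (τ i).succ with h5 | h5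
            · rw [h5, Equiv.swap_apply_right, Fin.val_castSucc, Fin.val_succ]
              omega
            rw [Equiv.swap_apply_of_ne_of_ne h4 h5]
          ext A
          constructor
          · rintro ⟨a, ha, hA⟩
            exact ⟨a, ha, h3 a ha ▸ hA⟩
          · rintro ⟨a, ha, hA⟩
            exact ⟨a, ha, (h3 a ha).symm ▸ hA⟩
      simpa only [mul_assoc] using h2
    -- Any other face forgets in which order two consecutive partitions are added, so interchanging
    -- them in `τ` cancels the terms in pairs.
    · refine Finset.sum_eq_zero fun ρ _ => ?_
      obtain ⟨i, rfl⟩ := Fin.exists_castSucc_eq.2 hi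
      have h2 := sum_sign_eq_zero (fun τ => (Equiv.Perm.sign ρ : ℤ) *
        b (augFace (TreeChains S) j i.castSucc (wordSimplex w ρ τ)))
        i.castSucc i.succ
        Fin.castSucc_lt_succ.ne fun τ => by
          refine congrArg _ (hface _ _ _ _ fun l hl => ?_)
          have h3 : ∀ a, a ≤ l → Equiv.swap i.castSucc i.succ a ≤ l := by
            intro a ha
            rcases eq_or_ne a i.castSucc with h4 | h4
            · rw [h4, Equiv.swap_apply_left]
              rw [h4] at ha
              exact Fin.castSucc_lt_iff_succ_le.1 (lt_of_le_of_ne ha hl.symm)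
            rcases eq_or_ne a i.succ with h5 | h5
            · rw [h5, Equiv.swap_apply_right]
              exact Fin.castSucc_lt_succ.le.trans (h5 ▸ ha)
            rwa [Equiv.swap_apply_of_ne_of_ne h4 h5]
          ext A
          constructor
          · rintro ⟨a, ha, hA⟩
            exact ⟨_, h3 a ha, hA⟩
          · rintro ⟨a, ha, hA⟩
            refine ⟨_, h3 a ha, ?_⟩
            rwa [Equiv.Perm.mul_apply, Equiv.swap_apply_self]
      rw [← h2]
      exact Finset.sum_congr rfl fun τ _ => by ring
  have h2 : wordPairing w (redCochainD (TreeChains S) j b) = ∑ i : Fin (j + 1),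
      (-1 : ℤ) ^ (i : ℕ) * ∑ ρ : Equiv.Perm (Fin (j + 2)), ∑ τ : Equiv.Perm (Fin (j + 1)),
      (Equiv.Perm.sign ρ * Equiv.Perm.sign τ : ℤ) *
        b (augFace (TreeChains S) j i (wordSimplex w ρ τ)) := by
    rw [wordPairing_apply]
    simp only [Finset.mul_sum]
    rw [Finset.sum_comm (s := (Finset.univ : Finset (Fin (j + 1))))]
    refine Finset.sum_congr rfl fun ρ _ => ?_
    rw [Finset.sum_comm (s := (Finset.univ : Finset (Fin (j + 1))))]
    refine Finset.sum_congr rfl fun τ _ => ?_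
    change _ * ∑ i : Fin (j + 1), _ = _
    rw [Finset.mul_sum]
    exact Finset.sum_congr rfl fun i _ => by ring
  rw [h2]
  exact Finset.sum_eq_zero fun i _ => by rw [h1 i, mul_zero]

lemma wordPairing_map (w : Fin (m + 2) ≃ S) (σ : Equiv.Perm S)
    (c : RedCochain (TreeChains S) m) :
    wordPairing w (redCochainMap (treeChainsMap σ) m c) = wordPairing (w.trans σ.symm) c := by
  rw [wordPairing_apply, wordPairing_apply]
  refine Finset.sum_congr rfl fun ρ _ => Finset.sum_congr rfl fun τ _ => congrArg _ ?_
  change c (AugSimplex.map (treeChainsMap σ) m (wordSimplex w ρ τ)) = _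
  refine congrArg c (augEdges_injective (funext fun k => ?_))
  rw [augEdges_map, augEdges_wordSimplex, augEdges_wordSimplex]
  ext A
  constructor
  · rintro ⟨B, ⟨i, hi, hB, l, rfl⟩, rfl⟩
    exact ⟨i, hi, hB.preimage σ.surjective, l, rfl⟩
  · rintro ⟨i, hi, hA, l, rfl⟩
    refine ⟨_, ⟨i, hi, ?_, l, rfl⟩, rfl⟩
    have h1 : block w (gapSet ρ (τ i)) l = σ '' block (w.trans σ.symm) (gapSet ρ (τ i)) l :=
      (σ.surjective.image_preimage _).symm
    rw [h1]
    exact hA.image σ.injective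

end Blocks

/-! ### Evaluation of combs on words -/

section Valley

variable {m : ℕ}

/-- The values of `v` decrease up to the position of the minimum and increase afterwards. -/
def IsValley (v : Equiv.Perm (Fin (m + 2))) : Prop :=
  ∀ i j l, i ≤ j → j ≤ l → v j ≤ max (v i) (v l)

/-- Omitting the minimum of `v` leaves a permutation of the `m + 1` gaps; moving the minimum to the
front accounts for the sign. -/
lemma exists_restPerm (v : Equiv.Perm (Fin (m + 2))) : ∃ π : Equiv.Perm (Fin (m + 1)),
    (∀ g, (π g).succ = v ((v.symm 0).succAbove g)) ∧
    Equiv.Perm.sign v = (-1) ^ (v.symm 0).val * Equiv.Perm.sign π := by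
  set p := v.symm 0
  let c : Equiv.Perm (Fin (m + 2)) := (Fin.cycleRange p).symm.trans v
  obtain ⟨⟨q, π⟩, hc⟩ := Equiv.Perm.decomposeFin.symm.surjective c
  have hq : q = 0 := by
    have h1 := congrArg (fun f : Equiv.Perm (Fin (m + 2)) => f 0) hc
    simpa [c, p] using h1
  subst hq
  refine ⟨π, fun g => ?_, ?_⟩
  · have h1 := congrArg (fun f : Equiv.Perm (Fin (m + 2)) => f g.succ) hc
    simpa [c] using h1
  · have h1 := congrArg Equiv.Perm.sign hc
    rw [Equiv.Perm.decomposeFin.symm_sign, if_pos rfl, one_mul] at h1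
    rw [h1]
    simp only [c]
    rw [Equiv.Perm.sign_trans, Equiv.Perm.sign_symm, Fin.sign_cycleRange, mul_comm, mul_assoc,
      ← mul_pow]
    simp

/-- In a valley the larger of the two values next to a gap is the one farther from the minimum. So
each position other than the minimum belongs to one gap. -/
lemma IsValley.max_eq {v : Equiv.Perm (Fin (m + 2))} (hv : IsValley v) (g : Fin (m + 1)) :
    max (v g.castSucc) (v g.succ) = v ((v.symm 0).succAbove g) := by
  have h0 : v (v.symm 0) = 0 := v.apply_symm_apply 0
  rcases lt_or_ge g.castSucc (v.symm 0) with h | h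
  · rw [Fin.succAbove_of_castSucc_lt _ _ h, max_eq_left]
    have h1 := hv g.castSucc g.succ (v.symm 0) Fin.castSucc_lt_succ.le
      (Fin.castSucc_lt_iff_succ_le.1 h)
    rwa [h0, max_eq_left (Fin.zero_le _)] at h1
  · rw [Fin.succAbove_of_le_castSucc _ _ h, max_eq_right]
    have h1 := hv (v.symm 0) g.castSucc g.succ h Fin.castSucc_lt_succ.le
    rwa [h0, max_eq_right (Fin.zero_le _)] at h1

variable {S : Type u} {w e : Fin (m + 2) ≃ S}

lemma mem_combFlag {q : Fin m} {i : Fin (m + 2)} :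
    w i ∈ combFlag e q ↔ (w.trans e.symm i).val ≤ q + 1 := Iff.rfl

/-- In a valley the first `q + 2` letters of `e` occupy an interval of `w`, and the gaps inside it
are the first `q + 1` gaps in the order `π`. They join these letters and no others. -/
lemma blocks_eq_of_isValley (hv : IsValley (w.trans e.symm)) {π : Equiv.Perm (Fin (m + 1))}
    (hπ : ∀ g, (π g).succ = w.trans e.symm (((w.trans e.symm).symm 0).succAbove g)) (q : Fin m) :
    blocks w (gapSet π.symm q) = {combFlag e q} := by
  set v := w.trans e.symm
  have hmem : ∀ g, g ∈ gapSet π.symm q ↔ (v g.castSucc).val ≤ q + 1 ∧ (v g.succ).val ≤ q + 1 := by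
    intro g
    have h1 : g ∈ gapSet π.symm q ↔ (π g).val ≤ q := Iff.rfl
    have h2 := congrArg Fin.val ((hv.max_eq g).trans (hπ g).symm)
    rw [Fin.val_succ] at h2
    have h3 : (max (v g.castSucc) (v g.succ)).val =
        max (v g.castSucc).val (v g.succ).val := Fin.coe_max _ _
    rw [h1]
    omega
  have hadj : ∀ i j, Linked (gapSet π.symm q) i j → i ≠ j → (v i).val ≤ q + 1 := by
    intro i j h hij
    have hi := i.2
    have hj := j.2
    rcases lt_or_gt_of_ne hij with h1 | h1 <;> rw [Fin.lt_def] at h1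
    · have h2 := h ⟨i, by omega⟩ (by simp only; omega) (by simp only; omega)
      exact ((hmem _).1 h2).1
    · have h2 := h ⟨i - 1, by omega⟩ (by simp only; omega) (by simp only; omega)
      have h3 := ((hmem _).1 h2).2
      rwa [show (⟨i - 1, by omega⟩ : Fin (m + 1)).succ = i from
        Fin.ext (by simp only [Fin.succ_mk]; omega)] at h3
  have hbetween : ∀ i j, (v i).val ≤ q + 1 → (v j).val ≤ q + 1 → ∀ l, i ≤ l → l ≤ j →
      (v l).val ≤ q + 1 := by
    intro i j hi hj l hil hlj
    have h1 := Fin.le_def.1 (hv i l j hil hlj)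
    have h3 : (max (v i) (v j)).val = max (v i).val (v j).val := Fin.coe_max _ _
    omega
  have hlink : ∀ i j, (v i).val ≤ q + 1 → (v j).val ≤ q + 1 → Linked (gapSet π.symm q) i j := by
    intro i j hi hj g h1 h2
    rcases le_total i j with h3 | h3 <;> rw [Fin.le_def] at h3
    · exact (hmem g).2 ⟨hbetween i j hi hj _ (by rw [Fin.le_def, Fin.val_castSucc]; omega)
        (by rw [Fin.le_def, Fin.val_castSucc]; omega),
        hbetween i j hi hj _ (by rw [Fin.le_def, Fin.val_succ]; omega)
        (by rw [Fin.le_def, Fin.val_succ]; omega)⟩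
    · exact (hmem g).2 ⟨hbetween j i hj hi _ (by rw [Fin.le_def, Fin.val_castSucc]; omega)
        (by rw [Fin.le_def, Fin.val_castSucc]; omega),
        hbetween j i hj hi _ (by rw [Fin.le_def, Fin.val_succ]; omega)
        (by rw [Fin.le_def, Fin.val_succ]; omega)⟩
  have hblock : ∀ i, (v i).val ≤ q + 1 → block w (gapSet π.symm q) i = combFlag e q := by
    intro i hi
    ext a
    obtain ⟨j, rfl⟩ := w.surjective a
    rw [apply_mem_block, mem_combFlag]
    refine ⟨fun h => ?_, fun h => hlink i j hi h⟩
    by_cases hij : j = i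
    · rw [hij]
      exact hi
    · exact hadj j i h.symm hij
  ext A
  rw [Set.mem_singleton_iff]
  constructor
  · rintro ⟨hA, i, rfl⟩
    obtain ⟨b, hb, hne⟩ := hA.exists_ne (w i)
    obtain ⟨j, rfl⟩ := w.surjective b
    exact hblock i (hadj i j (apply_mem_block.1 hb) fun h => hne (h ▸ rfl))
  · rintro rfl
    refine ⟨((isFlag_combFlag e).2.1 _ ⟨q, rfl⟩).1, v.symm 0, (hblock _ ?_).symm⟩
    rw [v.apply_symm_apply]
    exact Nat.zero_le _

lemma wordFlag_of_isValley (hv : IsValley (w.trans e.symm)) {π : Equiv.Perm (Fin (m + 1))}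
    (hπ : ∀ g, (π g).succ = w.trans e.symm (((w.trans e.symm).symm 0).succAbove g)) :
    wordFlag w π.symm 1 = fun k => combFlag e '' Set.Iic k := by
  funext k
  ext A
  change (∃ i ≤ k, A ∈ blocks w (gapSet π.symm ((1 : Equiv.Perm (Fin m)) i))) ↔ _
  simp only [Equiv.Perm.one_apply, blocks_eq_of_isValley hv hπ, Set.mem_singleton_iff]
  exact ⟨fun ⟨i, hi, h⟩ => ⟨i, hi, h.symm⟩, fun ⟨i, hi, h⟩ => ⟨i, hi, h.symm⟩⟩

/-- All blocks must be edges of a comb; those meet pairwise, so each partition has a single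
nontrivial block. These blocks grow strictly, which leaves only one size for each. So initial sets
of `e` are intervals of `w`, and both `ρ` and `τ` are forced. -/
lemma isValley_of_wordFlag {ρ : Equiv.Perm (Fin (m + 1))} {τ : Equiv.Perm (Fin m)}
    (h : wordFlag w ρ τ = fun k => combFlag e '' Set.Iic k) {π : Equiv.Perm (Fin (m + 1))}
    (hπ : ∀ g, (π g).succ = w.trans e.symm (((w.trans e.symm).symm 0).succAbove g)) :
    IsValley (w.trans e.symm) ∧ ρ = π.symm ∧ τ = 1 := by
  set v := w.trans e.symm
  have hcomb : ∀ q : Fin m, ∀ A ∈ blocks w (gapSet ρ q), ∃ l, A = combFlag e l := by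
    intro q A hA
    have h1 : A ∈ wordFlag w ρ τ (τ.symm q) := ⟨τ.symm q, le_rfl, by rwa [τ.apply_symm_apply]⟩
    rw [h] at h1
    obtain ⟨l, -, hl⟩ := h1
    exact ⟨l, hl.symm⟩
  have huniq : ∀ q : Fin m, ∀ A ∈ blocks w (gapSet ρ q), ∀ B ∈ blocks w (gapSet ρ q), A = B := by
    intro q A hA B hB
    have hmeet : ¬ Disjoint A B := by
      obtain ⟨l, rfl⟩ := hcomb q A hA
      obtain ⟨l', rfl⟩ := hcomb q B hB
      exact fun hd => Set.disjoint_left.1 hd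
        (apply_mem_initialSet.2 (Nat.zero_le _) : e 0 ∈ combFlag e l)
        (apply_mem_initialSet.2 (Nat.zero_le _))
    exact ((subset_or_disjoint_of_blocks subset_rfl hA hB).resolve_right hmeet).antisymm
      ((subset_or_disjoint_of_blocks subset_rfl hB hA).resolve_right fun hd => hmeet hd.symm)
  have hex : ∀ q : Fin m, ∃ l, blocks w (gapSet ρ q) = {combFlag e l} := by
    intro q
    have h1 := block_mem_blocks (w := w)
      (apply_mem_gapSet.2 (Nat.zero_le _) : ρ 0 ∈ gapSet ρ q)
    obtain ⟨l, hl⟩ := hcomb q _ h1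
    rw [hl] at h1
    exact ⟨l, Set.eq_singleton_iff_unique_mem.2 ⟨h1, fun B hB => huniq q B hB _ h1⟩⟩
  choose L hL using hex
  have hlinked : ∀ q i j, (v i).val ≤ L q + 1 → (v j).val ≤ L q + 1 →
      Linked (gapSet ρ q) i j := by
    intro q i j hi hj
    have h1 : combFlag e (L q) ∈ blocks w (gapSet ρ q) := by
      rw [hL q]
      rfl
    obtain ⟨-, l, hl⟩ := h1
    have h2 : w i ∈ combFlag e (L q) := hi
    have h3 : w j ∈ combFlag e (L q) := hj
    rw [hl] at h2 h3
    exact (apply_mem_block.1 h2).symm.trans (apply_mem_block.1 h3)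
  have hgap : ∀ (q : Fin m) g, g ∈ gapSet ρ q ↔
      (v g.castSucc).val ≤ L q + 1 ∧ (v g.succ).val ≤ L q + 1 := by
    intro q g
    refine ⟨fun hg => ?_, fun hg => linked_castSucc_succ.1 (hlinked q _ _ hg.1 hg.2)⟩
    have h1 : block w (gapSet ρ q) g.castSucc = combFlag e (L q) := by
      have := block_mem_blocks (w := w) hg
      rwa [hL q] at this
    have h2 : w g.castSucc ∈ block w (gapSet ρ q) g.castSucc := apply_mem_block.2 (.refl _ _)
    have h3 : w g.succ ∈ block w (gapSet ρ q) g.castSucc :=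
      apply_mem_block.2 (linked_castSucc_succ.2 hg)
    rw [h1] at h2 h3
    exact ⟨h2, h3⟩
  have hmono : StrictMono L := by
    intro q q' hqq
    by_contra hle
    have hle : (L q').val ≤ L q := not_lt.1 hle
    have h1 : ρ ⟨q', by omega⟩ ∈ gapSet ρ q' := apply_mem_gapSet.2 le_rfl
    have h2 : ρ ⟨q', by omega⟩ ∈ gapSet ρ q := by
      rw [hgap] at h1 ⊢
      omega
    have h3 := apply_mem_gapSet.1 h2
    exact absurd hqq (not_lt.2 h3)
  have hLq : ∀ q, (L q).val = q := by
    intro q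
    have := eq_of_strictMono (fun q => (L q).val + 1)
      (fun _ _ h => Nat.succ_lt_succ (hmono h)) (fun _ => Nat.succ_pos _)
      (fun i => (L i).2) q
    simpa using this
  have hv : IsValley v := by
    intro i j l hij hjl
    by_contra hlt
    rw [not_le] at hlt
    have hlt : (max (v i) (v l)).val < (v j).val := hlt
    have h3 : (max (v i) (v l)).val = max (v i).val (v l).val := Fin.coe_max _ _
    have h4 := (v j).2
    have hj1 : (v j).val ≠ (v i).val := by omega
    have hij' : i < j := lt_of_le_of_ne hij fun h => hj1 (by rw [h])
    have hjl' : j < l := lt_of_le_of_ne hjl fun h => by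
      have h5 : (v j).val = (v l).val := by rw [h]
      omega
    rw [Fin.lt_def] at hij' hjl'
    have hil : (v i).val ≠ (v l).val := fun h => by
      have := v.injective (Fin.ext h)
      rw [this] at hij'
      omega
    -- The index of the smallest block that contains the letters in positions `i` and `l`. As an
    -- interval of `w` it would also contain the letter in position `j`, whose value is too large.
    have h5 : max (v i).val (v l).val - 1 < m := by omega
    have h6 := hLq ⟨_, h5⟩
    simp only at h6
    have h7 := hlinked ⟨_, h5⟩ i l (by omega) (by omega)
    have h8 := h7 ⟨j, by omega⟩ (by simp only; omega) (by simp only; omega)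
    have h9 := ((hgap _ _).1 h8).1
    rw [h6] at h9
    change (v j).val ≤ _ at h9
    omega
  refine ⟨hv, ?_, ?_⟩
  · have h1 : ∀ g, ρ.symm g = π g := by
      intro g
      have hq : ∀ q : Fin m, (ρ.symm g).val ≤ q ↔ (π g).val ≤ q := by
        intro q
        have h1 : (ρ.symm g).val ≤ q ↔ _ := hgap q g
        have h2 := congrArg Fin.val ((hv.max_eq g).trans (hπ g).symm)
        rw [Fin.val_succ] at h2
        have h3 : (max (v g.castSucc) (v g.succ)).val =
            max (v g.castSucc).val (v g.succ).val := Fin.coe_max _ _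
        rw [h1, hLq]
        omega
      have h2 := (ρ.symm g).2
      have h3 := (π g).2
      refine Fin.ext ?_
      by_contra hne
      rcases lt_or_gt_of_ne hne with h4 | h4
      · have := (hq ⟨(ρ.symm g).val, by omega⟩).1 le_rfl
        simp only at this
        omega
      · have := (hq ⟨(π g).val, by omega⟩).2 le_rfl
        simp only at this
        omega
    rw [← Equiv.ext h1]
    rfl
  · have h1 : (fun k => (combFlag e ∘ τ) '' Set.Iic k) = fun k => combFlag e '' Set.Iic k := by
      rw [← h]
      funext k
      ext A
      change _ ↔ ∃ i ≤ k, A ∈ blocks w (gapSet ρ (τ i))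
      simp only [hL, Set.mem_singleton_iff]
      have h2 : ∀ q, L q = q := fun q => Fin.ext (hLq q)
      simp only [h2]
      exact ⟨fun ⟨i, hi, h⟩ => ⟨i, hi, h.symm⟩, fun ⟨i, hi, h⟩ => ⟨i, hi, h.symm⟩⟩
    have h2 := eq_of_image_Iic ((isFlag_combFlag e).1.comp τ.injective) h1
    exact Equiv.ext fun i => (isFlag_combFlag e).1 (congrFun h2 i)

open Classical in
/-- The evaluation of a comb on the fundamental class of a word. -/
theorem wordPairing_combFlag (w e : Fin (m + 2) ≃ S) :
    wordPairing w (flagCochain (combFlag e)) = if IsValley (w.trans e.symm) then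
      (Equiv.Perm.sign (w.trans e.symm) : ℤ) * (-1) ^ ((w.trans e.symm).symm 0).val else 0 := by
  obtain ⟨π, hπ, hsign⟩ := exists_restPerm (w.trans e.symm)
  have hval : ∀ ρ τ, flagCochain (combFlag e) (wordSimplex w ρ τ) =
      if wordFlag w ρ τ = fun k => combFlag e '' Set.Iic k then 1 else 0 := fun ρ τ => by
    rw [flagCochain, augEdges_wordSimplex]
  rw [wordPairing_apply]
  simp only [hval]
  split_ifs with hv
  · rw [Finset.sum_eq_single π.symm, Finset.sum_eq_single 1,
      if_pos (wordFlag_of_isValley hv hπ)]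
    · rw [Equiv.Perm.sign_one, Equiv.Perm.sign_symm, hsign]
      push_cast
      rw [mul_comm _ ((-1 : ℤ) ^ _), ← mul_assoc, ← mul_pow]
      simp
    · intro τ _ hτ
      rw [if_neg fun h => hτ (isValley_of_wordFlag h hπ).2.2, mul_zero]
    · simp
    · intro ρ _ hρ
      exact Finset.sum_eq_zero fun τ _ => by
        rw [if_neg fun h => hρ (isValley_of_wordFlag h hπ).2.1, mul_zero]
    · simp
  · exact Finset.sum_eq_zero fun ρ _ => Finset.sum_eq_zero fun τ _ => by
      rw [if_neg fun h => hv (isValley_of_wordFlag h hπ).1, mul_zero]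

/-- A valley that starts with its minimum is increasing. -/
lemma IsValley.eq_one {v : Equiv.Perm (Fin (m + 2))} (hv : IsValley v) (h0 : v 0 = 0) :
    v = 1 := by
  have h1 : StrictMono v := fun i j hij => lt_of_le_of_ne (by
    have := hv 0 i j (Fin.zero_le _) hij.le
    rwa [h0, max_eq_right (Fin.zero_le _)] at this) fun h => hij.ne (v.injective h)
  have h2 : (v : Fin (m + 2) → Fin (m + 2)) = id := h1.range_inj strictMono_id |>.1 (by
    rw [Set.range_id, v.surjective.range_eq])
  exact Equiv.ext (congrFun h2)

lemma isValley_one : IsValley (1 : Equiv.Perm (Fin (m + 2))) :=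
  fun _ _ _ _ h => h.trans (le_max_right _ _)

end Valley

/-! ### Left combs in the free Lie algebra and their coefficients -/

section LieWords

variable {S : Type u} {m : ℕ}

/-- The iterated bracket `[…[[a 0, a 1], a 2], …, a k]`. -/
def leftComb (a : ℕ → S) : ℕ → FreeLieAlgebra ℤ S
  | 0 => FreeLieAlgebra.of ℤ (a 0)
  | k + 1 => ⁅leftComb a k, FreeLieAlgebra.of ℤ (a (k + 1))⁆

lemma leftComb_congr {a b : ℕ → S} {k : ℕ} (h : ∀ i ≤ k, a i = b i) :
    leftComb a k = leftComb b k := by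
  induction k with
  | zero => rw [leftComb, leftComb, h 0 le_rfl]
  | succ k ih => rw [leftComb, leftComb, h _ le_rfl, ih fun i hi => h i (by omega)]

lemma image_Iic_succ (a : ℕ → S) (k : ℕ) : a '' Set.Iic (k + 1) = a '' Set.Iic k ∪ {a (k + 1)} := by
  have : Set.Iic (k + 1) = Set.Iic k ∪ {k + 1} := by
    ext i
    simp only [Set.mem_Iic, Set.mem_union, Set.mem_singleton_iff]
    omega
  rw [this, Set.image_union, Set.image_singleton]

lemma isLieMonomial_leftComb (a : ℕ → S) (k : ℕ) (ha : Set.InjOn a (Set.Iic k)) :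
    IsLieMonomial ℤ (a '' Set.Iic k) (leftComb a k) := by
  induction k with
  | zero =>
    have : Set.Iic 0 = {0} := by
      ext i
      simp
    rw [this, Set.image_singleton]
    exact .of _
  | succ k ih =>
    rw [image_Iic_succ]
    refine .bracket (Set.disjoint_singleton_right.2 ?_)
      (ih (ha.mono (Set.Iic_subset_Iic.2 (Nat.le_succ k)))) (.of _)
    rintro ⟨i, hi, h⟩
    have hi : i ≤ k := hi
    have := ha (Set.mem_Iic.2 (by omega)) (Set.mem_Iic.2 le_rfl) h
    omega

/-- The span of the left combs that start with `s` and contain the elements of `A` once each. -/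
def combSpan (s : S) (A : Set S) : Submodule ℤ (FreeLieAlgebra ℤ S) :=
  Submodule.span ℤ (Set.ofPred fun x => ∃ (a : ℕ → S) (k : ℕ), a 0 = s ∧
    Set.InjOn a (Set.Iic k) ∧ a '' Set.Iic k = A ∧ x = leftComb a k)

/-- Bracketing with a generator lengthens a comb. The Jacobi identity in the form `⁅x, ⁅y₁, y₂⁆⁆ =
⁅⁅x, y₁⁆, y₂⁆ - ⁅⁅x, y₂⁆, y₁⁆` reduces a bracket with any monomial to this case. -/
lemma lie_mem_combSpan {s : S} {B : Set S} {y : FreeLieAlgebra ℤ S} (hy : IsLieMonomial ℤ B y) :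
    ∀ {A : Set S} {x : FreeLieAlgebra ℤ S}, x ∈ combSpan s A → Disjoint A B →
      ⁅x, y⁆ ∈ combSpan s (A ∪ B) := by
  classical
  induction hy with
  | of b =>
    intro A x hx hAB
    have hb : b ∉ A := Set.disjoint_singleton_right.1 hAB
    induction hx using Submodule.span_induction with
    | mem x hx =>
      obtain ⟨a, k, h0, hinj, rfl, rfl⟩ := hx
      have hup : ∀ i ≤ k, Function.update a (k + 1) b i = a i := fun i hi =>
        Function.update_of_ne (by omega) _ _
      have himg : Function.update a (k + 1) b '' Set.Iic k = a '' Set.Iic k :=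
        Set.image_congr fun i hi => hup i hi
      refine Submodule.subset_span ⟨Function.update a (k + 1) b, k + 1, ?_, ?_, ?_, ?_⟩
      · rw [hup 0 (Nat.zero_le k), h0]
      · intro i hi j hj hij
        have hi : i ≤ k + 1 := hi
        have hj : j ≤ k + 1 := hj
        rcases Nat.lt_or_eq_of_le hi with hi | rfl <;> rcases Nat.lt_or_eq_of_le hj with hj | rfl
        · rw [hup i (by omega), hup j (by omega)] at hij
          exact hinj (Nat.le_of_lt_succ hi) (Nat.le_of_lt_succ hj) hij
        · rw [hup i (by omega), Function.update_self] at hij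
          exact absurd ⟨i, Nat.le_of_lt_succ hi, hij⟩ hb
        · rw [hup j (by omega), Function.update_self] at hij
          exact absurd ⟨j, Nat.le_of_lt_succ hj, hij.symm⟩ hb
        · rfl
      · rw [image_Iic_succ, himg, Function.update_self]
      · rw [leftComb, Function.update_self, leftComb_congr hup]
    | zero =>
      rw [zero_lie]
      exact Submodule.zero_mem _
    | add x y _ _ hx hy =>
      rw [add_lie]
      exact Submodule.add_mem _ hx hy
    | smul c x _ hx =>
      rw [smul_lie]
      exact Submodule.smul_mem _ c hx
  | @bracket B₁ B₂ y₁ y₂ h _ _ ih₁ ih₂ =>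
    intro A x hx hAB
    obtain ⟨hA₁, hA₂⟩ := Set.disjoint_union_right.1 hAB
    rw [leibniz_lie, ← lie_skew y₁ ⁅x, y₂⁆]
    refine Submodule.add_mem _ ?_ (Submodule.neg_mem _ ?_)
    · rw [← Set.union_assoc]
      exact ih₂ (ih₁ hx hA₁) (Set.disjoint_union_left.2 ⟨hA₂, h⟩)
    · rw [Set.union_comm B₁, ← Set.union_assoc]
      exact ih₁ (ih₂ hx hA₂) (Set.disjoint_union_left.2 ⟨hA₁, h.symm⟩)

lemma mem_combSpan {s : S} {A : Set S} {x : FreeLieAlgebra ℤ S} (hx : IsLieMonomial ℤ A x)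
    (hs : s ∈ A) : x ∈ combSpan s A := by
  induction hx with
  | of a =>
    obtain rfl : s = a := hs
    refine Submodule.subset_span ⟨fun _ => s, 0, rfl, ?_, ?_, rfl⟩
    · intro i hi j hj _
      have hi : i ≤ 0 := hi
      have hj : j ≤ 0 := hj
      omega
    · exact Set.Nonempty.image_const ⟨0, Set.self_mem_Iic⟩ s
  | @bracket A B x y h hx hy ihx ihy =>
    rcases hs with hs | hs
    · exact lie_mem_combSpan hy (ihx hs) h
    · rw [Set.union_comm, ← lie_skew]
      exact Submodule.neg_mem _ (lie_mem_combSpan hx (ihy hs) h.symm)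

/-- The letters of a word. -/
def letter (e : Fin (m + 2) ≃ S) (k : ℕ) : S := e (Fin.ofNat (m + 2) k)

lemma letter_eq (e : Fin (m + 2) ≃ S) {k : ℕ} (hk : k < m + 2) : letter e k = e ⟨k, hk⟩ := by
  refine congrArg e (Fin.ext ?_)
  simp [Nat.mod_eq_of_lt hk]

/-- The left comb of a word. -/
def wordComb (e : Fin (m + 2) ≃ S) : FreeLieAlgebra ℤ S := leftComb (letter e) (m + 1)

lemma wordComb_mem (e : Fin (m + 2) ≃ S) : wordComb e ∈ multilinearLie ℤ S := by
  refine Submodule.subset_span ?_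
  have h1 : Set.InjOn (letter e) (Set.Iic (m + 1)) := fun i hi j hj h => by
    have hi : i ≤ m + 1 := hi
    have hj : j ≤ m + 1 := hj
    rw [letter_eq e (by omega), letter_eq e (by omega)] at h
    exact congrArg Fin.val (e.injective h)
  have h2 : letter e '' Set.Iic (m + 1) = Set.univ := Set.eq_univ_of_forall fun a =>
    ⟨(e.symm a).val, by have := (e.symm a).2; exact Set.mem_Iic.2 (by omega), by
      rw [letter_eq e (e.symm a).2]
      exact e.apply_symm_apply a⟩
  have h3 := isLieMonomial_leftComb _ _ h1
  rw [h2] at h3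
  exact h3

/-- The multilinear part of the free Lie algebra is spanned by the left combs that start with a
given letter. -/
theorem multilinearLie_eq_span [Finite S] (hS : Nat.card S = m + 2) (s : S) :
    multilinearLie ℤ S = Submodule.span ℤ (Set.range fun e : WordsFrom s m => wordComb e.1) := by
  refine le_antisymm (Submodule.span_le.2 fun x hx => ?_) (Submodule.span_le.2 ?_)
  · have h1 : x ∈ combSpan s Set.univ := mem_combSpan hx trivial
    refine (Submodule.span_le.2 ?_ : combSpan s Set.univ ≤ _) h1
    rintro _ ⟨a, k, h0, hinj, himg, rfl⟩
    have hk : k = m + 1 := by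
      have h2 := hinj.ncard_image
      rw [himg, Set.ncard_univ, hS, ← Finset.coe_Iic, Set.ncard_coe_finset, Nat.card_Iic] at h2
      omega
    subst hk
    have hbij : Function.Bijective fun i : Fin (m + 2) => a i := by
      constructor
      · intro i j hij
        exact Fin.ext (hinj (Set.mem_Iic.2 (by omega)) (Set.mem_Iic.2 (by omega)) hij)
      · intro b
        obtain ⟨i, hi, rfl⟩ := himg.ge (Set.mem_univ b)
        have hi : i ≤ m + 1 := hi
        exact ⟨⟨i, by omega⟩, rfl⟩
    refine Submodule.subset_span ⟨⟨Equiv.ofBijective _ hbij, h0⟩, leftComb_congr fun i hi => ?_⟩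
    rw [letter_eq _ (by omega)]
    rfl
  · rintro _ ⟨e, rfl⟩
    exact wordComb_mem e.1

attribute [local instance] LieRing.ofAssociativeRing

/-- The representation of the free Lie algebra in which the letters of a word act as the steps of a
path. -/
def pathMatrix (w : Fin (m + 2) ≃ S) :
    FreeLieAlgebra ℤ S →ₗ⁅ℤ⁆ Matrix (Fin (m + 3)) (Fin (m + 3)) ℤ :=
  FreeLieAlgebra.lift ℤ fun a => Matrix.single (w.symm a).castSucc (w.symm a).succ 1

lemma pathMatrix_of (w : Fin (m + 2) ≃ S) (a : S) : pathMatrix w (FreeLieAlgebra.of ℤ a) =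
    Matrix.single (w.symm a).castSucc (w.symm a).succ 1 := FreeLieAlgebra.lift_of_apply _ _

/-- The coefficient of a word in a Lie element. -/
def lieCoeff (w : Fin (m + 2) ≃ S) : FreeLieAlgebra ℤ S →ₗ[ℤ] ℤ where
  toFun x := pathMatrix w x 0 (Fin.last _)
  map_add' x y := by rw [map_add, Matrix.add_apply]
  map_smul' c x := by
    rw [map_smul, Matrix.smul_apply]
    rfl

lemma lieCoeff_map (w : Fin (m + 2) ≃ S) (σ : Equiv.Perm S) (x : FreeLieAlgebra ℤ S) :
    lieCoeff w (freeLieMap ℤ σ x) = lieCoeff (w.trans σ.symm) x := by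
  have h : (pathMatrix w).comp (freeLieMap ℤ σ) = pathMatrix (w.trans σ.symm) := by
    refine FreeLieAlgebra.hom_ext fun a => ?_
    exact (congrArg (pathMatrix w) (freeLieMap_of ℤ σ a)).trans
      ((pathMatrix_of w _).trans (pathMatrix_of (w.trans σ.symm) a).symm)
  exact congrArg (fun f => f x 0 (Fin.last _)) h

/-- As long as the letters of `e` used so far occupy an interval of `w`, the comb acts as plus or
minus an elementary matrix from the left end to the right end of this interval. A next letter
adjacent on the right extends it, one adjacent on the left extends it with a minus sign, and any
other one gives zero. The exponent counts the letters added on the left. -/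
lemma pathMatrix_leftComb (w e : Fin (m + 2) ≃ S) (k : ℕ) (hk : k ≤ m + 1) :
    (∃ l r : Fin (m + 3), (∀ i, (w.trans e.symm i).val ≤ k ↔ l.val ≤ i.val ∧ i.val < r.val) ∧
      (∀ q ≤ k, ∀ i j l, i ≤ j → j ≤ l → (w.trans e.symm i).val ≤ q →
        (w.trans e.symm l).val ≤ q → (w.trans e.symm j).val ≤ q) ∧
      pathMatrix w (leftComb (letter e) k) =
        (-1 : ℤ) ^ (((w.trans e.symm).symm 0).val - l.val) • Matrix.single l r (1 : ℤ)) ∨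
    pathMatrix w (leftComb (letter e) k) = 0 ∧ ¬ IsValley (w.trans e.symm) := by
  set v := w.trans e.symm with hv_def
  have hletter : ∀ k (hk : k < m + 2), w.symm (letter e k) = v.symm ⟨k, hk⟩ := fun k hk => by
    rw [letter_eq e hk]
    rfl
  have hvp : ∀ k, v (v.symm k) = k := v.apply_symm_apply
  have hvi : ∀ {i j}, (v i).val = (v j).val → i = j := fun h => v.injective (Fin.ext h)
  have hint : ∀ k, ∀ l r : Fin (m + 3), (∀ i, (v i).val ≤ k ↔ l.val ≤ i.val ∧ i.val < r.val) →
      ∀ i j l, i ≤ j → j ≤ l → (v i).val ≤ k → (v l).val ≤ k → (v j).val ≤ k := by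
    intro k l r h i j l' hij hjl hi hl
    rw [h] at hi hl ⊢
    rw [Fin.le_def] at hij hjl
    omega
  induction k with
  | zero =>
    left
    have h1 : ∀ i, (v i).val ≤ 0 ↔
        (v.symm 0).castSucc.val ≤ i.val ∧ i.val < (v.symm 0).succ.val := by
      intro i
      rw [Fin.val_castSucc, Fin.val_succ]
      constructor
      · intro h
        have : i = v.symm 0 := hvi (by rw [hvp, Fin.val_zero]; omega)
        rw [this]
        omega
      · intro h
        have : i = v.symm 0 := Fin.ext (by omega)
        rw [this, hvp, Fin.val_zero]
    refine ⟨_, _, h1, fun q hq => ?_, ?_⟩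
    · obtain rfl : q = 0 := by omega
      exact hint 0 _ _ h1
    · rw [leftComb, pathMatrix_of, hletter 0 (by omega), Fin.val_castSucc, Nat.sub_self, pow_zero,
        one_smul]
      rfl
  | succ k ih =>
    rcases ih (by omega) with ⟨l, r, h1, h2, h3⟩ | ⟨h1, h2⟩
    · have hk2 : k + 1 < m + 2 := by omega
      set p := v.symm ⟨k + 1, hk2⟩
      have hp : (v p).val = k + 1 := congrArg Fin.val (hvp _)
      have hsucc : ∀ i, (v i).val ≤ k + 1 ↔ (v i).val ≤ k ∨ i = p := by
        intro i
        constructor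
        · intro h
          by_cases h4 : (v i).val ≤ k
          · exact .inl h4
          · exact .inr (hvi (by omega))
        · rintro (h | rfl)
          · omega
          · omega
      have hp' : ¬ (l.val ≤ p.val ∧ p.val < r.val) := by
        rw [← h1]
        omega
      have h0 : l.val ≤ (v.symm 0).val ∧ (v.symm 0).val < r.val := by
        rw [← h1, hvp]
        exact Nat.zero_le _
      have hmat : pathMatrix w (leftComb (letter e) (k + 1)) =
          (-1 : ℤ) ^ ((v.symm 0).val - l.val) • (Matrix.single l r (1 : ℤ) *
            Matrix.single p.castSucc p.succ 1 -
            Matrix.single p.castSucc p.succ 1 * Matrix.single l r 1) := by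
        rw [leftComb, LieHom.map_lie, h3, pathMatrix_of, hletter _ hk2, smul_lie, Ring.lie_def]
      by_cases hpr : r.val = p.val
      · left
        have hr : r = p.castSucc := Fin.ext hpr
        have h4 : ∀ i, (v i).val ≤ k + 1 ↔ l.val ≤ i.val ∧ i.val < p.succ.val := by
          intro i
          rw [hsucc, h1, Fin.ext_iff, Fin.val_succ]
          omega
        refine ⟨l, p.succ, h4, fun q hq => ?_, ?_⟩
        · rcases Nat.lt_or_eq_of_le hq with hq | rfl
          · exact h2 q (by omega)
          · exact hint _ _ _ h4
        · have hne : p.succ ≠ l := fun h => by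
            have := congrArg Fin.val h
            rw [Fin.val_succ] at this
            omega
          rw [hmat, hr, Matrix.single_mul_single_same, Matrix.single_mul_single_of_ne _ _ _ _ hne,
            sub_zero, one_mul]
      by_cases hpl : p.val + 1 = l.val
      · left
        have hl : l = p.succ := Fin.ext hpl.symm
        have h4 : ∀ i, (v i).val ≤ k + 1 ↔ p.castSucc.val ≤ i.val ∧ i.val < r.val := by
          intro i
          rw [hsucc, h1, Fin.ext_iff, Fin.val_castSucc]
          omega
        refine ⟨p.castSucc, r, h4, fun q hq => ?_, ?_⟩
        · rcases Nat.lt_or_eq_of_le hq with hq | rfl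
          · exact h2 q (by omega)
          · exact hint _ _ _ h4
        · have hne : r ≠ p.castSucc := fun h => hpr (congrArg Fin.val h)
          have hexp : (v.symm 0).val - p.castSucc.val = ((v.symm 0).val - l.val) + 1 := by
            rw [Fin.val_castSucc]
            omega
          rw [hmat, hexp, hl, Matrix.single_mul_single_same,
            Matrix.single_mul_single_of_ne _ _ _ _ hne, zero_sub, one_mul, smul_neg, pow_succ,
            mul_neg_one, neg_smul]
      · right
        refine ⟨?_, fun hval => ?_⟩
        · rw [hmat, Matrix.single_mul_single_of_ne _ _ _ _ fun h => hpr (congrArg Fin.val h),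
            Matrix.single_mul_single_of_ne _ _ _ _ fun h => hpl (by
              have := congrArg Fin.val h
              rwa [Fin.val_succ] at this), sub_zero, smul_zero]
        · have hp2 := p.2
          have hl2 : l.val < m + 2 := by omega
          have hvl : (v ⟨l, hl2⟩).val ≤ k := (h1 _).2 ⟨le_rfl, by simp only; omega⟩
          -- The position just outside the interval, on the side of the new letter, has a value
          -- larger than `k + 1`. It lies between two positions with values at most `k + 1`, which
          -- contradicts the valley condition.
          rcases Nat.lt_or_ge p.val l.val with h4 | h4
          · have h5 := Fin.le_def.1 (hval p ⟨l - 1, by omega⟩ ⟨l, hl2⟩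
              (by rw [Fin.le_def]; simp only; omega) (by rw [Fin.le_def]; simp only; omega))
            have h6 : (max (v p) (v ⟨l, hl2⟩)).val = max (v p).val (v ⟨l, hl2⟩).val :=
              Fin.coe_max _ _
            have h7 := (hsucc ⟨l - 1, by omega⟩).1 (by omega)
            rw [h1, Fin.ext_iff] at h7
            simp only at h7
            omega
          · have h5 := Fin.le_def.1 (hval ⟨l, hl2⟩ ⟨r, by omega⟩ p
              (by rw [Fin.le_def]; simp only; omega) (by rw [Fin.le_def]; simp only; omega))
            have h6 : (max (v ⟨l, hl2⟩) (v p)).val = max (v ⟨l, hl2⟩).val (v p).val :=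
              Fin.coe_max _ _
            have h7 := (hsucc ⟨r, by omega⟩).1 (by omega)
            rw [h1, Fin.ext_iff] at h7
            simp only at h7
            omega
    · right
      refine ⟨?_, h2⟩
      rw [leftComb, LieHom.map_lie, h1, zero_lie]

open Classical in
/-- The coefficients of a left comb. -/
theorem lieCoeff_wordComb (w e : Fin (m + 2) ≃ S) :
    lieCoeff w (wordComb e) =
      if IsValley (w.trans e.symm) then (-1) ^ ((w.trans e.symm).symm 0).val else 0 := by
  change pathMatrix w (wordComb e) 0 (Fin.last _) = _
  rcases pathMatrix_leftComb w e (m + 1) le_rfl with ⟨l, r, h1, h2, h3⟩ | ⟨h1, h2⟩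
  · have hv : IsValley (w.trans e.symm) := fun i j l hij hjl => by
      have h4 : (max (w.trans e.symm i) (w.trans e.symm l)).val =
        max (w.trans e.symm i).val (w.trans e.symm l).val := Fin.coe_max _ _
      rw [Fin.le_def, h4]
      exact h2 _ (by omega) i j l hij hjl (le_max_left _ _) (le_max_right _ _)
    have hl : l = 0 := by
      have := ((h1 0).1 (by omega)).1
      exact Fin.ext (by simpa using this)
    have hr : r = Fin.last _ := by
      have h4 := ((h1 (Fin.last _)).1 (by omega)).2
      have h5 := r.2
      rw [Fin.val_last] at h4
      exact Fin.ext (by rw [Fin.val_last]; omega)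
    rw [if_pos hv, wordComb, h3, hl, hr, Matrix.smul_apply, Matrix.single_apply_same]
    simp
  · rw [if_neg h2, wordComb, h1, Matrix.zero_apply]

end LieWords

/-- A spanning family with a dual family is a basis. -/
lemma exists_basis_of_dual {K V : Type*} [AddCommGroup V] [Module ℤ V] (v : K → V)
    (φ : K → V →ₗ[ℤ] ℤ) (h0 : Pairwise fun k l => φ k (v l) = 0) (h1 : ∀ k, φ k (v k) = 1)
    (hv : Submodule.span ℤ (Set.range v) = ⊤) :
    ∃ b : Module.Basis K ℤ V, (∀ k, b k = v k) ∧ ∀ x k, b.repr x k = φ k x := by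
  classical
  refine ⟨Module.Basis.mk (LinearIndependent.of_pairwise_dual_eq_zero_one v φ h0 h1) hv.ge,
    fun k => Module.Basis.mk_apply _ _ k, fun x k => ?_⟩
  set b := Module.Basis.mk (LinearIndependent.of_pairwise_dual_eq_zero_one v φ h0 h1) hv.ge
  have h : b.coord k = φ k := b.ext fun l => by
    rw [Module.Basis.coord_apply, b.repr_self, Finsupp.single_apply, Module.Basis.mk_apply]
    split_ifs with hkl
    · rw [hkl, h1]
    · exact (h0 (Ne.symm hkl)).symm
  exact congr($h x)

/-! ### Comparison of words with the same first letter -/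

section Words

variable {S : Type u} {m : ℕ}

/-- With a common first letter the valley starts at its minimum, so it is increasing. Hence words
and combs starting with `s` are dual to each other, both for Lie elements and for cohomology
classes. -/
lemma isValley_iff {s : S} (w e : WordsFrom s m) : IsValley (w.1.trans e.1.symm) ↔ w = e := by
  constructor
  · intro h
    have h1 := h.eq_one (by
      rw [Equiv.trans_apply, w.2, Equiv.symm_apply_eq, e.2])
    refine Subtype.ext (Equiv.ext fun i => ?_)
    have h2 := congr($h1 i)
    exact (Equiv.symm_apply_eq _).1 h2
  · rintro rfl
    rw [Equiv.self_trans_symm]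
    exact isValley_one

lemma sign_trans_mul (w e r : Fin (m + 2) ≃ S) :
    Equiv.Perm.sign (w.trans e.symm) * Equiv.Perm.sign (w.trans r.symm) =
      Equiv.Perm.sign (e.trans r.symm) := by
  have h : w.trans r.symm = (w.trans e.symm).trans (e.trans r.symm) := by
    ext i
    simp
  rw [h, Equiv.Perm.sign_trans, mul_comm (Equiv.Perm.sign (e.trans r.symm)), ← mul_assoc,
    Int.units_mul_self, one_mul]

lemma sign_trans_symm [Fintype S] [DecidableEq S] (w r : Fin (m + 2) ≃ S) (σ : Equiv.Perm S) :
    Equiv.Perm.sign ((w.trans σ.symm).trans r.symm) =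
      Equiv.Perm.sign σ * Equiv.Perm.sign (w.trans r.symm) := by
  have h : (w.trans σ.symm).trans r.symm =
      (w.trans r.symm).trans ((r.trans σ.symm).trans r.symm) := by
    ext i
    simp
  rw [h, Equiv.Perm.sign_trans, Equiv.Perm.sign_trans_trans_symm, Equiv.Perm.sign_symm]

end Words

/-! ### A basis of the Lie representation -/

section Lie

variable {S : Type u} [Finite S] {m : ℕ} (hS : Nat.card S = m + 2) (s : S)
include hS

/-- The left combs that start with a given letter form a basis of the Lie representation. -/
theorem exists_basis_multilinearLie : ∃ b : Module.Basis (WordsFrom s m) ℤ (multilinearLie ℤ S),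
    (∀ e, (b e : FreeLieAlgebra ℤ S) = wordComb e.1) ∧
      ∀ x w, b.repr x w = lieCoeff w.1 (x : FreeLieAlgebra ℤ S) := by
  classical
  obtain ⟨b, h1, h2⟩ := exists_basis_of_dual
    (fun e : WordsFrom s m => (⟨wordComb e.1, wordComb_mem e.1⟩ : multilinearLie ℤ S))
    (fun w => lieCoeff w.1 ∘ₗ (multilinearLie ℤ S).subtype)
    (fun w e hne => by
      change lieCoeff w.1 (wordComb e.1) = 0
      rw [lieCoeff_wordComb, if_neg ((isValley_iff w e).not.2 hne)])
    (fun w => by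
      change lieCoeff w.1 (wordComb w.1) = 1
      rw [lieCoeff_wordComb, if_pos ((isValley_iff w w).2 rfl), Equiv.self_trans_symm]
      rfl)
    (by
      refine Submodule.map_injective_of_injective (multilinearLie ℤ S).subtype_injective ?_
      rw [Submodule.map_span, ← Set.range_comp, Submodule.map_top, Submodule.range_subtype]
      exact (multilinearLie_eq_span hS s).symm)
  exact ⟨b, fun e => by rw [h1], h2⟩

/-- Already the words with a fixed first letter suffice, but equivariance is proved for all words at
once, as permutations move the first letter. -/
lemma multilinearLie_ext {x y : multilinearLie ℤ S}
    (h : ∀ w : Fin (m + 2) ≃ S, lieCoeff w (x : FreeLieAlgebra ℤ S) = lieCoeff w y) : x = y := by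
  have : 0 < Nat.card S := by omega
  obtain ⟨⟨s⟩, -⟩ := Nat.card_pos_iff.1 this
  obtain ⟨b, -, hb⟩ := exists_basis_multilinearLie hS s
  exact b.ext_elem fun w => by rw [hb, hb, h]

end Lie

/-! ### A basis of the cohomology -/

section Cohomology

variable {S : Type u} {m : ℕ}

/-- The pairing of a cohomology class with the sphere of bracketings of a word. -/
def classPairing (w : Fin (m + 2) ≃ S) : RedCohomology (TreeChains S) m →ₗ[ℤ] ℤ :=
  Submodule.liftQ _ (wordPairing w ∘ₗ (redCocycle (TreeChains S) m).subtype) fun _ hc =>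
    wordPairing_coboundary w hc

lemma classPairing_map (w : Fin (m + 2) ≃ S) (σ : Equiv.Perm S)
    (a : RedCohomology (TreeChains S) m) :
    classPairing w (redCohomologyMap (treeChainsMap σ) m a) = classPairing (w.trans σ.symm) a := by
  induction a using Submodule.Quotient.induction_on with
  | H c => exact wordPairing_map w σ c.1

lemma redCochainMap_flagCochain (σ : Equiv.Perm S) (e : Fin (m + 2) ≃ S) :
    redCochainMap (treeChainsMap σ) m (flagCochain (combFlag e)) =
      flagCochain (combFlag (e.trans σ)) := by
  funext x
  have hinj : Function.Injective fun E : Set (Set S) => (fun B => σ ⁻¹' B) '' E :=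
    Set.image_injective.2 (Set.preimage_injective.2 σ.surjective)
  have h1 : ∀ i, combFlag e i = σ ⁻¹' combFlag (e.trans σ) i := fun i => by
    ext a
    change (e.symm a).val ≤ i + 1 ↔ (e.symm (σ.symm (σ a))).val ≤ i + 1
    rw [σ.symm_apply_apply]
  have h2 : ∀ i, augEdges (AugSimplex.map (treeChainsMap σ) m x) i = combFlag e '' Set.Iic i ↔
      augEdges x i = combFlag (e.trans σ) '' Set.Iic i := fun i => by
    have h3 : combFlag e '' Set.Iic i =
        (fun B => σ ⁻¹' B) '' (combFlag (e.trans σ) '' Set.Iic i) := by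
      rw [Set.image_image]
      exact Set.image_congr fun l _ => h1 l
    have h4 : augEdges (AugSimplex.map (treeChainsMap σ) m x) i =
        (fun B => σ ⁻¹' B) '' augEdges x i := by
      rw [augEdges_map]
      ext A
      exact exists_congr fun B => and_congr_right fun _ => eq_comm
    rw [h3, h4]
    exact hinj.eq_iff
  have h5 : (augEdges (AugSimplex.map (treeChainsMap σ) m x) =
      fun i => combFlag e '' Set.Iic i) ↔
      augEdges x = fun i => combFlag (e.trans σ) '' Set.Iic i := by
    rw [funext_iff, funext_iff]
    exact forall_congr' h2
  change (if _ then (1 : ℤ) else 0) = if _ then 1 else 0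
  simp only [h5]

variable [Finite S] (hS : Nat.card S = m + 2)

/-- The cohomology class dual to a comb. -/
def combClass (e : Fin (m + 2) ≃ S) : RedCohomology (TreeChains S) m :=
  Submodule.Quotient.mk ⟨flagCochain (combFlag e),
    flagCochain_mem_redCocycle hS (isFlag_combFlag e).1⟩

lemma combClass_map (σ : Equiv.Perm S) (e : Fin (m + 2) ≃ S) :
    redCohomologyMap (treeChainsMap σ) m (combClass hS e) = combClass hS (e.trans σ) :=
  congrArg Submodule.Quotient.mk (Subtype.ext (redCochainMap_flagCochain σ e))

open Classical in
lemma classPairing_combClass (w e : Fin (m + 2) ≃ S) :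
    classPairing w (combClass hS e) = if IsValley (w.trans e.symm) then
      (Equiv.Perm.sign (w.trans e.symm) : ℤ) * (-1) ^ ((w.trans e.symm).symm 0).val else 0 :=
  wordPairing_combFlag w e

lemma span_combClass (s : S) :
    Submodule.span ℤ (Set.range fun e : WordsFrom s m => combClass hS e.1) = ⊤ := by
  set P := Submodule.span ℤ (Set.range fun e : WordsFrom s m => combClass hS e.1)
  refine eq_top_iff.2 fun a _ => ?_
  induction a using Submodule.Quotient.induction_on with
  | H c =>
    -- Applied to the sum of the coboundaries and the cocycles whose class lies in the span of the
    -- combs.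
    have h1 := cocycle_mem hS s (redCoboundary (TreeChains S) m ⊔
      (P.comap (Submodule.mkQ _)).map (redCocycle (TreeChains S) m).subtype) le_sup_left
      (fun w => Submodule.mem_sup_right
        ⟨⟨_, flagCochain_mem_redCocycle hS (isFlag_combFlag w.1).1⟩,
          Submodule.subset_span ⟨w, rfl⟩, rfl⟩) c.2
    obtain ⟨b, hb, _, ⟨y, hy, rfl⟩, h2⟩ := Submodule.mem_sup.1 h1
    have h3 : Submodule.Quotient.mk (p := (redCoboundary (TreeChains S) m).submoduleOf
        (redCocycle (TreeChains S) m)) c = Submodule.Quotient.mk y := by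
      rw [Submodule.Quotient.eq]
      change c.1 - y.1 ∈ redCoboundary (TreeChains S) m
      rw [← h2]
      simpa using hb
    rw [h3]
    exact hy

/-- The combs that start with a given letter form a basis of the cohomology. -/
theorem exists_basis_redCohomology (s : S) :
    ∃ b : Module.Basis (WordsFrom s m) ℤ (RedCohomology (TreeChains S) m),
      ∀ e, b e = combClass hS e.1 := by
  classical
  obtain ⟨b, h1, -⟩ := exists_basis_of_dual (fun e : WordsFrom s m => combClass hS e.1)
    (fun w => classPairing w.1)
    (fun w e hne => by
      change classPairing w.1 (combClass hS e.1) = 0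
      rw [classPairing_combClass, if_neg ((isValley_iff w e).not.2 hne)])
    (fun w => by
      rw [classPairing_combClass, if_pos ((isValley_iff w w).2 rfl), Equiv.self_trans_symm]
      simp [Equiv.Perm.sign_refl])
    (span_combClass hS s)
  exact ⟨b, h1⟩

end Cohomology

/-! ### Comparison of the representations -/

section Comparison

variable {S : Type u} {m : ℕ}

/-- The cohomology of the boundary of the space of trees is the twisted Lie representation. -/
theorem exists_equiv_signTwist [Fintype S] [DecidableEq S] (hS : Nat.card S = m + 2) :
    ∃ E : RedCohomology (TreeChains S) m ≃ₗ[ℤ] multilinearLie ℤ S, ∀ σ a,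
      E (redCohomologyMap (treeChainsMap σ) m a) = signTwist (lieRep ℤ S) σ (E a) := by
  classical
  have : 0 < Nat.card S := by omega
  obtain ⟨⟨s⟩, -⟩ := Nat.card_pos_iff.1 this
  obtain ⟨⟨r, hr⟩⟩ := exists_wordsFrom hS s
  obtain ⟨b, hb⟩ := exists_basis_redCohomology hS s
  obtain ⟨b', hb', -⟩ := exists_basis_multilinearLie hS s
  -- The two pairings of the words `w` and `e` differ by the sign of the permutation between them.
  -- Given a reference word `r`, this sign splits into a factor for `e`, put into the basis here,
  -- and one for `w`.
  let E := b.equiv (b'.unitsSMul fun e => Equiv.Perm.sign (e.1.trans r.symm)) (Equiv.refl _)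
  -- This characterizes `E` by all words, without reference to `s`. Relabelling by `σ` then changes
  -- only the sign of the word relative to `r`, by the sign of `σ`.
  have key : ∀ w a, lieCoeff w (E a : FreeLieAlgebra ℤ S) =
      (Equiv.Perm.sign (w.trans r.symm) : ℤ) * classPairing w a := by
    intro w a
    have h : lieCoeff w ∘ₗ (multilinearLie ℤ S).subtype ∘ₗ E.toLinearMap =
        (Equiv.Perm.sign (w.trans r.symm) : ℤ) • classPairing w := b.ext fun e => by
      change lieCoeff w (E (b e) : FreeLieAlgebra ℤ S) =
        (Equiv.Perm.sign (w.trans r.symm) : ℤ) * classPairing w (b e)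
      have h1 : (E (b e) : FreeLieAlgebra ℤ S) =
          (Equiv.Perm.sign (e.1.trans r.symm) : ℤ) • wordComb e.1 := by
        rw [Module.Basis.equiv_apply, Module.Basis.unitsSMul_apply, ← hb']
        rfl
      rw [h1, map_smul, hb, lieCoeff_wordComb, classPairing_combClass, smul_eq_mul]
      split_ifs
      · rw [← mul_assoc, ← sign_trans_mul w e.1 r, Units.val_mul]
        ring
      · rw [mul_zero, mul_zero]
    exact congr($h a)
  refine ⟨E, fun σ a => multilinearLie_ext hS fun w => ?_⟩
  have h1 : ((signTwist (lieRep ℤ S) σ (E a) : multilinearLie ℤ S) : FreeLieAlgebra ℤ S) =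
      (Equiv.Perm.sign σ : ℤ) • freeLieMap ℤ σ (E a) := rfl
  rw [h1, map_smul, lieCoeff_map, key, key, classPairing_map, sign_trans_symm, Units.val_mul,
    smul_eq_mul, ← mul_assoc, ← mul_assoc, ← Units.val_mul, Int.units_mul_self, Units.val_one,
    one_mul]

theorem nonempty_equiv_signTwist [Fintype S] [DecidableEq S] (hS : Nat.card S = m + 2) :
    Nonempty (Representation.Equiv (treeOperad.boundaryCohomologyRep S m)
      (signTwist (lieRep ℤ S))) := by
  obtain ⟨E, hE⟩ := exists_equiv_signTwist hS
  refine ⟨Representation.Equiv.mk ((boundaryCohomologyEquiv S m).symm.trans E) fun σ =>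
    LinearMap.ext fun a => ?_⟩
  obtain ⟨a, rfl⟩ := (boundaryCohomologyEquiv S m).surjective a
  change E ((boundaryCohomologyEquiv S m).symm (treeOperad.boundaryCohomologyRep S m σ _)) =
    signTwist (lieRep ℤ S) σ (E ((boundaryCohomologyEquiv S m).symm _))
  rw [← boundaryCohomologyEquiv_map, LinearEquiv.symm_apply_apply, LinearEquiv.symm_apply_apply, hE]

/-- The words that start with `s` form a torsor under the stabilizer of `s`. -/
def stabilizerEquivWords {s : S} (r : WordsFrom s m) :
    MulAction.stabilizer (Equiv.Perm S) s ≃ WordsFrom s m where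
  toFun σ := ⟨r.1.trans σ.1, by rw [Equiv.trans_apply, r.2]; exact σ.2⟩
  invFun w := ⟨r.1.symm.trans w.1, by
    change w.1 (r.1.symm s) = s
    rw [(Equiv.symm_apply_eq _).2 r.2.symm, w.2]⟩
  left_inv σ := Subtype.ext (Equiv.ext fun a => by simp)
  right_inv w := Subtype.ext (Equiv.ext fun a => by simp)

/-- Relabelling maps comb classes to comb classes without signs, and the stabilizer of `s` acts
simply transitively on the words that start with `s`. -/
theorem nonempty_equiv_leftRegular [Finite S] (hS : Nat.card S = m + 2) (s : S) :
    Nonempty (Representation.Equiv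
      ((treeOperad.boundaryCohomologyRep S m).comp
        (MulAction.stabilizer (Equiv.Perm S) s).subtype)
      (Representation.leftRegular ℤ (MulAction.stabilizer (Equiv.Perm S) s))) := by
  obtain ⟨r⟩ := exists_wordsFrom hS s
  obtain ⟨b, hb⟩ := exists_basis_redCohomology hS s
  let b' := (b.map (boundaryCohomologyEquiv S m)).reindex (stabilizerEquivWords r).symm
  have hb' : ∀ τ, b' τ = boundaryCohomologyEquiv S m (combClass hS (r.1.trans τ.1)) := fun τ => by
    rw [Module.Basis.reindex_apply, Module.Basis.map_apply, hb]
    rfl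
  have hmap : ∀ σ τ, treeOperad.boundaryCohomologyRep S m σ.1 (b' τ) = b' (σ * τ) := fun σ τ => by
    rw [hb', hb', ← boundaryCohomologyEquiv_map, combClass_map]
    rfl
  refine ⟨Representation.Equiv.mk (b'.repr.trans (MonoidAlgebra.coeffLinearEquiv ℤ).symm) fun σ =>
    b'.ext fun τ => ?_⟩
  change (MonoidAlgebra.coeffLinearEquiv ℤ).symm
      (b'.repr (treeOperad.boundaryCohomologyRep S m σ.1 (b' τ))) =
    Representation.leftRegular ℤ _ σ ((MonoidAlgebra.coeffLinearEquiv ℤ).symm (b'.repr (b' τ)))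
  rw [hmap, b'.repr_self, b'.repr_self]
  exact (Representation.ofMulAction_single σ τ (1 : ℤ)).symm

end Comparison

end TreeOperad

end

theorem mainTheorem9 :
    TreeOperad.treeOperad.{u}.IsEInfty ∧
    ∀ (S : Type u) [Fintype S] [DecidableEq S] (n : ℕ), n = Fintype.card S → 2 ≤ n →
      -- each composition map is injective
      (∀ M : Set S, TreeOperad.IsProper M → ∀ k : SimplexCategoryᵒᵖ,
        Function.Injective ((TreeOperad.treeOperad.faceMap M).app k)) ∧
      -- two different faces are disjoint or meet in a common subface
      (∀ M M' : Set S, TreeOperad.IsProper M → TreeOperad.IsProper M' → M ≠ M' →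
        TreeOperad.treeOperad.face M ⊓ TreeOperad.treeOperad.face M' = ⊥ ∨
        ∃ K : (TreeOperad.treeOperad.obj S).Subcomplex,
          TreeOperad.treeOperad.face M ⊓ TreeOperad.treeOperad.face M' = K ∧
          TreeOperad.treeOperad.IsSubface M K ∧ TreeOperad.treeOperad.IsSubface M' K) ∧
      -- the homotopy type of the boundary; for `n = 2` the sphere of dimension `-1` is empty
      (3 ≤ n → Nonempty (ContinuousMap.HomotopyEquiv
        (SSet.toTop.obj (TreeOperad.treeOperad.boundary S).toSSet)
        (TreeOperad.WedgeOfSpheres (n - 1).factorial (n - 3)))) ∧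
      (n = 2 → TreeOperad.treeOperad.boundary S = ⊥) ∧
      -- the homotopy type of the quotient by the boundary
      Nonempty (ContinuousMap.HomotopyEquiv
        (SSet.toTop.obj (TreeOperad.collapseSubcomplex (TreeOperad.treeOperad.boundary S)))
        (TreeOperad.WedgeOfSpheres (n - 1).factorial (n - 2))) ∧
      -- reduced cohomology of the boundary in degree `n - 3`, which has index `n - 2`
      Nonempty (Representation.Equiv (TreeOperad.treeOperad.boundaryCohomologyRep S (n - 2))
        (TreeOperad.signTwist (TreeOperad.lieRep ℤ S))) ∧
      -- its restriction to the symmetric group on `S ∖ {s}`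
      (∀ s : S, Nonempty (Representation.Equiv
        ((TreeOperad.treeOperad.boundaryCohomologyRep S (n - 2)).comp
          (MulAction.stabilizer (Equiv.Perm S) s).subtype)
        (Representation.leftRegular ℤ (MulAction.stabilizer (Equiv.Perm S) s)))) := by
  refine ⟨TreeOperad.isEInfty_treeOperad, fun S _ _ n hn hS => ?_⟩
  have hcard : Nat.card S = n := Nat.card_eq_fintype_card.trans hn.symm
  refine ⟨fun M hM k => TreeOperad.faceMap_injective hM k,
    fun M M' hM hM' hne => TreeOperad.face_inf_face hM hM' hne, fun h3 => ?_,
    fun h2 => TreeOperad.boundary_eq_bot (hcard.trans h2), ?_, ?_, fun s => ?_⟩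
  · rw [← hcard] at h3 ⊢
    exact TreeOperad.boundary_wedge h3
  · rw [← hcard] at hS ⊢
    exact TreeOperad.quotient_wedge hS
  · exact TreeOperad.nonempty_equiv_signTwist (by omega)
  · exact TreeOperad.nonempty_equiv_leftRegular (by omega) s
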